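/- Let $\Omega=(-1,1)^2\subset\mathbb R^2$, let $a(x)=1$ if $|x_1|<|x_2|$ and $a(x)=0$ otherwise, and for $\alpha,\beta\in\mathbb R$, $x\in\Omega$, $t\ge 0$ put $$\Phi(x,t)=\Phi_{\alpha,\beta}(x,t)=t^2\log^{-\beta}(e+t)+a(x)\,t^2\log^{\alpha}(e+t),\qquad \Phi^*(x,s)=\sup_{t\ge0}\bigl(st-\Phi(x,t)\bigr).$$ For a measurable vector field $f:\Omega\to\mathbb R^2$ let $\|f\|_{L^{\Phi}(\Omega)}=\inf\{\gamma>0:\int_\Omega\Phi(x,|f(x)|/\gamma)\,dx\le1\}$ (with $\inf\emptyset=\infty$), let $L^{\Phi}(\Omega)$ be the set of those $f$ with $\|f\|_{L^{\Phi}(\Omega)}<\infty$, and define $L^{\Phi^*}(\Omega)$ in the same way. Let $$W^{1,\Phi}_0(\Omega)=\{w\in W^{1,1}_0(\Omega):\nabla w\in L^{\Phi}(\Omega)\},\qquad \|w\|_{W^{1,\Phi}_0(\Omega)}=\|\nabla w\|_{L^{\Phi}(\Omega)},$$ where $\nabla$ is the weak gradient and $W^{1,1}_0(\Omega)$ is the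 closure of $C_0^\infty(\Omega)$ in $W^{1,1}(\Omega)$, and let $H^{1,\Phi}_0(\Omega)$ be the closure of $C_0^\infty(\Omega)$ in $W^{1,\Phi}_0(\Omega)$. Then: 1. $H^{1,\Phi}_0(\Omega)=W^{1,\Phi}_0(\Omega)$ if and only if $\min(\alpha,\beta)\le1$. 2. If $\alpha>1$ and $\beta>1$, then there is a vector field $b\in L^{\Phi^*}(\Omega)$ such that $b\cdot\nabla w$ is integrable on $\Omega$ for every $w\in W^{1,\Phi}_0(\Omega)$ and the functional $$\mathcal G(w)=\int_\Omega\Phi(x,|\nabla w|)\,dx+\int_\Omega b\cdot\nabla w\,dx$$ has a Lavrentiev gap: $$\inf_{w\in W^{1,\Phi}_0(\Omega)}\mathcal G(w)<\inf_{w\in H^{1,\Phi}_0(\Omega)}\mathcal G(w).$$ 3. If $\alpha>1$ and $\beta>1$, then $H^{1,\Phi}_0(\Omega)$ is a linear subspace of codimension one in $W^{1,\Phi}_0(\Omega)$. -/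

import Mathlib

open MeasureTheory
open scoped ENNReal

noncomputable section

namespace BorderlineDoublePhase

/-- The Euclidean plane; the coordinates `x₁, x₂` are `x 0, x 1`. -/
abbrev Plane : Type := EuclideanSpace ℝ (Fin 2)

/-- The square `Ω = (-1,1)²`. -/
def Square : Set Plane := {x | |x 0| < 1 ∧ |x 1| < 1}

/-- Lebesgue measure on `Ω`. -/
abbrev mu : Measure Plane := volume.restrict Square

/-! ### Generalized Orlicz spaces of vector fields on the square -/

/-- The Luxemburg functional
`inf {γ > 0 : ∫_Ω Φ(x, |f(x)| / γ) dx ≤ 1}`, equal to `∞` if there is no such `γ`. -/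
def luxNorm (Φ : Plane → ℝ → ℝ≥0∞) (f : Plane → Plane) : ℝ≥0∞ :=
  ⨅ (γ : ℝ) (_ : 0 < γ ∧ ∫⁻ x, Φ x (‖f x‖ / γ) ∂mu ≤ 1), ENNReal.ofReal γ

/-- Membership in the generalized Orlicz space `L^Φ(Ω)` (of vector fields). -/
def MemOrlicz (Φ : Plane → ℝ → ℝ≥0∞) (f : Plane → Plane) : Prop :=
  AEStronglyMeasurable f mu ∧ luxNorm Φ f < ∞

/-- The conjugate `Φ*(x,s) = sup_{t ≥ 0} (s t - Φ(x,t))`. The subtraction is truncated at `0`;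
for `Φ(x,0) = 0` this does not change the supremum, as `t = 0` already contributes `0`. -/
def conj (Φ : Plane → ℝ → ℝ≥0∞) (x : Plane) (s : ℝ) : ℝ≥0∞ :=
  ⨆ (t : ℝ) (_ : 0 ≤ t), (ENNReal.ofReal (s * t) - Φ x t)

/-! ### The integrand -/

open Classical in
/-- The checkerboard weight. -/
def weight (x : Plane) : ℝ := if |x 0| < |x 1| then 1 else 0

/-- `t² log^κ (e + t)`. -/
def logPow (κ t : ℝ) : ℝ := t ^ 2 * Real.log (Real.exp 1 + t) ^ κ

/-- `Φ_{α,β}(x,t) = t² log^{-β}(e+t) + a(x) t² log^α(e+t)`. -/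
def Phi (α β : ℝ) (x : Plane) (t : ℝ) : ℝ≥0∞ :=
  ENNReal.ofReal (logPow (-β) t + weight x * logPow α t)

/-! ### Test functions and the space `W^{1,1}(Ω)` -/

/-- `C_0^∞(Ω)`. -/
def IsTest (φ : Plane → ℝ) : Prop :=
  ContDiff ℝ ((⊤ : ℕ∞) : WithTop ℕ∞) φ ∧ HasCompactSupport φ ∧ tsupport φ ⊆ Square

/-- `g` is the weak gradient of `w` in `Ω` (for integrable `w` and `g`). -/
def HasWeakGrad (w : Plane → ℝ) (g : Plane → Plane) : Prop :=
  ∀ φ : Plane → ℝ, IsTest φ →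
    ∫ x, w x • gradient φ x ∂mu = - ∫ x, φ x • g x ∂mu

lemma isOpen_Square : IsOpen Square := by
  apply IsOpen.inter
  · exact isOpen_lt (f := fun x : Plane => |x 0|) (g := fun _ => 1) (by fun_prop) (by fun_prop)
  · exact isOpen_lt (f := fun x : Plane => |x 1|) (g := fun _ => 1) (by fun_prop) (by fun_prop)

lemma gradient_add' {φ ψ : Plane → ℝ} (hφ : IsTest φ) (hψ : IsTest ψ) (x : Plane) :
    gradient (fun y => φ y + ψ y) x = gradient φ x + gradient ψ x := by
  unfold gradient
  rw [fderiv_fun_add ((hφ.1.differentiable (by simp)) x) ((hψ.1.differentiable (by simp)) x),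
    map_add]

lemma gradient_smul' (c : ℝ) {φ : Plane → ℝ} (hφ : IsTest φ) (x : Plane) :
    gradient (fun y => c * φ y) x = c • gradient φ x := by
  unfold gradient
  rw [fderiv_const_mul ((hφ.1.differentiable (by simp)) x)]
  simp

lemma gradient_zero' (x : Plane) : gradient (fun _ : Plane => (0 : ℝ)) x = 0 := by
  simp [gradient]

lemma IsTest.zero : IsTest (fun _ => 0) :=
  ⟨contDiff_const, HasCompactSupport.zero, by
    have : tsupport (fun _ : Plane => (0 : ℝ)) = ∅ := tsupport_eq_empty_iff.2 rfl
    simp [this]⟩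

lemma IsTest.add {φ ψ : Plane → ℝ} (hφ : IsTest φ) (hψ : IsTest ψ) :
    IsTest (fun y => φ y + ψ y) :=
  ⟨hφ.1.add hψ.1, hφ.2.1.add hψ.2.1,
    (tsupport_add φ ψ).trans (Set.union_subset hφ.2.2 hψ.2.2)⟩

lemma IsTest.const_mul (c : ℝ) {φ : Plane → ℝ} (hφ : IsTest φ) :
    IsTest (fun y => c * φ y) :=
  ⟨contDiff_const.mul hφ.1, hφ.2.1.mul_left, (tsupport_mul_subset_right).trans hφ.2.2⟩

lemma continuous_gradient {φ : Plane → ℝ} (hφ : IsTest φ) : Continuous (gradient φ) := by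
  unfold gradient
  exact (LinearIsometryEquiv.continuous _).comp (hφ.1.continuous_fderiv (by simp))

lemma IsTest.bdd_gradient {φ : Plane → ℝ} (hφ : IsTest φ) :
    ∃ C, ∀ x, ‖gradient φ x‖ ≤ C := by
  have h1 : HasCompactSupport (fderiv ℝ φ) := hφ.2.1.fderiv ℝ
  obtain ⟨C, hC⟩ := h1.exists_bound_of_continuous (hφ.1.continuous_fderiv (by simp))
  exact ⟨C, fun x => by simpa [gradient] using hC x⟩

lemma integrable_smul_gradient {w : Plane → ℝ} (hw : Integrable w mu) {φ : Plane → ℝ}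
    (hφ : IsTest φ) : Integrable (fun x => w x • gradient φ x) mu := by
  obtain ⟨C, hC⟩ := hφ.bdd_gradient
  exact hw.smul_bdd C (continuous_gradient hφ).aestronglyMeasurable (ae_of_all _ hC)

lemma integrable_test_smul {g : Plane → Plane} (hg : Integrable g mu) {φ : Plane → ℝ}
    (hφ : IsTest φ) : Integrable (fun x => φ x • g x) mu := by
  obtain ⟨C, hC⟩ := hφ.2.1.exists_bound_of_continuous hφ.1.continuous
  exact hg.bdd_smul C hφ.1.continuous.aestronglyMeasurable (ae_of_all _ hC)

lemma L1int {F : Type*} [NormedAddCommGroup F] (w : Lp F 1 mu) : Integrable w mu :=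
  L1.integrable_coeFn w

lemma HasWeakGrad.unique {w : Plane → ℝ} {g h : Lp Plane 1 mu}
    (hg : HasWeakGrad w g) (hh : HasWeakGrad w h) : g = h := by
  have key : ∀ᵐ x ∂(volume : Measure Plane), x ∈ Square → (g x - h x : Plane) = 0 := by
    apply isOpen_Square.ae_eq_zero_of_integral_contDiff_smul_eq_zero
    · have hi : IntegrableOn (fun x => g x - h x) Square volume := (L1int g).sub (L1int h)
      exact hi.locallyIntegrableOn
    · intro φ h1 h2 h3
      have hφ : IsTest φ := ⟨h1, h2, h3⟩
      have e : ∫ x, φ x • (g x - h x) ∂(volume : Measure Plane)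
          = ∫ x, φ x • (g x - h x) ∂mu := by
        rw [setIntegral_eq_integral_of_forall_compl_eq_zero]
        intro x hx
        rw [image_eq_zero_of_notMem_tsupport (fun hx' => hx (h3 hx')), zero_smul]
      rw [e]
      simp only [smul_sub]
      rw [integral_sub (integrable_test_smul (L1int g) hφ) (integrable_test_smul (L1int h) hφ)]
      have a := hg φ hφ
      have b := hh φ hφ
      rw [a] at b
      rw [neg_inj.1 b, sub_self]
  apply Lp.ext
  have := (ae_restrict_iff' isOpen_Square.measurableSet).2 key
  filter_upwards [this] with x hx using sub_eq_zero.1 hx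

lemma HasWeakGrad.add {w v : Lp ℝ 1 mu} {g h : Lp Plane 1 mu}
    (hg : HasWeakGrad w g) (hh : HasWeakGrad v h) : HasWeakGrad (w + v : Lp ℝ 1 mu)
      (g + h : Lp Plane 1 mu) := by
  intro φ hφ
  have e1 : ∫ x, (w + v : Lp ℝ 1 mu) x • gradient φ x ∂mu
      = ∫ x, (w x • gradient φ x + v x • gradient φ x) ∂mu := by
    apply integral_congr_ae
    filter_upwards [Lp.coeFn_add w v] with x hx
    rw [hx, Pi.add_apply, add_smul]
  have e2 : ∫ x, φ x • (g + h : Lp Plane 1 mu) x ∂mu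
      = ∫ x, (φ x • g x + φ x • h x) ∂mu := by
    apply integral_congr_ae
    filter_upwards [Lp.coeFn_add g h] with x hx
    rw [hx, Pi.add_apply, smul_add]
  rw [e1, e2, integral_add (integrable_smul_gradient (L1int w) hφ)
    (integrable_smul_gradient (L1int v) hφ), integral_add (integrable_test_smul (L1int g) hφ)
    (integrable_test_smul (L1int h) hφ), hg φ hφ, hh φ hφ, neg_add]

lemma HasWeakGrad.smul (c : ℝ) {w : Lp ℝ 1 mu} {g : Lp Plane 1 mu}
    (hg : HasWeakGrad w g) : HasWeakGrad (c • w : Lp ℝ 1 mu) (c • g : Lp Plane 1 mu) := by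
  intro φ hφ
  have e1 : ∫ x, (c • w : Lp ℝ 1 mu) x • gradient φ x ∂mu
      = ∫ x, c • (w x • gradient φ x) ∂mu := by
    apply integral_congr_ae
    filter_upwards [Lp.coeFn_smul c w] with x hx
    rw [hx, Pi.smul_apply, smul_assoc]
  have e2 : ∫ x, φ x • (c • g : Lp Plane 1 mu) x ∂mu
      = ∫ x, c • (φ x • g x) ∂mu := by
    apply integral_congr_ae
    filter_upwards [Lp.coeFn_smul c g] with x hx
    rw [hx, Pi.smul_apply, smul_comm]
  rw [e1, e2, integral_smul, integral_smul, hg φ hφ, smul_neg]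

lemma HasWeakGrad.zero : HasWeakGrad (0 : Lp ℝ 1 mu) (0 : Lp Plane 1 mu) := by
  have h : HasWeakGrad (fun _ => 0) (fun _ => 0) := by
    intro φ _
    simp
  intro φ hφ
  rw [integral_congr_ae (g := fun x => (0 : ℝ) • gradient φ x), h φ hφ]
  · congr 1
    apply integral_congr_ae
    filter_upwards [Lp.coeFn_zero Plane 1 mu] with x hx
    rw [hx]; rfl
  · filter_upwards [Lp.coeFn_zero ℝ 1 mu] with x hx
    rw [hx]; rfl

/-- `W^{1,1}(Ω)`: the integrable functions with an integrable weak gradient. -/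
def W11 : Submodule ℝ (Lp ℝ 1 mu) where
  carrier := {w | ∃ g : Lp Plane 1 mu, HasWeakGrad w g}
  add_mem' := by
    rintro w v ⟨g, hg⟩ ⟨h, hh⟩
    exact ⟨g + h, hg.add hh⟩
  zero_mem' := ⟨0, HasWeakGrad.zero⟩
  smul_mem' := by
    rintro c w ⟨g, hg⟩
    exact ⟨c • g, hg.smul c⟩

/-- The weak gradient `∇ : W^{1,1}(Ω) → L¹(Ω)²`. -/
def weakGrad : W11 →ₗ[ℝ] Lp Plane 1 mu where
  toFun w := w.2.choose
  map_add' w v := (w + v).2.choose_spec.unique (w.2.choose_spec.add v.2.choose_spec)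
  map_smul' c w := (c • w).2.choose_spec.unique (w.2.choose_spec.smul c)

lemma weakGrad_spec (w : W11) : HasWeakGrad (w : Lp ℝ 1 mu) (weakGrad w) := w.2.choose_spec

/-! ### Elementary properties of the Luxemburg functional of `Φ_{α,β}` -/

lemma one_le_log {t : ℝ} (ht : 0 ≤ t) : 1 ≤ Real.log (Real.exp 1 + t) := by
  have h : 0 < Real.exp 1 + t := by positivity
  rw [Real.le_log_iff_exp_le h]
  linarith

lemma logPow_nonneg (κ : ℝ) {t : ℝ} (ht : 0 ≤ t) : 0 ≤ logPow κ t := by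
  have := one_le_log ht
  have h0 : 0 ≤ Real.log (Real.exp 1 + t) := by linarith
  exact mul_nonneg (sq_nonneg t) (Real.rpow_nonneg h0 κ)

lemma weight_nonneg (x : Plane) : 0 ≤ weight x := by
  unfold weight
  split_ifs <;> norm_num

lemma measurable_weight : Measurable weight := by
  unfold weight
  exact Measurable.ite (measurableSet_lt (by fun_prop) (by fun_prop)) measurable_const
    measurable_const

lemma log_ratio {s t : ℝ} (hs : 0 < s) (hst : s ≤ t) :
    Real.log (Real.exp 1 + t) ≤ Real.log (Real.exp 1 + s) * (1 + Real.log (t / s)) := by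
  have h1 := one_le_log hs.le
  have hr : 1 ≤ t / s := (one_le_div hs).2 hst
  have h2 : 0 ≤ Real.log (t / s) := Real.log_nonneg hr
  have h3 : Real.exp 1 + t ≤ (Real.exp 1 + s) * (t / s) := by
    have : s * (t / s) = t := by field_simp
    nlinarith [Real.exp_pos 1]
  have ht : 0 < t := hs.trans_le hst
  have h4 := Real.log_le_log (by positivity) h3
  rw [Real.log_mul (by positivity) (by positivity)] at h4
  nlinarith

lemma logPow_quasi (κ : ℝ) : ∃ M : ℝ, 1 ≤ M ∧ ∀ N, M ≤ N → ∀ s t : ℝ, 0 ≤ s → N * s ≤ t →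
    2 * logPow κ s ≤ logPow κ t := by
  have hlim : Filter.Tendsto (fun r : ℝ => (1 + Real.log r) ^ |κ| / r ^ 2) Filter.atTop
      (nhds 0) := by
    have h := (isLittleO_log_rpow_rpow_atTop |κ| (s := 2) (by norm_num))
    have h' : (fun r : ℝ => (1 + Real.log r) ^ |κ|) =O[Filter.atTop]
        (fun r : ℝ => Real.log r ^ |κ|) := by
      apply Asymptotics.IsBigO.of_bound (2 ^ |κ|)
      filter_upwards [Filter.eventually_ge_atTop (Real.exp 1)] with r hr
      have h1 : 1 ≤ Real.log r :=
        (Real.le_log_iff_exp_le (lt_of_lt_of_le (Real.exp_pos 1) hr)).2 hr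
      rw [Real.norm_of_nonneg (by positivity), Real.norm_of_nonneg (by positivity),
        ← Real.mul_rpow (by norm_num) (by linarith)]
      exact Real.rpow_le_rpow (by linarith) (by linarith) (abs_nonneg κ)
    have h2 := (h'.trans_isLittleO h).tendsto_div_nhds_zero
    refine h2.congr' ?_
    filter_upwards with r
    norm_num
  have hev := hlim.eventually (ge_mem_nhds (show (0 : ℝ) < 1 / 2 by norm_num))
  obtain ⟨M₀, hM₀⟩ := Filter.eventually_atTop.1 hev
  refine ⟨max 1 M₀, le_max_left _ _, fun N hN s t hs hst => ?_⟩
  have hN1 : 1 ≤ N := (le_max_left _ _).trans hN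
  rcases hs.eq_or_lt with rfl | hs
  · have : 0 ≤ t := by linarith
    simpa [logPow] using logPow_nonneg κ this
  have hst' : s ≤ t := by nlinarith
  have hts : N ≤ t / s := (le_div_iff₀ hs).2 hst
  have hr1 : 1 ≤ t / s := hN1.trans hts
  have hb := hM₀ (t / s) (((le_max_right _ _).trans hN).trans hts)
  have hl0 : 0 ≤ Real.log (t / s) := Real.log_nonneg hr1
  rw [div_le_iff₀ (by positivity)] at hb
  have ht : 0 < t := hs.trans_le hst'
  have hLs := one_le_log hs.le
  have hLt := one_le_log ht.le
  have hmono : Real.log (Real.exp 1 + s) ≤ Real.log (Real.exp 1 + t) :=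
    Real.log_le_log (by positivity) (by linarith)
  have hrat := log_ratio hs hst'
  have claim : Real.log (Real.exp 1 + s) ^ κ
      ≤ (1 + Real.log (t / s)) ^ |κ| * Real.log (Real.exp 1 + t) ^ κ := by
    rcases le_total 0 κ with hκ | hκ
    · have a1 := Real.rpow_le_rpow (by linarith) hmono hκ
      have a2 : 1 ≤ (1 + Real.log (t / s)) ^ |κ| :=
        Real.one_le_rpow (by linarith) (abs_nonneg κ)
      have a3 : 0 ≤ Real.log (Real.exp 1 + t) ^ κ := by positivity
      nlinarith
    · have a1 := Real.rpow_le_rpow (by linarith) hrat (neg_nonneg.2 hκ)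
      rw [Real.mul_rpow (by linarith) (by linarith)] at a1
      rw [abs_of_nonpos hκ]
      have b1 : Real.log (Real.exp 1 + s) ^ (-κ) = (Real.log (Real.exp 1 + s) ^ κ)⁻¹ :=
        Real.rpow_neg (by linarith) _
      have b2 : Real.log (Real.exp 1 + t) ^ (-κ) = (Real.log (Real.exp 1 + t) ^ κ)⁻¹ :=
        Real.rpow_neg (by linarith) _
      rw [b1, b2] at a1
      have p1 : 0 < Real.log (Real.exp 1 + s) ^ κ := by positivity
      have p2 : 0 < Real.log (Real.exp 1 + t) ^ κ := by positivity
      rw [inv_mul_eq_div, le_div_iff₀ p1, inv_mul_eq_div, div_le_iff₀ p2] at a1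
      exact a1
  have hLt0 : 0 ≤ Real.log (Real.exp 1 + t) ^ κ := by positivity
  unfold logPow
  calc 2 * (s ^ 2 * Real.log (Real.exp 1 + s) ^ κ)
      ≤ 2 * (s ^ 2 * ((1 + Real.log (t / s)) ^ |κ| * Real.log (Real.exp 1 + t) ^ κ)) := by
        gcongr
    _ ≤ 2 * (s ^ 2 * ((1 / 2 * (t / s) ^ 2) * Real.log (Real.exp 1 + t) ^ κ)) := by
        gcongr
    _ = t ^ 2 * Real.log (Real.exp 1 + t) ^ κ := by field_simp

lemma Phi_quasi (α β : ℝ) : ∃ M : ℝ, 1 ≤ M ∧ ∀ x s t, 0 ≤ s → M * s ≤ t →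
    2 * Phi α β x s ≤ Phi α β x t := by
  obtain ⟨M₁, h1, H1⟩ := logPow_quasi (-β)
  obtain ⟨M₂, h2, H2⟩ := logPow_quasi α
  refine ⟨max M₁ M₂, h1.trans (le_max_left _ _), fun x s t hs hst => ?_⟩
  have a := H1 _ (le_max_left _ _) s t hs hst
  have b := mul_le_mul_of_nonneg_left (H2 _ (le_max_right _ _) s t hs hst) (weight_nonneg x)
  unfold Phi
  rw [show (2 : ℝ≥0∞) = ENNReal.ofReal 2 by simp, ← ENNReal.ofReal_mul (by norm_num)]
  apply ENNReal.ofReal_le_ofReal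
  linarith

lemma aemeasurable_Phi (α β : ℝ) {f : Plane → Plane} (hf : AEStronglyMeasurable f mu) (γ : ℝ) :
    AEMeasurable (fun x => Phi α β x (‖f x‖ / γ)) mu := by
  have hn : AEMeasurable (fun x => ‖f x‖ / γ) mu := hf.norm.aemeasurable.div_const γ
  have hl : ∀ κ, Measurable (logPow κ) := fun κ => by
    unfold logPow
    fun_prop
  exact (((hl _).comp_aemeasurable hn).add
    (measurable_weight.aemeasurable.mul ((hl _).comp_aemeasurable hn))).ennreal_ofReal

lemma luxNorm_lt {Φ : Plane → ℝ → ℝ≥0∞} {f : Plane → Plane} {c : ℝ≥0∞} :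
    luxNorm Φ f < c ↔
      ∃ γ : ℝ, (0 < γ ∧ ∫⁻ x, Φ x (‖f x‖ / γ) ∂mu ≤ 1) ∧ ENNReal.ofReal γ < c := by
  simp only [luxNorm, iInf_lt_iff, exists_prop]

lemma luxNorm_congr {Φ : Plane → ℝ → ℝ≥0∞} {f g : Plane → Plane} (h : f =ᵐ[mu] g) :
    luxNorm Φ f = luxNorm Φ g := by
  have : ∀ γ : ℝ, ∫⁻ x, Φ x (‖f x‖ / γ) ∂mu = ∫⁻ x, Φ x (‖g x‖ / γ) ∂mu := fun γ =>
    lintegral_congr_ae (by filter_upwards [h] with x hx; rw [hx])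
  simp only [luxNorm, this]

lemma luxNorm_zero (α β : ℝ) : luxNorm (Phi α β) (fun _ => 0) = 0 := by
  by_contra h
  have hp : 0 < luxNorm (Phi α β) (fun _ => 0) := pos_iff_ne_zero.2 h
  obtain ⟨r, hr0, hr⟩ := ENNReal.lt_iff_exists_real_btwn.1 hp
  have hr1 : 0 < r := by simpa using hr.1
  have : luxNorm (Phi α β) (fun _ => 0) ≤ ENNReal.ofReal r :=
    iInf₂_le r ⟨hr1, by simp [Phi, logPow]⟩
  exact absurd hr.2 (not_lt.2 this)

lemma luxNorm_smul_le (α β : ℝ) (c : ℝ) (f : Plane → Plane) :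
    luxNorm (Phi α β) (fun x => c • f x) ≤ ENNReal.ofReal |c| * luxNorm (Phi α β) f := by
  rcases eq_or_ne c 0 with rfl | hc
  · simp [luxNorm_zero]
  have hc' : 0 < |c| := abs_pos.2 hc
  conv_rhs => unfold luxNorm
  rw [ENNReal.mul_iInf_of_ne (by simpa using hc) (by simp)]
  refine le_iInf fun γ => ?_
  rw [ENNReal.mul_iInf_of_ne (by simpa using hc) (by simp)]
  refine le_iInf fun hγ => ?_
  rw [← ENNReal.ofReal_mul hc'.le]
  refine iInf₂_le _ ⟨mul_pos hc' hγ.1, ?_⟩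
  convert hγ.2 using 4 with x
  rw [norm_smul, Real.norm_eq_abs, mul_div_mul_left _ _ hc'.ne']

lemma luxNorm_add_le (α β : ℝ) : ∃ K : ℝ≥0∞, K ≠ 0 ∧ K ≠ ∞ ∧ ∀ f g : Plane → Plane,
    AEStronglyMeasurable f mu → AEStronglyMeasurable g mu → ∀ c : ℝ≥0∞,
      luxNorm (Phi α β) f < c → luxNorm (Phi α β) g < c →
        luxNorm (Phi α β) (fun x => f x + g x) < K * c := by
  obtain ⟨M, hM1, hM⟩ := Phi_quasi α β
  have hM0 : 0 < M := by linarith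
  have hK0 : ENNReal.ofReal (2 * M) ≠ 0 := by
    simpa using hM0
  refine ⟨ENNReal.ofReal (2 * M), hK0, ENNReal.ofReal_ne_top, fun f g hf hg c hfc hgc => ?_⟩
  rw [luxNorm_lt] at hfc hgc
  obtain ⟨γ₁, ⟨h1, H1⟩, hc1⟩ := hfc
  obtain ⟨γ₂, ⟨h2, H2⟩, hc2⟩ := hgc
  rw [luxNorm_lt]
  have hmax : 0 < max γ₁ γ₂ := lt_max_of_lt_left h1
  refine ⟨2 * M * max γ₁ γ₂, ⟨by positivity, ?_⟩, ?_⟩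
  · have hpt : ∀ x, 2 * Phi α β x (‖f x + g x‖ / (2 * M * max γ₁ γ₂))
        ≤ Phi α β x (‖f x‖ / γ₁) + Phi α β x (‖g x‖ / γ₂) := by
      intro x
      have hs : 0 ≤ ‖f x + g x‖ / (2 * M * max γ₁ γ₂) := by positivity
      have e : M * (‖f x + g x‖ / (2 * M * max γ₁ γ₂))
          = ‖f x + g x‖ / 2 / max γ₁ γ₂ := by field_simp
      have htri := norm_add_le (f x) (g x)
      rcases le_total ‖f x‖ ‖g x‖ with hle | hle
      · refine (hM x _ (‖g x‖ / γ₂) hs ?_).trans le_add_self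
        rw [e]
        exact div_le_div₀ (norm_nonneg _) (by linarith) h2 (le_max_right _ _)
      · refine (hM x _ (‖f x‖ / γ₁) hs ?_).trans le_self_add
        rw [e]
        exact div_le_div₀ (norm_nonneg _) (by linarith) h1 (le_max_left _ _)
    have hint := lintegral_mono (μ := mu) hpt
    rw [lintegral_const_mul' _ _ (by simp), lintegral_add_left' (aemeasurable_Phi α β hf γ₁)]
      at hint
    have h3 : 2 * ∫⁻ x, Phi α β x (‖f x + g x‖ / (2 * M * max γ₁ γ₂)) ∂mu ≤ 2 * 1 :=
      hint.trans ((add_le_add H1 H2).trans (by norm_num))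
    exact (ENNReal.mul_le_mul_iff_right (by simp) (by simp)).1 h3
  · rw [ENNReal.ofReal_mul (by positivity)]
    refine (ENNReal.mul_lt_mul_iff_right hK0 ENNReal.ofReal_ne_top).2 ?_
    rcases max_choice γ₁ γ₂ with h | h <;> rw [h] <;> assumption

/-! ### The spaces with zero boundary values -/

/-- `W^{1,1}_0(Ω)`: the closure of `C_0^∞(Ω)` in `W^{1,1}(Ω)`. -/
def W110 : Submodule ℝ W11 where
  carrier := {w | ∀ ε : ℝ≥0∞, 0 < ε → ∃ φ : Plane → ℝ, IsTest φ ∧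
    eLpNorm (fun x => (w : Lp ℝ 1 mu) x - φ x) 1 mu
      + eLpNorm (fun x => weakGrad w x - gradient φ x) 1 mu < ε}
  add_mem' := by
    intro w v hw hv ε hε
    obtain ⟨φ, hφ, h1⟩ := hw (ε / 2) (ENNReal.half_pos hε.ne')
    obtain ⟨ψ, hψ, h2⟩ := hv (ε / 2) (ENNReal.half_pos hε.ne')
    refine ⟨_, hφ.add hψ, ?_⟩
    have a : eLpNorm (fun x => ((w + v : W11) : Lp ℝ 1 mu) x - (φ x + ψ x)) 1 mu
        ≤ eLpNorm (fun x => (w : Lp ℝ 1 mu) x - φ x) 1 mu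
          + eLpNorm (fun x => (v : Lp ℝ 1 mu) x - ψ x) 1 mu := by
      refine le_trans (le_of_eq ?_) (eLpNorm_add_le
        ((Lp.aestronglyMeasurable _).sub hφ.1.continuous.aestronglyMeasurable)
        ((Lp.aestronglyMeasurable _).sub hψ.1.continuous.aestronglyMeasurable) le_rfl)
      apply eLpNorm_congr_ae
      filter_upwards [Lp.coeFn_add (w : Lp ℝ 1 mu) v] with x hx
      simp only [Submodule.coe_add, hx, Pi.add_apply]
      abel
    have b : eLpNorm (fun x => weakGrad (w + v) x - gradient (fun y => φ y + ψ y) x) 1 mu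
        ≤ eLpNorm (fun x => weakGrad w x - gradient φ x) 1 mu
          + eLpNorm (fun x => weakGrad v x - gradient ψ x) 1 mu := by
      refine le_trans (le_of_eq ?_) (eLpNorm_add_le
        ((Lp.aestronglyMeasurable _).sub (continuous_gradient hφ).aestronglyMeasurable)
        ((Lp.aestronglyMeasurable _).sub (continuous_gradient hψ).aestronglyMeasurable) le_rfl)
      apply eLpNorm_congr_ae
      filter_upwards [Lp.coeFn_add (weakGrad w) (weakGrad v)] with x hx
      simp only [map_add, hx, Pi.add_apply, gradient_add' hφ hψ]
      abel
    calc _ ≤ _ := add_le_add a b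
      _ = (eLpNorm (fun x => (w : Lp ℝ 1 mu) x - φ x) 1 mu
            + eLpNorm (fun x => weakGrad w x - gradient φ x) 1 mu)
          + (eLpNorm (fun x => (v : Lp ℝ 1 mu) x - ψ x) 1 mu
            + eLpNorm (fun x => weakGrad v x - gradient ψ x) 1 mu) := by ring
      _ < ε / 2 + ε / 2 := ENNReal.add_lt_add h1 h2
      _ = ε := ENNReal.add_halves ε
  zero_mem' := by
    intro ε hε
    refine ⟨_, IsTest.zero, ?_⟩
    have a : eLpNorm (fun x => ((0 : W11) : Lp ℝ 1 mu) x - 0) 1 mu = 0 := by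
      rw [eLpNorm_congr_ae (g := fun _ => (0 : ℝ))]
      · simp
      · filter_upwards [Lp.coeFn_zero ℝ 1 mu] with x hx
        simp only [Submodule.coe_zero, hx, sub_zero]
        rfl
    have b : eLpNorm (fun x => weakGrad 0 x - gradient (fun _ : Plane => (0 : ℝ)) x) 1 mu
        = 0 := by
      rw [eLpNorm_congr_ae (g := fun _ => (0 : Plane))]
      · simp
      · filter_upwards [Lp.coeFn_zero Plane 1 mu] with x hx
        simp only [map_zero, hx, gradient_zero']
        simp
    rw [a, b]
    simpa using hε
  smul_mem' := by
    intro c w hw ε hε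
    have hne : ENNReal.ofReal (|c| + 1) ≠ 0 := by
      simp only [ne_eq, ENNReal.ofReal_eq_zero, not_le]
      positivity
    obtain ⟨φ, hφ, h1⟩ := hw (ε / ENNReal.ofReal (|c| + 1))
      (ENNReal.div_pos hε.ne' (by simp))
    refine ⟨_, hφ.const_mul c, ?_⟩
    have a : eLpNorm (fun x => ((c • w : W11) : Lp ℝ 1 mu) x - c * φ x) 1 mu
        = ‖c‖ₑ * eLpNorm (fun x => (w : Lp ℝ 1 mu) x - φ x) 1 mu := by
      rw [← eLpNorm_const_smul]
      apply eLpNorm_congr_ae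
      filter_upwards [Lp.coeFn_smul c (w : Lp ℝ 1 mu)] with x hx
      simp only [Submodule.coe_smul, hx, Pi.smul_apply, smul_eq_mul]
      ring
    have b : eLpNorm (fun x => weakGrad (c • w) x - gradient (fun y => c * φ y) x) 1 mu
        = ‖c‖ₑ * eLpNorm (fun x => weakGrad w x - gradient φ x) 1 mu := by
      rw [← eLpNorm_const_smul]
      apply eLpNorm_congr_ae
      filter_upwards [Lp.coeFn_smul c (weakGrad w)] with x hx
      simp only [map_smul, hx, Pi.smul_apply, gradient_smul' c hφ, smul_sub]
    rw [a, b, ← mul_add]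
    have hc : ‖c‖ₑ ≤ ENNReal.ofReal (|c| + 1) := by
      rw [Real.enorm_eq_ofReal_abs]
      exact ENNReal.ofReal_le_ofReal (by linarith)
    refine (mul_le_mul_left hc _).trans_lt ?_
    have := (ENNReal.lt_div_iff_mul_lt (Or.inl hne) (Or.inl (by simp))).1 h1
    rwa [mul_comm] at this

/-- `W^{1,Φ}_0(Ω) = {w ∈ W^{1,1}_0(Ω) : ∇w ∈ L^Φ(Ω)}` for `Φ = Φ_{α,β}`. -/
def W0 (α β : ℝ) : Submodule ℝ W11 where
  carrier := {w | w ∈ W110 ∧ MemOrlicz (Phi α β) (weakGrad w)}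
  add_mem' := by
    rintro w v ⟨hw, hw1, hw2⟩ ⟨hv, hv1, hv2⟩
    refine ⟨W110.add_mem hw hv, Lp.aestronglyMeasurable _, ?_⟩
    obtain ⟨K, -, hK, H⟩ := luxNorm_add_le α β
    obtain ⟨c, hc1, hc2⟩ := exists_between (max_lt hw2 hv2)
    have := H _ _ hw1 hv1 c ((le_max_left _ _).trans_lt hc1) ((le_max_right _ _).trans_lt hc1)
    rw [map_add, luxNorm_congr (Lp.coeFn_add (weakGrad w) (weakGrad v))]
    exact this.trans (ENNReal.mul_lt_top hK.lt_top hc2)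
  zero_mem' := by
    refine ⟨W110.zero_mem, Lp.aestronglyMeasurable _, ?_⟩
    rw [map_zero, luxNorm_congr (Lp.coeFn_zero Plane 1 mu)]
    exact (luxNorm_zero α β).trans_lt (by simp)
  smul_mem' := by
    rintro c w ⟨hw, hw1, hw2⟩
    refine ⟨W110.smul_mem c hw, Lp.aestronglyMeasurable _, ?_⟩
    rw [map_smul, luxNorm_congr (Lp.coeFn_smul c (weakGrad w))]
    exact (luxNorm_smul_le α β c _).trans_lt (ENNReal.mul_lt_top (by simp) hw2)

/-- `H^{1,Φ}_0(Ω)`: the closure of `C_0^∞(Ω)` in `W^{1,Φ}_0(Ω)` with respect to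
`‖∇w‖_{L^Φ(Ω)}`, for `Φ = Φ_{α,β}`. -/
def H0 (α β : ℝ) : Submodule ℝ W11 where
  carrier := {w | w ∈ W0 α β ∧ ∀ ε : ℝ≥0∞, 0 < ε → ∃ φ : Plane → ℝ, IsTest φ ∧
    luxNorm (Phi α β) (fun x => weakGrad w x - gradient φ x) < ε}
  add_mem' := by
    rintro w v ⟨hw, hw1⟩ ⟨hv, hv1⟩
    refine ⟨(W0 α β).add_mem hw hv, fun ε hε => ?_⟩
    obtain ⟨K, hK0, hK, H⟩ := luxNorm_add_le α β
    obtain ⟨φ, hφ, h1⟩ := hw1 (ε / K) (ENNReal.div_pos hε.ne' hK)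
    obtain ⟨ψ, hψ, h2⟩ := hv1 (ε / K) (ENNReal.div_pos hε.ne' hK)
    refine ⟨_, hφ.add hψ, ?_⟩
    have := H _ _ ((Lp.aestronglyMeasurable _).sub
      (continuous_gradient hφ).aestronglyMeasurable) ((Lp.aestronglyMeasurable _).sub
      (continuous_gradient hψ).aestronglyMeasurable) _ h1 h2
    rw [ENNReal.mul_div_cancel hK0 hK] at this
    refine lt_of_eq_of_lt (luxNorm_congr ?_) this
    filter_upwards [Lp.coeFn_add (weakGrad w) (weakGrad v)] with x hx
    simp only [map_add, hx, Pi.add_apply, gradient_add' hφ hψ, Pi.sub_apply]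
    abel
  zero_mem' := by
    refine ⟨(W0 α β).zero_mem, fun ε hε => ⟨_, IsTest.zero, ?_⟩⟩
    refine lt_of_eq_of_lt (luxNorm_congr (g := fun _ => 0) ?_) ((luxNorm_zero α β).trans_lt hε)
    filter_upwards [Lp.coeFn_zero Plane 1 mu] with x hx
    simp only [map_zero, hx, gradient_zero']
    simp
  smul_mem' := by
    rintro c w ⟨hw, hw1⟩
    refine ⟨(W0 α β).smul_mem c hw, fun ε hε => ?_⟩
    have hne : ENNReal.ofReal (|c| + 1) ≠ 0 := by
      simp only [ne_eq, ENNReal.ofReal_eq_zero, not_le]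
      positivity
    obtain ⟨φ, hφ, h1⟩ := hw1 (ε / ENNReal.ofReal (|c| + 1))
      (ENNReal.div_pos hε.ne' (by simp))
    refine ⟨_, hφ.const_mul c, ?_⟩
    have e : luxNorm (Phi α β) (fun x => weakGrad (c • w) x - gradient (fun y => c * φ y) x)
        = luxNorm (Phi α β) (fun x => c • (weakGrad w x - gradient φ x)) := by
      apply luxNorm_congr
      filter_upwards [Lp.coeFn_smul c (weakGrad w)] with x hx
      simp only [map_smul, hx, Pi.smul_apply, gradient_smul' c hφ, smul_sub]
    rw [e]
    refine (luxNorm_smul_le α β c _).trans_lt ?_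
    have hc : ENNReal.ofReal |c| ≤ ENNReal.ofReal (|c| + 1) :=
      ENNReal.ofReal_le_ofReal (by linarith)
    refine (mul_le_mul_left hc _).trans_lt ?_
    have := (ENNReal.lt_div_iff_mul_lt (Or.inl hne) (Or.inl (by simp))).1 h1
    rwa [mul_comm] at this

/-! ### The functional -/

/-- `𝓖(w) = ∫_Ω Φ_{α,β}(x,|∇w|) dx + ∫_Ω b · ∇w dx`. The first integral takes values in
`[0,∞]`, the second is a real number, so that the sum makes sense in the extended reals. -/
def energyG (α β : ℝ) (b : Plane → Plane) (w : W11) : EReal :=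
  ((∫⁻ x, Phi α β x ‖weakGrad w x‖ ∂mu : ℝ≥0∞) : EReal)
    + ((∫ x, inner ℝ (b x) (weakGrad w x) ∂mu : ℝ) : EReal)

end BorderlineDoublePhase

end

noncomputable section

namespace BorderlineDoublePhase

open Filter Topology

/-! The origin is a saddle point of the weight. In the upper and lower cones the integrand grows
like `t² log^α`, in the two side cones only like `t² log^{-β}`. The only obstruction to density is a
jump of `w` between the upper and the lower cone at the origin. Two borderline integrals decide
whether it is real. A jump of size `D`, spread over the side cones, has a gradient of size `D/|x|`
there and costs about `∫ dr / (r log^β(1/r))`, which is finite iff `β > 1`. Conversely, a jump is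
detected by pairing `∇w` with a divergence-free field of size `1/|x|` supported in the double cone,
and this field has finite conjugate energy, about `∫ dr / (r log^α(1/r))`, when `α > 1`.

Away from the origin there is no obstruction. If the gradient vanishes near `0`, dilate with factors
`1+ε` horizontally and `(1+ε)²` vertically and mollify at a much smaller scale. The dilation pulls
the support inside the square and moves points of the double cone strictly into it, so the mollifier
never mixes light-phase values into a heavy-phase point, and a Jensen inequality gives convergence
of the modular (`Sob.approximable`). What remains is to make a gradient vanish near `0`. With `c₁`,
`c₂` the averages of `w` in the two cones at scale `r`, one removes the angular profile of height `D
= c₁ - c₂` outside `B_r` and replaces `w` by a constant near `0`. By Poincaré inequalities on the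
ball and on each half cone, the error is the energy of `B_r` plus the cost of the jump `D`
(`Sob.modular_sub_holeGrad_le`). So density holds as soon as the cost `holeCost` tends to `0` along
some scales (`Sob.approximable_of_holeCost`).

If `β ≤ 1`, the jumps `d_n` at scale `4^{-n}` satisfy `∑ d_n² log^{-β}(e + 4^n d_n) < ∞`, because
the disjoint shells pay for them (`Sob.ePow_jump_le`). Since `∑ 1/(n log n)` diverges, the terms are
`o(1/(n log n))` along a subsequence, and this is enough to make the cost vanish (`holeCost_le`,
`Sob.approximable_of_le_one`). If `α ≤ 1 < β`, the origin has zero capacity for the whole integrand: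
cutoffs with harmonic coefficients have vanishing energy, and multiplying a bounded `w` by one minus
such a cutoff punches the hole (`Sob.approximable_of_le_one_of_nonneg`).

If `α, β > 1`, the flux `w ↦ ∫ b·∇w` with `b = bField` is well defined by Young's inequality and
vanishes on limits of test functions (`Approximable.integral_inner_bField`). A vanishing flux makes
the jumps tend to zero (`Sob.jump_eq`), and their cost is then controlled because `1/|x|` has finite
`-β` energy (`Sob.approximable_of_flux_eq_zero`). Hence `H0` is exactly the kernel of the flux. The
angular function `cutAng` has finite energy and flux `-1`, so the codimension is one. A large
multiple of `b` makes the functional negative at `cutAng` while it stays nonnegative on `H0`, which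
is the Lavrentiev gap. -/

/-! ### Growth of `t² log^κ(e+t)`: doubling, quasi-monotonicity and a Jensen inequality. -/

lemma log_rpow_compare (κ : ℝ) {s t : ℝ} (hs : 0 < s) (hst : s ≤ t) :
    Real.log (Real.exp 1 + s) ^ κ
      ≤ (1 + Real.log (t / s)) ^ |κ| * Real.log (Real.exp 1 + t) ^ κ ∧
    Real.log (Real.exp 1 + t) ^ κ
      ≤ (1 + Real.log (t / s)) ^ |κ| * Real.log (Real.exp 1 + s) ^ κ := by
  have ht : 0 < t := hs.trans_le hst
  have hLs := one_le_log hs.le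
  have hLt := one_le_log ht.le
  have hmono : Real.log (Real.exp 1 + s) ≤ Real.log (Real.exp 1 + t) :=
    Real.log_le_log (by positivity) (by linarith)
  have hrat := log_ratio hs hst
  have hl0 : 0 ≤ Real.log (t / s) := Real.log_nonneg ((one_le_div hs).2 hst)
  have a2 : 1 ≤ (1 + Real.log (t / s)) ^ |κ| :=
    Real.one_le_rpow (by linarith) (abs_nonneg κ)
  have p1 : 0 < Real.log (Real.exp 1 + s) ^ κ := by positivity
  have p2 : 0 < Real.log (Real.exp 1 + t) ^ κ := by positivity
  rcases le_total 0 κ with hκ | hκ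
  · have a1 := Real.rpow_le_rpow (by linarith) hmono hκ
    have a3 := Real.rpow_le_rpow (by linarith) hrat hκ
    rw [Real.mul_rpow (by linarith) (by linarith)] at a3
    rw [abs_of_nonneg hκ] at a2 ⊢
    exact ⟨by nlinarith, by linarith⟩
  · have a1 := Real.rpow_le_rpow (by linarith) hrat (neg_nonneg.2 hκ)
    have a3 := Real.rpow_le_rpow_of_nonpos (by linarith) hmono hκ
    rw [Real.mul_rpow (by linarith) (by linarith)] at a1
    rw [abs_of_nonpos hκ] at a2 ⊢
    have b1 : Real.log (Real.exp 1 + s) ^ (-κ) = (Real.log (Real.exp 1 + s) ^ κ)⁻¹ :=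
      Real.rpow_neg (by linarith) _
    have b2 : Real.log (Real.exp 1 + t) ^ (-κ) = (Real.log (Real.exp 1 + t) ^ κ)⁻¹ :=
      Real.rpow_neg (by linarith) _
    rw [b1, b2] at a1
    rw [inv_mul_eq_div, le_div_iff₀ p1, inv_mul_eq_div, div_le_iff₀ p2] at a1
    exact ⟨a1, by nlinarith⟩

/-- From `1 + u ≤ e^u` with `u = log r / (p+1)` one gets `1 + log r ≤ (p+1) r^{1/(p+1)}`; the `p`-th
power of the right side grows with exponent `p/(p+1) ≤ 1`. -/
lemma exists_one_add_log_rpow_le (p : ℝ) (hp : 0 ≤ p) :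
    ∃ C : ℝ, 1 ≤ C ∧ ∀ r : ℝ, 1 ≤ r → (1 + Real.log r) ^ p ≤ C * r := by
  refine ⟨((p + 1) ) ^ p, Real.one_le_rpow (by linarith) hp, fun r hr => ?_⟩
  have hr0 : 0 < r := by linarith
  have h1 : 1 + Real.log r ≤ (p + 1) * r ^ (1 / (p + 1)) := by
    have := Real.add_one_le_exp (Real.log r / (p + 1))
    rw [Real.rpow_def_of_pos hr0]
    have h2 : Real.log r * (1 / (p + 1)) = Real.log r / (p + 1) := by ring
    rw [h2]
    have h3 : (p + 1) * (Real.log r / (p + 1) + 1) = Real.log r + (p + 1) := by field_simp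
    have h4 := mul_le_mul_of_nonneg_left this (show (0 : ℝ) ≤ p + 1 by linarith)
    linarith
  have hl := Real.log_nonneg hr
  calc (1 + Real.log r) ^ p ≤ ((p + 1) * r ^ (1 / (p + 1))) ^ p :=
        Real.rpow_le_rpow (by linarith) h1 hp
    _ = (p + 1) ^ p * r ^ (1 / (p + 1) * p) := by
        rw [Real.mul_rpow (by linarith) (by positivity), ← Real.rpow_mul hr0.le]
    _ ≤ (p + 1) ^ p * r ^ (1 : ℝ) := by
        gcongr
        rw [one_div, inv_mul_le_iff₀ (by linarith)]; linarith
    _ = (p + 1) ^ p * r := by rw [Real.rpow_one]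

lemma logPow_zero (κ : ℝ) : logPow κ 0 = 0 := by simp [logPow]

/-- Of the two powers of `t/s` in the quadratic factor, one absorbs the change of the logarithm and
the other remains, so `logPow κ t / t` is nondecreasing up to a constant. This is the substitute for
convexity, for every real `κ`. -/
lemma logPow_quasi_incr (κ : ℝ) : ∃ C : ℝ, 1 ≤ C ∧ ∀ s t : ℝ, 0 ≤ s → s ≤ t →
    logPow κ s * t ≤ C * logPow κ t * s := by
  obtain ⟨C, hC, H⟩ := exists_one_add_log_rpow_le |κ| (abs_nonneg κ)
  refine ⟨C, hC, fun s t hs hst => ?_⟩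
  rcases hs.eq_or_lt with rfl | hs
  · simp [logPow]
  have h1 := (log_rpow_compare κ hs hst).1
  have h2 := H _ ((one_le_div hs).2 hst)
  have ht : 0 < t := hs.trans_le hst
  have hLt0 : 0 ≤ Real.log (Real.exp 1 + t) ^ κ := by
    have := one_le_log ht.le
    positivity
  unfold logPow
  calc s ^ 2 * Real.log (Real.exp 1 + s) ^ κ * t
      ≤ s ^ 2 * ((C * (t / s)) * Real.log (Real.exp 1 + t) ^ κ) * t := by
        have := h1.trans (mul_le_mul_of_nonneg_right h2 hLt0)
        gcongr
    _ = C * (t ^ 2 * Real.log (Real.exp 1 + t) ^ κ) * s := by field_simp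

lemma logPow_mul_le (κ : ℝ) : ∃ C : ℝ, 1 ≤ C ∧ ∀ c t : ℝ, 0 ≤ c → c ≤ 1 → 0 ≤ t →
    logPow κ (c * t) ≤ C * c * logPow κ t := by
  obtain ⟨C, hC, H⟩ := logPow_quasi_incr κ
  refine ⟨C, hC, fun c t hc hc1 ht => ?_⟩
  rcases ht.eq_or_lt with rfl | ht
  · simp [logPow]
  have := H (c * t) t (by positivity) (by nlinarith)
  have h2 : logPow κ (c * t) * t ≤ (C * c * logPow κ t) * t := by linarith
  exact le_of_mul_le_mul_right h2 ht

lemma logPow_mono (κ : ℝ) : ∃ C : ℝ, 1 ≤ C ∧ ∀ s t : ℝ, 0 ≤ s → s ≤ t →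
    logPow κ s ≤ C * logPow κ t := by
  obtain ⟨C, hC, H⟩ := logPow_mul_le κ
  refine ⟨C, hC, fun s t hs hst => ?_⟩
  rcases hs.eq_or_lt with rfl | hs
  · rw [logPow_zero]
    exact mul_nonneg (by linarith) (logPow_nonneg κ hst)
  have ht : 0 < t := hs.trans_le hst
  have h1 : s / t ≤ 1 := (div_le_one ht).2 hst
  have := H (s / t) t (by positivity) h1 ht.le
  rw [div_mul_cancel₀ _ ht.ne'] at this
  refine this.trans ?_
  have := logPow_nonneg κ ht.le
  have hC0 : 0 ≤ C := by linarith
  calc C * (s / t) * logPow κ t ≤ C * 1 * logPow κ t := by gcongr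
    _ = _ := by ring

/-- A doubling condition: multiplying the argument by a constant factor multiplies the logarithm by
at most a constant factor. -/
lemma logPow_scale (κ : ℝ) (lam : ℝ) : ∃ C : ℝ, 1 ≤ C ∧ ∀ s t : ℝ, 0 ≤ s → 0 ≤ t → s ≤ lam * t →
    logPow κ s ≤ C * logPow κ t := by
  obtain ⟨C, hC, H⟩ := logPow_mono κ
  set l := max lam 1 with hl
  have hl1 : 1 ≤ l := le_max_right _ _
  have hlog : 0 ≤ Real.log l := Real.log_nonneg hl1
  have hR : 1 ≤ (1 + Real.log l) ^ |κ| := Real.one_le_rpow (by linarith) (abs_nonneg κ)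
  refine ⟨C * (l ^ 2 * (1 + Real.log l) ^ |κ|), ?_, fun s t hs ht hst => ?_⟩
  · have : 1 ≤ l ^ 2 * (1 + Real.log l) ^ |κ| := one_le_mul_of_one_le_of_one_le (by nlinarith) hR
    exact one_le_mul_of_one_le_of_one_le hC this
  rcases ht.eq_or_lt with rfl | ht
  · have : s = 0 := by linarith
    subst this
    simp [logPow]
  have h1 : s ≤ l * t := hst.trans (mul_le_mul_of_nonneg_right (le_max_left _ _) ht.le)
  have h2 := H s (l * t) hs h1
  have h3 := (log_rpow_compare κ ht (show t ≤ l * t by nlinarith)).2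
  rw [mul_div_cancel_right₀ _ ht.ne'] at h3
  refine h2.trans ?_
  unfold logPow
  have hC0 : 0 ≤ C := by linarith
  calc C * ((l * t) ^ 2 * Real.log (Real.exp 1 + l * t) ^ κ)
      ≤ C * ((l * t) ^ 2 * ((1 + Real.log l) ^ |κ| * Real.log (Real.exp 1 + t) ^ κ)) := by
        gcongr
    _ = _ := by ring

/-- `t² log^κ(e+t)` with values in `[0,∞]`. -/
def ePow (κ t : ℝ) : ℝ≥0∞ := ENNReal.ofReal (logPow κ t)

lemma ePow_zero (κ : ℝ) : ePow κ 0 = 0 := by simp [ePow, logPow]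

lemma measurable_logPow (κ : ℝ) : Measurable (logPow κ) := by
  unfold logPow
  fun_prop

lemma measurable_ePow (κ : ℝ) : Measurable (ePow κ) :=
  (measurable_logPow κ).ennreal_ofReal

lemma ePow_ne_top (κ t : ℝ) : ePow κ t ≠ ∞ := ENNReal.ofReal_ne_top

lemma ePow_scale (κ lam : ℝ) : ∃ C : ℝ≥0∞, C ≠ ∞ ∧ ∀ s t : ℝ, 0 ≤ s → 0 ≤ t → s ≤ lam * t →
    ePow κ s ≤ C * ePow κ t := by
  obtain ⟨C, hC, H⟩ := logPow_scale κ lam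
  refine ⟨ENNReal.ofReal C, ENNReal.ofReal_ne_top, fun s t hs ht h => ?_⟩
  unfold ePow
  rw [← ENNReal.ofReal_mul (by linarith)]
  exact ENNReal.ofReal_le_ofReal (H s t hs ht h)

lemma ePow_mul_le (κ : ℝ) : ∃ C : ℝ≥0∞, C ≠ ∞ ∧ ∀ c s t : ℝ, 0 ≤ c → c ≤ 1 → 0 ≤ s → 0 ≤ t →
    s ≤ c * t → ePow κ s ≤ C * ENNReal.ofReal c * ePow κ t := by
  obtain ⟨C, hC, H⟩ := logPow_mul_le κ
  obtain ⟨D, hD, H'⟩ := logPow_mono κ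
  refine ⟨ENNReal.ofReal (D * C), ENNReal.ofReal_ne_top, fun c s t hc hc1 hs ht hst => ?_⟩
  unfold ePow
  rw [← ENNReal.ofReal_mul (by positivity), ← ENNReal.ofReal_mul (by positivity)]
  apply ENNReal.ofReal_le_ofReal
  have h1 := H' s (c * t) hs hst
  have h2 := H c t hc hc1 ht
  calc _ ≤ _ := h1
    _ ≤ D * (C * c * logPow κ t) := by gcongr
    _ = _ := by ring

/-- Quasi-monotonicity of `logPow κ t / t` replaces a supporting line. The constant depends on `κ`
and `A` only, not on the probability space, so that one lemma serves mollification, Poincaré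
inequalities and averages over shells. -/
lemma ePow_jensen (κ A : ℝ) : ∃ C : ℝ≥0∞, C ≠ ∞ ∧ ∀ (X : Type) [MeasurableSpace X]
    (P : Measure X) [IsProbabilityMeasure P] (g : X → ℝ) (m : ℝ), Integrable g P →
      (∀ x, 0 ≤ g x) → 0 ≤ m → m ≤ A * ∫ x, g x ∂P →
        ePow κ m ≤ C * ∫⁻ x, ePow κ (g x) ∂P := by
  obtain ⟨C, hC, H⟩ := logPow_quasi_incr κ
  obtain ⟨D, hD, H'⟩ := ePow_scale κ (2 * A)
  refine ⟨D * ENNReal.ofReal C, ENNReal.mul_ne_top hD ENNReal.ofReal_ne_top, ?_⟩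
  intro X _ P _ g m hg hg0 hm hmA
  -- Half the mean is used so that `g - a` has integral `a > 0`; with the full mean the integrated
  -- inequality would be empty.
  set a := (∫ x, g x ∂P) / 2 with ha
  have ha0 : 0 ≤ a := by
    have : 0 ≤ ∫ x, g x ∂P := integral_nonneg fun x => hg0 x
    positivity
  have h1 : ePow κ m ≤ D * ePow κ a := H' m a hm ha0 (by rw [ha]; linarith)
  rw [mul_assoc]
  refine h1.trans ?_
  gcongr
  rcases ha0.eq_or_lt with h0 | h0
  · rw [← h0, ePow_zero]; exact zero_le
  have hCa : 0 ≤ C * logPow κ a := mul_nonneg (by linarith) (logPow_nonneg κ ha0)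
  -- Where `g x ≥ a` this is quasi-monotonicity; elsewhere the left side is nonpositive.
  have hpt : ∀ x, (g x - a) * logPow κ a ≤ C * a * logPow κ (g x) := by
    intro x
    have hn := logPow_nonneg κ (hg0 x)
    have hna := logPow_nonneg κ ha0
    rcases le_total a (g x) with h | h
    · have := H a (g x) ha0 h
      nlinarith
    · have : (g x - a) * logPow κ a ≤ 0 := mul_nonpos_of_nonpos_of_nonneg (by linarith) hna
      have h3 : 0 ≤ C * a * logPow κ (g x) := by positivity
      linarith
  have hint : Integrable (fun x => (g x - a) * logPow κ a) P :=
    (hg.sub (integrable_const a)).mul_const _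
  have hI : ∫ x, (g x - a) * logPow κ a ∂P = a * logPow κ a := by
    rw [integral_mul_const, integral_sub hg (integrable_const a)]
    simp only [integral_const, probReal_univ, one_smul]
    rw [show ∫ x, g x ∂P = 2 * a by rw [ha]; ring]
    ring
  have h2 : ENNReal.ofReal (a * logPow κ a) ≤
      ∫⁻ x, ENNReal.ofReal (C * a * logPow κ (g x)) ∂P := by
    rw [← hI]
    calc ENNReal.ofReal (∫ x, (g x - a) * logPow κ a ∂P)
        ≤ ∫⁻ x, ENNReal.ofReal ((g x - a) * logPow κ a) ∂P := by
          rw [integral_eq_lintegral_pos_part_sub_lintegral_neg_part hint]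
          exact (ENNReal.ofReal_le_ofReal (sub_le_self _ ENNReal.toReal_nonneg)).trans
            ENNReal.ofReal_toReal_le
      _ ≤ _ := lintegral_mono fun x => ENNReal.ofReal_le_ofReal (hpt x)
  have h3 : ∀ x, ENNReal.ofReal (C * a * logPow κ (g x))
      = ENNReal.ofReal a * (ENNReal.ofReal C * ePow κ (g x)) := fun x => by
    unfold ePow
    rw [← ENNReal.ofReal_mul (by linarith), ← ENNReal.ofReal_mul h0.le]
    ring_nf
  simp only [h3] at h2
  rw [lintegral_const_mul' _ _ ENNReal.ofReal_ne_top,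
    lintegral_const_mul' _ _ ENNReal.ofReal_ne_top, ENNReal.ofReal_mul h0.le] at h2
  exact (ENNReal.mul_le_mul_iff_right (by simpa using h0) ENNReal.ofReal_ne_top).1 h2

/-! ### Scaling and quasi-triangle inequalities for the integrand, uniform in `x`. -/

lemma Phi_eq (α β : ℝ) (x : Plane) {t : ℝ} (ht : 0 ≤ t) :
    Phi α β x t = ePow (-β) t + ENNReal.ofReal (weight x) * ePow α t := by
  unfold Phi ePow
  rw [ENNReal.ofReal_add (logPow_nonneg _ ht) (mul_nonneg (weight_nonneg x) (logPow_nonneg _ ht)),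
    ENNReal.ofReal_mul (weight_nonneg x)]

lemma Phi_zero (α β : ℝ) (x : Plane) : Phi α β x 0 = 0 := by
  simp [Phi, logPow]

lemma ePow_le_Phi (α β : ℝ) (x : Plane) {t : ℝ} (ht : 0 ≤ t) : ePow (-β) t ≤ Phi α β x t := by
  rw [Phi_eq α β x ht]
  exact le_self_add

lemma Phi_ne_top (α β : ℝ) (x : Plane) (t : ℝ) : Phi α β x t ≠ ∞ := ENNReal.ofReal_ne_top

lemma Phi_scale (α β lam : ℝ) : ∃ C : ℝ≥0∞, C ≠ ∞ ∧ ∀ (x : Plane) (s t : ℝ), 0 ≤ s → 0 ≤ t →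
    s ≤ lam * t → Phi α β x s ≤ C * Phi α β x t := by
  obtain ⟨C, hC, H⟩ := ePow_scale (-β) lam
  obtain ⟨D, hD, H'⟩ := ePow_scale α lam
  refine ⟨max C D, (max_lt hC.lt_top hD.lt_top).ne, fun x s t hs ht h => ?_⟩
  rw [Phi_eq α β x hs, Phi_eq α β x ht, mul_add, mul_left_comm _ (ENNReal.ofReal (weight x))]
  gcongr
  · exact (H s t hs ht h).trans (by gcongr; exact le_max_left _ _)
  · exact (H' s t hs ht h).trans (by gcongr; exact le_max_right _ _)

lemma Phi_mul_le (α β : ℝ) : ∃ C : ℝ≥0∞, C ≠ ∞ ∧ ∀ (x : Plane) (c s t : ℝ), 0 ≤ c → c ≤ 1 →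
    0 ≤ s → 0 ≤ t → s ≤ c * t → Phi α β x s ≤ C * ENNReal.ofReal c * Phi α β x t := by
  obtain ⟨C, hC, H⟩ := ePow_mul_le (-β)
  obtain ⟨D, hD, H'⟩ := ePow_mul_le α
  refine ⟨max C D, (max_lt hC.lt_top hD.lt_top).ne, fun x c s t hc hc1 hs ht h => ?_⟩
  rw [Phi_eq α β x hs, Phi_eq α β x ht, mul_add, mul_left_comm _ (ENNReal.ofReal (weight x))]
  gcongr
  · exact (H c s t hc hc1 hs ht h).trans (by gcongr; exact le_max_left _ _)
  · exact (H' c s t hc hc1 hs ht h).trans (by gcongr; exact le_max_right _ _)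

lemma Phi_add_le (α β : ℝ) : ∃ C : ℝ≥0∞, C ≠ ∞ ∧ ∀ (x : Plane) (r s t : ℝ), 0 ≤ r → 0 ≤ s →
    0 ≤ t → r ≤ s + t → Phi α β x r ≤ C * (Phi α β x s + Phi α β x t) := by
  obtain ⟨C, hC, H⟩ := Phi_scale α β 2
  refine ⟨C, hC, fun x r s t hr hs ht h => ?_⟩
  rw [mul_add]
  rcases le_total s t with h' | h'
  · exact (H x r t hr ht (by linarith)).trans le_add_self
  · exact (H x r s hr hs (by linarith)).trans le_self_add

/-! ### Sobolev functions with zero boundary values as functions on the plane -/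

lemma norm_gradient (f : Plane → ℝ) (x : Plane) : ‖gradient f x‖ = ‖fderiv ℝ f x‖ := by
  simp [gradient]

lemma gradient_mul {f h : Plane → ℝ} {x : Plane} (hf : DifferentiableAt ℝ f x)
    (hh : DifferentiableAt ℝ h x) :
    gradient (fun y => f y * h y) x = f x • gradient h x + h x • gradient f x := by
  unfold gradient
  rw [fderiv_fun_mul hf hh, map_add]
  simp

lemma gradient_comp_real {G : ℝ → ℝ} {f : Plane → ℝ} {x : Plane} (hf : DifferentiableAt ℝ f x)
    (hG : DifferentiableAt ℝ G (f x)) :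
    gradient (fun y => G (f y)) x = deriv G (f x) • gradient f x := by
  unfold gradient
  have : fderiv ℝ (fun y => G (f y)) x = deriv G (f x) • fderiv ℝ f x := by
    have := hG.hasDerivAt.comp_hasFDerivAt x hf.hasFDerivAt
    exact this.fderiv
  rw [this]
  simp

lemma exists_subseq_ae {F : Type} [NormedAddCommGroup F] {f : ℕ → Plane → F} {f₀ : Plane → F}
    (hf : ∀ n, AEStronglyMeasurable (f n) volume) (hf₀ : AEStronglyMeasurable f₀ volume)
    (h : Tendsto (fun n => ∫⁻ x, ‖f₀ x - f n x‖ₑ) atTop (𝓝 0)) :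
    ∃ ns : ℕ → ℕ, StrictMono ns ∧
      ∀ᵐ x, Tendsto (fun i => f (ns i) x) atTop (𝓝 (f₀ x)) := by
  refine (tendstoInMeasure_of_tendsto_eLpNorm (p := 1) one_ne_zero hf hf₀ ?_).exists_seq_tendsto_ae
  refine h.congr fun n => ?_
  rw [eLpNorm_one_eq_lintegral_enorm]
  refine lintegral_congr fun x => ?_
  rw [Pi.sub_apply, ← enorm_neg, neg_sub]

lemma exists_seq_tendsto_zero {X : Type*} {p : X → Prop} {a : X → ℝ≥0∞}
    (h : ∀ ε : ℝ≥0∞, 0 < ε → ∃ x, p x ∧ a x < ε) :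
    ∃ x : ℕ → X, (∀ n, p (x n)) ∧ Tendsto (fun n => a (x n)) atTop (𝓝 0) := by
  have : ∀ n : ℕ, ∃ x, p x ∧ a x < ((n : ℝ≥0∞) + 1)⁻¹ := fun n =>
    h _ (ENNReal.inv_pos.2 (by finiteness))
  choose x hx hx' using this
  refine ⟨x, hx, ?_⟩
  refine tendsto_of_tendsto_of_tendsto_of_le_of_le tendsto_const_nhds ?_ (fun _ => zero_le)
    (fun n => (hx' n).le)
  have := (tendsto_add_atTop_iff_nat (f := fun n : ℕ => ((n : ℝ≥0∞))⁻¹) 1).2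
    ENNReal.tendsto_inv_nat_nhds_zero
  simpa using this

lemma IsTest.continuous {φ : Plane → ℝ} (hφ : IsTest φ) : Continuous φ := hφ.1.continuous

lemma IsTest.integrable {φ : Plane → ℝ} (hφ : IsTest φ) : Integrable φ :=
  hφ.continuous.integrable_of_hasCompactSupport hφ.2.1

lemma IsTest.hasCompactSupport_gradient {φ : Plane → ℝ} (hφ : IsTest φ) :
    HasCompactSupport (gradient φ) := by
  have h1 : HasCompactSupport (fderiv ℝ φ) := hφ.2.1.fderiv ℝ
  exact h1.comp_left (g := fun L => (InnerProductSpace.toDual ℝ Plane).symm L) (by simp)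

lemma IsTest.integrable_gradient {φ : Plane → ℝ} (hφ : IsTest φ) : Integrable (gradient φ) :=
  (continuous_gradient hφ).integrable_of_hasCompactSupport hφ.hasCompactSupport_gradient

lemma IsTest.differentiable {φ : Plane → ℝ} (hφ : IsTest φ) : Differentiable ℝ φ :=
  hφ.1.differentiable (by simp)

lemma IsTest.eq_zero {φ : Plane → ℝ} (hφ : IsTest φ) {x : Plane} (hx : x ∉ Square) : φ x = 0 :=
  image_eq_zero_of_notMem_tsupport fun h => hx (hφ.2.2 h)

lemma IsTest.gradient_eq_zero {φ : Plane → ℝ} (hφ : IsTest φ) {x : Plane} (hx : x ∉ Square) :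
    gradient φ x = 0 := by
  have h : x ∉ tsupport (fderiv ℝ φ) := fun h => hx (hφ.2.2 (tsupport_fderiv_subset ℝ h))
  have := image_eq_zero_of_notMem_tsupport h
  simp [gradient, this]

/-- `w` is the limit in `L¹` of test functions, whose gradients converge to `g` in `L¹`. -/
structure Sob (w : Plane → ℝ) (g : Plane → Plane) : Prop where
  meas : Measurable w
  meas_grad : Measurable g
  approx : ∀ ε : ℝ≥0∞, 0 < ε → ∃ φ : Plane → ℝ, IsTest φ ∧
    (∫⁻ x, ‖w x - φ x‖ₑ) + ∫⁻ x, ‖g x - gradient φ x‖ₑ < ε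

lemma Sob.of_test {φ : Plane → ℝ} (hφ : IsTest φ) : Sob φ (gradient φ) where
  meas := hφ.continuous.measurable
  meas_grad := (continuous_gradient hφ).measurable
  approx ε hε := ⟨φ, hφ, by simpa using hε⟩

lemma lintegral_enorm_sub_le {F : Type} [NormedAddCommGroup F] [MeasurableSpace F]
    [BorelSpace F] [SecondCountableTopology F]
    {a b c : Plane → F} (ha : Measurable a) (hb : Measurable b) :
    ∫⁻ x, ‖a x - c x‖ₑ ≤ (∫⁻ x, ‖a x - b x‖ₑ) + ∫⁻ x, ‖b x - c x‖ₑ := by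
  have hm : Measurable fun x => ‖a x - b x‖ₑ := (ha.sub hb).enorm
  rw [← lintegral_add_left hm]
  refine lintegral_mono fun x => ?_
  have := enorm_add_le (a x - b x) (b x - c x)
  simpa using this

/-- Closedness of the class under joint `L¹` limits of function and gradient; all later
constructions only have to be checked on test functions. -/
lemma Sob.of_approx {w : Plane → ℝ} {g : Plane → Plane} (hw : Measurable w) (hg : Measurable g)
    (h : ∀ ε : ℝ≥0∞, 0 < ε → ∃ (w' : Plane → ℝ) (g' : Plane → Plane), Sob w' g' ∧
      (∫⁻ x, ‖w x - w' x‖ₑ) + ∫⁻ x, ‖g x - g' x‖ₑ < ε) : Sob w g where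
  meas := hw
  meas_grad := hg
  approx ε hε := by
    obtain ⟨w', g', hS, h1⟩ := h (ε / 2) (ENNReal.half_pos hε.ne')
    obtain ⟨φ, hφ, h2⟩ := hS.approx (ε / 2) (ENNReal.half_pos hε.ne')
    refine ⟨φ, hφ, ?_⟩
    calc _ ≤ _ := add_le_add (lintegral_enorm_sub_le hw hS.meas)
            (lintegral_enorm_sub_le hg hS.meas_grad)
      _ = ((∫⁻ x, ‖w x - w' x‖ₑ) + ∫⁻ x, ‖g x - g' x‖ₑ)
          + ((∫⁻ x, ‖w' x - φ x‖ₑ) + ∫⁻ x, ‖g' x - gradient φ x‖ₑ) := by ring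
      _ < ε / 2 + ε / 2 := ENNReal.add_lt_add h1 h2
      _ = ε := ENNReal.add_halves ε

lemma Sob.of_tendsto {w : Plane → ℝ} {g : Plane → Plane} (hw : Measurable w) (hg : Measurable g)
    {w' : ℕ → Plane → ℝ} {g' : ℕ → Plane → Plane} (hS : ∀ n, Sob (w' n) (g' n))
    (h1 : Tendsto (fun n => ∫⁻ x, ‖w x - w' n x‖ₑ) atTop (𝓝 0))
    (h2 : Tendsto (fun n => ∫⁻ x, ‖g x - g' n x‖ₑ) atTop (𝓝 0)) : Sob w g := by
  refine Sob.of_approx hw hg fun ε hε => ?_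
  have := h1.add h2
  rw [add_zero] at this
  obtain ⟨n, hn⟩ := (this.eventually (gt_mem_nhds hε)).exists
  exact ⟨w' n, g' n, hS n, hn⟩

lemma Sob.exists_seq {w : Plane → ℝ} {g : Plane → Plane} (h : Sob w g) :
    ∃ φ : ℕ → Plane → ℝ, (∀ n, IsTest (φ n)) ∧
      Tendsto (fun n => ∫⁻ x, ‖w x - φ n x‖ₑ) atTop (𝓝 0) ∧
      Tendsto (fun n => ∫⁻ x, ‖g x - gradient (φ n) x‖ₑ) atTop (𝓝 0) := by
  obtain ⟨φ, hφ, hlim⟩ := exists_seq_tendsto_zero h.approx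
  refine ⟨φ, hφ, ?_, ?_⟩
  · exact tendsto_of_tendsto_of_tendsto_of_le_of_le tendsto_const_nhds hlim (fun _ => zero_le)
      (fun n => le_self_add)
  · exact tendsto_of_tendsto_of_tendsto_of_le_of_le tendsto_const_nhds hlim (fun _ => zero_le)
      (fun n => le_add_self)

lemma Sob.exists_seq_ae {w : Plane → ℝ} {g : Plane → Plane} (h : Sob w g) :
    ∃ φ : ℕ → Plane → ℝ, (∀ n, IsTest (φ n)) ∧
      Tendsto (fun n => ∫⁻ x, ‖w x - φ n x‖ₑ) atTop (𝓝 0) ∧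
      Tendsto (fun n => ∫⁻ x, ‖g x - gradient (φ n) x‖ₑ) atTop (𝓝 0) ∧
      (∀ᵐ x, Tendsto (fun n => φ n x) atTop (𝓝 (w x))) := by
  obtain ⟨φ, hφ, h1, h2⟩ := h.exists_seq
  obtain ⟨ns, hns, hae⟩ := exists_subseq_ae (fun n => (hφ n).continuous.aestronglyMeasurable)
    h.meas.aestronglyMeasurable h1
  exact ⟨fun n => φ (ns n), fun n => hφ _, h1.comp hns.tendsto_atTop, h2.comp hns.tendsto_atTop,
    hae⟩

lemma Sob.integrable {w : Plane → ℝ} {g : Plane → Plane} (h : Sob w g) :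
    Integrable w ∧ Integrable g := by
  obtain ⟨φ, hφ, h1⟩ := h.approx 1 one_pos
  have e1 : Integrable (fun x => w x - φ x) :=
    ⟨(h.meas.sub hφ.continuous.measurable).aestronglyMeasurable,
      (lt_of_le_of_lt le_self_add h1).trans ENNReal.one_lt_top⟩
  have e2 : Integrable (fun x => g x - gradient φ x) :=
    ⟨(h.meas_grad.sub (continuous_gradient hφ).measurable).aestronglyMeasurable,
      (lt_of_le_of_lt le_add_self h1).trans ENNReal.one_lt_top⟩
  constructor
  · exact (e1.add hφ.integrable).congr (ae_of_all _ fun x => by simp)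
  · exact (e2.add hφ.integrable_gradient).congr (ae_of_all _ fun x => by simp)

lemma Sob.congr {w w' : Plane → ℝ} {g g' : Plane → Plane} (h : Sob w g) (hw : w =ᵐ[volume] w')
    (hg : g =ᵐ[volume] g') (hw' : Measurable w') (hg' : Measurable g') : Sob w' g' := by
  refine Sob.of_approx hw' hg' fun ε hε => ⟨w, g, h, ?_⟩
  have e1 : ∫⁻ x, ‖w' x - w x‖ₑ = 0 := by
    rw [lintegral_congr_ae (g := fun _ => 0), lintegral_zero]
    filter_upwards [hw] with x hx
    simp [hx]
  have e2 : ∫⁻ x, ‖g' x - g x‖ₑ = 0 := by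
    rw [lintegral_congr_ae (g := fun _ => 0), lintegral_zero]
    filter_upwards [hg] with x hx
    simp [hx]
  rw [e1, e2]
  simpa using hε

lemma Sob.ae_eq_zero {w : Plane → ℝ} {g : Plane → Plane} (h : Sob w g) :
    ∀ᵐ x, x ∉ Square → w x = 0 ∧ g x = 0 := by
  have hc : MeasurableSet Squareᶜ := isOpen_Square.measurableSet.compl
  have key : (∫⁻ x in Squareᶜ, ‖w x‖ₑ) + ∫⁻ x in Squareᶜ, ‖g x‖ₑ = 0 := by
    refine le_antisymm (le_of_forall_gt fun ε hε => ?_) zero_le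
    obtain ⟨φ, hφ, h1⟩ := h.approx ε hε
    refine lt_of_le_of_lt (add_le_add ?_ ?_) h1
    · rw [setLIntegral_congr_fun (g := fun x => ‖w x - φ x‖ₑ) hc]
      · exact setLIntegral_le_lintegral _ _
      · intro x hx
        simp [hφ.eq_zero hx]
    · rw [setLIntegral_congr_fun (g := fun x => ‖g x - gradient φ x‖ₑ) hc]
      · exact setLIntegral_le_lintegral _ _
      · intro x hx
        simp [hφ.gradient_eq_zero hx]
  rw [add_eq_zero, lintegral_eq_zero_iff h.meas.enorm, lintegral_eq_zero_iff h.meas_grad.enorm]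
    at key
  filter_upwards [(ae_restrict_iff' hc).1 key.1, (ae_restrict_iff' hc).1 key.2] with x h1 h2 hx
  exact ⟨by simpa using h1 hx, by simpa using h2 hx⟩

lemma Sob.const_mul {w : Plane → ℝ} {g : Plane → Plane} (c : ℝ) (h : Sob w g) :
    Sob (fun x => c * w x) (fun x => c • g x) := by
  obtain ⟨φ, hφ, h1, h2⟩ := h.exists_seq
  refine Sob.of_tendsto (h.meas.const_mul c) (h.meas_grad.const_smul c)
    (fun n => Sob.of_test ((hφ n).const_mul c)) ?_ ?_
  · have := ENNReal.Tendsto.const_mul (a := ‖c‖ₑ) h1 (Or.inr (by simp))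
    rw [mul_zero] at this
    refine this.congr fun n => ?_
    rw [← lintegral_const_mul' _ _ (by simp)]
    refine lintegral_congr fun x => ?_
    rw [← enorm_mul, mul_sub]
  · have := ENNReal.Tendsto.const_mul (a := ‖c‖ₑ) h2 (Or.inr (by simp))
    rw [mul_zero] at this
    refine this.congr fun n => ?_
    rw [← lintegral_const_mul' _ _ (by simp)]
    refine lintegral_congr fun x => ?_
    rw [gradient_smul' c (hφ n), ← enorm_smul, smul_sub]

lemma tendsto_lintegral_add {F : Type} [NormedAddCommGroup F] [MeasurableSpace F]
    [BorelSpace F] [SecondCountableTopology F]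
    {a b : Plane → F} {a' b' : ℕ → Plane → F} (ha : Measurable a) (ha' : ∀ n, Measurable (a' n))
    (h1 : Tendsto (fun n => ∫⁻ x, ‖a x - a' n x‖ₑ) atTop (𝓝 0))
    (h2 : Tendsto (fun n => ∫⁻ x, ‖b x - b' n x‖ₑ) atTop (𝓝 0)) :
    Tendsto (fun n => ∫⁻ x, ‖(a x + b x) - (a' n x + b' n x)‖ₑ) atTop (𝓝 0) := by
  have := h1.add h2
  rw [add_zero] at this
  refine tendsto_of_tendsto_of_tendsto_of_le_of_le tendsto_const_nhds this (fun _ => zero_le)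
    fun n => ?_
  have hm : Measurable fun x => ‖a x - a' n x‖ₑ := (ha.sub (ha' n)).enorm
  rw [← lintegral_add_left hm]
  refine lintegral_mono fun x => ?_
  have := enorm_add_le (a x - a' n x) (b x - b' n x)
  rwa [add_sub_add_comm]

lemma Sob.add {w v : Plane → ℝ} {g h : Plane → Plane} (hw : Sob w g) (hv : Sob v h) :
    Sob (fun x => w x + v x) (fun x => g x + h x) := by
  obtain ⟨φ, hφ, h1, h2⟩ := hw.exists_seq
  obtain ⟨ψ, hψ, h3, h4⟩ := hv.exists_seq
  refine Sob.of_tendsto (hw.meas.add hv.meas) (hw.meas_grad.add hv.meas_grad)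
    (fun n => Sob.of_test ((hφ n).add (hψ n))) ?_ ?_
  · exact tendsto_lintegral_add hw.meas (fun n => (hφ n).continuous.measurable) h1 h3
  · simp only [gradient_add' (hφ _) (hψ _)]
    exact tendsto_lintegral_add hw.meas_grad (fun n => (continuous_gradient (hφ n)).measurable)
      h2 h4

lemma tendsto_lintegral_mul_of_bdd {F F' : Type} [NormedAddCommGroup F] [NormedAddCommGroup F']
    {a : Plane → F} {a' : ℕ → Plane → F} {B : Plane → F → F'} (C : ℝ)
    (hB : ∀ x y z, ‖B x y - B x z‖ ≤ C * ‖y - z‖)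
    (h1 : Tendsto (fun n => ∫⁻ x, ‖a x - a' n x‖ₑ) atTop (𝓝 0)) :
    Tendsto (fun n => ∫⁻ x, ‖B x (a x) - B x (a' n x)‖ₑ) atTop (𝓝 0) := by
  have := ENNReal.Tendsto.const_mul (a := ENNReal.ofReal |C|) h1 (Or.inr (by simp))
  rw [mul_zero] at this
  refine tendsto_of_tendsto_of_tendsto_of_le_of_le tendsto_const_nhds this (fun _ => zero_le)
    fun n => ?_
  simp only
  rw [← lintegral_const_mul' _ _ (by simp)]
  refine lintegral_mono fun x => ?_
  simp only [← ofReal_norm, ← ENNReal.ofReal_mul (abs_nonneg C)]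
  refine ENNReal.ofReal_le_ofReal ((hB x _ _).trans ?_)
  gcongr
  exact le_abs_self C

lemma IsTest.smooth_mul {η φ : Plane → ℝ} (hη : ContDiff ℝ ((⊤ : ℕ∞) : WithTop ℕ∞) η)
    (hφ : IsTest φ) : IsTest (fun x => η x * φ x) :=
  ⟨hη.mul hφ.1, hφ.2.1.mul_left, tsupport_mul_subset_right.trans hφ.2.2⟩

lemma Sob.smooth_mul {w : Plane → ℝ} {g : Plane → Plane} (h : Sob w g) {η : Plane → ℝ} {C : ℝ}
    (hη : ContDiff ℝ ((⊤ : ℕ∞) : WithTop ℕ∞) η) (hb : ∀ x, |η x| ≤ C)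
    (hb' : ∀ x, ‖gradient η x‖ ≤ C) :
    Sob (fun x => η x * w x) (fun x => η x • g x + w x • gradient η x) := by
  obtain ⟨φ, hφ, h1, h2⟩ := h.exists_seq
  have hηd : Differentiable ℝ η := hη.differentiable (by simp)
  have hηg : Continuous (gradient η) := by
    unfold gradient
    exact (LinearIsometryEquiv.continuous _).comp (hη.continuous_fderiv (by simp))
  refine Sob.of_tendsto (hη.continuous.measurable.mul h.meas)
    ((hη.continuous.measurable.smul h.meas_grad).add (h.meas.smul hηg.measurable))
    (fun n => Sob.of_test ((hφ n).smooth_mul hη)) ?_ ?_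
  · refine tendsto_lintegral_mul_of_bdd (B := fun x y => η x * y) C (fun x y z => ?_) h1
    rw [← mul_sub, norm_mul]
    exact mul_le_mul_of_nonneg_right (hb x) (norm_nonneg _)
  · simp only [gradient_mul (hηd _) ((hφ _).differentiable _)]
    refine tendsto_lintegral_add (hη.continuous.measurable.smul h.meas_grad)
      (fun n => hη.continuous.measurable.smul (continuous_gradient (hφ n)).measurable) ?_ ?_
    · refine tendsto_lintegral_mul_of_bdd (B := fun x y => η x • y) C (fun x y z => ?_) h2
      rw [← smul_sub, norm_smul]
      exact mul_le_mul_of_nonneg_right (hb x) (norm_nonneg _)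
    · refine tendsto_lintegral_mul_of_bdd (B := fun x y => y • gradient η x) C
        (fun x y z => ?_) h1
      rw [← sub_smul, norm_smul, mul_comm]
      exact mul_le_mul_of_nonneg_right (hb' x) (norm_nonneg _)

lemma IsTest.comp_left {G : ℝ → ℝ} (hG : ContDiff ℝ ((⊤ : ℕ∞) : WithTop ℕ∞) G) (h0 : G 0 = 0)
    {φ : Plane → ℝ} (hφ : IsTest φ) : IsTest (fun x => G (φ x)) := by
  refine ⟨hG.comp hφ.1, hφ.2.1.comp_left h0, ?_⟩
  exact (tsupport_comp_subset h0 φ).trans hφ.2.2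

/-- The error `G'(w)g - G'(φ)∇φ` is split as `(G'(w) - G'(φ))g + G'(φ)(g - ∇φ)`. The second term is
small in `L¹` by boundedness of `G'`; the first needs an a.e. convergent subsequence and dominated
convergence. -/
lemma Sob.comp_left {w : Plane → ℝ} {g : Plane → Plane} (h : Sob w g) {G : ℝ → ℝ} {C : ℝ}
    (hG : ContDiff ℝ ((⊤ : ℕ∞) : WithTop ℕ∞) G) (h0 : G 0 = 0) (hC : ∀ t, |deriv G t| ≤ C) :
    Sob (fun x => G (w x)) (fun x => deriv G (w x) • g x) := by
  obtain ⟨φ, hφ, h1, h2, hae⟩ := h.exists_seq_ae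
  have hGd : Differentiable ℝ G := hG.differentiable (by simp)
  have hGc : Continuous (deriv G) := hG.continuous_deriv (by simp)
  refine Sob.of_tendsto (hG.continuous.measurable.comp h.meas)
    ((hGc.measurable.comp h.meas).smul h.meas_grad)
    (fun n => Sob.of_test ((hφ n).comp_left hG h0)) ?_ ?_
  · refine tendsto_lintegral_mul_of_bdd (B := fun _ y => G y) C (fun x y z => ?_) h1
    exact Convex.norm_image_sub_le_of_norm_deriv_le (fun x _ => hGd x) (fun x _ => hC x)
      convex_univ (Set.mem_univ _) (Set.mem_univ _)
  · simp only [gradient_comp_real ((hφ _).differentiable _) (hGd _)]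
    have e1 : Tendsto (fun n => ∫⁻ x, ‖(deriv G (w x) - deriv G (φ n x)) • g x‖ₑ) atTop (𝓝 0) := by
      have := tendsto_lintegral_of_dominated_convergence (μ := (volume : Measure Plane))
        (F := fun n x => ‖(deriv G (w x) - deriv G (φ n x)) • g x‖ₑ) (f := fun _ => 0)
        (fun x => ENNReal.ofReal (2 * C) * ‖g x‖ₑ) (fun n => ?_) (fun n => ae_of_all _ fun x => ?_)
        ?_ ?_
      · simpa using this
      · exact (((hGc.measurable.comp h.meas).sub
          (hGc.measurable.comp (hφ n).continuous.measurable)).smul h.meas_grad).enorm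
      · simp only
        rw [enorm_smul]
        gcongr
        rw [← ofReal_norm]
        apply ENNReal.ofReal_le_ofReal
        have := abs_sub (deriv G (w x)) (deriv G (φ n x))
        rw [Real.norm_eq_abs]
        linarith [hC (w x), hC (φ n x)]
      · rw [lintegral_const_mul' _ _ ENNReal.ofReal_ne_top]
        exact ENNReal.mul_ne_top ENNReal.ofReal_ne_top h.integrable.2.2.ne
      · filter_upwards [hae] with x hx
        have hh : Tendsto (fun n => deriv G (φ n x)) atTop (𝓝 (deriv G (w x))) :=
          (hGc.tendsto _).comp hx
        have := ((tendsto_const_nhds (x := deriv G (w x))).sub hh).smul_const (g x)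
        simpa using this.enorm
    have e2 : Tendsto (fun n => ENNReal.ofReal C * ∫⁻ x, ‖g x - gradient (φ n) x‖ₑ) atTop (𝓝 0) := by
      have := ENNReal.Tendsto.const_mul (a := ENNReal.ofReal C) h2 (Or.inr (by simp))
      simpa using this
    have := e1.add e2
    rw [add_zero] at this
    refine tendsto_of_tendsto_of_tendsto_of_le_of_le tendsto_const_nhds this (fun _ => zero_le)
      fun n => ?_
    simp only
    have hm : Measurable fun x => ‖(deriv G (w x) - deriv G (φ n x)) • g x‖ₑ :=
      (((hGc.measurable.comp h.meas).sub
          (hGc.measurable.comp (hφ n).continuous.measurable)).smul h.meas_grad).enorm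
    rw [← lintegral_const_mul' _ _ ENNReal.ofReal_ne_top, ← lintegral_add_left hm]
    refine lintegral_mono fun x => ?_
    have : deriv G (w x) • g x - deriv G (φ n x) • gradient (φ n) x
        = (deriv G (w x) - deriv G (φ n x)) • g x
          + deriv G (φ n x) • (g x - gradient (φ n) x) := by
      rw [sub_smul, smul_sub]; abel
    rw [this]
    refine (enorm_add_le _ _).trans ?_
    gcongr
    rw [enorm_smul]
    gcongr
    rw [← ofReal_norm]
    exact ENNReal.ofReal_le_ofReal (hC _)

lemma test_integral_gradient {φ ψ : Plane → ℝ} (hφ : IsTest φ)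
    (hψ : ContDiff ℝ ((⊤ : ℕ∞) : WithTop ℕ∞) ψ) :
    ∫ x, φ x • gradient ψ x = - ∫ x, ψ x • gradient φ x := by
  have hψg : Continuous (gradient ψ) := by
    unfold gradient
    exact (LinearIsometryEquiv.continuous _).comp (hψ.continuous_fderiv (by simp))
  have hψd : Differentiable ℝ ψ := hψ.differentiable (by simp)
  have i1 : Integrable (fun x => φ x • gradient ψ x) :=
    (hφ.continuous.smul hψg).integrable_of_hasCompactSupport hφ.2.1.smul_right
  have i2 : Integrable (fun x => ψ x • gradient φ x) :=
    (hψ.continuous.smul (continuous_gradient hφ)).integrable_of_hasCompactSupport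
      hφ.hasCompactSupport_gradient.smul_left
  refine ext_inner_left ℝ fun v => ?_
  rw [inner_neg_right, ← integral_inner i1, ← integral_inner i2]
  have e : ∀ (f : Plane → ℝ) x, inner ℝ v (gradient f x) = fderiv ℝ f x v := fun f x => by
    rw [inner_gradient_right]; simp
  simp only [inner_smul_right, e]
  have j1 : Integrable (fun x => φ x * fderiv ℝ ψ x v) := by
    simpa only [inner_smul_right, e] using i1.const_inner (𝕜 := ℝ) v
  have j2 : Integrable (fun x => ψ x * fderiv ℝ φ x v) := by
    simpa only [inner_smul_right, e] using i2.const_inner (𝕜 := ℝ) v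
  rw [integral_mul_fderiv_eq_neg_fderiv_mul_of_integrable]
  · simp only [mul_comm]
  · simpa only [mul_comm] using j2
  · exact j1
  · exact (hφ.continuous.mul hψ.continuous).integrable_of_hasCompactSupport hφ.2.1.mul_right
  · exact fun x _ => hφ.differentiable x
  · exact fun x _ => hψd x

/-- The zero boundary values of `w` alone remove the boundary term, so `ψ` need not have compact
support in the square. This allows translated mollifier kernels as `ψ`. -/
lemma Sob.integral_gradient {w : Plane → ℝ} {g : Plane → Plane} (h : Sob w g) {ψ : Plane → ℝ}
    (hψ : ContDiff ℝ ((⊤ : ℕ∞) : WithTop ℕ∞) ψ) {C : ℝ} (hb : ∀ x, |ψ x| ≤ C)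
    (hb' : ∀ x, ‖gradient ψ x‖ ≤ C) :
    ∫ x, w x • gradient ψ x = - ∫ x, ψ x • g x := by
  obtain ⟨φ, hφ, h1, h2⟩ := h.exists_seq
  have hψg : Continuous (gradient ψ) := by
    unfold gradient
    exact (LinearIsometryEquiv.continuous _).comp (hψ.continuous_fderiv (by simp))
  have t1 : Tendsto (fun n => ∫ x, φ n x • gradient ψ x) atTop (𝓝 (∫ x, w x • gradient ψ x)) := by
    refine tendsto_integral_of_L1 (fun x => w x • gradient ψ x) (h.meas.smul hψg.measurable).aestronglyMeasurable
      (Eventually.of_forall fun n => (hφ n).integrable.smul_bdd C hψg.aestronglyMeasurable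
        (ae_of_all _ hb')) ?_
    have := tendsto_lintegral_mul_of_bdd (B := fun x (y : ℝ) => y • gradient ψ x) C
        (fun x y z => ?_) h1
    · refine this.congr fun n => lintegral_congr fun x => ?_
      rw [← enorm_neg, neg_sub]
    · rw [← sub_smul, norm_smul, mul_comm]
      exact mul_le_mul_of_nonneg_right (hb' x) (norm_nonneg _)
  have t2 : Tendsto (fun n => ∫ x, ψ x • gradient (φ n) x) atTop (𝓝 (∫ x, ψ x • g x)) := by
    refine tendsto_integral_of_L1 (fun x => ψ x • g x)
      (hψ.continuous.measurable.smul h.meas_grad).aestronglyMeasurable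
      (Eventually.of_forall fun n => (hφ n).integrable_gradient.bdd_smul C
        hψ.continuous.aestronglyMeasurable (ae_of_all _ hb)) ?_
    have := tendsto_lintegral_mul_of_bdd (B := fun x y => ψ x • y) C
        (fun x y z => ?_) h2
    · refine this.congr fun n => lintegral_congr fun x => ?_
      rw [← enorm_neg, neg_sub]
    · rw [← smul_sub, norm_smul]
      exact mul_le_mul_of_nonneg_right (hb x) (norm_nonneg _)
  refine tendsto_nhds_unique t1 ?_
  refine t2.neg.congr fun n => ?_
  rw [test_integral_gradient (hφ n) hψ]

/-! ### The modular and the spaces `W0`, `H0` -/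

/-- The modular `∫ Φ_{α,β}(x,|g(x)|) dx` of a vector field on the plane. -/
def modular (α β : ℝ) (g : Plane → Plane) : ℝ≥0∞ := ∫⁻ x, Phi α β x ‖g x‖

lemma measurable_Phi_comp (α β : ℝ) {f : Plane → ℝ} (hf : Measurable f) :
    Measurable (fun x => Phi α β x (f x)) := by
  unfold Phi
  exact (((measurable_logPow _).comp hf).add
    (measurable_weight.mul ((measurable_logPow _).comp hf))).ennreal_ofReal

lemma measurable_Phi_norm (α β : ℝ) {g : Plane → Plane} (hg : Measurable g) :
    Measurable (fun x => Phi α β x ‖g x‖) := measurable_Phi_comp α β hg.norm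

/-- Doubling turns a bound for `f/γ` into one for `f`; conversely the modular of `f/γ` decays at
least like `1/γ`, so a large `γ` brings it below one. -/
lemma luxNorm_lt_top_iff (α β : ℝ) (f : Plane → Plane) :
    luxNorm (Phi α β) f < ∞ ↔ ∫⁻ x, Phi α β x ‖f x‖ ∂mu < ∞ := by
  rw [luxNorm_lt]
  constructor
  · rintro ⟨γ, ⟨hγ, h⟩, -⟩
    obtain ⟨C, hC, H⟩ := Phi_scale α β γ
    calc ∫⁻ x, Phi α β x ‖f x‖ ∂mu ≤ ∫⁻ x, C * Phi α β x (‖f x‖ / γ) ∂mu :=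
          lintegral_mono fun x => H x _ _ (norm_nonneg _) (by positivity)
            (by rw [mul_div_cancel₀ _ hγ.ne'])
      _ = C * ∫⁻ x, Phi α β x (‖f x‖ / γ) ∂mu := lintegral_const_mul' _ _ hC
      _ ≤ C * 1 := by gcongr
      _ < ∞ := by simpa using hC.lt_top
  · intro h
    obtain ⟨C, hC, H⟩ := Phi_mul_le α β
    set R := C * ∫⁻ x, Phi α β x ‖f x‖ ∂mu with hR
    have hRt : R ≠ ∞ := ENNReal.mul_ne_top hC h.ne
    -- `γ ≥ 1` makes `γ⁻¹` an admissible contraction factor in `Phi_mul_le`, and `γ ≥ R` makes the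
    -- scaled modular at most one.
    set γ := max 1 R.toReal with hγ
    have hγ1 : 1 ≤ γ := le_max_left _ _
    refine ⟨γ, ⟨by linarith, ?_⟩, by simp⟩
    calc ∫⁻ x, Phi α β x (‖f x‖ / γ) ∂mu
        ≤ ∫⁻ x, (C * ENNReal.ofReal γ⁻¹) * Phi α β x ‖f x‖ ∂mu :=
          lintegral_mono fun x => H x γ⁻¹ _ _ (by positivity) (inv_le_one_of_one_le₀ hγ1)
            (by positivity) (norm_nonneg _) (by rw [div_eq_inv_mul])
      _ = ENNReal.ofReal γ⁻¹ * R := by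
          rw [lintegral_const_mul' _ _ (ENNReal.mul_ne_top hC ENNReal.ofReal_ne_top), hR]
          ring
      _ ≤ ENNReal.ofReal γ⁻¹ * ENNReal.ofReal γ := by
          gcongr
          rw [← ENNReal.ofReal_toReal hRt]
          exact ENNReal.ofReal_le_ofReal (le_max_right _ _)
      _ = 1 := by
          rw [← ENNReal.ofReal_mul (by positivity), inv_mul_cancel₀ (by positivity),
            ENNReal.ofReal_one]

lemma exists_modular_lt (α β : ℝ) {ε : ℝ≥0∞} (hε : 0 < ε) : ∃ δ : ℝ≥0∞, 0 < δ ∧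
    ∀ f : Plane → Plane, luxNorm (Phi α β) f < δ → ∫⁻ x, Phi α β x ‖f x‖ ∂mu < ε := by
  obtain ⟨C, hC, H⟩ := Phi_mul_le α β
  refine ⟨min 1 (ε / (C + 1)), lt_min one_pos (ENNReal.div_pos hε.ne' (by finiteness)),
    fun f hf => ?_⟩
  rw [luxNorm_lt] at hf
  obtain ⟨γ, ⟨hγ, h⟩, hγ2⟩ := hf
  have h1 : γ ≤ 1 := by
    have := hγ2.le.trans (min_le_left _ _)
    rwa [ENNReal.ofReal_le_one] at this
  have h2 := hγ2.trans_le (min_le_right _ _)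
  calc ∫⁻ x, Phi α β x ‖f x‖ ∂mu
      ≤ ∫⁻ x, (C * ENNReal.ofReal γ) * Phi α β x (‖f x‖ / γ) ∂mu :=
        lintegral_mono fun x => H x γ _ _ hγ.le h1 (by positivity) (by positivity)
            (by rw [mul_div_cancel₀ _ hγ.ne'])
    _ = (C * ENNReal.ofReal γ) * ∫⁻ x, Phi α β x (‖f x‖ / γ) ∂mu :=
        lintegral_const_mul' _ _ (ENNReal.mul_ne_top hC ENNReal.ofReal_ne_top)
    _ ≤ (C + 1) * ENNReal.ofReal γ * 1 := by gcongr; exact le_self_add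
    _ < ε := by
        rw [mul_one, mul_comm]
        exact (ENNReal.lt_div_iff_mul_lt (Or.inl (by simp)) (Or.inl (by finiteness))).1 h2

lemma exists_luxNorm_lt (α β : ℝ) {ε : ℝ≥0∞} (hε : 0 < ε) : ∃ δ : ℝ≥0∞, 0 < δ ∧
    ∀ f : Plane → Plane, ∫⁻ x, Phi α β x ‖f x‖ ∂mu < δ → luxNorm (Phi α β) f < ε := by
  obtain ⟨γ, hγ0, hγ⟩ := ENNReal.lt_iff_exists_real_btwn.1 hε
  have hγ1 : 0 < γ := by simpa using hγ.1
  obtain ⟨C, hC, H⟩ := Phi_scale α β γ⁻¹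
  refine ⟨(C + 1)⁻¹, ENNReal.inv_pos.2 (by finiteness), fun f hf => ?_⟩
  rw [luxNorm_lt]
  refine ⟨γ, ⟨hγ1, ?_⟩, hγ.2⟩
  calc ∫⁻ x, Phi α β x (‖f x‖ / γ) ∂mu ≤ ∫⁻ x, C * Phi α β x ‖f x‖ ∂mu :=
        lintegral_mono fun x => H x _ _ (by positivity) (by positivity)
          (by rw [div_eq_inv_mul])
    _ = C * ∫⁻ x, Phi α β x ‖f x‖ ∂mu := lintegral_const_mul' _ _ hC
    _ ≤ (C + 1) * (C + 1)⁻¹ := by gcongr; exact le_self_add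
    _ ≤ 1 := ENNReal.mul_inv_le_one _

lemma lintegral_mu_eq {F : Plane → ℝ≥0∞} (h : ∀ᵐ x, x ∉ Square → F x = 0) :
    ∫⁻ x, F x ∂mu = ∫⁻ x, F x := by
  rw [← lintegral_add_compl (μ := volume) F isOpen_Square.measurableSet]
  have : ∫⁻ x in Squareᶜ, F x = 0 := by
    rw [lintegral_congr_ae (g := fun _ => 0), lintegral_zero]
    exact (ae_restrict_iff' isOpen_Square.measurableSet.compl).2 h
  rw [this, add_zero]

lemma modular_eq_mu (α β : ℝ) {f g : Plane → Plane} (hfg : f =ᵐ[mu] g)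
    (h : ∀ᵐ x, x ∉ Square → g x = 0) : ∫⁻ x, Phi α β x ‖f x‖ ∂mu = modular α β g := by
  unfold modular
  rw [← lintegral_mu_eq (F := fun x => Phi α β x ‖g x‖)]
  · refine lintegral_congr_ae ?_
    filter_upwards [hfg] with x hx
    rw [hx]
  · filter_upwards [h] with x hx hx'
    simp [hx hx', Phi_zero]

/-- The extension by zero of an element of `W^{1,1}(Ω)`. -/
def rep (w : W11) : Plane → ℝ := Square.indicator (w : Lp ℝ 1 mu)

/-- The extension by zero of the weak gradient. -/
def repGrad (w : W11) : Plane → Plane := Square.indicator (weakGrad w)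

lemma repGrad_ae (w : W11) : (weakGrad w : Plane → Plane) =ᵐ[mu] repGrad w :=
  (indicator_ae_eq_restrict isOpen_Square.measurableSet).symm

lemma repGrad_eq_zero (w : W11) : ∀ x, x ∉ Square → repGrad w x = 0 := fun _ hx =>
  Set.indicator_of_notMem hx _

lemma Sob.of_mem_W110 {w : W11} (h : w ∈ W110) : Sob (rep w) (repGrad w) where
  meas := (Lp.stronglyMeasurable _).measurable.indicator isOpen_Square.measurableSet
  meas_grad := (Lp.stronglyMeasurable _).measurable.indicator isOpen_Square.measurableSet
  approx ε hε := by
    obtain ⟨φ, hφ, h1⟩ := h ε hε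
    refine ⟨φ, hφ, ?_⟩
    rw [eLpNorm_one_eq_lintegral_enorm, eLpNorm_one_eq_lintegral_enorm] at h1
    convert h1 using 2
    · rw [← lintegral_mu_eq]
      · refine lintegral_congr_ae ?_
        filter_upwards [indicator_ae_eq_restrict (f := (w : Lp ℝ 1 mu))
          isOpen_Square.measurableSet] with x hx
        rw [rep, hx]
      · exact ae_of_all _ fun x hx => by simp [rep, hx, hφ.eq_zero hx]
    · rw [← lintegral_mu_eq]
      · refine lintegral_congr_ae ?_
        filter_upwards [repGrad_ae w] with x hx
        rw [hx]
      · exact ae_of_all _ fun x hx => by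
          simp [repGrad_eq_zero w x hx, hφ.gradient_eq_zero hx]

/-- The way back from plane functions to the space: integration by parts identifies `g` as a weak
gradient, and uniqueness identifies it with the chosen one. -/
lemma Sob.exists_mem_W110 {w : Plane → ℝ} {g : Plane → Plane} (h : Sob w g) :
    ∃ v ∈ W110, ((v : Lp ℝ 1 mu) : Plane → ℝ) =ᵐ[mu] w ∧
      (weakGrad v : Plane → Plane) =ᵐ[mu] g := by
  have hw : Integrable w mu := h.integrable.1.restrict
  have hg : Integrable g mu := h.integrable.2.restrict
  have hwg : HasWeakGrad (hw.toL1 w) (hg.toL1 g) := by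
    intro ψ hψ
    obtain ⟨C, hC⟩ := hψ.2.1.exists_bound_of_continuous hψ.continuous
    obtain ⟨C', hC'⟩ := hψ.bdd_gradient
    have key := h.integral_gradient hψ.1 (C := max C C') (fun x => (hC x).trans (le_max_left _ _))
      (fun x => (hC' x).trans (le_max_right _ _))
    have e1 : ∫ x, (hw.toL1 w) x • gradient ψ x ∂mu = ∫ x, w x • gradient ψ x := by
      rw [← setIntegral_eq_integral_of_forall_compl_eq_zero (s := Square)
        (f := fun x => w x • gradient ψ x) (μ := volume)
        (fun x hx => by rw [hψ.gradient_eq_zero hx, smul_zero])]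
      refine integral_congr_ae ?_
      filter_upwards [hw.coeFn_toL1] with x hx
      rw [hx]
    have e2 : ∫ x, ψ x • (hg.toL1 g) x ∂mu = ∫ x, ψ x • g x := by
      rw [← setIntegral_eq_integral_of_forall_compl_eq_zero (s := Square)
        (f := fun x => ψ x • g x) (μ := volume)
        (fun x hx => by rw [hψ.eq_zero hx, zero_smul])]
      refine integral_congr_ae ?_
      filter_upwards [hg.coeFn_toL1] with x hx
      rw [hx]
    rw [e1, e2, key]
  set v : W11 := ⟨hw.toL1 w, hg.toL1 g, hwg⟩ with hv
  have hv1 : weakGrad v = hg.toL1 g := (weakGrad_spec v).unique hwg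
  have a1 : ((v : Lp ℝ 1 mu) : Plane → ℝ) =ᵐ[mu] w := hw.coeFn_toL1
  have a2 : (weakGrad v : Plane → Plane) =ᵐ[mu] g := by rw [hv1]; exact hg.coeFn_toL1
  refine ⟨v, fun ε hε => ?_, a1, a2⟩
  obtain ⟨φ, hφ, h1⟩ := h.approx ε hε
  refine ⟨φ, hφ, lt_of_le_of_lt ?_ h1⟩
  rw [eLpNorm_one_eq_lintegral_enorm, eLpNorm_one_eq_lintegral_enorm]
  refine add_le_add ?_ ?_
  · rw [lintegral_congr_ae (g := fun x => ‖w x - φ x‖ₑ)]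
    · exact setLIntegral_le_lintegral _ _
    · filter_upwards [a1] with x hx
      rw [hx]
  · rw [lintegral_congr_ae (g := fun x => ‖g x - gradient φ x‖ₑ)]
    · exact setLIntegral_le_lintegral _ _
    · filter_upwards [a2] with x hx
      rw [hx]

lemma mem_W0_iff {α β : ℝ} {w : W11} :
    w ∈ W0 α β ↔ w ∈ W110 ∧ modular α β (repGrad w) < ∞ := by
  have h : w ∈ W0 α β ↔ w ∈ W110 ∧ MemOrlicz (Phi α β) (weakGrad w) := Iff.rfl
  rw [h, MemOrlicz, luxNorm_lt_top_iff,
    modular_eq_mu α β (repGrad_ae w) (ae_of_all _ (repGrad_eq_zero w))]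
  simp [Lp.aestronglyMeasurable]

lemma mem_H0_iff {α β : ℝ} {w : W11} :
    w ∈ H0 α β ↔ w ∈ W0 α β ∧ ∀ ε : ℝ≥0∞, 0 < ε → ∃ φ : Plane → ℝ, IsTest φ ∧
      modular α β (fun x => repGrad w x - gradient φ x) < ε := by
  have h : w ∈ H0 α β ↔ w ∈ W0 α β ∧ ∀ ε : ℝ≥0∞, 0 < ε → ∃ φ : Plane → ℝ, IsTest φ ∧
    luxNorm (Phi α β) (fun x => weakGrad w x - gradient φ x) < ε := Iff.rfl
  have key : ∀ φ : Plane → ℝ, IsTest φ → ∫⁻ x, Phi α β x ‖weakGrad w x - gradient φ x‖ ∂mu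
      = modular α β (fun x => repGrad w x - gradient φ x) := fun φ hφ => by
    refine modular_eq_mu α β (f := fun x => weakGrad w x - gradient φ x) ?_ ?_
    · filter_upwards [repGrad_ae w] with x hx
      rw [hx]
    · exact ae_of_all _ fun x hx => by
        simp [repGrad_eq_zero w x hx, hφ.gradient_eq_zero hx]
  rw [h]
  refine and_congr_right fun _ => ⟨fun H ε hε => ?_, fun H ε hε => ?_⟩
  · obtain ⟨δ, hδ, hd⟩ := exists_modular_lt α β hε
    obtain ⟨φ, hφ, h1⟩ := H δ hδ
    exact ⟨φ, hφ, by rw [← key φ hφ]; exact hd _ h1⟩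
  · obtain ⟨δ, hδ, hd⟩ := exists_luxNorm_lt α β hε
    obtain ⟨φ, hφ, h1⟩ := H δ hδ
    exact ⟨φ, hφ, hd _ (by rw [key φ hφ]; exact h1)⟩

lemma Sob.exists_mem_W0 {α β : ℝ} {w : Plane → ℝ} {g : Plane → Plane} (h : Sob w g)
    (hg : modular α β g < ∞) : ∃ v ∈ W0 α β, (weakGrad v : Plane → Plane) =ᵐ[mu] g := by
  obtain ⟨v, hv, -, h2⟩ := h.exists_mem_W110
  refine ⟨v, ⟨hv, Lp.aestronglyMeasurable _, ?_⟩, h2⟩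
  rw [luxNorm_lt_top_iff, modular_eq_mu α β h2]
  · exact hg
  · filter_upwards [h.ae_eq_zero] with x hx hx'
    exact (hx hx').2

lemma modular_add_le (α β : ℝ) : ∃ C : ℝ≥0∞, C ≠ ∞ ∧ ∀ f g h : Plane → Plane,
    Measurable f → (∀ᵐ x, ‖h x‖ ≤ ‖f x‖ + ‖g x‖) →
      modular α β h ≤ C * (modular α β f + modular α β g) := by
  obtain ⟨C, hC, H⟩ := Phi_add_le α β
  refine ⟨C, hC, fun f g h hf hle => ?_⟩
  unfold modular
  rw [← lintegral_add_left (measurable_Phi_norm α β hf), ← lintegral_const_mul' _ _ hC]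
  refine lintegral_mono_ae ?_
  filter_upwards [hle] with x hx
  exact H x _ _ _ (norm_nonneg _) (norm_nonneg _) (norm_nonneg _) hx

lemma modular_scale (α β lam : ℝ) : ∃ C : ℝ≥0∞, C ≠ ∞ ∧ ∀ f g : Plane → Plane,
    (∀ᵐ x, ‖f x‖ ≤ lam * ‖g x‖) → modular α β f ≤ C * modular α β g := by
  obtain ⟨C, hC, H⟩ := Phi_scale α β lam
  refine ⟨C, hC, fun f g hle => ?_⟩
  unfold modular
  rw [← lintegral_const_mul' _ _ hC]
  refine lintegral_mono_ae ?_
  filter_upwards [hle] with x hx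
  exact H x _ _ (norm_nonneg _) (norm_nonneg _) hx

/-- The vector fields which can be approximated by gradients of test functions with respect to
the modular. -/
def Approximable (α β : ℝ) (g : Plane → Plane) : Prop :=
  ∀ ε : ℝ≥0∞, 0 < ε → ∃ φ : Plane → ℝ, IsTest φ ∧
    modular α β (fun x => g x - gradient φ x) < ε

/-- The approximable fields are closed for modular convergence, by the quasi-triangle inequality. -/
lemma approximable_of_approx {α β : ℝ} {g : Plane → Plane} (hg : Measurable g)
    (h : ∀ ε : ℝ≥0∞, 0 < ε → ∃ g' : Plane → Plane, Measurable g' ∧ Approximable α β g' ∧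
      modular α β (fun x => g x - g' x) < ε) : Approximable α β g := by
  intro ε hε
  obtain ⟨C, hC, H⟩ := modular_add_le α β
  have hδ : 0 < ε / (C + 1) / 2 :=
    ENNReal.half_pos (ENNReal.div_pos hε.ne' (by finiteness)).ne'
  obtain ⟨g', hg', h1, h2⟩ := h _ hδ
  obtain ⟨φ, hφ, h3⟩ := h1 _ hδ
  refine ⟨φ, hφ, ?_⟩
  have := H (fun x => g x - g' x) (fun x => g' x - gradient φ x) (fun x => g x - gradient φ x)
    (hg.sub hg') (ae_of_all _ fun x => by
      have := norm_add_le (g x - g' x) (g' x - gradient φ x)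
      simpa using this)
  have h4 := ENNReal.add_lt_add h2 h3
  rw [ENNReal.add_halves] at h4
  have h5 := (ENNReal.lt_div_iff_mul_lt (Or.inl (by simp)) (Or.inl (by finiteness))).1 h4
  refine (this.trans ?_).trans_lt h5
  rw [mul_comm]
  gcongr
  exact le_self_add

/-! ### Anisotropic dilations and mollification -/

lemma plane_norm_sq (x : Plane) : ‖x‖ ^ 2 = x 0 ^ 2 + x 1 ^ 2 := by
  rw [EuclideanSpace.norm_sq_eq]
  simp [Fin.sum_univ_two]

lemma plane_inner (x y : Plane) : inner ℝ x y = x 0 * y 0 + x 1 * y 1 := by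
  rw [PiLp.inner_apply, Fin.sum_univ_two]
  simp [mul_comm]

lemma abs_coord_le (x : Plane) (i : Fin 2) : |x i| ≤ ‖x‖ := by
  simpa using PiLp.norm_apply_le x i

/-- The dilation `(x₁, x₂) ↦ ((1+ε)x₁, (1+ε)²x₂)`. -/
def stretch (ε : ℝ) : Plane →ₗ[ℝ] Plane :=
  Matrix.toEuclideanLin (Matrix.diagonal ![1 + ε, (1 + ε) ^ 2])

lemma stretch_zero (ε : ℝ) (x : Plane) : stretch ε x 0 = (1 + ε) * x 0 := by
  simp [stretch, Matrix.toLpLin_apply]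

lemma stretch_one (ε : ℝ) (x : Plane) : stretch ε x 1 = (1 + ε) ^ 2 * x 1 := by
  simp [stretch, Matrix.toLpLin_apply]

lemma det_stretch (ε : ℝ) : LinearMap.det (stretch ε) = (1 + ε) ^ 3 := by
  rw [stretch, Matrix.toEuclideanLin_eq_toLin_orthonormal, LinearMap.det_toLin]
  simp; ring

lemma continuous_stretch (ε : ℝ) : Continuous (stretch ε) :=
  LinearMap.continuous_of_finiteDimensional _

lemma inner_stretch (ε : ℝ) (x y : Plane) :
    inner ℝ (stretch ε x) y = inner ℝ x (stretch ε y) := by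
  simp only [plane_inner, stretch_zero, stretch_one]
  ring

lemma norm_le_stretch {ε : ℝ} (hε : 0 ≤ ε) (x : Plane) : ‖x‖ ≤ ‖stretch ε x‖ := by
  refine le_of_sq_le_sq ?_ (norm_nonneg _)
  rw [plane_norm_sq, plane_norm_sq, stretch_zero, stretch_one, mul_pow, mul_pow]
  have h1 : 1 ≤ (1 + ε) ^ 2 := by nlinarith
  have h2 : 1 ≤ ((1 + ε) ^ 2) ^ 2 := by nlinarith
  nlinarith [sq_nonneg (x 0), sq_nonneg (x 1)]

lemma norm_stretch_sub_le {ε : ℝ} (hε : 0 ≤ ε) (hε1 : ε ≤ 1) (x : Plane) :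
    ‖stretch ε x - x‖ ≤ 3 * ε * ‖x‖ := by
  refine le_of_sq_le_sq ?_ (by positivity)
  rw [mul_pow, plane_norm_sq, plane_norm_sq]
  simp only [PiLp.sub_apply, stretch_zero, stretch_one]
  have e0 : (1 + ε) * x 0 - x 0 = ε * x 0 := by ring
  have e1 : (1 + ε) ^ 2 * x 1 - x 1 = ε * (2 + ε) * x 1 := by ring
  rw [e0, e1, mul_pow, mul_pow, mul_pow, mul_pow]
  have h : (2 + ε) ^ 2 ≤ 9 := by nlinarith
  have p0 := mul_nonneg (sq_nonneg ε) (sq_nonneg (x 0))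
  have p1 := mul_nonneg (sq_nonneg ε) (sq_nonneg (x 1))
  nlinarith

lemma norm_stretch_le {ε : ℝ} (hε : 0 ≤ ε) (hε1 : ε ≤ 1) (x : Plane) :
    ‖stretch ε x‖ ≤ 4 * ‖x‖ := by
  have h1 := norm_stretch_sub_le hε hε1 x
  have h2 := norm_add_le (stretch ε x - x) x
  rw [sub_add_cancel] at h2
  nlinarith [norm_nonneg x]

/-- The Jacobian of the dilation is `(1+ε)³ ≥ 1`, so composition with it does not increase
integrals. -/
lemma lintegral_stretch_le {ε : ℝ} (hε : 0 ≤ ε) {F : Plane → ℝ≥0∞} (hF : Measurable F) :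
    ∫⁻ x, F (stretch ε x) ≤ ∫⁻ x, F x := by
  have hd : (1 : ℝ) ≤ (1 + ε) ^ 3 := one_le_pow₀ (by linarith)
  rw [← lintegral_map hF (continuous_stretch ε).measurable,
    Measure.map_linearMap_addHaar_eq_smul_addHaar _ (by rw [det_stretch]; positivity),
    lintegral_smul_measure, det_stretch]
  refine mul_le_of_le_one_left zero_le ?_
  rw [ENNReal.ofReal_le_one, abs_of_nonneg (by positivity)]
  exact inv_le_one_of_one_le₀ hd

/-- A smooth probability density supported in the ball of radius `δ`. -/
structure IsKernel (δ : ℝ) (k : Plane → ℝ) : Prop where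
  smooth : ContDiff ℝ ((⊤ : ℕ∞) : WithTop ℕ∞) k
  nonneg : ∀ x, 0 ≤ k x
  integral_eq : ∫ x, k x = 1
  eq_zero : ∀ x, δ ≤ ‖x‖ → k x = 0

lemma exists_isKernel {δ : ℝ} (hδ : 0 < δ) : ∃ k, IsKernel δ k := by
  let f : ContDiffBump (0 : Plane) := ⟨δ / 2, δ, by linarith, by linarith⟩
  refine ⟨f.normed volume, f.contDiff_normed, fun x => f.nonneg_normed x, f.integral_normed,
    fun x hx => ?_⟩
  have h : x ∉ Function.support (f.normed volume) := by
    rw [f.support_normed_eq]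
    simpa [f] using hx
  simpa using h

namespace IsKernel

variable {δ : ℝ} {k : Plane → ℝ}

lemma hasCompactSupport (hk : IsKernel δ k) : HasCompactSupport k := by
  refine HasCompactSupport.of_support_subset_isCompact (isCompact_closedBall (0 : Plane) δ) ?_
  intro x hx
  by_contra h
  exact hx (hk.eq_zero x (by simpa using (not_le.1 (by simpa using h)).le))

lemma integrable (hk : IsKernel δ k) : Integrable k :=
  hk.smooth.continuous.integrable_of_hasCompactSupport hk.hasCompactSupport

lemma exists_bound (hk : IsKernel δ k) : ∃ C, ∀ x, ‖k x‖ ≤ C :=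
  hk.hasCompactSupport.exists_bound_of_continuous hk.smooth.continuous

lemma lintegral_eq (hk : IsKernel δ k) (z : Plane) :
    ∫⁻ y, ENNReal.ofReal (k (z - y)) = 1 := by
  rw [lintegral_sub_left_eq_self (fun y => ENNReal.ofReal (k y)) z,
    ← ofReal_integral_eq_lintegral_ofReal hk.integrable (ae_of_all _ hk.nonneg), hk.integral_eq,
    ENNReal.ofReal_one]

lemma integral_eq' (hk : IsKernel δ k) (z : Plane) : ∫ y, k (z - y) = 1 := by
  rw [integral_sub_left_eq_self (fun y => k y) volume z, hk.integral_eq]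

lemma integrable_smul (hk : IsKernel δ k) {F : Type} [NormedAddCommGroup F] [NormedSpace ℝ F]
    {f : Plane → F} (hf : Integrable f) (z : Plane) : Integrable (fun y => k (z - y) • f y) := by
  obtain ⟨C, hC⟩ := hk.exists_bound
  exact hf.bdd_smul C (hk.smooth.continuous.comp
    (continuous_const.sub continuous_id)).aestronglyMeasurable (ae_of_all _ fun y => hC _)

end IsKernel

/-- Mollification. -/
def moll {F : Type} [NormedAddCommGroup F] [NormedSpace ℝ F] (k : Plane → ℝ) (f : Plane → F)
    (z : Plane) : F := ∫ y, k (z - y) • f y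

variable {F : Type} [NormedAddCommGroup F] [NormedSpace ℝ F] [MeasurableSpace F] [BorelSpace F]
  [SecondCountableTopology F]

lemma measurable_moll {δ : ℝ} {k : Plane → ℝ} (hk : IsKernel δ k) {f : Plane → F}
    (hf : Measurable f) : Measurable (moll k f) := by
  have h : StronglyMeasurable (fun p : Plane × Plane => k (p.1 - p.2) • f p.2) := by
    have h1 : Measurable (fun p : Plane × Plane => k (p.1 - p.2)) :=
      hk.smooth.continuous.measurable.comp (measurable_fst.sub measurable_snd)
    exact (h1.smul (hf.comp measurable_snd)).stronglyMeasurable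
  exact h.integral_prod_right'.measurable

/-- Since the kernel has mass one, the difference is an average of the differences `f x - f (T x -
t)` over `|t| < δ`; Tonelli then reduces the claim to continuity of translations composed with `T`.
-/
lemma lintegral_sub_moll_le [CompleteSpace F] {δ : ℝ} {k : Plane → ℝ} (hk : IsKernel δ k) {f : Plane → F}
    (hf : Measurable f) (hfi : Integrable f) {T : Plane → Plane} (hT : Measurable T) {η : ℝ≥0∞}
    (h : ∀ t, ‖t‖ < δ → ∫⁻ x, ‖f x - f (T x - t)‖ₑ ≤ η) :
    ∫⁻ x, ‖f x - moll k f (T x)‖ₑ ≤ η := by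
  have hkm : Measurable fun t => ENNReal.ofReal (k t) :=
    hk.smooth.continuous.measurable.ennreal_ofReal
  have h1 : ∀ x, ‖f x - moll k f (T x)‖ₑ
      ≤ ∫⁻ t, ENNReal.ofReal (k t) * ‖f x - f (T x - t)‖ₑ := by
    intro x
    have e1 : f x - moll k f (T x) = ∫ y, k (T x - y) • (f x - f y) := by
      simp only [smul_sub]
      have hi : Integrable (fun y => k (T x - y) • f x) :=
        (hk.integrable.comp_sub_left (T x)).smul_const _
      rw [integral_sub hi (hk.integrable_smul hfi _), integral_smul_const, hk.integral_eq',
        one_smul, moll]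
    rw [e1]
    refine (enorm_integral_le_lintegral_enorm _).trans (le_of_eq ?_)
    rw [← lintegral_sub_left_eq_self
      (fun t => ENNReal.ofReal (k t) * ‖f x - f (T x - t)‖ₑ) (T x)]
    refine lintegral_congr fun y => ?_
    rw [enorm_smul, Real.enorm_of_nonneg (hk.nonneg _), sub_sub_cancel]
  have hm : Measurable fun p : Plane × Plane => ENNReal.ofReal (k p.2) *
      ‖f p.1 - f (T p.1 - p.2)‖ₑ :=
    (hkm.comp measurable_snd).mul ((hf.comp measurable_fst).sub
      (hf.comp ((hT.comp measurable_fst).sub measurable_snd))).enorm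
  calc ∫⁻ x, ‖f x - moll k f (T x)‖ₑ
      ≤ ∫⁻ x, ∫⁻ t, ENNReal.ofReal (k t) * ‖f x - f (T x - t)‖ₑ := lintegral_mono h1
    _ = ∫⁻ t, ∫⁻ x, ENNReal.ofReal (k t) * ‖f x - f (T x - t)‖ₑ :=
        lintegral_lintegral_swap hm.aemeasurable
    _ = ∫⁻ t, ENNReal.ofReal (k t) * ∫⁻ x, ‖f x - f (T x - t)‖ₑ := by
        refine lintegral_congr fun t => ?_
        rw [lintegral_const_mul' _ _ ENNReal.ofReal_ne_top]
    _ ≤ ∫⁻ t, ENNReal.ofReal (k t) * η := by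
        refine lintegral_mono fun t => ?_
        rcases lt_or_ge ‖t‖ δ with ht | ht
        · exact mul_le_mul_right (h t ht) _
        · simp [hk.eq_zero t ht]
    _ = η := by
        rw [lintegral_mul_const _ hkm]
        have := hk.lintegral_eq 0
        rw [lintegral_sub_left_eq_self (fun y => ENNReal.ofReal (k y)) 0] at this
        rw [this, one_mul]

/-- Density of continuous compactly supported functions: the approximating function is uniformly
continuous, and the two error terms are controlled because dilation and translation do not increase
the `L¹` norm. -/
lemma exists_stretch_translate_close {f : Plane → F}
    (hf : Measurable f) (hfi : Integrable f) {η : ℝ≥0∞} (hη : 0 < η) :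
    ∃ ρ : ℝ, 0 < ρ ∧ ∀ (ε : ℝ) (t : Plane), 0 < ε → ε < ρ → ‖t‖ < ρ →
      ∫⁻ x, ‖f x - f (stretch ε x - t)‖ₑ ≤ η := by
  have hη3 : η / 3 ≠ 0 := (ENNReal.div_pos hη.ne' (by simp)).ne'
  obtain ⟨h, hhs, hfh, hhc, hhi⟩ := hfi.exists_hasCompactSupport_lintegral_sub_le hη3
  obtain ⟨R, hR0, hR⟩ : ∃ R : ℝ, 0 < R ∧ ∀ x, R ≤ ‖x‖ → h x = 0 := by
    obtain ⟨R, hR⟩ := hhs.isCompact.isBounded.subset_ball (0 : Plane)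
    refine ⟨max R 1, by positivity, fun x hx => image_eq_zero_of_notMem_tsupport fun hx' => ?_⟩
    have := hR hx'
    simp only [Metric.mem_ball, dist_zero_right] at this
    exact absurd (le_max_left R 1) (by linarith)
  -- Outside this ball both `h x` and `h (stretch ε x - t)` vanish, because the dilation does not
  -- decrease norms and `‖t‖ < 1`.
  set S := Metric.closedBall (0 : Plane) (R + 1) with hS
  have hSv : volume S ≠ ∞ := (isCompact_closedBall _ _).measure_lt_top.ne
  obtain ⟨η', hη'0, hη'⟩ : ∃ η' : ℝ, 0 < η' ∧ ENNReal.ofReal η' * volume S ≤ η / 3 := by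
    have : 0 < η / 3 / (volume S + 1) := ENNReal.div_pos hη3 (by finiteness)
    obtain ⟨r, hr0, hr⟩ := ENNReal.lt_iff_exists_real_btwn.1 this
    refine ⟨r, by simpa using hr.1, ?_⟩
    have h2 := (ENNReal.lt_div_iff_mul_lt (Or.inl (by simp)) (Or.inl (by finiteness))).1 hr.2
    exact (mul_le_mul_right le_self_add _).trans h2.le
  have huc := hhs.uniformContinuous_of_continuous hhc
  obtain ⟨d, hd0, hd⟩ := Metric.uniformContinuous_iff.1 huc η' hη'0
  -- On `S` the displacement is at most `‖t‖ + 3ε(R+1)`, which this choice keeps below the modulus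
  -- `d` of uniform continuity.
  refine ⟨min 1 (d / (1 + 3 * (R + 1))), lt_min one_pos (by positivity), ?_⟩
  intro ε t hε hερ ht
  have hε1 : ε ≤ 1 := (hερ.trans_le (min_le_left _ _)).le
  have ht1 : ‖t‖ < 1 := ht.trans_le (min_le_left _ _)
  have hεd := hερ.trans_le (min_le_right _ _)
  have htd := ht.trans_le (min_le_right _ _)
  have hmid : ∀ x, ‖h x - h (stretch ε x - t)‖ₑ
      ≤ S.indicator (fun _ => ENNReal.ofReal η') x := by
    intro x
    by_cases hx : x ∈ S
    · rw [Set.indicator_of_mem hx, ← ofReal_norm]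
      apply ENNReal.ofReal_le_ofReal
      rw [← dist_eq_norm]
      refine (hd ?_).le
      have hx' : ‖x‖ ≤ R + 1 := by simpa [hS] using hx
      rw [dist_eq_norm]
      have e : x - (stretch ε x - t) = t - (stretch ε x - x) := by abel
      rw [e]
      have h1 := norm_sub_le t (stretch ε x - x)
      have h2 := norm_stretch_sub_le hε.le hε1 x
      have h3 : 3 * ε * ‖x‖ ≤ 3 * ε * (R + 1) := by gcongr
      rw [lt_div_iff₀ (by positivity)] at hεd htd
      rcases le_total ε ‖t‖ with hh | hh
      · nlinarith
      · nlinarith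
    · have hx' : R + 1 < ‖x‖ := by simpa [hS] using hx
      rw [hR x (by linarith), hR]
      · simp
      · have h1 := norm_le_stretch hε.le x
        have h2 := norm_sub_norm_le (stretch ε x) t
        linarith
  have hfhm : Measurable fun x => ‖f x - h x‖ₑ := (hf.sub hhc.measurable).enorm
  have hTm := (continuous_stretch ε).measurable
  have hhm : Measurable fun x => ‖h x - h (stretch ε x - t)‖ₑ :=
    (hhc.measurable.sub (hhc.measurable.comp (hTm.sub_const t))).enorm
  calc ∫⁻ x, ‖f x - f (stretch ε x - t)‖ₑ
      ≤ ∫⁻ x, (‖f x - h x‖ₑ + (‖h x - h (stretch ε x - t)‖ₑ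
          + ‖f (stretch ε x - t) - h (stretch ε x - t)‖ₑ)) := by
        refine lintegral_mono fun x => ?_
        have e : f x - f (stretch ε x - t) = (f x - h x) + ((h x - h (stretch ε x - t))
          - (f (stretch ε x - t) - h (stretch ε x - t))) := by abel
        simp only
        rw [e]
        exact (enorm_add_le _ _).trans (by gcongr; exact enorm_sub_le)
    _ = (∫⁻ x, ‖f x - h x‖ₑ) + ((∫⁻ x, ‖h x - h (stretch ε x - t)‖ₑ)
          + ∫⁻ x, ‖f (stretch ε x - t) - h (stretch ε x - t)‖ₑ) := by
        rw [lintegral_add_left hfhm, lintegral_add_left hhm]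
    _ ≤ η / 3 + (η / 3 + η / 3) := by
        gcongr
        · refine (lintegral_mono hmid).trans ?_
          rw [lintegral_indicator_const measurableSet_closedBall]
          exact hη'
        · have := lintegral_stretch_le hε.le (F := fun z => ‖f (z - t) - h (z - t)‖ₑ)
            (hfhm.comp (measurable_id.sub_const t))
          refine this.trans ?_
          rw [lintegral_sub_right_eq_self (fun z => ‖f z - h z‖ₑ) t]
          exact hfh
    _ = η := by rw [← add_assoc, ENNReal.add_thirds]

lemma tendsto_moll [CompleteSpace F] {f : Plane → F} (hf : Measurable f) (hfi : Integrable f) {ε δ : ℕ → ℝ}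
    {k : ℕ → Plane → ℝ} (hk : ∀ n, IsKernel (δ n) (k n)) (hε : ∀ n, 0 < ε n)
    (hε0 : Tendsto ε atTop (𝓝 0)) (hδ0 : Tendsto δ atTop (𝓝 0)) :
    Tendsto (fun n => ∫⁻ x, ‖f x - moll (k n) f (stretch (ε n) x)‖ₑ) atTop (𝓝 0) := by
  rw [ENNReal.tendsto_nhds_zero]
  intro η hη
  obtain ⟨ρ, hρ, H⟩ := exists_stretch_translate_close hf hfi hη
  filter_upwards [hε0.eventually (gt_mem_nhds hρ), hδ0.eventually (gt_mem_nhds hρ)] with n h1 h2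
  exact lintegral_sub_moll_le (hk n) hf hfi (continuous_stretch _).measurable
    fun t ht => H _ t (hε n) h1 (ht.trans h2)

lemma ePow_jensen_density (κ A : ℝ) : ∃ C : ℝ≥0∞, C ≠ ∞ ∧ ∀ (ρ : Plane → ℝ) (f : Plane → ℝ) (m : ℝ),
    Measurable ρ → (∀ y, 0 ≤ ρ y) → ∫⁻ y, ENNReal.ofReal (ρ y) = 1 →
      Integrable (fun y => ρ y * f y) → (∀ y, 0 ≤ f y) → 0 ≤ m → m ≤ A * ∫ y, ρ y * f y →
        Measurable f → ePow κ m ≤ C * ∫⁻ y, ENNReal.ofReal (ρ y) * ePow κ (f y) := by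
  obtain ⟨C, hC, H⟩ := ePow_jensen κ A
  refine ⟨C, hC, fun ρ f m hρ hρ0 hρ1 hi hf0 hm hmA hf => ?_⟩
  have hρm : Measurable fun y => ENNReal.ofReal (ρ y) := hρ.ennreal_ofReal
  have hfin : ∀ᵐ y ∂(volume : Measure Plane), ENNReal.ofReal (ρ y) < ∞ :=
    ae_of_all _ fun y => ENNReal.ofReal_lt_top
  set P : Measure Plane := volume.withDensity fun y => ENNReal.ofReal (ρ y) with hP
  have : IsProbabilityMeasure P := ⟨by rw [hP, withDensity_apply _ .univ]; simpa using hρ1⟩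
  have e : ∀ y, (ENNReal.ofReal (ρ y)).toReal • f y = ρ y * f y := fun y => by
    rw [ENNReal.toReal_ofReal (hρ0 y), smul_eq_mul]
  have hfP : Integrable f P := by
    rw [hP, integrable_withDensity_iff_integrable_smul' hρm hfin]
    simpa only [e] using hi
  have := H Plane P f m hfP hf0 hm (by
    rw [hP, integral_withDensity_eq_integral_toReal_smul hρm hfin]
    simpa only [e] using hmA)
  have hm' : Measurable fun y => ePow κ (f y) := (measurable_ePow κ).comp hf
  rwa [hP, lintegral_withDensity_eq_lintegral_mul _ hρm hm'] at this

/-- Dominated convergence with a majorant that is fixed up to an error vanishing in `L¹`: the part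
`min f H` is dominated in the usual sense and the excess is at most `R`. -/
lemma tendsto_lintegral_zero_of_le {f : ℕ → Plane → ℝ≥0∞} {H : Plane → ℝ≥0∞}
    {R : ℕ → Plane → ℝ≥0∞} (hf : ∀ n, Measurable (f n)) (hH : Measurable H)
    (hHt : ∫⁻ x, H x ≠ ∞)
    (hle : ∀ n, ∀ᵐ x, f n x ≤ H x + R n x) (hR : Tendsto (fun n => ∫⁻ x, R n x) atTop (𝓝 0))
    (hf0 : ∀ᵐ x, Tendsto (fun n => f n x) atTop (𝓝 0)) :
    Tendsto (fun n => ∫⁻ x, f n x) atTop (𝓝 0) := by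
  have h1 : Tendsto (fun n => ∫⁻ x, min (f n x) (H x)) atTop (𝓝 0) := by
    have := tendsto_lintegral_of_dominated_convergence (μ := (volume : Measure Plane))
      (F := fun n x => min (f n x) (H x)) (f := fun _ => 0) H
      (fun n => (hf n).min hH) (fun n => ae_of_all _ fun x => min_le_right _ _) hHt ?_
    · simpa using this
    · filter_upwards [hf0] with x hx
      exact tendsto_of_tendsto_of_tendsto_of_le_of_le tendsto_const_nhds hx (fun _ => zero_le)
        fun n => min_le_left _ _
  have h2 := h1.add hR
  rw [add_zero] at h2
  refine tendsto_of_tendsto_of_tendsto_of_le_of_le tendsto_const_nhds h2 (fun _ => zero_le)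
    fun n => ?_
  have hm : Measurable fun x => min (f n x) (H x) := (hf n).min hH
  simp only
  rw [← lintegral_add_left hm]
  refine lintegral_mono_ae ?_
  filter_upwards [hle n] with x hx
  rcases le_total (f n x) (H x) with h | h
  · rw [min_eq_left h]; exact le_self_add
  · rw [min_eq_right h]; exact hx

lemma tendsto_Phi_zero (α β : ℝ) (x : Plane) {s : ℕ → ℝ} (hs : ∀ n, 0 ≤ s n)
    (h : Tendsto s atTop (𝓝 0)) : Tendsto (fun n => Phi α β x (s n)) atTop (𝓝 0) := by
  obtain ⟨C, hC, H⟩ := Phi_mul_le α β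
  have h1 : Tendsto (fun n => C * ENNReal.ofReal (s n) * Phi α β x 1) atTop (𝓝 0) := by
    have h2 : Tendsto (fun n => ENNReal.ofReal (s n)) atTop (𝓝 0) := by
      simpa using ENNReal.tendsto_ofReal h
    have h3 := ENNReal.Tendsto.const_mul (a := C) h2 (Or.inr hC)
    have h4 := ENNReal.Tendsto.mul_const (b := Phi α β x 1) h3 (Or.inr (Phi_ne_top _ _ _ _))
    simpa using h4
  refine tendsto_of_tendsto_of_tendsto_of_le_of_le' tendsto_const_nhds h1
    (Eventually.of_forall fun _ => zero_le) ?_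
  filter_upwards [h.eventually (gt_mem_nhds one_pos)] with n hn
  exact H x (s n) (s n) 1 (hs n) hn.le (hs n) zero_le_one (by simp)

lemma mem_Square {x : Plane} : x ∈ Square ↔ |x 0| < 1 ∧ |x 1| < 1 := Iff.rfl

/-- The derivative falls on the kernel, and `Sob.integral_gradient` with `ψ = k(z - ·)` moves it to
`w`. The point `z` is arbitrary, near the boundary as well, since `w` has zero boundary values. -/
lemma hasGradientAt_moll {w : Plane → ℝ} {g : Plane → Plane} (h : Sob w g) {δ : ℝ}
    {k : Plane → ℝ} (hk : IsKernel δ k) (z : Plane) : HasGradientAt (moll k w) (moll k g z) z := by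
  have hconv : moll k w = convolution k w (ContinuousLinearMap.lsmul ℝ ℝ) volume := by
    ext z
    rw [convolution_lsmul_swap]
    rfl
  have h1 := hk.hasCompactSupport.hasFDerivAt_convolution_left (ContinuousLinearMap.lsmul ℝ ℝ)
    (hk.smooth.of_le (by simp)) (h.integrable.1.locallyIntegrable (μ := volume)) z
  rw [← hconv] at h1
  have hd : DifferentiableAt ℝ (moll k w) z := h1.differentiableAt
  have hsm : ContDiff ℝ ((⊤ : ℕ∞) : WithTop ℕ∞) fun y => k (z - y) :=
    hk.smooth.comp (contDiff_const.sub contDiff_id)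
  have hgr : ∀ y, gradient (fun y => k (z - y)) y = - gradient k (z - y) := by
    intro y
    unfold gradient
    have : fderiv ℝ (fun y => k (z - y)) y = - fderiv ℝ k (z - y) := by
      have h2 : HasFDerivAt (fun y : Plane => z - y) (-ContinuousLinearMap.id ℝ Plane) y :=
        (hasFDerivAt_id y).const_sub z
      have h3 := ((hk.smooth.differentiable (by simp)) (z - y)).hasFDerivAt.comp y h2
      have h4 := h3.fderiv
      rw [ContinuousLinearMap.comp_neg, ContinuousLinearMap.comp_id] at h4
      exact h4
    rw [this, map_neg]
  have hkg : Continuous (fderiv ℝ k) := hk.smooth.continuous_fderiv (by simp)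
  obtain ⟨C, hC⟩ := hk.exists_bound
  obtain ⟨C', hC'⟩ := (hk.hasCompactSupport.fderiv ℝ).exists_bound_of_continuous hkg
  have hint := h.integral_gradient hsm (C := max C C') (fun y => (hC _).trans (le_max_left _ _))
    (fun y => by rw [hgr, norm_neg, norm_gradient]; exact (hC' _).trans (le_max_right _ _))
  have hgrad : gradient (moll k w) z = moll k g z := by
    have h5 : moll k g z = ∫ y, w y • gradient k (z - y) := by
      have : (fun y => w y • gradient (fun y => k (z - y)) y)
          = fun y => -(w y • gradient k (z - y)) := by
        ext1 y; rw [hgr, smul_neg]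
      rw [this, integral_neg] at hint
      exact (neg_injective hint).symm
    have hi2 : Integrable (fun y => w y • gradient k (z - y)) := by
      refine h.integrable.1.smul_bdd C' ?_ (ae_of_all _ fun y => by
        rw [norm_gradient]; exact hC' _)
      unfold gradient
      exact ((LinearIsometryEquiv.continuous _).comp
        (hkg.comp (continuous_const.sub continuous_id))).aestronglyMeasurable
    refine ext_inner_right ℝ fun v => ?_
    rw [inner_gradient_left, h1.fderiv, h5, real_inner_comm, ← integral_inner hi2]
    rw [convolution_eq_swap, ContinuousLinearMap.integral_apply]
    · refine integral_congr_ae (ae_of_all _ fun y => ?_)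
      simp only [ContinuousLinearMap.precompL_apply, ContinuousLinearMap.lsmul_apply,
        inner_smul_right, smul_eq_mul]
      rw [inner_gradient_right]
      simp [mul_comm]
    · have := ConvolutionExistsAt.integrable_swap
        ((hk.hasCompactSupport.fderiv ℝ).convolutionExists_left
          (ContinuousLinearMap.precompL Plane (ContinuousLinearMap.lsmul ℝ ℝ)) hkg
          (h.integrable.1.locallyIntegrable (μ := volume)) z)
      exact this
  rw [← hgrad]
  exact hd.hasGradientAt

lemma contDiff_moll {w : Plane → ℝ} (hw : Integrable w) {δ : ℝ}
    {k : Plane → ℝ} (hk : IsKernel δ k) :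
    ContDiff ℝ ((⊤ : ℕ∞) : WithTop ℕ∞) (moll k w) := by
  have hconv : moll k w = convolution k w (ContinuousLinearMap.lsmul ℝ ℝ) volume := by
    ext z
    rw [convolution_lsmul_swap]
    rfl
  rw [hconv]
  exact hk.hasCompactSupport.contDiff_convolution_left _ hk.smooth
    (hw.locallyIntegrable (μ := volume))

lemma gradient_moll_stretch {w : Plane → ℝ} {g : Plane → Plane} (h : Sob w g) {δ : ℝ}
    {k : Plane → ℝ} (hk : IsKernel δ k) (ε : ℝ) (x : Plane) :
    gradient (fun x => moll k w (stretch ε x)) x = stretch ε (moll k g (stretch ε x)) := by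
  have h1 := (hasGradientAt_moll h hk (stretch ε x)).hasFDerivAt
  have h2 := (LinearMap.toContinuousLinearMap (stretch ε)).hasFDerivAt (x := x)
  have h3 := (h1.comp x h2).fderiv
  refine ext_inner_right ℝ fun v => ?_
  rw [inner_gradient_left, inner_stretch]
  have h4 : (fun x => moll k w (stretch ε x))
      = moll k w ∘ ⇑(stretch ε) := rfl
  rw [h4]
  erw [h3]
  rfl

/-- Precomposition with the dilation shrinks the support by at least `1+ε`, while mollification
enlarges it by `δ < ε`. The result lives in the closed square of half-width `q = (1+δ)/(1+ε) < 1`.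
-/
lemma isTest_moll_stretch {w : Plane → ℝ} {g : Plane → Plane} (h : Sob w g) {δ ε : ℝ}
    {k : Plane → ℝ} (hk : IsKernel δ k) (hε : 0 < ε) (hδε : δ < ε) (hδ : 0 ≤ δ) :
    IsTest (fun x => moll k w (stretch ε x)) := by
  set q := (1 + δ) / (1 + ε) with hq
  have hq1 : q < 1 := (div_lt_one (by linarith)).2 (by linarith)
  have hq0 : 0 ≤ q := by positivity
  have hz : ∀ x : Plane, (q < |x 0| ∨ q < |x 1|) → moll k w (stretch ε x) = 0 := by
    intro x hx
    refine integral_eq_zero_of_ae ?_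
    filter_upwards [h.ae_eq_zero] with y hy
    by_cases hyS : y ∈ Square
    · rw [hk.eq_zero, zero_smul]; rfl
      by_contra hlt
      push Not at hlt
      rw [mem_Square] at hyS
      have c0 := (abs_coord_le (stretch ε x - y) 0).trans_lt hlt
      have c1 := (abs_coord_le (stretch ε x - y) 1).trans_lt hlt
      simp only [PiLp.sub_apply, stretch_zero, stretch_one] at c0 c1
      have t0 := abs_sub_abs_le_abs_sub ((1 + ε) * x 0) (y 0)
      have t1 := abs_sub_abs_le_abs_sub ((1 + ε) ^ 2 * x 1) (y 1)
      rw [abs_mul, abs_of_pos (by positivity)] at t0 t1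
      have e : (1 + ε) * q = 1 + δ := by rw [hq]; field_simp
      rcases hx with hx | hx
      · have := mul_lt_mul_of_pos_left hx (show 0 < 1 + ε by linarith)
        linarith [hyS.1]
      · have := mul_lt_mul_of_pos_left hx (show 0 < 1 + ε by linarith)
        have h2 : (1 + ε) * |x 1| ≤ (1 + ε) ^ 2 * |x 1| := by
          have : (1 + ε) ≤ (1 + ε) ^ 2 := by nlinarith
          exact mul_le_mul_of_nonneg_right this (abs_nonneg _)
        linarith [hyS.2]
    · rw [(hy hyS).1, smul_zero]; rfl
  set S : Set Plane := {x | |x 0| ≤ q ∧ |x 1| ≤ q} with hS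
  have hSc : IsClosed S := by
    apply IsClosed.inter
    · exact isClosed_le (f := fun x : Plane => |x 0|) (g := fun _ => q) (by fun_prop) (by fun_prop)
    · exact isClosed_le (f := fun x : Plane => |x 1|) (g := fun _ => q) (by fun_prop) (by fun_prop)
  have hSb : S ⊆ Metric.closedBall 0 (2 * q) := by
    intro x hx
    rw [mem_closedBall_zero_iff]
    refine le_of_sq_le_sq ?_ (by positivity)
    rw [plane_norm_sq, ← sq_abs (x 0), ← sq_abs (x 1)]
    nlinarith [hx.1, hx.2, abs_nonneg (x 0), abs_nonneg (x 1)]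
  have hsupp : Function.support (fun x => moll k w (stretch ε x)) ⊆ S := by
    intro x hx
    by_contra hxS
    refine hx (hz x ?_)
    by_contra hcon
    push Not at hcon
    exact hxS hcon
  have hts := closure_minimal hsupp hSc
  refine ⟨?_, ?_, ?_⟩
  · exact (contDiff_moll h.integrable.1 hk).comp
      (LinearMap.toContinuousLinearMap (stretch ε)).contDiff
  · exact HasCompactSupport.of_support_subset_isCompact
      ((isCompact_closedBall _ _).of_isClosed_subset hSc hSb) hsupp
  · exact hts.trans fun x hx => ⟨hx.1.trans_lt hq1, hx.2.trans_lt hq1⟩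

/-! ### Gradients vanishing near the origin are approximable. -/

/-- The reason for the anisotropic dilation. The vertical coordinate is stretched by an extra factor
`1+ε`, so the image of a point of the double cone has a margin of at least `ε|x₂|` to the boundary
of the cone. Since `y` has norm at least `δ₀`, one has `|x₂| ≥ δ₀/16`, and the margin `εδ₀/16`
exceeds twice the kernel radius. -/
lemma weight_eq_one_of_close {x y : Plane} {δ₀ δ ε : ℝ} (hε : 0 < ε) (hε1 : ε ≤ 1)
    (hδ : δ ≤ ε * δ₀ / 64) (hδ₀ : 0 < δ₀) (hx : weight x = 1) (hy : δ₀ ≤ ‖y‖)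
    (hxy : ‖stretch ε x - y‖ < δ) : weight y = 1 := by
  have hx' : |x 0| < |x 1| := by
    by_contra h
    simp [weight, h] at hx
  have c0 := (abs_coord_le (stretch ε x - y) 0).trans_lt hxy
  have c1 := (abs_coord_le (stretch ε x - y) 1).trans_lt hxy
  simp only [PiLp.sub_apply, stretch_zero, stretch_one] at c0 c1
  have t0 := abs_sub_abs_le_abs_sub (y 0) ((1 + ε) * x 0)
  have t1 := abs_sub_abs_le_abs_sub ((1 + ε) ^ 2 * x 1) (y 1)
  have t2 := abs_sub_abs_le_abs_sub (y 1) ((1 + ε) ^ 2 * x 1)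
  rw [abs_sub_comm, abs_mul, abs_of_pos (show 0 < 1 + ε by linarith)] at t0
  rw [abs_mul, abs_of_pos (show 0 < (1 + ε) ^ 2 by positivity)] at t1
  rw [abs_sub_comm, abs_mul, abs_of_pos (show 0 < (1 + ε) ^ 2 by positivity)] at t2
  have hy2 : δ₀ ≤ |y 0| + |y 1| := by
    refine hy.trans (le_of_sq_le_sq ?_ (by positivity))
    rw [plane_norm_sq, ← sq_abs (y 0), ← sq_abs (y 1)]
    nlinarith [abs_nonneg (y 0), abs_nonneg (y 1)]
  have hp : 0 ≤ |x 0| := abs_nonneg _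
  have hsq : (1 + ε) ^ 2 ≤ 4 := by nlinarith
  have hεδ : ε * δ₀ ≤ δ₀ := by nlinarith
  have h5 : (1 + ε) * |x 0| ≤ (1 + ε) * |x 1| := by gcongr
  have h6 : (1 + ε) ^ 2 * |x 1| ≤ 4 * |x 1| := by gcongr
  have h7 : (1 + ε) * |x 1| ≤ (1 + ε) ^ 2 * |x 1| := by
    have : (1 + ε) ≤ (1 + ε) ^ 2 := by nlinarith
    gcongr
  have h8 : δ₀ / 16 ≤ |x 1| := by linarith
  have h9 : ε * (δ₀ / 16) ≤ ε * |x 1| := by gcongr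
  have h10 : (1 + ε) * |x 1| + ε * |x 1| ≤ (1 + ε) ^ 2 * |x 1| := by
    nlinarith [mul_nonneg (sq_nonneg ε) (abs_nonneg (x 1))]
  have h11 : |y 0| < |y 1| := by nlinarith
  simp [weight, h11]

/-- The approximants are mollifications of `w` composed with the dilation. Quasi-Jensen bounds the
integrand at their gradients by the mollified, dilated energy density of `g`, which converges in
`L¹`; so the modulars have a convergent majorant, and a.e. convergence of the gradients finishes the
proof. -/
theorem Sob.approximable {α β : ℝ} {w : Plane → ℝ} {g : Plane → Plane} (h : Sob w g)
    (hg : modular α β g < ∞) {δ₀ : ℝ} (hδ₀ : 0 < δ₀) (hz : ∀ᵐ x, ‖x‖ < δ₀ → g x = 0) :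
    Approximable α β g := by
  obtain ⟨C₁, hC₁, J₁⟩ := ePow_jensen_density (-β) 4
  obtain ⟨C₂, hC₂, J₂⟩ := ePow_jensen_density α 4
  obtain ⟨C₃, hC₃, hadd⟩ := Phi_add_le α β
  -- The kernel radius will be `c ε`: the factor `δ₀/64` is what `weight_eq_one_of_close` asks for,
  -- and `c < 1` keeps the radius below `ε`, as the support condition requires.
  set c := min δ₀ 1 / 64 with hc
  have hc0 : 0 < c := by positivity
  have hc1 : c < 1 := by
    have := min_le_right δ₀ 1
    rw [hc]; linarith
  have hcδ : c ≤ δ₀ / 64 := by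
    have := min_le_left δ₀ 1
    rw [hc]; linarith
  set ε : ℕ → ℝ := fun n => 1 / ((n : ℝ) + 1) with hε
  have hε0 : ∀ n, 0 < ε n := fun n => by simp only [hε]; positivity
  have hε1 : ∀ n, ε n ≤ 1 := fun n => by
    simp only [hε]
    rw [div_le_one (by positivity)]
    linarith [Nat.cast_nonneg (α := ℝ) n]
  have hεlim : Tendsto ε atTop (𝓝 0) := tendsto_one_div_add_atTop_nhds_zero_nat
  have hδ0 : ∀ n, 0 < c * ε n := fun n => mul_pos hc0 (hε0 n)
  choose k hk using fun n => exists_isKernel (hδ0 n)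
  have hδlim : Tendsto (fun n => c * ε n) atTop (𝓝 0) := by
    simpa using hεlim.const_mul c
  -- the density of the modular
  set Hr : Plane → ℝ := fun x => logPow (-β) ‖g x‖ + weight x * logPow α ‖g x‖ with hHr
  have hHr0 : ∀ x, 0 ≤ Hr x := fun x => add_nonneg (logPow_nonneg _ (norm_nonneg _))
    (mul_nonneg (weight_nonneg x) (logPow_nonneg _ (norm_nonneg _)))
  have hHm : Measurable Hr := ((measurable_logPow _).comp h.meas_grad.norm).add
    (measurable_weight.mul ((measurable_logPow _).comp h.meas_grad.norm))
  have hHPhi : ∀ x, ENNReal.ofReal (Hr x) = Phi α β x ‖g x‖ := fun x => rfl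
  have hHi : Integrable Hr := by
    refine ⟨hHm.aestronglyMeasurable, ?_⟩
    rw [hasFiniteIntegral_iff_ofReal (ae_of_all _ hHr0)]
    exact hg
  have hgn : Integrable (fun y => ‖g y‖) := h.integrable.2.norm
  set φ : ℕ → Plane → ℝ := fun n x => moll (k n) w (stretch (ε n) x) with hφ
  have hφt : ∀ n, IsTest (φ n) := fun n => isTest_moll_stretch h (hk n) (hε0 n)
    (by have := hε0 n; nlinarith) (hδ0 n).le
  have hφg : ∀ n x, gradient (φ n) x = stretch (ε n) (moll (k n) g (stretch (ε n) x)) :=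
    fun n x => gradient_moll_stretch h (hk n) (ε n) x
  -- pointwise bound by quasi-Jensen
  have hbound : ∀ n x, Phi α β x ‖gradient (φ n) x‖
      ≤ max C₁ C₂ * ENNReal.ofReal (moll (k n) Hr (stretch (ε n) x)) := by
    intro n x
    set z := stretch (ε n) x with hzdef
    have hkm : Measurable fun y => k n (z - y) :=
      (hk n).smooth.continuous.measurable.comp (measurable_id.const_sub z)
    have hi := (hk n).integrable_smul hgn z
    have hm : ‖gradient (φ n) x‖ ≤ 4 * ∫ y, k n (z - y) * ‖g y‖ := by
      rw [hφg]
      refine (norm_stretch_le (hε0 n).le (hε1 n) _).trans ?_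
      gcongr
      refine (norm_integral_le_integral_norm _).trans (le_of_eq ?_)
      congr 1 with y
      rw [norm_smul, Real.norm_of_nonneg ((hk n).nonneg _)]
    have j1 := J₁ (fun y => k n (z - y)) (fun y => ‖g y‖) _ hkm (fun y => (hk n).nonneg _)
      ((hk n).lintegral_eq z) hi (fun y => norm_nonneg _) (norm_nonneg _) hm h.meas_grad.norm
    have j2 := J₂ (fun y => k n (z - y)) (fun y => ‖g y‖) _ hkm (fun y => (hk n).nonneg _)
      ((hk n).lintegral_eq z) hi (fun y => norm_nonneg _) (norm_nonneg _) hm h.meas_grad.norm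
    have hK : ENNReal.ofReal (moll (k n) Hr z)
        = (∫⁻ y, ENNReal.ofReal (k n (z - y)) * ePow (-β) ‖g y‖) +
          ∫⁻ y, ENNReal.ofReal (k n (z - y)) * (ENNReal.ofReal (weight y) * ePow α ‖g y‖) := by
      have hm1 : Measurable fun y => ENNReal.ofReal (k n (z - y)) * ePow (-β) ‖g y‖ :=
        hkm.ennreal_ofReal.mul ((measurable_ePow _).comp h.meas_grad.norm)
      rw [← lintegral_add_left hm1, moll, ofReal_integral_eq_lintegral_ofReal
        ((hk n).integrable_smul hHi z)
        (ae_of_all _ fun y => mul_nonneg ((hk n).nonneg _) (hHr0 y))]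
      refine lintegral_congr fun y => ?_
      rw [smul_eq_mul, ENNReal.ofReal_mul ((hk n).nonneg _), hHPhi, Phi_eq _ _ _ (norm_nonneg _),
        mul_add]
    rw [Phi_eq _ _ _ (norm_nonneg _), hK, mul_add]
    refine add_le_add (j1.trans (by gcongr; exact le_max_left _ _)) ?_
    by_cases hwx : weight x = 1
    · rw [hwx, ENNReal.ofReal_one, one_mul]
      refine j2.trans ?_
      gcongr ?_ * ?_
      · exact le_max_right _ _
      · refine lintegral_mono_ae ?_
        filter_upwards [hz] with y hy
        -- Inserting the weight under the integral is harmless: near the origin `g` vanishes, far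
        -- from `z` the kernel vanishes, and at all other `y` the weight is one.
        by_cases hyδ : ‖y‖ < δ₀
        · simp [hy hyδ, ePow_zero]
        · by_cases hky : ‖z - y‖ < c * ε n
          · rw [weight_eq_one_of_close (hε0 n) (hε1 n)
              (show c * ε n ≤ ε n * δ₀ / 64 by have := hε0 n; nlinarith) hδ₀ hwx
              (not_lt.1 hyδ) hky]
            simp
          · rw [(hk n).eq_zero _ (not_lt.1 hky)]
            simp
    · have : weight x = 0 := by
        unfold weight at hwx ⊢
        split_ifs at hwx ⊢ <;> simp_all
      rw [this]
      simp
  -- convergence along a subsequence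
  have hLH := tendsto_moll hHm hHi hk hε0 hεlim hδlim
  have hLg := tendsto_moll h.meas_grad h.integrable.2 hk hε0 hεlim hδlim
  obtain ⟨ns, hns, hae⟩ := exists_subseq_ae (f := fun n x => moll (k n) g (stretch (ε n) x))
    (fun n => ((measurable_moll (hk n) h.meas_grad).comp
      (continuous_stretch _).measurable).aestronglyMeasurable)
    h.meas_grad.aestronglyMeasurable hLg
  set D := C₃ * (1 + max C₁ C₂) with hD
  have hmax : max C₁ C₂ ≠ ∞ := (max_lt hC₁.lt_top hC₂.lt_top).ne
  have hDt : D ≠ ∞ := by finiteness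
  have hfin := tendsto_lintegral_zero_of_le
    (f := fun n x => Phi α β x ‖g x - gradient (φ (ns n)) x‖)
    (H := fun x => D * Phi α β x ‖g x‖)
    (R := fun n x => D * ‖Hr x - moll (k (ns n)) Hr (stretch (ε (ns n)) x)‖ₑ)
    (fun n => measurable_Phi_norm _ _
      (h.meas_grad.sub (continuous_gradient (hφt (ns n))).measurable))
    ((measurable_Phi_norm _ _ h.meas_grad).const_mul _) ?_ ?_ ?_ ?_
  · intro η hη
    obtain ⟨n, hn⟩ := (hfin.eventually (gt_mem_nhds hη)).exists
    exact ⟨φ (ns n), hφt _, hn⟩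
  · rw [lintegral_const_mul' _ _ hDt]
    exact ENNReal.mul_ne_top hDt hg.ne
  · refine fun n => ae_of_all _ fun x => ?_
    refine (hadd x _ ‖g x‖ ‖gradient (φ (ns n)) x‖ (norm_nonneg _) (norm_nonneg _)
      (norm_nonneg _) (norm_sub_le _ _)).trans ?_
    set K := moll (k (ns n)) Hr (stretch (ε (ns n)) x) with hK
    have h1 := hbound (ns n) x
    have h2 : ENNReal.ofReal K ≤ Phi α β x ‖g x‖ + ‖Hr x - K‖ₑ := by
      rw [← hHPhi, ← ofReal_norm, ← ENNReal.ofReal_add (hHr0 x) (norm_nonneg _)]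
      apply ENNReal.ofReal_le_ofReal
      have := neg_abs_le (Hr x - K)
      rw [Real.norm_eq_abs]
      linarith
    calc C₃ * (Phi α β x ‖g x‖ + Phi α β x ‖gradient (φ (ns n)) x‖)
        ≤ C₃ * ((Phi α β x ‖g x‖ + ‖Hr x - K‖ₑ)
            + max C₁ C₂ * (Phi α β x ‖g x‖ + ‖Hr x - K‖ₑ)) := by
          gcongr
          · exact le_self_add
          · exact h1.trans (by gcongr)
      _ = D * Phi α β x ‖g x‖ + D * ‖Hr x - K‖ₑ := by rw [hD]; ring
  · have := ENNReal.Tendsto.const_mul (a := D) (hLH.comp hns.tendsto_atTop) (Or.inr hDt)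
    rw [mul_zero] at this
    refine this.congr fun n => ?_
    rw [lintegral_const_mul' _ _ hDt]
    rfl
  · filter_upwards [hae] with x hx
    refine tendsto_Phi_zero _ _ _ (fun n => norm_nonneg _) ?_
    have h1 : Tendsto (fun n => gradient (φ (ns n)) x) atTop (𝓝 (g x)) := by
      have h2 : Tendsto (fun n => stretch (ε (ns n)) (moll (k (ns n)) g (stretch (ε (ns n)) x))
          - moll (k (ns n)) g (stretch (ε (ns n)) x)) atTop (𝓝 0) := by
        refine squeeze_zero_norm (fun n => norm_stretch_sub_le (hε0 _).le (hε1 _) _) ?_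
        have := ((hεlim.comp hns.tendsto_atTop).const_mul 3).mul hx.norm
        simpa using this
      have h3 := h2.add hx
      rw [zero_add] at h3
      refine h3.congr fun n => ?_
      rw [hφg]; abel
    have h4 := (tendsto_const_nhds (x := g x)).sub h1
    rw [sub_self] at h4
    simpa using h4.norm

/-! ### A Poincaré inequality on convex sets -/

lemma lintegral_comp_affine (G : Plane → ℝ≥0∞) (hG : Measurable G) (a : Plane) {t : ℝ}
    (ht : t ≠ 0) : ∫⁻ x, G (a + t • x) = ENNReal.ofReal (t ^ 2)⁻¹ * ∫⁻ x, G x := by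
  have h1 : ∫⁻ x, G (a + t • x) = ∫⁻ x, G (a + x) ∂(Measure.map (t • ·) volume) := by
    have hm : Measurable fun x => G (a + x) := hG.comp (measurable_const_add a)
    rw [lintegral_map hm (measurable_const_smul t)]
  rw [h1, Measure.map_addHaar_smul _ ht, lintegral_smul_measure,
    lintegral_add_left_eq_self (fun x => G x) a]
  simp [abs_of_nonneg, sq_nonneg]

/-- Convexity keeps the contraction towards `y` inside `K`, and its inverse Jacobian `t⁻²` is at
most `4` for `t ≥ 1/2`. -/
lemma setLIntegral_comp_affine_le {K : Set Plane} (hK : MeasurableSet K) (hKc : Convex ℝ K)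
    {F : Plane → ℝ≥0∞} (hF : Measurable F) {y : Plane} (hy : y ∈ K) {t : ℝ} (ht : 1 / 2 ≤ t)
    (ht1 : t ≤ 1) : ∫⁻ x in K, F ((1 - t) • y + t • x) ≤ 4 * ∫⁻ x in K, F x := by
  have h1 : ∫⁻ x in K, F ((1 - t) • y + t • x)
      ≤ ∫⁻ x, K.indicator F ((1 - t) • y + t • x) := by
    rw [← lintegral_indicator hK]
    refine lintegral_mono fun x => ?_
    by_cases hx : x ∈ K
    · rw [Set.indicator_of_mem hx, Set.indicator_of_mem]
      exact hKc hy hx (by linarith) (by linarith) (by ring)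
    · rw [Set.indicator_of_notMem hx]; exact zero_le
  refine h1.trans ?_
  rw [lintegral_comp_affine _ (hF.indicator hK) _ (by linarith), lintegral_indicator hK]
  gcongr
  rw [show (4 : ℝ≥0∞) = ENNReal.ofReal 4 by simp]
  apply ENNReal.ofReal_le_ofReal
  rw [inv_le_comm₀ (by positivity) (by norm_num)]
  nlinarith

lemma measurable_segment {F : Plane → ℝ≥0∞} (hF : Measurable F) :
    Measurable fun p : (Plane × Plane) × ℝ => F ((1 - p.2) • p.1.2 + p.2 • p.1.1) := by
  have : Measurable fun p : (Plane × Plane) × ℝ => (1 - p.2) • p.1.2 + p.2 • p.1.1 := by fun_prop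
  exact hF.comp this

lemma measurable_segment_right {F : Plane → ℝ≥0∞} (hF : Measurable F) (x : Plane) :
    Measurable fun p : Plane × ℝ => F ((1 - p.2) • p.1 + p.2 • x) := by
  have : Measurable fun p : Plane × ℝ => (1 - p.2) • p.1 + p.2 • x := by fun_prop
  exact hF.comp this

lemma measurable_segment_pair {F : Plane → ℝ≥0∞} (hF : Measurable F) (t : ℝ) :
    Measurable fun p : Plane × Plane => F ((1 - t) • p.2 + t • p.1) := by
  have : Measurable fun p : Plane × Plane => (1 - t) • p.2 + t • p.1 := by fun_prop
  exact hF.comp this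

lemma measurable_lintegral_segment {F : Plane → ℝ≥0∞} (hF : Measurable F) :
    Measurable fun p : Plane × Plane =>
      ∫⁻ t in Set.Ioc (0 : ℝ) 1, F ((1 - t) • p.2 + t • p.1) :=
  Measurable.lintegral_prod_right' (measurable_segment hF)

lemma lintegral_segment_swap {F : Plane → ℝ≥0∞} (hF : Measurable F) (K : Set Plane) :
    ∫⁻ x in K, ∫⁻ y in K, ∫⁻ t in Set.Ioc (0 : ℝ) 1, F ((1 - t) • y + t • x)
      = ∫⁻ t in Set.Ioc (0 : ℝ) 1, ∫⁻ x in K, ∫⁻ y in K, F ((1 - t) • y + t • x) := by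
  have e1 : ∀ x, ∫⁻ y in K, ∫⁻ t in Set.Ioc (0 : ℝ) 1, F ((1 - t) • y + t • x)
      = ∫⁻ t in Set.Ioc (0 : ℝ) 1, ∫⁻ y in K, F ((1 - t) • y + t • x) := fun x =>
    lintegral_lintegral_swap (measurable_segment_right hF x).aemeasurable
  simp only [e1]
  have h2 : Measurable fun q : (Plane × ℝ) × Plane =>
      F ((1 - q.1.2) • q.2 + q.1.2 • q.1.1) := by
    have : Measurable fun q : (Plane × ℝ) × Plane => (1 - q.1.2) • q.2 + q.1.2 • q.1.1 := by
      fun_prop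
    exact hF.comp this
  have h3 : Measurable fun q : Plane × ℝ => ∫⁻ y in K, F ((1 - q.2) • y + q.2 • q.1) :=
    Measurable.lintegral_prod_right' h2
  exact lintegral_lintegral_swap h3.aemeasurable

/-- For `t ≥ 1/2` the change of variables is made in `x`, for `t ≤ 1/2` in `y`; one of the two
coefficients is always at least `1/2`. -/
lemma lintegral_segment_fixed_le {K : Set Plane} (hK : MeasurableSet K) (hKc : Convex ℝ K)
    {F : Plane → ℝ≥0∞} (hF : Measurable F) {t : ℝ} (ht : t ∈ Set.Ioc (0 : ℝ) 1) :
    ∫⁻ x in K, ∫⁻ y in K, F ((1 - t) • y + t • x) ≤ 4 * volume K * ∫⁻ x in K, F x := by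
  have hc : ∫⁻ _ in K, (4 * ∫⁻ x in K, F x) = 4 * volume K * ∫⁻ x in K, F x := by
    rw [setLIntegral_const]; ring
  rcases le_total (1 / 2) t with h | h
  · have e : ∫⁻ x in K, ∫⁻ y in K, F ((1 - t) • y + t • x)
        = ∫⁻ y in K, ∫⁻ x in K, F ((1 - t) • y + t • x) :=
      lintegral_lintegral_swap (measurable_segment_pair hF t).aemeasurable
    rw [e, ← hc]
    exact setLIntegral_mono' hK fun y hy => setLIntegral_comp_affine_le hK hKc hF hy h ht.2
  · rw [← hc]
    refine setLIntegral_mono' hK fun x hx => ?_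
    have := setLIntegral_comp_affine_le hK hKc hF hx (t := 1 - t) (by linarith)
      (by linarith [ht.1])
    simp only [sub_sub_cancel] at this
    refine (le_of_eq ?_).trans this
    refine lintegral_congr fun y => ?_
    rw [add_comm]

lemma lintegral_segment_le {K : Set Plane} (hK : MeasurableSet K) (hKc : Convex ℝ K)
    {F : Plane → ℝ≥0∞} (hF : Measurable F) :
    ∫⁻ x in K, ∫⁻ y in K, ∫⁻ t in Set.Ioc (0 : ℝ) 1, F ((1 - t) • y + t • x)
      ≤ 4 * volume K * ∫⁻ x in K, F x := by
  rw [lintegral_segment_swap hF]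
  have hc : ∫⁻ _ in Set.Ioc (0 : ℝ) 1, (4 * volume K * ∫⁻ x in K, F x)
      = 4 * volume K * ∫⁻ x in K, F x := by
    rw [setLIntegral_const]; simp
  rw [← hc]
  exact setLIntegral_mono' measurableSet_Ioc fun t ht => lintegral_segment_fixed_le hK hKc hF ht

lemma IsTest.enorm_sub_le {φ : Plane → ℝ} (hφ : IsTest φ) (x y : Plane) :
    ‖φ x - φ y‖ₑ ≤ ‖x - y‖ₑ * ∫⁻ t in Set.Ioc (0 : ℝ) 1, ‖gradient φ ((1 - t) • y + t • x)‖ₑ := by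
  have hd : ∀ t : ℝ, HasDerivAt (fun t : ℝ => φ ((1 - t) • y + t • x))
      (inner ℝ (gradient φ ((1 - t) • y + t • x)) (x - y)) t := by
    intro t
    have h1 : HasDerivAt (fun t : ℝ => (1 - t) • y + t • x) (x - y) t := by
      have a := ((hasDerivAt_id t).const_sub 1).smul_const y
      have b := (hasDerivAt_id t).smul_const x
      refine (a.add b).congr_deriv ?_
      rw [neg_smul, one_smul, one_smul]; abel
    rw [inner_gradient_left]
    exact (hφ.differentiable _).hasFDerivAt.comp_hasDerivAt t h1
  have hc : Continuous fun t : ℝ => inner ℝ (gradient φ ((1 - t) • y + t • x)) (x - y) :=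
    ((continuous_gradient hφ).comp (by fun_prop)).inner continuous_const
  have := intervalIntegral.integral_eq_sub_of_hasDerivAt (a := 0) (b := 1) (fun t _ => hd t)
    (hc.intervalIntegrable 0 1)
  simp only [sub_zero, one_smul, zero_smul, add_zero, sub_self, zero_add] at this
  rw [← this, intervalIntegral.integral_of_le zero_le_one]
  refine (enorm_integral_le_lintegral_enorm _).trans ?_
  rw [← lintegral_const_mul' _ _ (by simp)]
  refine lintegral_mono fun t => ?_
  simp only [← ofReal_norm, ← ENNReal.ofReal_mul (norm_nonneg _)]
  apply ENNReal.ofReal_le_ofReal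
  rw [mul_comm]
  exact norm_inner_le_norm _ _

/-- The average (times the area) of `|f|` over the segments from `x` to the points of `K`. -/
def segInt (K : Set Plane) (f : Plane → Plane) (x : Plane) : ℝ≥0∞ :=
  ∫⁻ y in K, ∫⁻ t in Set.Ioc (0 : ℝ) 1, ‖f ((1 - t) • y + t • x)‖ₑ

lemma measurable_segInt (K : Set Plane) {f : Plane → Plane} (hf : Measurable f) :
    Measurable (segInt K f) :=
  Measurable.lintegral_prod_right' (measurable_lintegral_segment hf.enorm)

lemma segInt_le (K : Set Plane) {f g : Plane → Plane} (hf : Measurable f)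
    (x : Plane) : segInt K g x ≤ segInt K f x + segInt K (fun z => f z - g z) x := by
  have m1 : Measurable fun y => ∫⁻ t in Set.Ioc (0 : ℝ) 1, ‖f ((1 - t) • y + t • x)‖ₑ :=
    Measurable.lintegral_prod_right' (measurable_segment_right hf.enorm x)
  unfold segInt
  rw [← lintegral_add_left m1]
  refine lintegral_mono fun y => ?_
  have m2 : Measurable fun t : ℝ => ‖f ((1 - t) • y + t • x)‖ₑ := by
    have : Measurable fun t : ℝ => (1 - t) • y + t • x := by fun_prop
    exact (hf.comp this).enorm
  rw [← lintegral_add_left m2]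
  refine lintegral_mono fun t => ?_
  have := enorm_sub_le (a := f ((1 - t) • y + t • x))
    (b := f ((1 - t) • y + t • x) - g ((1 - t) • y + t • x))
  rwa [sub_sub_cancel] at this

lemma IsTest.lintegral_sub_le {φ w : Plane → ℝ} (hφ : IsTest φ) (hw : Measurable w)
    {g : Plane → Plane} (hg : Measurable g)
    {K : Set Plane} (hK : MeasurableSet K) {d : ℝ}
    (hd : ∀ x ∈ K, ∀ y ∈ K, ‖x - y‖ ≤ d) {x : Plane} (hx : x ∈ K) :
    ∫⁻ y in K, ‖w x - w y‖ₑ ≤ ENNReal.ofReal d * segInt K g x +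
      ((volume K * ‖w x - φ x‖ₑ + ∫⁻ y, ‖w y - φ y‖ₑ)
        + ENNReal.ofReal d * segInt K (fun z => g z - gradient φ z) x) := by
  have hφm := hφ.continuous.measurable
  have a1 : ∀ y ∈ K, ‖w x - w y‖ₑ ≤ (‖w x - φ x‖ₑ + ‖w y - φ y‖ₑ) + ENNReal.ofReal d *
      ∫⁻ t in Set.Ioc (0 : ℝ) 1, ‖gradient φ ((1 - t) • y + t • x)‖ₑ := by
    intro y hy
    have e : w x - w y = ((w x - φ x) - (w y - φ y)) + (φ x - φ y) := by ring
    rw [e]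
    refine (enorm_add_le _ _).trans (add_le_add _root_.enorm_sub_le ?_)
    refine (hφ.enorm_sub_le x y).trans ?_
    gcongr
    rw [← ofReal_norm]
    exact ENNReal.ofReal_le_ofReal (hd x hx y hy)
  have m3 : Measurable fun y => ‖w x - φ x‖ₑ + ‖w y - φ y‖ₑ :=
    measurable_const.add (hw.sub hφm).enorm
  calc ∫⁻ y in K, ‖w x - w y‖ₑ
      ≤ ∫⁻ y in K, ((‖w x - φ x‖ₑ + ‖w y - φ y‖ₑ) + ENNReal.ofReal d *
          ∫⁻ t in Set.Ioc (0 : ℝ) 1, ‖gradient φ ((1 - t) • y + t • x)‖ₑ) :=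
        setLIntegral_mono' hK a1
    _ = (volume K * ‖w x - φ x‖ₑ + ∫⁻ y in K, ‖w y - φ y‖ₑ)
          + ENNReal.ofReal d * segInt K (gradient φ) x := by
        rw [lintegral_add_left m3, lintegral_add_left measurable_const, setLIntegral_const,
          lintegral_const_mul' _ _ ENNReal.ofReal_ne_top, mul_comm (volume K), segInt]
    _ ≤ (volume K * ‖w x - φ x‖ₑ + ∫⁻ y, ‖w y - φ y‖ₑ)
          + ENNReal.ofReal d * (segInt K g x + segInt K (fun z => g z - gradient φ z) x) := by
        gcongr
        · exact Measure.restrict_le_self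
        · exact segInt_le K hg x
    _ = _ := by rw [mul_add]; ring

/-- For test functions this is the fundamental theorem of calculus along segments. To pass to the
limit for a.e. `x`, one shows that the truncated excess of the left side over the right has zero
integral over `K`. -/
lemma Sob.lintegral_enorm_sub_le {w : Plane → ℝ} {g : Plane → Plane} (h : Sob w g)
    {K : Set Plane} (hK : MeasurableSet K) (hKc : Convex ℝ K) (hKv : volume K ≠ ∞) {d : ℝ}
    (hd : ∀ x ∈ K, ∀ y ∈ K, ‖x - y‖ ≤ d) :
    ∀ᵐ x ∂(volume.restrict K), ∫⁻ y in K, ‖w x - w y‖ₑ ≤ ENNReal.ofReal d * segInt K g x := by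
  obtain ⟨φ, hφ, h1, h2⟩ := h.exists_seq
  have hmQ : Measurable fun x => ∫⁻ y in K, ‖w x - w y‖ₑ :=
    Measurable.lintegral_prod_right' (f := fun p : Plane × Plane => ‖w p.1 - w p.2‖ₑ)
      ((h.meas.comp measurable_fst).sub (h.meas.comp measurable_snd)).enorm
  have hlim : Tendsto (fun n => (volume K * ∫⁻ x, ‖w x - φ n x‖ₑ) +
      (∫⁻ x, ‖w x - φ n x‖ₑ) * volume K +
        ENNReal.ofReal d * (4 * volume K * ∫⁻ x, ‖g x - gradient (φ n) x‖ₑ)) atTop (𝓝 0) := by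
    have t1 := ENNReal.Tendsto.const_mul (a := volume K) h1 (Or.inr hKv)
    have t2 := ENNReal.Tendsto.mul_const (b := volume K) h1 (Or.inr hKv)
    have t3 := ENNReal.Tendsto.const_mul (a := ENNReal.ofReal d)
      (ENNReal.Tendsto.const_mul (a := 4 * volume K) h2 (Or.inr (by finiteness))) (Or.inr (by simp))
    simpa using (t1.add t2).add t3
  have hzero : ∫⁻ x in K, ((∫⁻ y in K, ‖w x - w y‖ₑ) - ENNReal.ofReal d * segInt K g x) = 0 := by
    refine le_antisymm (ge_of_tendsto' hlim fun n => ?_) zero_le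
    have hφm := (hφ n).continuous.measurable
    have hgm := (continuous_gradient (hφ n)).measurable
    have m4 : Measurable fun x => volume K * ‖w x - φ n x‖ₑ :=
      (h.meas.sub hφm).enorm.const_mul _
    calc _ ≤ ∫⁻ x in K, ((volume K * ‖w x - φ n x‖ₑ + ∫⁻ y, ‖w y - φ n y‖ₑ)
        + ENNReal.ofReal d * segInt K (fun z => g z - gradient (φ n) z) x) :=
          setLIntegral_mono' hK fun x hx => tsub_le_iff_left.2
            ((hφ n).lintegral_sub_le h.meas h.meas_grad hK hd hx)
      _ = (volume K * ∫⁻ x in K, ‖w x - φ n x‖ₑ) + (∫⁻ x, ‖w x - φ n x‖ₑ) * volume K +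
          ENNReal.ofReal d * ∫⁻ x in K, segInt K (fun z => g z - gradient (φ n) z) x := by
          rw [lintegral_add_left (m4.add_const _), lintegral_add_left m4, setLIntegral_const,
            lintegral_const_mul' _ _ hKv, lintegral_const_mul' _ _ ENNReal.ofReal_ne_top]
      _ ≤ _ := by
          gcongr
          · exact Measure.restrict_le_self
          · refine (lintegral_segment_le hK hKc (h.meas_grad.sub hgm).enorm).trans ?_
            exact mul_le_mul_right (setLIntegral_le_lintegral _ _) _
  have hm : Measurable fun x => (∫⁻ y in K, ‖w x - w y‖ₑ) - ENNReal.ofReal d * segInt K g x :=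
    hmQ.sub ((measurable_segInt K h.meas_grad).const_mul _)
  rw [lintegral_eq_zero_iff hm] at hzero
  filter_upwards [hzero] with x hx
  exact tsub_eq_zero_iff_le.1 hx

/-- The oscillation at `x` is bounded by the mean of `|g|` over segments from `x` into `K`;
quasi-Jensen moves `ePow κ` inside this mean, and `lintegral_segment_le` integrates over `x`. The
function `m` is left abstract so that deviations from weighted averages can be inserted. The
constant is independent of the shape of `K`. -/
lemma Sob.poincare (κ A : ℝ) : ∃ C : ℝ≥0∞, C ≠ ∞ ∧ ∀ (w : Plane → ℝ) (g : Plane → Plane)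
    (_ : Sob w g) (K : Set Plane) (_ : MeasurableSet K) (_ : Convex ℝ K) (_ : volume K ≠ ∞)
    (_ : volume K ≠ 0) (d : ℝ) (_ : 0 < d) (_ : ∀ x ∈ K, ∀ y ∈ K, ‖x - y‖ ≤ d) (m : Plane → ℝ),
    (∀ x ∈ K, 0 ≤ m x) →
    (∀ᵐ x ∂(volume.restrict K), m x * (d * (volume K).toReal) ≤ A * ∫ y in K, |w x - w y|) →
      ∫⁻ x in K, ePow κ (m x) ≤ C * ∫⁻ x in K, ePow κ ‖g x‖ := by
  obtain ⟨C, hC, J⟩ := ePow_jensen κ (max A 0)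
  refine ⟨C * 4, by finiteness, ?_⟩
  intro w g h K hK hKc hKv hKv0 d hd0 hd m hm0 hm
  set V := (volume K).toReal with hV
  have hV0 : 0 < V := ENNReal.toReal_pos hKv0 hKv
  -- The law of a uniform end point in `K` together with a uniform position on the segment to it.
  set P : Measure (Plane × ℝ) := ((volume K)⁻¹ • volume.restrict K).prod
    (volume.restrict (Set.Ioc (0 : ℝ) 1)) with hP
  have hp1 : IsProbabilityMeasure ((volume K)⁻¹ • (volume : Measure Plane).restrict K) :=
    ⟨by simp [ENNReal.inv_mul_cancel hKv0 hKv]⟩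
  have hp2 : IsProbabilityMeasure ((volume : Measure ℝ).restrict (Set.Ioc (0 : ℝ) 1)) :=
    ⟨by simp⟩
  have hpP : IsProbabilityMeasure P := by rw [hP]; infer_instance
  have hgx : ∀ x, Measurable fun p : Plane × ℝ => g ((1 - p.2) • p.1 + p.2 • x) := fun x => by
    have : Measurable fun p : Plane × ℝ => (1 - p.2) • p.1 + p.2 • x := by fun_prop
    exact h.meas_grad.comp this
  have hPint : ∀ F : Plane × ℝ → ℝ≥0∞, Measurable F → ∫⁻ p, F p ∂P
      = (volume K)⁻¹ * ∫⁻ y in K, ∫⁻ t in Set.Ioc (0 : ℝ) 1, F (y, t) := fun F hF => by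
    rw [hP, lintegral_prod _ hF.aemeasurable, lintegral_smul_measure]
    rfl
  have hfin : ∀ᵐ x ∂(volume.restrict K), segInt K g x < ∞ := by
    refine ae_lt_top (measurable_segInt K h.meas_grad) ?_
    refine ne_top_of_le_ne_top ?_ (lintegral_segment_le hK hKc h.meas_grad.enorm)
    have : ∫⁻ x in K, ‖g x‖ₑ ≠ ∞ := h.integrable.2.restrict.2.ne
    finiteness
  have hpt : ∀ᵐ x ∂(volume.restrict K), ePow κ (m x) ≤ C * ((volume K)⁻¹ *
      ∫⁻ y in K, ∫⁻ t in Set.Ioc (0 : ℝ) 1, ePow κ ‖g ((1 - t) • y + t • x)‖) := by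
    filter_upwards [hfin, hm, h.lintegral_enorm_sub_le hK hKc hKv hd, ae_restrict_mem hK]
      with x hx1 hx2 hx3 hxK
    have hgi : Integrable (fun p : Plane × ℝ => ‖g ((1 - p.2) • p.1 + p.2 • x)‖) P := by
      refine ⟨(hgx x).norm.aestronglyMeasurable, ?_⟩
      rw [hasFiniteIntegral_iff_enorm]
      simp only [enorm_norm]
      rw [hPint _ (hgx x).enorm]
      exact ENNReal.mul_lt_top (ENNReal.inv_lt_top.2 (pos_iff_ne_zero.2 hKv0)) hx1
    have hI : ∫ p, ‖g ((1 - p.2) • p.1 + p.2 • x)‖ ∂P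
        = (segInt K g x).toReal / V := by
      rw [integral_norm_eq_lintegral_enorm (hgx x).aestronglyMeasurable,
        hPint _ (hgx x).enorm, ENNReal.toReal_mul, ENNReal.toReal_inv, hV, segInt]
      ring
    have hI0 : 0 ≤ ∫ p, ‖g ((1 - p.2) • p.1 + p.2 • x)‖ ∂P :=
      integral_nonneg fun p => norm_nonneg _
    have hmle : m x ≤ max A 0 * ∫ p, ‖g ((1 - p.2) • p.1 + p.2 • x)‖ ∂P := by
      have h4 : ∫ y in K, |w x - w y| ≤
          d * (segInt K g x).toReal := by
        have e : ∫ y in K, |w x - w y| = (∫⁻ y in K, ‖w x - w y‖ₑ).toReal := by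
          rw [← integral_norm_eq_lintegral_enorm (h.meas.const_sub (w x)).aestronglyMeasurable]
          rfl
        rw [e]
        have := ENNReal.toReal_mono (by finiteness) hx3
        rwa [ENNReal.toReal_mul, ENNReal.toReal_ofReal hd0.le] at this
      have h5 : 0 ≤ ∫ y in K, |w x - w y| := integral_nonneg fun y => abs_nonneg _
      rw [hI]
      have h6 : m x * (d * V) ≤ max A 0 * (d *
          (segInt K g x).toReal) :=
        hx2.trans ((mul_le_mul_of_nonneg_right (le_max_left A 0) h5).trans
          (mul_le_mul_of_nonneg_left h4 (le_max_right A 0)))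
      rw [mul_div_assoc', le_div_iff₀ hV0]
      have h7 : (m x * V) * d ≤ (max A 0 *
          (segInt K g x).toReal) * d := by
        linarith
      exact le_of_mul_le_mul_right h7 hd0
    have := J (Plane × ℝ) P _ (m x) hgi (fun p => norm_nonneg _) (hm0 x hxK) hmle
    rwa [hPint (fun p => ePow κ ‖g ((1 - p.2) • p.1 + p.2 • x)‖)
      ((measurable_ePow κ).comp (hgx x).norm)] at this
  have hKi : (volume K)⁻¹ ≠ ∞ := ENNReal.inv_ne_top.2 hKv0
  have hF : Measurable fun x => ePow κ ‖g x‖ := (measurable_ePow κ).comp h.meas_grad.norm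
  calc ∫⁻ x in K, ePow κ (m x) ≤ ∫⁻ x in K, C * ((volume K)⁻¹ *
      ∫⁻ y in K, ∫⁻ t in Set.Ioc (0 : ℝ) 1, ePow κ ‖g ((1 - t) • y + t • x)‖) :=
        lintegral_mono_ae hpt
    _ = C * ((volume K)⁻¹ * ∫⁻ x in K,
      ∫⁻ y in K, ∫⁻ t in Set.Ioc (0 : ℝ) 1, ePow κ ‖g ((1 - t) • y + t • x)‖) := by
        rw [lintegral_const_mul' _ _ hC, lintegral_const_mul' _ _ hKi]
    _ ≤ C * ((volume K)⁻¹ * (4 * volume K * ∫⁻ x in K, ePow κ ‖g x‖)) := by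
        gcongr
        exact lintegral_segment_le hK hKc hF
    _ = C * 4 * ((volume K)⁻¹ * volume K) * ∫⁻ x in K, ePow κ ‖g x‖ := by ring
    _ = _ := by rw [ENNReal.inv_mul_cancel hKv0 hKv, mul_one]

/-! ### Cutoff functions and the angular function -/

/-- The standard bump function, `1` on the ball of radius `1/2` and `0` off the unit ball. -/
def stdBump : ContDiffBump (0 : Plane) := ⟨1 / 2, 1, by norm_num, by norm_num⟩

/-- A cutoff function, `1` on the ball of radius `r/2` and `0` off the ball of radius `r`. -/
def cut (r : ℝ) (x : Plane) : ℝ := stdBump (r⁻¹ • x)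

lemma contDiff_cut (r : ℝ) : ContDiff ℝ ((⊤ : ℕ∞) : WithTop ℕ∞) (cut r) :=
  stdBump.contDiff.comp (contDiff_const_smul _)

lemma cut_nonneg (r : ℝ) (x : Plane) : 0 ≤ cut r x := stdBump.nonneg

lemma cut_le_one (r : ℝ) (x : Plane) : cut r x ≤ 1 := stdBump.le_one

lemma cut_eq_one {r : ℝ} (hr : 0 < r) {x : Plane} (hx : ‖x‖ ≤ r / 2) : cut r x = 1 := by
  apply stdBump.one_of_mem_closedBall
  rw [mem_closedBall_zero_iff, norm_smul, norm_inv, Real.norm_of_nonneg hr.le]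
  change r⁻¹ * ‖x‖ ≤ 1 / 2
  rw [inv_mul_le_iff₀ hr]
  linarith

lemma cut_eq_zero {r : ℝ} (hr : 0 < r) {x : Plane} (hx : r ≤ ‖x‖) : cut r x = 0 := by
  apply stdBump.zero_of_le_dist
  rw [dist_zero_right, norm_smul, norm_inv, Real.norm_of_nonneg hr.le]
  change 1 ≤ r⁻¹ * ‖x‖
  rw [le_inv_mul_iff₀ hr]
  linarith

lemma differentiable_cut (r : ℝ) : Differentiable ℝ (cut r) :=
  (contDiff_cut r).differentiable (by simp)

lemma gradient_cut_eq_zero_of_le {r : ℝ} (hr : 0 < r) {x : Plane} (hx : ‖x‖ ≤ r / 2) :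
    gradient (cut r) x = 0 := by
  have : IsLocalMax (cut r) x := Eventually.of_forall fun y => by
    rw [cut_eq_one hr hx]; exact cut_le_one r y
  simp [gradient, this.fderiv_eq_zero]

lemma gradient_cut_eq_zero_of_ge {r : ℝ} (hr : 0 < r) {x : Plane} (hx : r ≤ ‖x‖) :
    gradient (cut r) x = 0 := by
  have : IsLocalMin (cut r) x := Eventually.of_forall fun y => by
    rw [cut_eq_zero hr hx]; exact cut_nonneg r y
  simp [gradient, this.fderiv_eq_zero]

lemma exists_gradient_cut_le : ∃ C : ℝ, 0 < C ∧ ∀ r : ℝ, 0 < r → ∀ x,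
    ‖gradient (cut r) x‖ ≤ C / r := by
  obtain ⟨C, hC⟩ := (stdBump.hasCompactSupport.fderiv ℝ).exists_bound_of_continuous
    ((stdBump.contDiff (n := 1)).continuous_fderiv (by simp))
  refine ⟨max C 1, by positivity, fun r hr x => ?_⟩
  rw [norm_gradient]
  have h : fderiv ℝ (cut r) x = r⁻¹ • fderiv ℝ stdBump (r⁻¹ • x) :=
    fderiv_comp_smul ..
  rw [h, norm_smul, norm_inv, Real.norm_of_nonneg hr.le, div_eq_inv_mul]
  gcongr
  exact (hC _).trans (le_max_left _ _)

lemma closedBall_subset_Square {r : ℝ} (hr : r < 1) :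
    Metric.closedBall (0 : Plane) r ⊆ Square := by
  intro x hx
  rw [mem_closedBall_zero_iff] at hx
  exact ⟨((abs_coord_le x 0).trans hx).trans_lt hr, ((abs_coord_le x 1).trans hx).trans_lt hr⟩

lemma isTest_of_eq_zero {φ : Plane → ℝ} (h : ContDiff ℝ ((⊤ : ℕ∞) : WithTop ℕ∞) φ) {r : ℝ}
    (hr : r < 1) (h0 : ∀ x, r < ‖x‖ → φ x = 0) : IsTest φ := by
  have hs : Function.support φ ⊆ Metric.closedBall (0 : Plane) r := by
    intro x hx
    rw [mem_closedBall_zero_iff]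
    by_contra hlt
    exact hx (h0 x (not_le.1 hlt))
  exact ⟨h, HasCompactSupport.of_support_subset_isCompact (isCompact_closedBall _ _) hs,
    (closure_minimal hs Metric.isClosed_closedBall).trans (closedBall_subset_Square hr)⟩

lemma isTest_cut {r : ℝ} (hr : 0 < r) (hr1 : r < 1) : IsTest (cut r) :=
  isTest_of_eq_zero (contDiff_cut r) hr1 fun _ hx => cut_eq_zero hr hx.le

/-- The angular function: `1/2` in the upper cone, `-1/2` in the lower cone. -/
def ang (x : Plane) : ℝ := Real.smoothTransition ((√2 * (x 1 / ‖x‖) + 1) / 2) - 1 / 2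

lemma abs_ang_le (x : Plane) : |ang x| ≤ 1 / 2 := by
  unfold ang
  have h1 := Real.smoothTransition.nonneg ((√2 * (x 1 / ‖x‖) + 1) / 2)
  have h2 := Real.smoothTransition.le_one ((√2 * (x 1 / ‖x‖) + 1) / 2)
  rw [abs_le]
  constructor <;> linarith

lemma norm_le_sqrt_two_mul {x : Plane} (hx : |x 0| ≤ |x 1|) : ‖x‖ ≤ √2 * |x 1| := by
  refine le_of_sq_le_sq ?_ (by positivity)
  rw [plane_norm_sq, mul_pow, Real.sq_sqrt (by norm_num), sq_abs]
  have := sq_le_sq' (by linarith [abs_nonneg (x 0), abs_nonneg (x 1)]) hx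
  rw [sq_abs, sq_abs] at this
  linarith

lemma ang_top {x : Plane} (hx : |x 0| < x 1) : ang x = 1 / 2 := by
  have h1 : 0 < x 1 := (abs_nonneg _).trans_lt hx
  have h0 : 0 < ‖x‖ := h1.trans_le ((le_abs_self _).trans (abs_coord_le x 1))
  have h2 := norm_le_sqrt_two_mul (x := x) (by rw [abs_of_pos h1]; exact hx.le)
  rw [abs_of_pos h1] at h2
  unfold ang
  rw [Real.smoothTransition.one_of_one_le]
  · norm_num
  · have : 1 ≤ √2 * (x 1 / ‖x‖) := by
      rw [mul_div_assoc', le_div_iff₀ h0]; linarith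
    linarith

lemma ang_bot {x : Plane} (hx : |x 0| < -x 1) : ang x = -(1 / 2) := by
  have h1 : x 1 < 0 := by linarith [abs_nonneg (x 0)]
  have h0 : 0 < ‖x‖ := by
    have := (neg_le_abs (x 1)).trans (abs_coord_le x 1)
    linarith
  have h2 := norm_le_sqrt_two_mul (x := x) (by rw [abs_of_neg h1]; exact hx.le)
  rw [abs_of_neg h1] at h2
  unfold ang
  rw [Real.smoothTransition.zero_of_nonpos]
  · norm_num
  · have : √2 * (x 1 / ‖x‖) ≤ -1 := by
      rw [mul_div_assoc', div_le_iff₀ h0]; linarith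
    linarith

lemma contDiffAt_ang {x : Plane} (hx : x ≠ 0) :
    ContDiffAt ℝ ((⊤ : ℕ∞) : WithTop ℕ∞) ang x := by
  unfold ang
  have h1 : ContDiffAt ℝ ((⊤ : ℕ∞) : WithTop ℕ∞) (fun y : Plane => y 1) x := by fun_prop
  have h2 : ContDiffAt ℝ ((⊤ : ℕ∞) : WithTop ℕ∞) (fun y : Plane => ‖y‖) x :=
    contDiffAt_norm ℝ hx
  have h3 := h1.div h2 (norm_ne_zero_iff.2 hx)
  have h4 : ContDiffAt ℝ ((⊤ : ℕ∞) : WithTop ℕ∞)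
      (fun y : Plane => (√2 * (y 1 / ‖y‖) + 1) / 2) x :=
    ((contDiffAt_const.mul h3).add contDiffAt_const).div_const 2
  exact ((Real.smoothTransition.contDiff.contDiffAt).comp x h4).sub contDiffAt_const

lemma measurable_ang : Measurable ang := by
  unfold ang
  have h : Measurable fun x : Plane => (√2 * (x 1 / ‖x‖) + 1) / 2 := by fun_prop
  exact (Real.smoothTransition.continuous.measurable.comp h).sub_const _

lemma ang_smul {c : ℝ} (hc : 0 < c) (x : Plane) : ang (c • x) = ang x := by
  unfold ang
  rw [norm_smul, Real.norm_of_nonneg hc.le, PiLp.smul_apply, smul_eq_mul,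
    mul_div_mul_left _ _ hc.ne']

/-- `ang` is homogeneous of degree `0`, so its gradient is homogeneous of degree `-1` and is bounded
on the unit circle by compactness. -/
lemma exists_gradient_ang_le : ∃ C : ℝ, 0 < C ∧ ∀ x : Plane, x ≠ 0 →
    ‖gradient ang x‖ ≤ C / ‖x‖ := by
  have hco : ContinuousOn (fderiv ℝ ang) (Metric.sphere (0 : Plane) 1) := by
    intro x hx
    have hx0 : x ≠ 0 := by
      rintro rfl
      simp at hx
    exact ((contDiffAt_ang hx0).continuousAt_fderiv (by simp)).continuousWithinAt
  obtain ⟨C, hC⟩ := (isCompact_sphere (0 : Plane) 1).exists_bound_of_continuousOn hco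
  refine ⟨max C 1, by positivity, fun x hx => ?_⟩
  have hn : 0 < ‖x‖ := norm_pos_iff.2 hx
  have e : fderiv ℝ ang x = ‖x‖⁻¹ • fderiv ℝ ang (‖x‖⁻¹ • x) := by
    have : ang = fun y => ang (‖x‖⁻¹ • y) := by
      ext y; rw [ang_smul (by positivity)]
    conv_lhs => rw [this]
    exact fderiv_comp_smul ..
  rw [norm_gradient, e, norm_smul, norm_inv, norm_norm, div_eq_inv_mul]
  gcongr
  refine (hC _ ?_).trans (le_max_left _ _)
  rw [mem_sphere_zero_iff_norm, norm_smul, norm_inv, norm_norm, inv_mul_cancel₀ hn.ne']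

lemma gradient_ang_eq_zero {x : Plane} (hx : |x 0| < |x 1|) : gradient ang x = 0 := by
  have hc0 : Continuous fun y : Plane => |y 0| := by fun_prop
  have hc1 : Continuous fun y : Plane => y 1 := by fun_prop
  have hc2 : Continuous fun y : Plane => -y 1 := by fun_prop
  rcases lt_abs.1 hx with h | h
  · have : ang =ᶠ[𝓝 x] fun _ => 1 / 2 :=
      (hc0.continuousAt.eventually_lt hc1.continuousAt h).mono fun y hy => ang_top hy
    rw [this.gradient_eq, gradient_fun_const]
  · have : ang =ᶠ[𝓝 x] fun _ => -(1 / 2) :=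
      (hc0.continuousAt.eventually_lt hc2.continuousAt h).mono fun y hy => ang_bot hy
    rw [this.gradient_eq, gradient_fun_const]

/-- The angular function, cut off. -/
def cutAng (x : Plane) : ℝ := cut (1 / 2) x * ang x

/-- The gradient of `cutAng` off the origin. -/
def cutAngGrad (x : Plane) : Plane :=
  cut (1 / 2) x • gradient ang x + ang x • gradient (cut (1 / 2)) x

lemma contDiffAt_cutAng {x : Plane} (hx : x ≠ 0) :
    ContDiffAt ℝ ((⊤ : ℕ∞) : WithTop ℕ∞) cutAng x :=
  (contDiff_cut _).contDiffAt.mul (contDiffAt_ang hx)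

lemma gradient_cutAng {x : Plane} (hx : x ≠ 0) : gradient cutAng x = cutAngGrad x :=
  gradient_mul (differentiable_cut _ x) ((contDiffAt_ang hx).differentiableAt (by simp))

lemma measurable_gradient (f : Plane → ℝ) : Measurable (gradient f) :=
  (LinearIsometryEquiv.continuous _).measurable.comp (measurable_fderiv ℝ f)

lemma measurable_cutAng : Measurable cutAng :=
  (contDiff_cut _).continuous.measurable.mul measurable_ang

lemma measurable_cutAngGrad : Measurable cutAngGrad :=
  ((contDiff_cut _).continuous.measurable.smul (measurable_gradient _)).add
    (measurable_ang.smul (measurable_gradient _))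

lemma abs_cutAng_le (x : Plane) : |cutAng x| ≤ 1 / 2 := by
  unfold cutAng
  rw [abs_mul, abs_of_nonneg (cut_nonneg _ _)]
  have := cut_le_one (1 / 2) x
  have := abs_ang_le x
  nlinarith [cut_nonneg (1 / 2) x, abs_nonneg (ang x)]

lemma cutAngGrad_eq_zero {x : Plane} (hx : 1 / 2 ≤ ‖x‖) : cutAngGrad x = 0 := by
  rw [cutAngGrad, cut_eq_zero (by norm_num) hx, gradient_cut_eq_zero_of_ge (by norm_num) hx]
  simp

/-- The singularity `1/|x|` sits in the side cones only, because `ang` is locally constant in the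
double cone. So the `α`-phase never sees it. -/
lemma exists_cutAngGrad_le : ∃ C : ℝ, 0 < C ∧ (∀ x : Plane, x ≠ 0 →
    ‖cutAngGrad x‖ ≤ C / ‖x‖) ∧ ∀ x : Plane, |x 0| < |x 1| → ‖cutAngGrad x‖ ≤ C := by
  obtain ⟨C, hC, H⟩ := exists_gradient_ang_le
  obtain ⟨C', hC', H'⟩ := exists_gradient_cut_le
  have hb : ∀ x, ‖ang x • gradient (cut (1 / 2)) x‖ ≤ C' := by
    intro x
    rw [norm_smul, Real.norm_eq_abs]
    have h1 := H' (1 / 2) (by norm_num) x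
    have h2 := abs_ang_le x
    have h3 : C' / (1 / 2) = 2 * C' := by ring
    rw [h3] at h1
    nlinarith [abs_nonneg (ang x), norm_nonneg (gradient (cut (1 / 2)) x)]
  refine ⟨C + C', by positivity, fun x hx => ?_, fun x hx => ?_⟩
  · have hn : 0 < ‖x‖ := norm_pos_iff.2 hx
    rcases le_or_gt (1 / 2) ‖x‖ with h | h
    · rw [cutAngGrad_eq_zero h, norm_zero]; positivity
    · refine (norm_add_le _ _).trans ?_
      rw [add_div]
      gcongr
      · rw [norm_smul, Real.norm_of_nonneg (cut_nonneg _ _)]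
        have := H x hx
        have := cut_le_one (1 / 2) x
        nlinarith [cut_nonneg (1 / 2) x, norm_nonneg (gradient ang x)]
      · refine (hb x).trans ?_
        rw [le_div_iff₀ hn]
        nlinarith
  · rw [cutAngGrad, gradient_ang_eq_zero hx, smul_zero, zero_add]
    linarith [hb x]

/-- The angular function, cut off near the origin too. -/
def holeAng (r : ℝ) (x : Plane) : ℝ := (1 - cut r x) * cutAng x

lemma contDiff_holeAng {r : ℝ} (hr : 0 < r) :
    ContDiff ℝ ((⊤ : ℕ∞) : WithTop ℕ∞) (holeAng r) := by
  rw [contDiff_iff_contDiffAt]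
  intro x
  by_cases hx : x = 0
  · have : holeAng r =ᶠ[𝓝 x] fun _ => 0 := by
      filter_upwards [Metric.ball_mem_nhds x (half_pos hr)] with y hy
      rw [hx, mem_ball_zero_iff] at hy
      rw [holeAng, cut_eq_one hr hy.le]; ring
    exact contDiffAt_const.congr_of_eventuallyEq this
  · exact (contDiffAt_const.sub (contDiff_cut r).contDiffAt).mul (contDiffAt_cutAng hx)

lemma isTest_holeAng {r : ℝ} (hr : 0 < r) : IsTest (holeAng r) :=
  isTest_of_eq_zero (contDiff_holeAng hr) (r := 1 / 2) (by norm_num) fun x hx => by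
    rw [holeAng, cutAng, cut_eq_zero (by norm_num) hx.le]; ring

lemma gradient_holeAng {r : ℝ} {x : Plane} (hx : x ≠ 0) :
    gradient (holeAng r) x = (1 - cut r x) • cutAngGrad x - cutAng x • gradient (cut r) x := by
  have hd : DifferentiableAt ℝ (fun y => 1 - cut r y) x :=
    (differentiableAt_const _).sub (differentiable_cut r x)
  have h := gradient_mul hd ((contDiffAt_cutAng hx).differentiableAt (by simp))
  have e : gradient (fun y => 1 - cut r y) x = - gradient (cut r) x := by
    unfold gradient
    rw [fderiv_const_sub, map_neg]
  rw [e, gradient_cutAng hx, smul_neg, ← sub_eq_add_neg] at h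
  exact h

lemma gradient_holeAng_eq_zero {r : ℝ} (hr : 0 < r) {x : Plane} (hx : ‖x‖ < r / 2) :
    gradient (holeAng r) x = 0 := by
  have : holeAng r =ᶠ[𝓝 x] fun _ => 0 := by
    filter_upwards [continuous_norm.continuousAt.eventually_lt continuousAt_const hx] with y hy
    rw [holeAng, cut_eq_one hr hy.le]; ring
  rw [this.gradient_eq, gradient_fun_const]

/-! ### Averages against densities and punching a hole at the origin. -/

/-- A probability density of amplitude at most `C / r²` that vanishes off `V`. -/
structure IsDensity (C r : ℝ) (V : Set Plane) (k : Plane → ℝ) : Prop where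
  meas : Measurable k
  bound : ∀ x, |k x| ≤ C / r ^ 2
  zero : ∀ x, x ∉ V → k x = 0
  integral : ∫ x, k x = 1

lemma IsDensity.mono {C r : ℝ} {V V' : Set Plane} {k : Plane → ℝ} (h : IsDensity C r V k)
    (hV : V ⊆ V') : IsDensity C r V' k :=
  ⟨h.meas, h.bound, fun x hx => h.zero x fun hx' => hx (hV hx'), h.integral⟩

lemma IsDensity.integrable {C r : ℝ} {V : Set Plane} {k : Plane → ℝ} (h : IsDensity C r V k) :
    Integrable k := by
  by_contra hk
  have := h.integral
  rw [integral_undef hk] at this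
  exact zero_ne_one this

lemma IsDensity.integrable_mul {C r : ℝ} {V : Set Plane} {k : Plane → ℝ} (h : IsDensity C r V k)
    {w : Plane → ℝ} (hw : Integrable w) : Integrable fun x => k x * w x :=
  hw.bdd_mul h.meas.aestronglyMeasurable (ae_of_all _ h.bound)

lemma volume_ball_plane {r : ℝ} (hr : 0 ≤ r) :
    volume (Metric.ball (0 : Plane) r) = ENNReal.ofReal (r ^ 2 * Real.pi) := by
  rw [EuclideanSpace.volume_ball_fin_two, ENNReal.ofReal_mul (by positivity),
    ← ENNReal.ofReal_pow hr]

/-- The deviation equals `∫ k(y)(w x - w y) dy`, and `|k| ≤ C₀/r²` compares it with the plain mean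
oscillation, since `K` has area at most `π r²`. -/
lemma Sob.poincare_avg (κ C₀ : ℝ) : ∃ C : ℝ≥0∞, C ≠ ∞ ∧ ∀ (w : Plane → ℝ) (g : Plane → Plane)
    (_ : Sob w g) (r : ℝ) (_ : 0 < r) (K : Set Plane) (_ : MeasurableSet K) (_ : Convex ℝ K)
    (_ : K ⊆ Metric.ball 0 r) (_ : volume K ≠ 0) (k : Plane → ℝ), IsDensity C₀ r K k →
      ∫⁻ x in K, ePow κ (|w x - ∫ y, k y * w y| / r) ≤ C * ∫⁻ x in K, ePow κ ‖g x‖ := by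
  obtain ⟨C, hC, H⟩ := Sob.poincare κ (2 * Real.pi * C₀)
  refine ⟨C, hC, fun w g h r hr K hK hKc hKr hK0 k hk => ?_⟩
  have hvol : volume K ≤ ENNReal.ofReal (r ^ 2 * Real.pi) :=
    (measure_mono hKr).trans_eq (volume_ball_plane hr.le)
  have hKv : volume K ≠ ∞ := (hvol.trans_lt ENNReal.ofReal_lt_top).ne
  refine H w g h K hK hKc hKv hK0 (2 * r) (by positivity) ?_ _ (fun x _ => by positivity) ?_
  · intro x hx y hy
    have h1 := mem_ball_zero_iff.1 (hKr hx)
    have h2 := mem_ball_zero_iff.1 (hKr hy)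
    have := norm_sub_le x y
    linarith
  · refine ae_of_all _ fun x => ?_
    have hwi := h.integrable.1
    have hi : IntegrableOn (fun y => |w x - w y|) K :=
      ((integrableOn_const hKv).sub hwi.integrableOn).abs
    have e : w x - ∫ y, k y * w y = ∫ y, k y * (w x - w y) := by
      simp only [mul_sub]
      rw [integral_sub (hk.integrable.mul_const _) (hk.integrable_mul hwi), integral_mul_const,
        hk.integral, one_mul]
    have h1 : |w x - ∫ y, k y * w y| ≤ C₀ / r ^ 2 * ∫ y in K, |w x - w y| := by
      rw [e, ← setIntegral_eq_integral_of_forall_compl_eq_zero (s := K), ← integral_const_mul]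
      · refine (Real.norm_eq_abs _).ge.trans (norm_integral_le_of_norm_le (μ := volume.restrict K) (hi.const_mul _) (ae_of_all _ fun y => ?_))
        rw [Real.norm_eq_abs, abs_mul]
        exact mul_le_mul_of_nonneg_right (hk.bound y) (abs_nonneg _)
      · intro y hy
        rw [hk.zero y hy, zero_mul]
    have hV : (volume K).toReal ≤ r ^ 2 * Real.pi :=
      ENNReal.toReal_le_of_le_ofReal (by positivity) hvol
    have hI : 0 ≤ ∫ y in K, |w x - w y| := integral_nonneg fun _ => abs_nonneg _
    have hC0 : 0 ≤ C₀ / r ^ 2 := (abs_nonneg _).trans (hk.bound 0)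
    calc |w x - ∫ y, k y * w y| / r * (2 * r * (volume K).toReal)
        = 2 * |w x - ∫ y, k y * w y| * (volume K).toReal := by field_simp
      _ ≤ 2 * (C₀ / r ^ 2 * ∫ y in K, |w x - w y|) * (r ^ 2 * Real.pi) := by gcongr
      _ = 2 * Real.pi * C₀ * ∫ y in K, |w x - w y| := by field_simp

/-- The upper cone. -/
def topCone : Set Plane := {x | |x 0| < x 1}

/-- The lower cone. -/
def botCone : Set Plane := {x | |x 0| < -x 1}

lemma isOpen_topCone : IsOpen topCone :=
  isOpen_lt (f := fun x : Plane => |x 0|) (g := fun x => x 1) (by fun_prop) (by fun_prop)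

lemma isOpen_botCone : IsOpen botCone :=
  isOpen_lt (f := fun x : Plane => |x 0|) (g := fun x => -x 1) (by fun_prop) (by fun_prop)

lemma convex_topCone : Convex ℝ topCone := by
  intro x hx y hy a b ha hb hab
  have hx' : |x 0| < x 1 := hx
  have hy' : |y 0| < y 1 := hy
  change |(a • x + b • y) 0| < (a • x + b • y) 1
  simp only [PiLp.add_apply, PiLp.smul_apply, smul_eq_mul]
  have h1 := abs_add_le (a * x 0) (b * y 0)
  rw [abs_mul, abs_mul, abs_of_nonneg ha, abs_of_nonneg hb] at h1
  rcases ha.eq_or_lt with rfl | ha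
  · simp_all
  · nlinarith

lemma convex_botCone : Convex ℝ botCone := by
  intro x hx y hy a b ha hb hab
  have hx' : |x 0| < -x 1 := hx
  have hy' : |y 0| < -y 1 := hy
  change |(a • x + b • y) 0| < -(a • x + b • y) 1
  simp only [PiLp.add_apply, PiLp.smul_apply, smul_eq_mul]
  have h1 := abs_add_le (a * x 0) (b * y 0)
  rw [abs_mul, abs_mul, abs_of_nonneg ha, abs_of_nonneg hb] at h1
  rcases ha.eq_or_lt with rfl | ha
  · simp_all
  · nlinarith

lemma topCone_or_botCone {x : Plane} (hx : |x 0| < |x 1|) : x ∈ topCone ∨ x ∈ botCone :=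
  lt_abs.1 hx

lemma weight_eq_one {x : Plane} (hx : |x 0| < |x 1|) : weight x = 1 := if_pos hx

lemma weight_eq_zero {x : Plane} (hx : ¬ |x 0| < |x 1|) : weight x = 0 := if_neg hx

lemma weight_topCone {x : Plane} (hx : x ∈ topCone) : weight x = 1 :=
  weight_eq_one (lt_abs.2 (Or.inl hx))

lemma weight_botCone {x : Plane} (hx : x ∈ botCone) : weight x = 1 :=
  weight_eq_one (lt_abs.2 (Or.inr hx))

/-- The cost of replacing a function with gradient `g` and angular jump `D` by a function that is
constant near the origin. -/
def holeCost (α β : ℝ) (g : Plane → Plane) (r D : ℝ) : ℝ≥0∞ :=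
  (∫⁻ x in Metric.ball 0 r, Phi α β x ‖g x‖) +
    ((∫⁻ x in {x : Plane | r / 2 ≤ ‖x‖ ∧ ‖x‖ ≤ 1}, ePow (-β) (|D| / ‖x‖)) + ePow α |D|)

lemma volume_ne_zero_of_isDensity {C r : ℝ} {V : Set Plane} {k : Plane → ℝ}
    (h : IsDensity C r V k) : volume V ≠ 0 := by
  intro h0
  have : ∫ x, k x = 0 := by
    rw [← setIntegral_eq_integral_of_forall_compl_eq_zero h.zero,
      Measure.restrict_eq_zero.2 h0, integral_zero_measure]
  rw [h.integral] at this
  exact one_ne_zero this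

/-- The oscillation terms of the cut-off, bounded by the energy in the ball. -/
lemma Sob.osc_le (α β C₀ : ℝ) : ∃ C : ℝ≥0∞, C ≠ ∞ ∧ ∀ (w : Plane → ℝ) (g : Plane → Plane)
    (_ : Sob w g) (r : ℝ) (_ : 0 < r) (k₁ k₂ : Plane → ℝ),
    IsDensity C₀ r (topCone ∩ Metric.ball 0 r) k₁ →
    IsDensity C₀ r (botCone ∩ Metric.ball 0 r) k₂ →
    ∀ u : Plane → ℝ, (∀ x, |u x| ≤ max |w x - ∫ y, k₁ y * w y| |w x - ∫ y, k₂ y * w y|) →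
      (∀ x ∈ topCone, |u x| ≤ |w x - ∫ y, k₁ y * w y|) →
      (∀ x ∈ botCone, |u x| ≤ |w x - ∫ y, k₂ y * w y|) →
      ∫⁻ x in Metric.ball 0 r, Phi α β x (|u x| / r)
        ≤ C * ∫⁻ x in Metric.ball 0 r, Phi α β x ‖g x‖ := by
  obtain ⟨C₁, hC₁, H₁⟩ := Sob.poincare_avg (-β) C₀
  obtain ⟨C₂, hC₂, H₂⟩ := Sob.poincare_avg α C₀
  obtain ⟨E₁, hE₁, M₁⟩ := ePow_scale (-β) 1
  obtain ⟨E₂, hE₂, M₂⟩ := ePow_scale α 1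
  refine ⟨E₁ * (C₁ + C₁) + (E₂ * C₂ + E₂ * C₂), by finiteness, ?_⟩
  intro w g h r hr k₁ k₂ hk₁ hk₂ u hu hu₁ hu₂
  set c₁ := ∫ y, k₁ y * w y
  set c₂ := ∫ y, k₂ y * w y
  set B := Metric.ball (0 : Plane) r
  have hB : MeasurableSet B := Metric.isOpen_ball.measurableSet
  have hT : MeasurableSet (topCone ∩ B) := isOpen_topCone.measurableSet.inter hB
  have hT' : MeasurableSet (botCone ∩ B) := isOpen_botCone.measurableSet.inter hB
  -- The light phase is estimated on the whole ball, with either average. The heavy phase is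
  -- estimated on each half cone separately with its own average: each half cone is convex, but
  -- their union is not.
  have pt : ∀ x ∈ B, Phi α β x (|u x| / r) ≤
      (E₁ * (ePow (-β) (|w x - c₁| / r) + ePow (-β) (|w x - c₂| / r))) +
      ((topCone ∩ B).indicator (fun x => E₂ * ePow α (|w x - c₁| / r)) x +
        (botCone ∩ B).indicator (fun x => E₂ * ePow α (|w x - c₂| / r)) x) := by
    intro x hx
    rw [Phi_eq α β x (by positivity)]
    refine add_le_add ?_ ?_
    · rw [mul_add]
      rcases le_max_iff.1 (hu x) with h' | h'
      · refine le_trans ?_ le_self_add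
        exact M₁ _ _ (by positivity) (by positivity) (by rw [one_mul]; gcongr)
      · refine le_trans ?_ le_add_self
        exact M₁ _ _ (by positivity) (by positivity) (by rw [one_mul]; gcongr)
    · by_cases hw : |x 0| < |x 1|
      · rw [weight_eq_one hw, ENNReal.ofReal_one, one_mul]
        rcases topCone_or_botCone hw with ht | ht
        · refine le_trans ?_ le_self_add
          rw [Set.indicator_of_mem (show x ∈ topCone ∩ B from ⟨ht, hx⟩)]
          exact M₂ _ _ (by positivity) (by positivity)
            (by rw [one_mul]; exact div_le_div_of_nonneg_right (hu₁ x ht) hr.le)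
        · refine le_trans ?_ le_add_self
          rw [Set.indicator_of_mem (show x ∈ botCone ∩ B from ⟨ht, hx⟩)]
          exact M₂ _ _ (by positivity) (by positivity)
            (by rw [one_mul]; exact div_le_div_of_nonneg_right (hu₂ x ht) hr.le)
      · rw [weight_eq_zero hw]; simp
  have mp : ∀ κ c, Measurable fun x => ePow κ (|w x - c| / r) := fun κ c =>
    (measurable_ePow κ).comp (((h.meas.sub_const c).norm).div_const r)
  have mi : ∀ c, Measurable fun x => E₂ * ePow α (|w x - c| / r) := fun c =>
    (mp α c).const_mul _
  have m0 : Measurable fun x => ePow (-β) (|w x - c₁| / r) + ePow (-β) (|w x - c₂| / r) :=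
    (mp _ _).add (mp _ _)
  have m1 : Measurable fun x => E₁ * (ePow (-β) (|w x - c₁| / r) + ePow (-β) (|w x - c₂| / r)) :=
    ((mp _ _).add (mp _ _)).const_mul _
  have m2 : Measurable fun x => (topCone ∩ B).indicator (fun x => E₂ * ePow α (|w x - c₁| / r)) x :=
    (mi _).indicator hT
  refine (setLIntegral_mono' hB pt).trans ?_
  rw [lintegral_add_left m1, lintegral_add_left m2, lintegral_const_mul _ m0,
    lintegral_add_left (mp _ _), setLIntegral_indicator hT, setLIntegral_indicator hT',
    lintegral_const_mul _ (mp _ _), lintegral_const_mul _ (mp _ _),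
    Set.inter_assoc, Set.inter_assoc, Set.inter_self]
  have hBc : Convex ℝ B := convex_ball _ _
  have hv := volume_ne_zero_of_isDensity (hk₁.mono (Set.inter_subset_right))
  have a1 := H₁ w g h r hr B hB hBc subset_rfl hv k₁ (hk₁.mono (Set.inter_subset_right))
  have a2 := H₁ w g h r hr B hB hBc subset_rfl hv k₂ (hk₂.mono (Set.inter_subset_right))
  have a3 := H₂ w g h r hr _ hT (convex_topCone.inter hBc) Set.inter_subset_right
    (volume_ne_zero_of_isDensity hk₁) k₁ hk₁
  have a4 := H₂ w g h r hr _ hT' (convex_botCone.inter hBc) Set.inter_subset_right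
    (volume_ne_zero_of_isDensity hk₂) k₂ hk₂
  have b1 : ∫⁻ x in B, ePow (-β) ‖g x‖ ≤ ∫⁻ x in B, Phi α β x ‖g x‖ :=
    lintegral_mono fun x => ePow_le_Phi α β x (norm_nonneg _)
  have b2 : ∀ V : Set Plane, MeasurableSet V → (∀ x ∈ V, weight x = 1) →
      ∫⁻ x in V ∩ B, ePow α ‖g x‖ ≤ ∫⁻ x in B, Phi α β x ‖g x‖ := by
    intro V hV hV1
    refine (setLIntegral_mono' (hV.inter hB) fun x hx => ?_).trans
      (lintegral_mono_set Set.inter_subset_right)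
    rw [Phi_eq α β x (norm_nonneg _), hV1 x hx.1, ENNReal.ofReal_one, one_mul]
    exact le_add_self
  have b3 := b2 _ isOpen_topCone.measurableSet fun x hx => weight_topCone hx
  have b4 := b2 _ isOpen_botCone.measurableSet fun x hx => weight_botCone hx
  rw [add_mul, add_mul (E₂ * C₂), mul_assoc, add_mul C₁, mul_assoc]
  gcongr
  · exact a1.trans (by gcongr)
  · exact a2.trans (by gcongr)
  · exact a3.trans (by gcongr)
  · exact a4.trans (by gcongr)

/-- The gradient of the function obtained from `w` by removing the angular jump `D` and replacing
the function by the constant `c` near the origin. -/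
def holeGrad (w : Plane → ℝ) (g : Plane → Plane) (r D c : ℝ) (x : Plane) : Plane :=
  ((1 - cut r x) • g x - w x • gradient (cut r) x) +
    (-D • gradient (holeAng r) x + c • gradient (cut r) x)

lemma Sob.holeGrad {w : Plane → ℝ} {g : Plane → Plane} (h : Sob w g) {r : ℝ} (hr : 0 < r)
    (hr1 : r < 1) (D c : ℝ) : ∃ w', Sob w' (holeGrad w g r D c) := by
  obtain ⟨C, hC, H⟩ := exists_gradient_cut_le
  have e : ∀ x, gradient (fun y => 1 - cut r y) x = - gradient (cut r) x := by
    intro x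
    unfold gradient
    rw [fderiv_const_sub, map_neg]
  have h1 := h.smooth_mul (η := fun y => 1 - cut r y) (C := max 1 (C / r))
    (contDiff_const.sub (contDiff_cut r))
    (fun x => le_trans (by
      rw [abs_le]; constructor <;> linarith [cut_nonneg r x, cut_le_one r x]) (le_max_left _ _))
    (fun x => by rw [e, norm_neg]; exact (H r hr x).trans (le_max_right _ _))
  have h2 := (Sob.of_test (isTest_holeAng hr)).const_mul (-D)
  have h3 := (Sob.of_test (isTest_cut hr hr1)).const_mul c
  have h4 := h1.add (h2.add h3)
  refine ⟨_, h4.congr (ae_of_all _ fun _ => rfl) (ae_of_all _ fun x => ?_) h4.meas ?_⟩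
  · simp only [BorderlineDoublePhase.holeGrad, e, smul_neg, ← sub_eq_add_neg]
  · have := h4.meas_grad
    simp only [e, smul_neg, ← sub_eq_add_neg] at this
    exact this

lemma holeGrad_eq_zero (w : Plane → ℝ) (g : Plane → Plane) {r : ℝ} (hr : 0 < r) (D c : ℝ)
    {x : Plane} (hx : ‖x‖ < r / 2) : holeGrad w g r D c x = 0 := by
  rw [holeGrad, gradient_holeAng_eq_zero hr hx, gradient_cut_eq_zero_of_le hr hx.le,
    cut_eq_one hr hx.le]
  simp

/-- The condition `r ≤ 1/4` puts the support of `∇(cut r)` where the outer cutoff equals one. There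
`cutAng` is `ang`, and the terms with `∇(cut r)` combine to the deviation of `w` from the profile `D
ang + c`. -/
lemma sub_holeGrad (w : Plane → ℝ) (g : Plane → Plane) {r : ℝ} (hr : 0 < r) (hr1 : r ≤ 1 / 4)
    (D c : ℝ) {x : Plane} (hx : x ≠ 0) : g x - holeGrad w g r D c x =
      (cut r x • g x + (w x - (D * ang x + c)) • gradient (cut r) x) +
        D • ((1 - cut r x) • cutAngGrad x) := by
  rw [holeGrad, gradient_holeAng hx]
  have e : cutAng x • gradient (cut r) x = ang x • gradient (cut r) x := by
    rcases le_total r ‖x‖ with h | h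
    · rw [gradient_cut_eq_zero_of_ge hr h, smul_zero, smul_zero]
    · rw [cutAng, cut_eq_one (by norm_num) (by linarith), one_mul]
  rw [e]
  module

lemma Phi_add₃_le (α β : ℝ) : ∃ C : ℝ≥0∞, C ≠ ∞ ∧ ∀ (x : Plane) (a b c : Plane),
    Phi α β x ‖(a + b) + c‖ ≤ C * ((Phi α β x ‖a‖ + Phi α β x ‖b‖) + Phi α β x ‖c‖) := by
  obtain ⟨C, hC, H⟩ := Phi_add_le α β
  refine ⟨C * (C + 1), by finiteness, fun x a b c => ?_⟩
  have h1 := H x _ _ _ (norm_nonneg _) (norm_nonneg _) (norm_nonneg _) (norm_add_le (a + b) c)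
  have h2 := H x _ _ _ (norm_nonneg _) (norm_nonneg _) (norm_nonneg _) (norm_add_le a b)
  refine h1.trans ?_
  rw [mul_assoc]
  gcongr
  rw [mul_add, add_mul C 1, add_mul C 1, one_mul, one_mul]
  exact add_le_add (h2.trans le_self_add) le_add_self

/-- The price of the angular jump outside the hole: gradient `|D|/|x|` in the light phase, but only
of order `|D|` in the heavy phase by the second bound in `exists_cutAngGrad_le`. -/
lemma cost_outer_le (α β : ℝ) : ∃ C : ℝ≥0∞, C ≠ ∞ ∧ ∀ r D : ℝ, 0 < r →
    ∫⁻ x, Phi α β x ‖D • ((1 - cut r x) • cutAngGrad x)‖ ≤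
      C * ((∫⁻ x in {x : Plane | r / 2 ≤ ‖x‖ ∧ ‖x‖ ≤ 1}, ePow (-β) (|D| / ‖x‖)) + ePow α |D|) := by
  obtain ⟨A, hA, H1, H2⟩ := exists_cutAngGrad_le
  obtain ⟨E₁, hE₁, M₁⟩ := ePow_scale (-β) A
  obtain ⟨E₂, hE₂, M₂⟩ := ePow_scale α A
  refine ⟨E₁ + E₂ * ENNReal.ofReal (1 ^ 2 * Real.pi), by finiteness, fun r D hr => ?_⟩
  set S : Set Plane := {x : Plane | r / 2 ≤ ‖x‖ ∧ ‖x‖ ≤ 1} with hS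
  have hSm : MeasurableSet S :=
    (measurableSet_le measurable_const measurable_norm).inter
      (measurableSet_le measurable_norm measurable_const)
  set B := Metric.ball (0 : Plane) 1
  have hB : MeasurableSet B := Metric.isOpen_ball.measurableSet
  have pt : ∀ x, Phi α β x ‖D • ((1 - cut r x) • cutAngGrad x)‖ ≤
      S.indicator (fun x => E₁ * ePow (-β) (|D| / ‖x‖)) x + B.indicator (fun _ => E₂ * ePow α |D|) x := by
    intro x
    rcases le_total ‖x‖ (r / 2) with h | h
    · rw [cut_eq_one hr h]
      simp [Phi_zero]
    rcases le_total (1 / 2) ‖x‖ with h' | h'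
    · rw [cutAngGrad_eq_zero h']
      simp [Phi_zero]
    have hx0 : 0 < ‖x‖ := by linarith
    have hc : |1 - cut r x| ≤ 1 := by
      rw [abs_le]; constructor <;> linarith [cut_nonneg r x, cut_le_one r x]
    have hn : ‖D • ((1 - cut r x) • cutAngGrad x)‖ ≤ |D| * ‖cutAngGrad x‖ := by
      rw [norm_smul, norm_smul, Real.norm_eq_abs, Real.norm_eq_abs]
      gcongr
      exact mul_le_of_le_one_left (norm_nonneg _) hc
    rw [Set.indicator_of_mem (show x ∈ S from ⟨h, by linarith⟩),
      Set.indicator_of_mem (mem_ball_zero_iff.2 (by linarith)), Phi_eq α β x (norm_nonneg _)]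
    refine add_le_add (M₁ _ _ (norm_nonneg _) (by positivity) (hn.trans ?_)) ?_
    · calc |D| * ‖cutAngGrad x‖ ≤ |D| * (A / ‖x‖) := by
            gcongr; exact H1 x (norm_pos_iff.1 hx0)
        _ = A * (|D| / ‖x‖) := by ring
    · by_cases hw : |x 0| < |x 1|
      · rw [weight_eq_one hw, ENNReal.ofReal_one, one_mul]
        refine M₂ _ _ (norm_nonneg _) (abs_nonneg _) (hn.trans ?_)
        rw [mul_comm]
        gcongr
        exact H2 x hw
      · rw [weight_eq_zero hw]; simp
  have mS : Measurable fun x : Plane => ePow (-β) (|D| / ‖x‖) :=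
    (measurable_ePow _).comp (by fun_prop)
  refine (lintegral_mono pt).trans ?_
  rw [lintegral_add_right _ (measurable_const.indicator hB), lintegral_indicator hSm,
    lintegral_indicator hB, lintegral_const_mul _ mS, lintegral_const, Measure.restrict_apply_univ,
    volume_ball_plane zero_le_one, mul_right_comm, add_mul]
  gcongr
  · exact le_self_add
  · exact le_add_self

/-- Functions with small hole cost have approximants that vanish near the origin. -/
lemma Sob.modular_sub_holeGrad_le (α β C₀ : ℝ) : ∃ C : ℝ≥0∞, C ≠ ∞ ∧
    ∀ (w : Plane → ℝ) (g : Plane → Plane) (_ : Sob w g) (r : ℝ) (_ : 0 < r) (_ : r ≤ 1 / 4)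
    (k₁ k₂ : Plane → ℝ), IsDensity C₀ r (topCone ∩ Metric.ball 0 r) k₁ →
    IsDensity C₀ r (botCone ∩ Metric.ball 0 r) k₂ →
    modular α β (fun x => g x - BorderlineDoublePhase.holeGrad w g r
      ((∫ y, k₁ y * w y) - ∫ y, k₂ y * w y) (((∫ y, k₁ y * w y) + ∫ y, k₂ y * w y) / 2) x) ≤
      C * holeCost α β g r ((∫ y, k₁ y * w y) - ∫ y, k₂ y * w y) := by
  obtain ⟨C₁, hC₁, H₁⟩ := Sob.osc_le α β C₀
  obtain ⟨C₂, hC₂, H₂⟩ := cost_outer_le α β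
  obtain ⟨C₃, hC₃, H₃⟩ := Phi_add₃_le α β
  obtain ⟨A, hA, hcut⟩ := exists_gradient_cut_le
  obtain ⟨E, hE, M⟩ := Phi_scale α β A
  obtain ⟨E', hE', M'⟩ := Phi_scale α β 1
  refine ⟨C₃ * (E' + E * C₁ + C₂), by finiteness, ?_⟩
  intro w g h r hr hr1 k₁ k₂ hk₁ hk₂
  set c₁ := ∫ y, k₁ y * w y
  set c₂ := ∫ y, k₂ y * w y
  set u : Plane → ℝ := fun x => w x - ((c₁ - c₂) * ang x + (c₁ + c₂) / 2) with hu
  -- The profile `(c₁ - c₂) ang + (c₁ + c₂)/2` is the convex combination of `c₁`, `c₂` with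
  -- coefficients `1/2 ± ang`; it is `c₁` in the upper and `c₂` in the lower cone.
  have hconv : ∀ x, |u x| ≤ max |w x - c₁| |w x - c₂| := by
    intro x
    have e : u x = (w x - c₁) * (1 / 2 + ang x) + (w x - c₂) * (1 / 2 - ang x) := by
      simp only [hu]; ring
    have ha := abs_le.1 (abs_ang_le x)
    rw [e]
    refine (abs_add_le _ _).trans ?_
    rw [abs_mul, abs_mul, abs_of_nonneg (show 0 ≤ 1 / 2 + ang x by linarith),
      abs_of_nonneg (show 0 ≤ 1 / 2 - ang x by linarith)]
    nlinarith [le_max_left |w x - c₁| |w x - c₂|, le_max_right |w x - c₁| |w x - c₂|]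
  have hosc := H₁ w g h r hr k₁ k₂ hk₁ hk₂ u hconv
    (fun x hx => by simp only [hu]; rw [ang_top hx]; apply le_of_eq; congr 1; ring)
    (fun x hx => by simp only [hu]; rw [ang_bot hx]; apply le_of_eq; congr 1; ring)
  have hout := H₂ r (c₁ - c₂) hr
  set B := Metric.ball (0 : Plane) r
  have hB : MeasurableSet B := Metric.isOpen_ball.measurableSet
  have pt : ∀ x : Plane, x ≠ 0 → Phi α β x ‖g x - BorderlineDoublePhase.holeGrad w g r (c₁ - c₂)
      ((c₁ + c₂) / 2) x‖ ≤ C₃ * ((B.indicator (fun x => E' * Phi α β x ‖g x‖) x +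
        B.indicator (fun x => E * Phi α β x (|u x| / r)) x) +
          Phi α β x ‖(c₁ - c₂) • ((1 - cut r x) • cutAngGrad x)‖) := by
    intro x hx
    rw [sub_holeGrad w g hr hr1 _ _ hx]
    refine (H₃ x _ _ _).trans ?_
    gcongr
    · by_cases hxB : x ∈ B
      · rw [Set.indicator_of_mem hxB]
        refine M' x _ _ (norm_nonneg _) (norm_nonneg _) ?_
        rw [norm_smul, Real.norm_of_nonneg (cut_nonneg r x)]
        gcongr
        exact cut_le_one r x
      · have : r ≤ ‖x‖ := not_lt.1 fun hlt => hxB (mem_ball_zero_iff.2 hlt)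
        rw [cut_eq_zero hr this]
        simp [Phi_zero]
    · by_cases hxB : x ∈ B
      · rw [Set.indicator_of_mem hxB]
        refine M x _ _ (norm_nonneg _) (by positivity) ?_
        rw [norm_smul, Real.norm_eq_abs]
        calc |u x| * ‖gradient (cut r) x‖ ≤ |u x| * (A / r) := by gcongr; exact hcut r hr x
          _ = A * (|u x| / r) := by ring
      · have : r ≤ ‖x‖ := not_lt.1 fun hlt => hxB (mem_ball_zero_iff.2 hlt)
        rw [gradient_cut_eq_zero_of_ge hr this]
        simp [Phi_zero]
  have hne : ∀ᵐ x : Plane, x ≠ 0 := by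
    rw [ae_iff]; simp
  have mu' : Measurable u :=
    h.meas.sub ((measurable_ang.const_mul _).add_const _)
  have m1 : Measurable fun x => E' * Phi α β x ‖g x‖ :=
    (measurable_Phi_norm α β h.meas_grad).const_mul _
  have m2 : Measurable fun x => E * Phi α β x (|u x| / r) :=
    (measurable_Phi_comp α β (mu'.norm.div_const r)).const_mul _
  have m3 : Measurable fun x => B.indicator (fun x => E' * Phi α β x ‖g x‖) x := m1.indicator hB
  have m4 : Measurable fun x => B.indicator (fun x => E' * Phi α β x ‖g x‖) x +
        B.indicator (fun x => E * Phi α β x (|u x| / r)) x := m3.add (m2.indicator hB)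
  refine (lintegral_mono_ae (hne.mono pt)).trans ?_
  rw [lintegral_const_mul' _ _ hC₃, lintegral_add_left m4, lintegral_add_left m3,
    lintegral_indicator hB, lintegral_indicator hB, lintegral_const_mul' _ _ hE',
    lintegral_const_mul' _ _ hE, mul_assoc]
  gcongr
  rw [holeCost]
  set I := ∫⁻ x in B, Phi α β x ‖g x‖
  set J := (∫⁻ x in {x : Plane | r / 2 ≤ ‖x‖ ∧ ‖x‖ ≤ 1}, ePow (-β) (|c₁ - c₂| / ‖x‖)) +
    ePow α |c₁ - c₂|
  calc _ ≤ E' * I + E * (C₁ * I) + C₂ * J := by gcongr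
    _ = (E' + E * C₁) * I + C₂ * J := by ring
    _ ≤ (E' + E * C₁ + C₂) * I + (E' + E * C₁ + C₂) * J := by
      exact add_le_add (mul_le_mul_left le_self_add _) (mul_le_mul_left le_add_self _)
    _ = _ := by ring

/-- A sequence of scales with vanishing hole cost makes a gradient approximable. -/
lemma Sob.approximable_of_holeCost {α β C₀ : ℝ} {w : Plane → ℝ} {g : Plane → Plane} (h : Sob w g)
    (hg : modular α β g < ∞)
    (H : ∀ ε : ℝ≥0∞, 0 < ε → ∃ (r : ℝ) (k₁ k₂ : Plane → ℝ), 0 < r ∧ r ≤ 1 / 4 ∧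
      IsDensity C₀ r (topCone ∩ Metric.ball 0 r) k₁ ∧
      IsDensity C₀ r (botCone ∩ Metric.ball 0 r) k₂ ∧
      holeCost α β g r ((∫ y, k₁ y * w y) - ∫ y, k₂ y * w y) < ε) : Approximable α β g := by
  obtain ⟨C, hC, HC⟩ := Sob.modular_sub_holeGrad_le α β C₀
  obtain ⟨A, hA, HA⟩ := modular_add_le α β
  refine approximable_of_approx h.meas_grad fun ε hε => ?_
  -- The minimum with `1` makes the distance finite even for `ε = ∞`, so that the modified field
  -- again has finite modular.
  have hε' : 0 < min ε 1 / (C + 1) :=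
    ENNReal.div_pos (lt_min hε one_pos).ne' (by finiteness)
  obtain ⟨r, k₁, k₂, hr, hr1, hk₁, hk₂, hcost⟩ := H _ hε'
  have hm := HC w g h r hr hr1 k₁ k₂ hk₁ hk₂
  set D := (∫ y, k₁ y * w y) - ∫ y, k₂ y * w y
  set c := ((∫ y, k₁ y * w y) + ∫ y, k₂ y * w y) / 2
  obtain ⟨w', hw'⟩ := h.holeGrad hr (by linarith) D c
  have hlt : modular α β (fun x => g x - BorderlineDoublePhase.holeGrad w g r D c x) < min ε 1 := by
    refine hm.trans_lt ?_
    have h1 : (C + 1) * holeCost α β g r D < min ε 1 := by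
      rwa [mul_comm, ← ENNReal.lt_div_iff_mul_lt (Or.inl (by simp)) (Or.inl (by finiteness))]
    exact (mul_le_mul_left le_self_add _).trans_lt h1
  refine ⟨_, hw'.meas_grad, ?_, hlt.trans_le (min_le_left _ _)⟩
  refine hw'.approximable ?_ (half_pos hr) (ae_of_all _ fun x hx => holeGrad_eq_zero w g hr D c hx)
  refine (HA g (fun x => g x - BorderlineDoublePhase.holeGrad w g r D c x) _ h.meas_grad
    (ae_of_all _ fun x => ?_)).trans_lt ?_
  · have := norm_sub_le (g x) (g x - BorderlineDoublePhase.holeGrad w g r D c x)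
    rwa [sub_sub_cancel] at this
  · exact ENNReal.mul_lt_top hA.lt_top
      (ENNReal.add_lt_top.2 ⟨hg, hlt.trans_le ((min_le_right _ _).trans le_top)⟩)

/-! ### Jumps across the origin, controlled by the energy of shells. -/

/-- The set `U`, carried along the segment from `q` to `p`, sweeps only through `S`; the fundamental
theorem of calculus and translation invariance give the bound. Applied with a ball `U`, it compares
averages over translated balls. -/
lemma IsTest.lintegral_translate_le {φ : Plane → ℝ} (hφ : IsTest φ) (p q : Plane) {U S : Set Plane}
    (hU : MeasurableSet U) (hS : MeasurableSet S)
    (hUS : ∀ t ∈ Set.Ioc (0 : ℝ) 1, ∀ y ∈ U, ((1 - t) • q + t • p) + y ∈ S) :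
    ∫⁻ y in U, ‖φ (p + y) - φ (q + y)‖ₑ ≤ ‖p - q‖ₑ * ∫⁻ x in S, ‖gradient φ x‖ₑ := by
  have hG : Measurable fun x => ‖gradient φ x‖ₑ := (continuous_gradient hφ).measurable.enorm
  have h1 : ∀ y, ‖φ (p + y) - φ (q + y)‖ₑ ≤ ‖p - q‖ₑ * ∫⁻ t in Set.Ioc (0 : ℝ) 1,
      ‖gradient φ (((1 - t) • q + t • p) + y)‖ₑ := by
    intro y
    have := hφ.enorm_sub_le (p + y) (q + y)
    rw [add_sub_add_right_eq_sub] at this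
    refine this.trans_eq ?_
    congr 1
    refine lintegral_congr fun t => ?_
    congr 2
    module
  have hm : Measurable fun z : Plane × ℝ => ‖gradient φ (((1 - z.2) • q + z.2 • p) + z.1)‖ₑ :=
    hG.comp (g := fun x => ‖gradient φ x‖ₑ) (by fun_prop)
  refine (lintegral_mono h1).trans ?_
  rw [lintegral_const_mul' _ _ (by simp), lintegral_lintegral_swap hm.aemeasurable]
  gcongr
  calc _ ≤ ∫⁻ _ in Set.Ioc (0 : ℝ) 1, ∫⁻ x in S, ‖gradient φ x‖ₑ := by
        refine setLIntegral_mono' measurableSet_Ioc fun t ht => ?_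
        rw [← lintegral_indicator hU, ← lintegral_indicator hS,
          ← lintegral_add_left_eq_self (S.indicator fun x => ‖gradient φ x‖ₑ) ((1 - t) • q + t • p)]
        refine lintegral_mono fun y => ?_
        by_cases hy : y ∈ U
        · rw [Set.indicator_of_mem hy, Set.indicator_of_mem (hUS t ht y hy)]
        · rw [Set.indicator_of_notMem hy]; exact zero_le
    _ = _ := by rw [setLIntegral_const]; simp

lemma Sob.lintegral_translate_le {w : Plane → ℝ} {g : Plane → Plane} (h : Sob w g) (p q : Plane)
    {U S : Set Plane} (hU : MeasurableSet U) (hS : MeasurableSet S)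
    (hUS : ∀ t ∈ Set.Ioc (0 : ℝ) 1, ∀ y ∈ U, ((1 - t) • q + t • p) + y ∈ S) :
    ∫⁻ y in U, ‖w (p + y) - w (q + y)‖ₑ ≤ ‖p - q‖ₑ * ∫⁻ x in S, ‖g x‖ₑ := by
  obtain ⟨φ, hφ, h1, h2⟩ := h.exists_seq
  have hlim : Tendsto (fun n => ‖p - q‖ₑ * ((∫⁻ x in S, ‖g x‖ₑ) +
      ∫⁻ x, ‖g x - gradient (φ n) x‖ₑ) + ((∫⁻ x, ‖w x - φ n x‖ₑ) + ∫⁻ x, ‖w x - φ n x‖ₑ)) atTop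
      (𝓝 (‖p - q‖ₑ * ((∫⁻ x in S, ‖g x‖ₑ) + 0) + (0 + 0))) :=
    (ENNReal.Tendsto.const_mul (tendsto_const_nhds.add h2) (Or.inr (by simp))).add (h1.add h1)
  rw [add_zero, add_zero, add_zero] at hlim
  refine ge_of_tendsto' hlim fun n => ?_
  have hm : ∀ c, Measurable fun y => ‖w (c + y) - φ n (c + y)‖ₑ := fun c =>
    ((h.meas.sub (hφ n).continuous.measurable).comp (measurable_const_add c)).enorm
  have hm2 : Measurable fun y => ‖φ n (p + y) - φ n (q + y)‖ₑ :=
    (((hφ n).continuous.measurable.comp (measurable_const_add p)).sub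
      ((hφ n).continuous.measurable.comp (measurable_const_add q))).enorm
  have pt : ∀ y, ‖w (p + y) - w (q + y)‖ₑ ≤ ‖φ n (p + y) - φ n (q + y)‖ₑ +
      (‖w (p + y) - φ n (p + y)‖ₑ + ‖w (q + y) - φ n (q + y)‖ₑ) := by
    intro y
    have e : w (p + y) - w (q + y) = (φ n (p + y) - φ n (q + y)) +
      ((w (p + y) - φ n (p + y)) - (w (q + y) - φ n (q + y))) := by ring
    rw [e]
    exact (enorm_add_le _ _).trans (by gcongr; exact _root_.enorm_sub_le)
  have hgr : ∫⁻ x in S, ‖gradient (φ n) x‖ₑ ≤ (∫⁻ x in S, ‖g x‖ₑ) +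
      ∫⁻ x, ‖g x - gradient (φ n) x‖ₑ := by
    have hgm : Measurable fun x => ‖g x‖ₑ := h.meas_grad.enorm
    calc ∫⁻ x in S, ‖gradient (φ n) x‖ₑ
        ≤ ∫⁻ x in S, (‖g x‖ₑ + ‖g x - gradient (φ n) x‖ₑ) := by
          refine lintegral_mono fun x => ?_
          have e : gradient (φ n) x = g x - (g x - gradient (φ n) x) := by abel
          conv_lhs => rw [e]
          exact _root_.enorm_sub_le
      _ = (∫⁻ x in S, ‖g x‖ₑ) + ∫⁻ x in S, ‖g x - gradient (φ n) x‖ₑ := lintegral_add_left hgm _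
      _ ≤ _ := add_le_add le_rfl (setLIntegral_le_lintegral _ _)
  have htr : ∀ c, ∫⁻ y in U, ‖w (c + y) - φ n (c + y)‖ₑ ≤ ∫⁻ x, ‖w x - φ n x‖ₑ := fun c =>
    (setLIntegral_le_lintegral _ _).trans_eq
      (lintegral_add_left_eq_self (fun x => ‖w x - φ n x‖ₑ) c)
  refine (lintegral_mono pt).trans ?_
  rw [lintegral_add_left hm2, lintegral_add_left (hm p)]
  exact add_le_add (((hφ n).lintegral_translate_le p q hU hS hUS).trans (by gcongr))
    (add_le_add (htr p) (htr q))

/-- The annulus `r/4 < |x| ≤ r`. -/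
def shell (r : ℝ) : Set Plane := {x | r / 4 < ‖x‖ ∧ ‖x‖ ≤ r}

lemma measurableSet_shell (r : ℝ) : MeasurableSet (shell r) :=
  (measurableSet_lt measurable_const measurable_norm).inter
    (measurableSet_le measurable_norm measurable_const)

lemma volume_shell_le {r : ℝ} (hr : 0 ≤ r) : volume (shell r) ≤ ENNReal.ofReal (r ^ 2 * Real.pi) := by
  have : shell r ⊆ Metric.closedBall 0 r := fun x hx => mem_closedBall_zero_iff.2 hx.2
  refine (measure_mono this).trans_eq ?_
  rw [Measure.addHaar_closedBall_eq_addHaar_ball, volume_ball_plane hr]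

/-- The uniform density of the ball of radius `r / 8` centred at the origin. -/
def unifDensity (r : ℝ) : Plane → ℝ :=
  (Metric.ball (0 : Plane) (r / 8)).indicator fun _ => 64 / Real.pi / r ^ 2

lemma measurable_unifDensity (r : ℝ) : Measurable (unifDensity r) :=
  measurable_const.indicator Metric.isOpen_ball.measurableSet

lemma isDensity_unifDensity {r : ℝ} (hr : 0 < r) (c : Plane) {V : Set Plane}
    (hV : Metric.ball c (r / 8) ⊆ V) :
    IsDensity (64 / Real.pi) r V fun x => unifDensity r (x - c) where
  meas := (measurable_unifDensity r).comp (measurable_sub_const c)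
  bound x := by
    unfold unifDensity Set.indicator
    have : 0 ≤ 64 / Real.pi / r ^ 2 := by positivity
    split_ifs
    · rw [abs_of_nonneg this]
    · simpa using this
  zero x hx := by
    refine Set.indicator_of_notMem (fun h => hx (hV ?_)) _
    rwa [mem_ball_zero_iff, ← dist_eq_norm] at h
  integral := by
    rw [integral_sub_right_eq_self (unifDensity r) c]
    unfold unifDensity
    rw [integral_indicator Metric.isOpen_ball.measurableSet, setIntegral_const, measureReal_def,
      volume_ball_plane (by positivity), ENNReal.toReal_ofReal (by positivity), smul_eq_mul]
    field_simp
    norm_num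

lemma integral_unifDensity_sub (r : ℝ) {w : Plane → ℝ} (hw : Integrable w) (p q : Plane) :
    (∫ y, unifDensity r (y - p) * w y) - ∫ y, unifDensity r (y - q) * w y =
      64 / Real.pi / r ^ 2 * ∫ y in Metric.ball 0 (r / 8), (w (p + y) - w (q + y)) := by
  have e : ∀ c, ∫ y, unifDensity r (y - c) * w y =
      64 / Real.pi / r ^ 2 * ∫ y in Metric.ball 0 (r / 8), w (c + y) := by
    intro c
    rw [← integral_add_left_eq_self _ c, ← integral_const_mul,
      ← integral_indicator Metric.isOpen_ball.measurableSet]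
    congr 1
    ext y
    rw [add_sub_cancel_left, unifDensity]
    by_cases hy : y ∈ Metric.ball (0 : Plane) (r / 8)
    · rw [Set.indicator_of_mem hy, Set.indicator_of_mem hy]
    · rw [Set.indicator_of_notMem hy, Set.indicator_of_notMem hy, zero_mul]
  rw [e, e, integral_sub (hw.comp_add_left p).integrableOn (hw.comp_add_left q).integrableOn,
    mul_sub]

lemma Sob.abs_integral_unifDensity_sub_le {w : Plane → ℝ} {g : Plane → Plane} (h : Sob w g) {r : ℝ}
    (hr : 0 < r) (p q : Plane) {S : Set Plane} (hS : MeasurableSet S)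
    (hUS : ∀ t ∈ Set.Ioc (0 : ℝ) 1, ∀ y ∈ Metric.ball (0 : Plane) (r / 8),
      ((1 - t) • q + t • p) + y ∈ S) :
    |(∫ y, unifDensity r (y - p) * w y) - ∫ y, unifDensity r (y - q) * w y| ≤
      64 / Real.pi / r ^ 2 * (‖p - q‖ * ∫ x in S, ‖g x‖) := by
  rw [integral_unifDensity_sub r h.integrable.1, abs_mul, abs_of_nonneg (by positivity)]
  gcongr
  have h1 := h.lintegral_translate_le p q Metric.isOpen_ball.measurableSet hS hUS
  rw [← ofReal_integral_norm_eq_lintegral_enorm h.integrable.2.integrableOn, ← ofReal_norm,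
    ← ENNReal.ofReal_mul (norm_nonneg _)] at h1
  have h2 := (enorm_integral_le_lintegral_enorm (μ := volume.restrict (Metric.ball (0 : Plane) (r / 8)))
    fun y => w (p + y) - w (q + y)).trans h1
  rw [Real.enorm_eq_ofReal_abs] at h2
  exact (ENNReal.ofReal_le_ofReal_iff (mul_nonneg (norm_nonneg _)
    (integral_nonneg fun _ => norm_nonneg _))).1 h2

/-- A thickening by `r/8` of the segment between `(3r/4, 0)` and `(0, ±3r/4)` stays in the shell: `X
+ Y ≥ r/2` bounds the norm from below, and `a² + b² ≤ (3r/4)²` bounds it from above. The sign `σ`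
treats the upper and the lower quadrant together. -/
lemma mem_shell_of_corner {r a b σ : ℝ} {x : Plane} (hr : 0 < r) (ha : 0 ≤ a) (hb : 0 ≤ b)
    (hab : a + b = 3 / 4 * r) (hσ : σ ^ 2 = 1) (h0 : |x 0 - a| ≤ r / 8)
    (h1 : |σ * x 1 - b| ≤ r / 8) : x ∈ shell r := by
  have hn : ‖x‖ ^ 2 = x 0 ^ 2 + (σ * x 1) ^ 2 := by
    rw [plane_norm_sq, mul_pow, hσ, one_mul]
  generalize σ * x 1 = Y at *
  generalize x 0 = X at *
  rw [abs_le] at h0 h1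
  constructor
  · refine lt_of_pow_lt_pow_left₀ 2 (norm_nonneg _) ?_
    rw [hn]
    have : r / 2 ≤ X + Y := by linarith
    nlinarith [sq_nonneg (X - Y)]
  · refine le_of_sq_le_sq ?_ hr.le
    rw [hn]
    have e0 : X ^ 2 ≤ (a + r / 8) ^ 2 := sq_le_sq' (by linarith) (by linarith)
    have e1 : Y ^ 2 ≤ (b + r / 8) ^ 2 := sq_le_sq' (by linarith) (by linarith)
    have e2 : a ^ 2 + b ^ 2 ≤ (3 / 4 * r) ^ 2 := by rw [← hab]; nlinarith [mul_nonneg ha hb]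
    nlinarith [mul_pos hr hr]

/-- The point `(0, 3 r / 4)` in the upper cone. -/
def topPt (r : ℝ) : Plane := !₂[0, 3 / 4 * r]

/-- The point `(0, -3 r / 4)` in the lower cone. -/
def botPt (r : ℝ) : Plane := !₂[0, -(3 / 4 * r)]

/-- The point `(3 r / 4, 0)`. -/
def midPt (r : ℝ) : Plane := !₂[3 / 4 * r, 0]

lemma ball_topPt_subset {r : ℝ} (hr : 0 < r) :
    Metric.ball (topPt r) (r / 8) ⊆ shell r ∧
      Metric.ball (topPt r) (r / 8) ⊆ topCone ∩ Metric.ball 0 r := by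
  have key : ∀ x ∈ Metric.ball (topPt r) (r / 8), |x 0| < r / 8 ∧ |x 1 - 3 / 4 * r| < r / 8 := by
    intro x hx
    rw [mem_ball_iff_norm] at hx
    have h0 := (abs_coord_le (x - topPt r) 0).trans_lt hx
    have h1 := (abs_coord_le (x - topPt r) 1).trans_lt hx
    simpa [topPt] using And.intro h0 h1
  constructor
  · intro x hx
    obtain ⟨h0, h1⟩ := key x hx
    exact mem_shell_of_corner hr le_rfl (by positivity) (zero_add _) (one_pow 2)
      (by simpa using h0.le) (by simpa using h1.le)
  · intro x hx
    obtain ⟨h0, h1⟩ := key x hx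
    rw [abs_lt] at h1
    refine ⟨show |x 0| < x 1 by linarith, mem_ball_zero_iff.2 ?_⟩
    refine lt_of_pow_lt_pow_left₀ 2 hr.le ?_
    rw [plane_norm_sq, ← sq_abs (x 0)]
    nlinarith [abs_nonneg (x 0)]

lemma ball_botPt_subset {r : ℝ} (hr : 0 < r) :
    Metric.ball (botPt r) (r / 8) ⊆ botCone ∩ Metric.ball 0 r := by
  intro x hx
  rw [mem_ball_iff_norm] at hx
  have h0 := (abs_coord_le (x - botPt r) 0).trans_lt hx
  have h1 := (abs_coord_le (x - botPt r) 1).trans_lt hx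
  simp only [botPt, PiLp.sub_apply, Matrix.cons_val_zero, Matrix.cons_val_one, sub_zero,
    sub_neg_eq_add] at h0 h1
  rw [abs_lt] at h1
  refine ⟨show |x 0| < -x 1 by linarith, mem_ball_zero_iff.2 ?_⟩
  refine lt_of_pow_lt_pow_left₀ 2 hr.le ?_
  rw [plane_norm_sq, ← sq_abs (x 0)]
  nlinarith [abs_nonneg (x 0)]

/-- The jump of `w` across the origin at scale `r`. -/
def jump (w : Plane → ℝ) (r : ℝ) : ℝ :=
  (∫ y, unifDensity r (y - topPt r) * w y) - ∫ y, unifDensity r (y - botPt r) * w y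

/-- A ball of radius `r/8` is moved from the upper cone to the lower one around the origin, via the
right side cone, inside the shell. Each of the two legs has length at most `3r/2`, and `192 = 2 · 64
· 3/2`. -/
lemma Sob.abs_jump_le {w : Plane → ℝ} {g : Plane → Plane} (h : Sob w g) {r : ℝ} (hr : 0 < r) :
    |jump w r| / r ≤ 192 * (1 / (r ^ 2 * Real.pi) * ∫ x in shell r, ‖g x‖) := by
  have hI : 0 ≤ ∫ x in shell r, ‖g x‖ := integral_nonneg fun _ => norm_nonneg _
  have h1 := h.abs_integral_unifDensity_sub_le hr (topPt r) (midPt r) (measurableSet_shell r)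
    (fun t ht y hy => by
      rw [mem_ball_zero_iff] at hy
      refine mem_shell_of_corner hr (a := (1 - t) * (3 / 4 * r)) (b := t * (3 / 4 * r)) (σ := 1)
        (mul_nonneg (by linarith [ht.2]) (by positivity)) (mul_nonneg ht.1.le (by positivity))
        (by ring) (by norm_num) ?_ ?_
      · simpa [topPt, midPt] using (abs_coord_le y 0).trans hy.le
      · simpa [topPt, midPt] using (abs_coord_le y 1).trans hy.le)
  have h2 := h.abs_integral_unifDensity_sub_le hr (botPt r) (midPt r) (measurableSet_shell r)
    (fun t ht y hy => by
      rw [mem_ball_zero_iff] at hy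
      refine mem_shell_of_corner hr (a := (1 - t) * (3 / 4 * r)) (b := t * (3 / 4 * r)) (σ := -1)
        (mul_nonneg (by linarith [ht.2]) (by positivity)) (mul_nonneg ht.1.le (by positivity))
        (by ring) (by norm_num) ?_ ?_
      · simpa [botPt, midPt] using (abs_coord_le y 0).trans hy.le
      · have e : -1 * (((1 - t) • midPt r + t • botPt r) + y) 1 - t * (3 / 4 * r) = - y 1 := by
          simp [botPt, midPt]
        rw [e, abs_neg]
        exact (abs_coord_le y 1).trans hy.le)
  have d1 : ‖topPt r - midPt r‖ ≤ 3 / 2 * r := by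
    refine le_of_sq_le_sq ?_ (by positivity)
    rw [plane_norm_sq]
    simp [topPt, midPt]
    nlinarith
  have d2 : ‖botPt r - midPt r‖ ≤ 3 / 2 * r := by
    refine le_of_sq_le_sq ?_ (by positivity)
    rw [plane_norm_sq]
    simp [botPt, midPt]
    nlinarith
  have h3 : |jump w r| ≤ 64 / Real.pi / r ^ 2 * (3 / 2 * r * ∫ x in shell r, ‖g x‖) +
      64 / Real.pi / r ^ 2 * (3 / 2 * r * ∫ x in shell r, ‖g x‖) := by
    have e : jump w r = ((∫ y, unifDensity r (y - topPt r) * w y) -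
        ∫ y, unifDensity r (y - midPt r) * w y) - ((∫ y, unifDensity r (y - botPt r) * w y) -
        ∫ y, unifDensity r (y - midPt r) * w y) := by unfold jump; ring
    rw [e]
    refine (abs_sub _ _).trans (add_le_add (h1.trans ?_) (h2.trans ?_)) <;> gcongr
  rw [div_le_iff₀ hr]
  refine h3.trans_eq ?_
  field_simp
  ring

lemma le_volume_shell {r : ℝ} (hr : 0 < r) : ENNReal.ofReal (r ^ 2) ≤ 64 * volume (shell r) := by
  have h := measure_mono (μ := volume) (ball_topPt_subset hr).1
  rw [Measure.addHaar_ball_center, volume_ball_plane (by positivity)] at h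
  calc ENNReal.ofReal (r ^ 2) ≤ ENNReal.ofReal (64 * ((r / 8) ^ 2 * Real.pi)) := by
        apply ENNReal.ofReal_le_ofReal
        nlinarith [Real.pi_gt_three, sq_nonneg r]
    _ = 64 * ENNReal.ofReal ((r / 8) ^ 2 * Real.pi) := by
        rw [ENNReal.ofReal_mul (by norm_num)]; simp
    _ ≤ _ := by gcongr

/-- The energy in an annulus controls the jump. -/
lemma Sob.ePow_jump_le (κ : ℝ) : ∃ C : ℝ≥0∞, C ≠ ∞ ∧ ∀ (w : Plane → ℝ) (g : Plane → Plane)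
    (_ : Sob w g) (r : ℝ) (_ : 0 < r),
    ENNReal.ofReal (r ^ 2) * ePow κ (|jump w r| / r) ≤ C * ∫⁻ x in shell r, ePow κ ‖g x‖ := by
  obtain ⟨C, hC, J⟩ := ePow_jensen κ 192
  refine ⟨64 * C, by finiteness, fun w g h r hr => ?_⟩
  set S := shell r
  have hS0 : volume S ≠ 0 := by
    intro h0
    have := le_volume_shell hr
    rw [h0, mul_zero, nonpos_iff_eq_zero, ENNReal.ofReal_eq_zero] at this
    nlinarith
  have hSle := volume_shell_le hr.le
  have hS : volume S ≠ ∞ := (hSle.trans_lt ENNReal.ofReal_lt_top).ne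
  have hV0 : 0 < (volume S).toReal := ENNReal.toReal_pos hS0 hS
  have hV : (volume S).toReal ≤ r ^ 2 * Real.pi :=
    ENNReal.toReal_le_of_le_ofReal (by positivity) hSle
  have hp : IsProbabilityMeasure ((volume S)⁻¹ • (volume : Measure Plane).restrict S) :=
    ⟨by simp [ENNReal.inv_mul_cancel hS0 hS]⟩
  have hI : 0 ≤ ∫ x in S, ‖g x‖ := integral_nonneg fun _ => norm_nonneg _
  have hj := J Plane ((volume S)⁻¹ • (volume : Measure Plane).restrict S) (fun x => ‖g x‖)
    (|jump w r| / r) ((h.integrable.2.norm.integrableOn (s := S)).smul_measure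
      (by simpa using hS0)) (fun _ => norm_nonneg _) (by positivity) (by
        refine (h.abs_jump_le hr).trans ?_
        rw [integral_smul_measure, smul_eq_mul, ENNReal.toReal_inv, ← one_div]
        gcongr)
  rw [lintegral_smul_measure, smul_eq_mul] at hj
  calc ENNReal.ofReal (r ^ 2) * ePow κ (|jump w r| / r)
      ≤ (64 * volume S) * (C * ((volume S)⁻¹ * ∫⁻ x in S, ePow κ ‖g x‖)) := by
        gcongr
        exact le_volume_shell hr
    _ = (volume S * (volume S)⁻¹) * (64 * C * ∫⁻ x in S, ePow κ ‖g x‖) := by ring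
    _ = _ := by rw [ENNReal.mul_inv_cancel hS0 hS, one_mul]

/-! ### Shells of ratio four and the case `β ≤ 1`. -/

lemma exists_mem_shell {x : Plane} (h0 : x ≠ 0) (h1 : ‖x‖ ≤ 1) :
    ∃ j : ℕ, x ∈ shell ((1 / 4) ^ j) := by
  obtain ⟨j, hj⟩ := exists_nat_pow_near_of_lt_one (norm_pos_iff.2 h0) h1
    (show (0 : ℝ) < 1 / 4 by norm_num) (by norm_num)
  refine ⟨j, ?_, hj.2⟩
  have := hj.1
  rwa [pow_succ, mul_one_div] at this

lemma lintegral_annulus_le (f : Plane → ℝ≥0∞) (n : ℕ) :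
    ∫⁻ x in {x : Plane | (1 / 4 : ℝ) ^ n / 2 ≤ ‖x‖ ∧ ‖x‖ ≤ 1}, f x
      ≤ ∑ j ∈ Finset.range (n + 1), ∫⁻ x in shell ((1 / 4) ^ j), f x := by
  have hsub : {x : Plane | (1 / 4 : ℝ) ^ n / 2 ≤ ‖x‖ ∧ ‖x‖ ≤ 1} ⊆
      ⋃ j ∈ Finset.range (n + 1), shell ((1 / 4) ^ j) := by
    rintro x ⟨hx, hx1⟩
    have hp : (0 : ℝ) < (1 / 4) ^ n := by positivity
    obtain ⟨j, hj⟩ := exists_mem_shell (norm_pos_iff.1 (by linarith)) hx1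
    simp only [Set.mem_iUnion, Finset.mem_range]
    refine ⟨j, ?_, hj⟩
    by_contra hlt
    have h1 : (1 / 4 : ℝ) ^ j ≤ (1 / 4) ^ (n + 1) :=
      pow_le_pow_of_le_one (by norm_num) (by norm_num) (by omega)
    have h2 := hj.2
    rw [pow_succ] at h1
    linarith
  refine (lintegral_mono_set hsub).trans ?_
  rw [← Finset.sum_attach]
  refine (lintegral_mono_set (t := ⋃ j : Finset.range (n + 1), shell ((1 / 4) ^ (j : ℕ)))
    (by intro x; simp)).trans ?_
  refine (lintegral_iUnion_le _ _).trans ?_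
  rw [tsum_fintype]
  rfl

lemma lintegral_punctured_le (f : Plane → ℝ≥0∞) :
    ∫⁻ x in Metric.closedBall (0 : Plane) 1, f x ≤ ∑' j : ℕ, ∫⁻ x in shell ((1 / 4) ^ j), f x := by
  refine le_trans ?_ (lintegral_iUnion_le _ _)
  rw [setLIntegral_congr (ae_eq_set.2 ⟨?_, ?_⟩)]
  · refine measure_mono_null (t := {0}) ?_ (measure_singleton 0)
    rintro x ⟨hx, hx'⟩
    by_contra h0
    obtain ⟨j, hj⟩ := exists_mem_shell h0 (mem_closedBall_zero_iff.1 hx)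
    exact hx' (Set.mem_iUnion.2 ⟨j, hj⟩)
  · refine measure_mono_null (t := ∅) ?_ measure_empty
    rintro x ⟨hx, hx'⟩
    obtain ⟨j, hj⟩ := Set.mem_iUnion.1 hx
    exact hx' (mem_closedBall_zero_iff.2 (hj.2.trans (pow_le_one₀ (by norm_num) (by norm_num))))

/-- On the shell `d/|x|` is comparable with `d/r`, and the area, of order `r²`, cancels the factor
`r⁻²`: only the logarithm depends on the scale. -/
lemma lintegral_shell_ePow_le (κ : ℝ) : ∃ C : ℝ, 0 ≤ C ∧ ∀ r d : ℝ, 0 < r → 0 ≤ d →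
    ∫⁻ x in shell r, ePow κ (d / ‖x‖) ≤
      ENNReal.ofReal (C * (d ^ 2 * Real.log (Real.exp 1 + d / r) ^ κ)) := by
  obtain ⟨C, hC, H⟩ := logPow_scale κ 4
  refine ⟨C * Real.pi, by positivity, fun r d hr hd => ?_⟩
  calc ∫⁻ x in shell r, ePow κ (d / ‖x‖)
      ≤ ∫⁻ _ in shell r, ENNReal.ofReal (C * logPow κ (d / r)) := by
        refine setLIntegral_mono' (measurableSet_shell r) fun x hx => ?_
        have hx0 : 0 < ‖x‖ := lt_trans (by positivity) hx.1
        refine ENNReal.ofReal_le_ofReal (H _ _ (by positivity) (by positivity) ?_)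
        rw [← mul_div_assoc, div_le_div_iff₀ hx0 hr]
        nlinarith [hx.1]
    _ = ENNReal.ofReal (C * logPow κ (d / r)) * volume (shell r) := setLIntegral_const _ _
    _ ≤ ENNReal.ofReal (C * logPow κ (d / r)) * ENNReal.ofReal (r ^ 2 * Real.pi) := by
        gcongr
        exact volume_shell_le hr.le
    _ = _ := by
        rw [← ENNReal.ofReal_mul (mul_nonneg (by linarith) (logPow_nonneg _ (by positivity)))]
        congr 1
        unfold logPow
        field_simp

lemma log_exp_add_le {d : ℝ} (hd : 0 ≤ d) (n : ℕ) :
    Real.log (Real.exp 1 + d / (1 / 4) ^ n) ≤ 2 * (n + 1) * (1 + d) := by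
  have h4 : (1 : ℝ) ≤ 4 ^ n := one_le_pow₀ (by norm_num)
  have e1 : (1 : ℝ) < Real.exp 1 := Real.one_lt_exp_iff.2 one_pos
  have e : d / (1 / 4) ^ n = d * 4 ^ n := by
    rw [one_div, inv_pow, div_inv_eq_mul]
  have h1 : Real.exp 1 + d / (1 / 4) ^ n ≤ (Real.exp 1 * Real.exp d) * 4 ^ n := by
    rw [e]
    have : d + 1 ≤ Real.exp d := Real.add_one_le_exp d
    have h2 : Real.exp 1 + d ≤ Real.exp 1 * Real.exp d := by nlinarith
    nlinarith
  have h2 := Real.log_le_log (by positivity) h1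
  rw [Real.log_mul (by positivity) (by positivity), Real.log_mul (by positivity) (by positivity),
    Real.log_exp, Real.log_exp, Real.log_pow] at h2
  have h3 : Real.log 4 ≤ 2 := by
    rw [show (4 : ℝ) = 2 ^ 2 by norm_num, Real.log_pow]
    have := Real.log_two_lt_d9
    push_cast
    linarith
  have hn : (0 : ℝ) ≤ n := n.cast_nonneg
  nlinarith [mul_nonneg hn hd, mul_le_mul_of_nonneg_left h3 hn]

lemma sum_ite_lt_eq (m n : ℕ) : ∑ j ∈ Finset.range (n + 1), (if m < j then 2 / ((j : ℝ) - m) else 0)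
    = ∑ i ∈ Finset.range (n - m), 2 * ((i + 1 : ℕ) : ℝ)⁻¹ := by
  induction n with
  | zero => simp
  | succ n ih =>
    rw [Finset.sum_range_succ, ih]
    split_ifs with h
    · have hle : m ≤ n := Nat.lt_succ_iff.1 h
      rw [Nat.succ_sub hle, Finset.sum_range_succ]
      congr 1
      push_cast [Nat.cast_sub hle]
      rw [div_eq_mul_inv]
      congr 2
      ring
    · rw [show n + 1 - m = n - m by omega, add_zero]

lemma sum_ite_lt_le (m n : ℕ) : ∑ j ∈ Finset.range (n + 1), (if m < j then 2 / ((j : ℝ) - m) else 0)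
    ≤ 2 * (1 + Real.log (n + 1)) := by
  rw [sum_ite_lt_eq, ← Finset.mul_sum]
  have h := harmonic_le_one_add_log (n - m)
  rw [harmonic] at h
  push_cast at h ⊢
  have h2 : Real.log ((n - m : ℕ) : ℝ) ≤ Real.log (n + 1) := by
    rcases Nat.eq_zero_or_pos (n - m) with h0 | h0
    · rw [h0, Nat.cast_zero, Real.log_zero]
      exact Real.log_nonneg (by linarith [n.cast_nonneg (α := ℝ)])
    · refine Real.log_le_log (by exact_mod_cast h0) ?_
      have : ((n - m : ℕ) : ℝ) ≤ n := by exact_mod_cast Nat.sub_le n m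
      linarith
  linarith

/-- The cost of spreading a jump `d` over the shells `0, …, n`, expressed through the single term
that the energy of the last shell controls. While `d 4^j ≤ 1` the logarithms are bounded and the
terms sum geometrically to `O(d)`. Beyond that scale each term is at most the last one times `ℓ_n /
(j - m)`, and the harmonic sum and `ℓ_n ≤ 4(n+1)` give the factor `(n+1)(1 + log(n+1))`. -/
lemma sum_log_rpow_le {β : ℝ} (hβ : β ≤ 1) : ∃ C : ℝ, 0 < C ∧ ∀ (n : ℕ) (d : ℝ), 0 ≤ d → d ≤ 1 →
    ∑ j ∈ Finset.range (n + 1), d ^ 2 * Real.log (Real.exp 1 + d / (1 / 4) ^ j) ^ (-β) ≤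
      C * (d + ((n + 1) * (1 + Real.log (n + 1))) *
        (d ^ 2 * Real.log (Real.exp 1 + d / (1 / 4) ^ n) ^ (-β))) := by
  refine ⟨2 ^ |β| * 2 + 8, by positivity, fun n d hd hd1 => ?_⟩
  have hLn : 0 ≤ Real.log ((n : ℝ) + 1) := Real.log_nonneg (by linarith [n.cast_nonneg (α := ℝ)])
  rcases hd.eq_or_lt with rfl | hd0
  · simp
  set ℓ : ℕ → ℝ := fun j => Real.log (Real.exp 1 + d / (1 / 4) ^ j) with hℓ
  have hℓ1 : ∀ j, 1 ≤ ℓ j := fun j => one_le_log (by positivity)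
  have hℓ0 : ∀ j, 0 < ℓ j := fun j => one_pos.trans_le (hℓ1 j)
  have e4 : ∀ j : ℕ, d / (1 / 4) ^ j = d * 4 ^ j := fun j => by
    rw [one_div, inv_pow, div_inv_eq_mul]
  -- `m` is the scale with `d 4^m ≤ 1 < d 4^(m+1)`, where the logarithm starts to grow.
  obtain ⟨m, hm1, hm2⟩ := exists_nat_pow_near ((one_le_div hd0).2 hd1)
    (show (1 : ℝ) < 4 by norm_num)
  rw [le_div_iff₀ hd0] at hm1
  rw [div_lt_iff₀ hd0] at hm2
  have hmono : ∀ j ≤ n, ℓ j ≤ ℓ n := by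
    intro j hj
    refine Real.log_le_log (by positivity) ?_
    rw [e4, e4]
    have := pow_le_pow_right₀ (show (1 : ℝ) ≤ 4 by norm_num) hj
    gcongr
  have pt : ∀ j ∈ Finset.range (n + 1), d ^ 2 * ℓ j ^ (-β) ≤ 2 ^ |β| * d * (1 / 4) ^ j +
      d ^ 2 * ℓ n ^ (1 - β) * (if m < j then 2 / ((j : ℝ) - m) else 0) := by
    intro j hj
    have hjn : j ≤ n := Nat.lt_succ_iff.1 (Finset.mem_range.1 hj)
    split_ifs with h
    · refine le_trans ?_ (le_add_of_nonneg_left (by positivity))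
      have hjm : (0 : ℝ) < (j : ℝ) - m := by
        have : (m : ℝ) < j := by exact_mod_cast h
        linarith
      have hlow : ((j : ℝ) - m) / 2 ≤ ℓ j := by
        have h1 : (4 : ℝ) ^ (j - m - 1) ≤ Real.exp 1 + d / (1 / 4) ^ j := by
          rw [e4, show j = (m + 1) + (j - m - 1) by omega, pow_add,
            show m + 1 + (j - m - 1) - m - 1 = j - m - 1 by omega]
          have : (0 : ℝ) < 4 ^ (j - m - 1) := by positivity
          nlinarith [Real.exp_pos 1]
        have h2 := Real.log_le_log (by positivity) h1
        rw [Real.log_pow] at h2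
        have h3 : (1 : ℝ) ≤ Real.log 4 := by
          rw [show (4 : ℝ) = 2 ^ 2 by norm_num, Real.log_pow]
          have := Real.log_two_gt_d9
          push_cast
          linarith
        have h4 : ((j - m - 1 : ℕ) : ℝ) = (j : ℝ) - m - 1 := by
          rw [Nat.cast_sub (by omega), Nat.cast_sub h.le]; simp
        rw [h4] at h2
        have h5 : 0 ≤ (j : ℝ) - m - 1 := by rw [← h4]; positivity
        have h6 : ((j : ℝ) - m - 1) * 1 ≤ ((j : ℝ) - m - 1) * Real.log 4 := by gcongr
        have h7 := hℓ1 j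
        have h8 : (j : ℝ) - m - 1 ≤ ℓ j := by simp only [hℓ]; linarith
        linarith
      rw [mul_assoc]
      gcongr
      -- Here `β ≤ 1` enters: `1 - β ≥ 0` lets `ℓ j` grow to `ℓ n` in the numerator, and the linear
      -- lower bound is spent on the denominator.
      calc ℓ j ^ (-β) = ℓ j ^ (1 - β) / ℓ j := by
            rw [show -β = (1 - β) - 1 by ring, Real.rpow_sub_one (hℓ0 j).ne']
        _ ≤ ℓ n ^ (1 - β) / (((j : ℝ) - m) / 2) := by
            exact div_le_div₀ (Real.rpow_nonneg (hℓ0 n).le _)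
              (Real.rpow_le_rpow (hℓ0 j).le (hmono j hjn) (by linarith)) (half_pos hjm) hlow
        _ = ℓ n ^ (1 - β) * (2 / ((j : ℝ) - m)) := by field_simp
    · rw [mul_zero, add_zero]
      have hdj : d * 4 ^ j ≤ 1 := by
        have := pow_le_pow_right₀ (show (1 : ℝ) ≤ 4 by norm_num) (not_lt.1 h)
        calc d * 4 ^ j ≤ d * 4 ^ m := by gcongr
          _ ≤ 1 := by linarith
      have hup : ℓ j ≤ 2 := by
        have h1 : Real.exp 1 + d / (1 / 4) ^ j ≤ Real.exp 2 := by
          rw [e4, show (2 : ℝ) = 1 + 1 by norm_num, Real.exp_add]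
          nlinarith [Real.add_one_le_exp (1 : ℝ)]
        have := Real.log_le_log (by positivity) h1
        rwa [Real.log_exp] at this
      have h1 : ℓ j ^ (-β) ≤ 2 ^ |β| := by
        calc ℓ j ^ (-β) ≤ ℓ j ^ |β| := Real.rpow_le_rpow_of_exponent_le (hℓ1 j) (neg_le_abs β)
          _ ≤ 2 ^ |β| := Real.rpow_le_rpow (hℓ0 j).le hup (abs_nonneg β)
      have h2 : d ≤ (1 / 4) ^ j := by
        rw [one_div, inv_pow, ← one_div, le_div_iff₀ (by positivity)]
        exact hdj
      calc d ^ 2 * ℓ j ^ (-β) ≤ (d * (1 / 4) ^ j) * 2 ^ |β| := by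
            rw [sq]
            have := Real.rpow_nonneg (hℓ0 j).le (-β)
            gcongr
        _ = _ := by ring
  refine (Finset.sum_le_sum pt).trans ?_
  rw [Finset.sum_add_distrib, ← Finset.mul_sum, ← Finset.mul_sum]
  have hgeo : ∑ j ∈ Finset.range (n + 1), (1 / 4 : ℝ) ^ j ≤ 2 := by
    refine (Summable.sum_le_tsum _ (fun _ _ => by positivity)
      (summable_geometric_of_lt_one (by norm_num) (by norm_num))).trans ?_
    rw [tsum_geometric_of_lt_one (by norm_num) (by norm_num)]
    norm_num
  have hℓn : ℓ n ≤ 4 * (n + 1) := by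
    have := log_exp_add_le hd n
    simp only [hℓ]
    nlinarith [n.cast_nonneg (α := ℝ)]
  have hX : 0 ≤ d ^ 2 * ℓ n ^ (-β) := mul_nonneg (sq_nonneg _) (Real.rpow_nonneg (hℓ0 n).le _)
  have e1 : ℓ n ^ (1 - β) = ℓ n * ℓ n ^ (-β) := by
    rw [sub_eq_add_neg, Real.rpow_add (hℓ0 n), Real.rpow_one]
  have h2 : d ^ 2 * ℓ n ^ (1 - β) * ∑ j ∈ Finset.range (n + 1),
      (if m < j then 2 / ((j : ℝ) - m) else 0) ≤
      8 * (((n + 1) * (1 + Real.log (n + 1))) * (d ^ 2 * ℓ n ^ (-β))) := by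
    rw [e1]
    calc _ ≤ d ^ 2 * (ℓ n * ℓ n ^ (-β)) * (2 * (1 + Real.log (n + 1))) := by
          have := (hℓ0 n).le
          have := Real.rpow_nonneg (hℓ0 n).le (-β)
          gcongr
          exact sum_ite_lt_le m n
      _ = (d ^ 2 * ℓ n ^ (-β)) * (2 * (1 + Real.log (n + 1))) * ℓ n := by ring
      _ ≤ (d ^ 2 * ℓ n ^ (-β)) * (2 * (1 + Real.log (n + 1))) * (4 * (n + 1)) := by gcongr
      _ = _ := by ring
  have h3 : 2 ^ |β| * d * ∑ j ∈ Finset.range (n + 1), (1 / 4 : ℝ) ^ j ≤ 2 ^ |β| * d * 2 := by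
    gcongr
  have hB : (0 : ℝ) < 2 ^ |β| := by positivity
  have hY : 0 ≤ ((n + 1) * (1 + Real.log (n + 1))) * (d ^ 2 * ℓ n ^ (-β)) := by positivity
  simp only [hℓ] at *
  nlinarith [mul_nonneg hB.le hY]

/-- Cauchy condensation: the terms at `2^k`, multiplied by `2^k`, are at least of order `1/(k+2)`.
-/
lemma not_summable_inv_mul_log :
    ¬ Summable fun n : ℕ => (((n : ℝ) + 1) * (1 + Real.log (n + 1)))⁻¹ := by
  have hlog : ∀ n : ℕ, 0 ≤ Real.log ((n : ℝ) + 1) := fun n =>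
    Real.log_nonneg (by linarith [n.cast_nonneg (α := ℝ)])
  rw [← summable_condensed_iff_of_nonneg]
  · intro h
    refine Real.not_summable_natCast_inv ((summable_nat_add_iff 2).1 ?_)
    refine Summable.of_nonneg_of_le (fun n => by positivity) (fun k => ?_) (h.mul_left 2)
    have h2 : (1 : ℝ) ≤ 2 ^ k := one_le_pow₀ (by norm_num)
    have h1 : Real.log ((2 : ℝ) ^ k + 1) ≤ k + 1 := by
      have h3 : (2 : ℝ) ^ k + 1 ≤ 2 ^ (k + 1) := by rw [pow_succ]; linarith
      have h4 := Real.log_le_log (by positivity) h3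
      rw [Real.log_pow] at h4
      push_cast at h4
      have := Real.log_two_lt_d9
      nlinarith [k.cast_nonneg (α := ℝ)]
    have h0 : 0 ≤ Real.log ((2 : ℝ) ^ k + 1) := Real.log_nonneg (by linarith)
    push_cast
    rw [← div_eq_mul_inv, ← mul_div_assoc, inv_eq_one_div, div_le_div_iff₀ (by positivity)
      (by positivity)]
    nlinarith
  · intro n
    have := hlog n
    positivity
  · intro m n hm hmn
    have := hlog m
    have hc : (m : ℝ) ≤ n := by exact_mod_cast hmn
    have hl : Real.log ((m : ℝ) + 1) ≤ Real.log (n + 1) := Real.log_le_log (by positivity) (by linarith)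
    gcongr

/-- A summable sequence is infinitely often small compared with `1 / (n log n)`. -/
lemma exists_seq_mul_log_lt {f : ℕ → ℝ} (hf : Summable f) :
    ∃ ns : ℕ → ℕ, (∀ k, k < ns k) ∧
      ∀ k, ((ns k : ℝ) + 1) * (1 + Real.log (ns k + 1)) * f (ns k) < 1 / ((k : ℝ) + 1) := by
  suffices H : ∀ k : ℕ, ∃ n, k < n ∧
      ((n : ℝ) + 1) * (1 + Real.log (n + 1)) * f n < 1 / ((k : ℝ) + 1) by
    choose ns h1 h2 using H
    exact ⟨ns, h1, h2⟩
  intro k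
  by_contra! hc
  refine not_summable_inv_mul_log ((summable_nat_add_iff (k + 1)).1 ?_)
  refine Summable.of_nonneg_of_le (fun n => ?_) (fun n => ?_)
    (((summable_nat_add_iff (k + 1)).2 hf).mul_left ((k : ℝ) + 1))
  · have : 0 ≤ Real.log (((n + (k + 1) : ℕ) : ℝ) + 1) :=
      Real.log_nonneg (by linarith [(n + (k + 1)).cast_nonneg (α := ℝ)])
    positivity
  · have h0 : 0 ≤ Real.log (((n + (k + 1) : ℕ) : ℝ) + 1) :=
      Real.log_nonneg (by linarith [(n + (k + 1)).cast_nonneg (α := ℝ)])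
    have := hc (n + (k + 1)) (by omega)
    have hk : (0 : ℝ) < (k : ℝ) + 1 := by positivity
    rw [inv_le_iff_one_le_mul₀ (by positivity)]
    rw [div_le_iff₀ hk] at this
    linarith

lemma tendsto_ePow_zero (κ : ℝ) {s : ℕ → ℝ} (h : Tendsto s atTop (𝓝 0)) :
    Tendsto (fun n => ePow κ (s n)) atTop (𝓝 0) := by
  have hc : ContinuousAt (logPow κ) 0 := by
    unfold logPow
    refine (continuousAt_id.pow 2).mul (ContinuousAt.rpow_const ?_ (Or.inl (by simp)))
    exact ContinuousAt.log (by fun_prop) (by simp)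
  have h1 := hc.tendsto.comp h
  rw [logPow_zero] at h1
  simpa [ePow] using ENNReal.tendsto_ofReal h1

lemma tendsto_lintegral_ball_zero {α β : ℝ} {g : Plane → Plane} (hg : modular α β g < ∞) :
    Tendsto (fun n : ℕ => ∫⁻ x in Metric.ball (0 : Plane) ((1 / 4) ^ n), Phi α β x ‖g x‖) atTop
      (𝓝 0) := by
  refine tendsto_setLIntegral_zero hg.ne ?_
  have h1 : Tendsto (fun n : ℕ => ((1 / 4 : ℝ) ^ n) ^ 2 * Real.pi) atTop (𝓝 0) := by
    have := (tendsto_pow_atTop_nhds_zero_of_lt_one (show (0 : ℝ) ≤ 1 / 4 by norm_num)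
      (by norm_num)).pow 2 |>.mul_const Real.pi
    simpa using this
  have h2 := ENNReal.tendsto_ofReal h1
  rw [ENNReal.ofReal_zero] at h2
  refine h2.congr fun n => ?_
  simp only [Function.comp]
  rw [volume_ball_plane (by positivity)]

lemma summable_shell_energy {α β : ℝ} {g : Plane → Plane} (hg : modular α β g < ∞) :
    Summable fun n : ℕ => (∫⁻ x in shell ((1 / 4) ^ n), ePow (-β) ‖g x‖).toReal := by
  refine ENNReal.summable_toReal (ne_of_lt (lt_of_le_of_lt ?_ hg))
  have hd : Pairwise (Function.onFun Disjoint fun n : ℕ => shell ((1 / 4 : ℝ) ^ n)) := by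
    have key : ∀ m n : ℕ, m < n → Disjoint (shell ((1 / 4 : ℝ) ^ m)) (shell ((1 / 4 : ℝ) ^ n)) := by
      intro m n hmn
      rw [Set.disjoint_left]
      rintro x hx hx'
      have h1 : (1 / 4 : ℝ) ^ n ≤ (1 / 4) ^ (m + 1) :=
        pow_le_pow_of_le_one (by norm_num) (by norm_num) hmn
      rw [pow_succ] at h1
      linarith [hx.1, hx'.2]
    intro m n hmn
    rcases lt_or_gt_of_ne hmn with h | h
    · exact key m n h
    · exact (key n m h).symm
  rw [← lintegral_iUnion (fun n => measurableSet_shell _) hd]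
  exact (setLIntegral_le_lintegral _ _).trans
    (lintegral_mono fun x => ePow_le_Phi α β x (norm_nonneg _))

/-- The annulus of the hole cost is covered by the shells `0, …, n`, and `sum_log_rpow_le` sums
their contributions. -/
lemma holeCost_le (α β : ℝ) (hβ : β ≤ 1) : ∃ C : ℝ, 0 ≤ C ∧ ∀ (g : Plane → Plane) (n : ℕ) (D : ℝ),
    |D| ≤ 1 → holeCost α β g ((1 / 4) ^ n) D ≤
      (∫⁻ x in Metric.ball (0 : Plane) ((1 / 4) ^ n), Phi α β x ‖g x‖) +
      (ENNReal.ofReal (C * (|D| + ((n + 1) * (1 + Real.log (n + 1))) *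
        (|D| ^ 2 * Real.log (Real.exp 1 + |D| / (1 / 4) ^ n) ^ (-β)))) + ePow α |D|) := by
  obtain ⟨C₁, hC₁, H₁⟩ := lintegral_shell_ePow_le (-β)
  obtain ⟨C₂, hC₂, H₂⟩ := sum_log_rpow_le hβ
  refine ⟨C₁ * C₂, by positivity, fun g n D hD => ?_⟩
  unfold holeCost
  gcongr
  refine (lintegral_annulus_le _ n).trans ?_
  refine (Finset.sum_le_sum fun j _ => H₁ ((1 / 4) ^ j) |D| (by positivity) (abs_nonneg _)).trans ?_
  rw [← ENNReal.ofReal_sum_of_nonneg, ← Finset.mul_sum, mul_assoc]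
  · exact ENNReal.ofReal_le_ofReal
      (mul_le_mul_of_nonneg_left (H₂ n |D| (abs_nonneg _) hD) hC₁)
  · intro j _
    have := one_le_log (t := |D| / (1 / 4) ^ j) (by positivity)
    positivity

/-- For `β ≤ 1` every gradient of finite energy is approximable. -/
theorem Sob.approximable_of_le_one {α β : ℝ} (hβ : β ≤ 1) {w : Plane → ℝ} {g : Plane → Plane}
    (h : Sob w g) (hg : modular α β g < ∞) : Approximable α β g := by
  obtain ⟨C₁, hC₁, H₁⟩ := Sob.ePow_jump_le (-β)
  obtain ⟨C₂, hC₂, H₂⟩ := holeCost_le α β hβ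
  set r : ℕ → ℝ := fun n => (1 / 4) ^ n with hr
  have hr0 : ∀ n, 0 < r n := fun n => by positivity
  set d : ℕ → ℝ := fun n => |jump w (r n)| with hd
  have hd0 : ∀ n, 0 ≤ d n := fun n => abs_nonneg _
  set ℓ : ℕ → ℝ := fun n => Real.log (Real.exp 1 + d n / (1 / 4) ^ n) with hℓ
  have hℓ1 : ∀ n, 1 ≤ ℓ n := fun n => one_le_log (div_nonneg (hd0 n) (hr0 n).le)
  set X : ℕ → ℝ := fun n => d n ^ 2 * ℓ n ^ (-β) with hX
  have hX0 : ∀ n, 0 ≤ X n := fun n =>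
    mul_nonneg (sq_nonneg _) (Real.rpow_nonneg (by linarith [hℓ1 n]) _)
  -- `X n` is `r²` times the `-β` energy density of slope `d/r` at `r = 4^{-n}`. By
  -- `Sob.ePow_jump_le` it is bounded by the energy of the `n`-th shell, and the shells are
  -- disjoint.
  have hXs : Summable X := by
    refine Summable.of_nonneg_of_le hX0 (fun n => ?_)
      ((summable_shell_energy hg).mul_left C₁.toReal)
    have h1 := H₁ w g h (r n) (hr0 n)
    have e : ENNReal.ofReal (r n ^ 2) * ePow (-β) (|jump w (r n)| / r n) = ENNReal.ofReal (X n) := by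
      rw [ePow, ← ENNReal.ofReal_mul (sq_nonneg _)]
      congr 1
      have := (hr0 n).ne'
      simp only [logPow, hX, hℓ, hd]
      change _ = |jump w (r n)| ^ 2 * Real.log (Real.exp 1 + |jump w (r n)| / r n) ^ (-β)
      field_simp
    rw [e] at h1
    have hfin : C₁ * ∫⁻ x in shell (r n), ePow (-β) ‖g x‖ ≠ ∞ :=
      ENNReal.mul_ne_top hC₁ (((setLIntegral_le_lintegral _ _).trans
        (lintegral_mono fun x => ePow_le_Phi α β x (norm_nonneg _))).trans_lt hg).ne
    rw [← ENNReal.toReal_mul]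
    exact (ENNReal.ofReal_le_iff_le_toReal hfin).1 h1
  -- Only a subsequence of scales is available: summability gives `X n = o(1/(n log n))` infinitely
  -- often, not always.
  obtain ⟨ns, hns, hlt⟩ := exists_seq_mul_log_lt hXs
  set Y : ℕ → ℝ := fun k => ((ns k : ℝ) + 1) * (1 + Real.log (ns k + 1)) * X (ns k) with hY
  have hlog : ∀ n : ℕ, 0 ≤ Real.log ((n : ℝ) + 1) := fun n =>
    Real.log_nonneg (by linarith [n.cast_nonneg (α := ℝ)])
  have hY0 : ∀ k, 0 ≤ Y k := fun k => by
    have := hlog (ns k)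
    have := hX0 (ns k)
    positivity
  have hYlim : Tendsto Y atTop (𝓝 0) :=
    squeeze_zero hY0 (fun k => (hlt k).le) tendsto_one_div_add_atTop_nhds_zero_nat
  -- Smallness of `Y` forces smallness of the jump itself: `β ≤ 1` gives `d²/ℓ ≤ X`, and `ℓ ≤
  -- 2(n+1)(1+d)` grows only linearly in `n`.
  have hdY : ∀ k, d (ns k) ^ 2 ≤ 2 * Y k * (1 + d (ns k)) := by
    intro k
    set n := ns k
    have h1 : d n ^ 2 * (ℓ n)⁻¹ ≤ X n := by
      have : (ℓ n)⁻¹ ≤ ℓ n ^ (-β) := by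
        rw [← Real.rpow_neg_one]
        exact Real.rpow_le_rpow_of_exponent_le (hℓ1 n) (by linarith)
      exact mul_le_mul_of_nonneg_left this (sq_nonneg _)
    rw [← div_eq_mul_inv, div_le_iff₀ (by linarith [hℓ1 n])] at h1
    have h2 := log_exp_add_le (hd0 n) n
    have h3 : X n * ℓ n ≤ X n * (2 * (n + 1) * (1 + d n)) := mul_le_mul_of_nonneg_left h2 (hX0 n)
    have h4 : ((n : ℝ) + 1) * X n ≤ Y k := by
      simp only [hY]
      have : 0 ≤ ((n : ℝ) + 1) * X n := mul_nonneg (by positivity) (hX0 n)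
      nlinarith [hlog n, mul_nonneg (hlog n) this]
    have h5 : ((n : ℝ) + 1) * X n * (2 * (1 + d n)) ≤ Y k * (2 * (1 + d n)) :=
      mul_le_mul_of_nonneg_right h4 (by linarith [hd0 n])
    linarith
  have hY4 : ∀ᶠ k in atTop, Y k < 1 / 4 := hYlim.eventually (gt_mem_nhds (by norm_num))
  have hd1 : ∀ᶠ k in atTop, d (ns k) ≤ 1 := by
    filter_upwards [hY4] with k hk
    have := hdY k
    by_contra! hc
    nlinarith [hY0 k]
  have hdlim : Tendsto (fun k => d (ns k)) atTop (𝓝 0) := by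
    have h1 : Tendsto (fun k => √(4 * Y k)) atTop (𝓝 0) := by
      have := (hYlim.const_mul 4).sqrt
      simpa using this
    refine squeeze_zero' (Eventually.of_forall fun k => hd0 _) ?_ h1
    filter_upwards [hd1] with k hk
    refine Real.le_sqrt_of_sq_le ((hdY k).trans ?_)
    nlinarith [hY0 k]
  have hnslim : Tendsto ns atTop atTop :=
    tendsto_atTop_mono (fun k => (hns k).le) tendsto_id
  have hbig : Tendsto (fun k => (∫⁻ x in Metric.ball (0 : Plane) (r (ns k)), Phi α β x ‖g x‖) +
      (ENNReal.ofReal (C₂ * (d (ns k) + Y k)) + ePow α (d (ns k)))) atTop (𝓝 0) := by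
    have h1 := (tendsto_lintegral_ball_zero hg).comp hnslim
    have h2 := ENNReal.tendsto_ofReal ((hdlim.add hYlim).const_mul C₂)
    have h3 := h1.add (h2.add (tendsto_ePow_zero α hdlim))
    simpa [hr] using h3
  refine h.approximable_of_holeCost hg (C₀ := 64 / Real.pi) fun ε hε => ?_
  obtain ⟨k, hk, hk1⟩ := ((hbig.eventually (gt_mem_nhds hε)).and hd1).exists
  refine ⟨r (ns k), _, _, hr0 _, ?_, isDensity_unifDensity (hr0 _) _ (ball_topPt_subset (hr0 _)).2,
    isDensity_unifDensity (hr0 _) _ (ball_botPt_subset (hr0 _)), (H₂ g (ns k) _ hk1).trans_lt hk⟩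
  have := hns k
  calc r (ns k) ≤ (1 / 4) ^ 1 := pow_le_pow_of_le_one (by norm_num) (by norm_num) (by omega)
    _ = 1 / 4 := pow_one _

/-! ### Logarithmic cutoffs and the case `α ≤ 1`. -/

/-- In this range the weight can be forgotten: `t² log(e+t)` dominates both phases and still gives a
point of the plane zero capacity. -/
lemma Phi_le_ePow_one {α β : ℝ} (hα : α ≤ 1) (hβ : 0 ≤ β) (x : Plane) {t : ℝ} (ht : 0 ≤ t) :
    Phi α β x t ≤ 2 * ePow 1 t := by
  have hl := one_le_log ht
  have key : ∀ κ ≤ (1 : ℝ), ePow κ t ≤ ePow 1 t := fun κ hκ =>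
    ENNReal.ofReal_le_ofReal (mul_le_mul_of_nonneg_left
      (Real.rpow_le_rpow_of_exponent_le hl hκ) (sq_nonneg t))
  have hw : ENNReal.ofReal (weight x) ≤ 1 := by
    rw [ENNReal.ofReal_le_one]; unfold weight; split_ifs <;> norm_num
  rw [Phi_eq α β x ht, two_mul]
  exact add_le_add (key _ (by linarith)) ((mul_le_mul' hw (key _ hα)).trans_eq (one_mul _))

/-- The partial sums of the harmonic series. -/
def harmSum (N : ℕ) : ℝ := ∑ j ∈ Finset.range N, ((j : ℝ) + 1)⁻¹

lemma one_le_harmSum {N : ℕ} (hN : 1 ≤ N) : 1 ≤ harmSum N := by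
  have := Finset.single_le_sum (f := fun j : ℕ => ((j : ℝ) + 1)⁻¹) (s := Finset.range N)
    (fun _ _ => by positivity) (Finset.mem_range.2 hN)
  simpa [harmSum] using this

lemma tendsto_harmSum : Tendsto harmSum atTop atTop := by
  have := Real.tendsto_sum_range_one_div_nat_succ_atTop
  simp only [one_div] at this
  exact this

/-- Logarithmic cutoff functions: `1` near the origin, with small energy. -/
def logCut (N : ℕ) (x : Plane) : ℝ :=
  ∑ j ∈ Finset.range N, ((j : ℝ) + 1)⁻¹ / harmSum N * cut ((1 / 4) ^ j) x

lemma contDiff_logCut (N : ℕ) : ContDiff ℝ ((⊤ : ℕ∞) : WithTop ℕ∞) (logCut N) :=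
  ContDiff.sum fun _ _ => contDiff_const.mul (contDiff_cut _)

lemma sum_harm_coeff {N : ℕ} (hN : 1 ≤ N) :
    ∑ j ∈ Finset.range N, ((j : ℝ) + 1)⁻¹ / harmSum N = 1 := by
  rw [← Finset.sum_div]
  exact div_self (one_pos.trans_le (one_le_harmSum hN)).ne'

lemma harm_coeff_nonneg {N : ℕ} (hN : 1 ≤ N) (j : ℕ) : 0 ≤ ((j : ℝ) + 1)⁻¹ / harmSum N :=
  div_nonneg (by positivity) (by linarith [one_le_harmSum hN])

lemma logCut_nonneg {N : ℕ} (hN : 1 ≤ N) (x : Plane) : 0 ≤ logCut N x :=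
  Finset.sum_nonneg fun j _ => mul_nonneg (harm_coeff_nonneg hN j) (cut_nonneg _ _)

lemma logCut_le_one {N : ℕ} (hN : 1 ≤ N) (x : Plane) : logCut N x ≤ 1 := by
  rw [← sum_harm_coeff hN]
  exact Finset.sum_le_sum fun j _ =>
    mul_le_of_le_one_right (harm_coeff_nonneg hN j) (cut_le_one _ _)

lemma logCut_eq_one {N : ℕ} (hN : 1 ≤ N) {x : Plane} (hx : ‖x‖ ≤ (1 / 4) ^ N / 2) :
    logCut N x = 1 := by
  rw [← sum_harm_coeff hN]
  refine Finset.sum_congr rfl fun j hj => ?_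
  rw [cut_eq_one (by positivity), mul_one]
  refine hx.trans ?_
  have : (1 / 4 : ℝ) ^ N ≤ (1 / 4) ^ j :=
    pow_le_pow_of_le_one (by norm_num) (by norm_num) (Finset.mem_range.1 hj).le
  linarith

lemma gradient_logCut (N : ℕ) (x : Plane) : gradient (logCut N) x =
    ∑ j ∈ Finset.range N, (((j : ℝ) + 1)⁻¹ / harmSum N) • gradient (cut ((1 / 4) ^ j)) x := by
  unfold gradient logCut
  rw [fderiv_fun_sum fun j _ => (differentiable_cut _ x).const_mul _, map_sum]
  refine Finset.sum_congr rfl fun j _ => ?_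
  rw [fderiv_const_mul (differentiable_cut _ x)]
  simp

lemma gradient_logCut_eq_zero_of_ge (N : ℕ) {x : Plane} (hx : 1 ≤ ‖x‖) :
    gradient (logCut N) x = 0 := by
  rw [gradient_logCut]
  refine Finset.sum_eq_zero fun j _ => ?_
  rw [gradient_cut_eq_zero_of_ge (by positivity)
    ((pow_le_one₀ (by norm_num) (by norm_num)).trans hx), smul_zero]

lemma gradient_logCut_eq_zero {N : ℕ} {x : Plane} (hx : ‖x‖ ≤ (1 / 4) ^ N / 2) :
    gradient (logCut N) x = 0 := by
  rw [gradient_logCut]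
  refine Finset.sum_eq_zero fun j hj => ?_
  have : (1 / 4 : ℝ) ^ N ≤ (1 / 4) ^ j :=
    pow_le_pow_of_le_one (by norm_num) (by norm_num) (Finset.mem_range.1 hj).le
  rw [gradient_cut_eq_zero_of_le (by positivity) (hx.trans (by linarith)), smul_zero]

lemma gradient_logCut_of_mem_shell (N : ℕ) {x : Plane} {j : ℕ} (hx : x ∈ shell ((1 / 4) ^ j)) :
    gradient (logCut N) x =
      if j < N then (((j : ℝ) + 1)⁻¹ / harmSum N) • gradient (cut ((1 / 4) ^ j)) x else 0 := by
  have hz : ∀ i : ℕ, i ≠ j → gradient (cut ((1 / 4) ^ i)) x = 0 := by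
    intro i hij
    rcases lt_or_gt_of_ne hij with h | h
    · refine gradient_cut_eq_zero_of_le (by positivity) (hx.2.trans ?_)
      have : (1 / 4 : ℝ) ^ j ≤ (1 / 4) ^ (i + 1) :=
        pow_le_pow_of_le_one (by norm_num) (by norm_num) h
      rw [pow_succ] at this
      have : (0 : ℝ) < (1 / 4) ^ i := by positivity
      linarith
    · refine gradient_cut_eq_zero_of_ge (by positivity) (le_trans ?_ hx.1.le)
      have : (1 / 4 : ℝ) ^ i ≤ (1 / 4) ^ (j + 1) :=
        pow_le_pow_of_le_one (by norm_num) (by norm_num) h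
      rw [pow_succ] at this
      linarith
  rw [gradient_logCut]
  split_ifs with h
  · exact Finset.sum_eq_single_of_mem j (Finset.mem_range.2 h) fun i _ hij => by
      rw [hz i hij, smul_zero]
  · exact Finset.sum_eq_zero fun i hi => by
      rw [hz i (by rintro rfl; exact h (Finset.mem_range.1 hi)), smul_zero]

/-- On the `j`-th shell only the `j`-th cutoff varies, with slope of order `4^j / ((j+1)S)`, where
`S = harmSum N`. The area is of order `16^{-j}` and the logarithm at most of order `j+1`, so the
shell contributes `O(1/((j+1)S²))`. The sum is `O(1/S)`; the harmonic coefficients are chosen to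
balance the logarithm. -/
lemma modular_gradient_logCut_le {α β : ℝ} (hα : α ≤ 1) (hβ : 0 ≤ β) : ∃ C : ℝ, 0 ≤ C ∧
    ∀ N : ℕ, 1 ≤ N → modular α β (gradient (logCut N)) ≤ ENNReal.ofReal (C / harmSum N) := by
  obtain ⟨A, hA, H⟩ := exists_gradient_cut_le
  obtain ⟨E, hE, M⟩ := logPow_mono 1
  set K := 2 * E * (A ^ 2 * (2 * (1 + A)) * Real.pi) with hK
  refine ⟨K, by positivity, fun N hN => ?_⟩
  have hS := one_le_harmSum hN
  have hS0 : 0 < harmSum N := by linarith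
  have h1 : modular α β (gradient (logCut N)) =
      ∫⁻ x in Metric.closedBall (0 : Plane) 1, Phi α β x ‖gradient (logCut N) x‖ := by
    rw [modular, ← lintegral_indicator Metric.isClosed_closedBall.measurableSet]
    refine lintegral_congr fun x => ?_
    by_cases hx : x ∈ Metric.closedBall (0 : Plane) 1
    · rw [Set.indicator_of_mem hx]
    · rw [Set.indicator_of_notMem hx, gradient_logCut_eq_zero_of_ge, norm_zero, Phi_zero]
      exact (not_le.1 fun h => hx (mem_closedBall_zero_iff.2 h)).le
  have hsh : ∀ j : ℕ, ∫⁻ x in shell ((1 / 4) ^ j), Phi α β x ‖gradient (logCut N) x‖ ≤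
      if j < N then ENNReal.ofReal (K / harmSum N ^ 2 * ((j : ℝ) + 1)⁻¹) else 0 := by
    intro j
    set r : ℝ := (1 / 4) ^ j with hr
    have hr0 : 0 < r := by positivity
    split_ifs with h
    · set t : ℝ := ((j : ℝ) + 1)⁻¹ / harmSum N * (A / r) with ht
      have hc1 : ((j : ℝ) + 1)⁻¹ / harmSum N ≤ 1 :=
        div_le_one_of_le₀ ((inv_le_one_of_one_le₀ (by linarith [j.cast_nonneg (α := ℝ)])).trans hS)
          hS0.le
      have ht0 : 0 ≤ t := by positivity
      have hlog : Real.log (Real.exp 1 + t) ≤ 2 * (j + 1) * (1 + A) := by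
        refine le_trans (Real.log_le_log (by positivity) ?_) (log_exp_add_le hA.le j)
        have : t ≤ 1 * (A / r) := mul_le_mul_of_nonneg_right hc1 (by positivity)
        linarith
      have hpt : ∀ x ∈ shell r, Phi α β x ‖gradient (logCut N) x‖ ≤
          ENNReal.ofReal (2 * (E * logPow 1 t)) := by
        intro x hx
        refine (Phi_le_ePow_one hα hβ x (norm_nonneg _)).trans ?_
        rw [ENNReal.ofReal_mul (by norm_num), ENNReal.ofReal_ofNat]
        gcongr
        refine ENNReal.ofReal_le_ofReal (M _ _ (norm_nonneg _) ?_)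
        rw [gradient_logCut_of_mem_shell N hx, if_pos h, norm_smul,
          Real.norm_of_nonneg (by positivity)]
        exact mul_le_mul_of_nonneg_left (H r hr0 x) (by positivity)
      refine (setLIntegral_mono' (measurableSet_shell r) hpt).trans ?_
      rw [setLIntegral_const]
      refine (mul_le_mul_right (volume_shell_le hr0.le) _).trans ?_
      rw [← ENNReal.ofReal_mul (mul_nonneg (by norm_num)
        (mul_nonneg (by linarith) (logPow_nonneg _ ht0)))]
      refine ENNReal.ofReal_le_ofReal ?_
      rw [logPow, Real.rpow_one]
      calc 2 * (E * (t ^ 2 * Real.log (Real.exp 1 + t))) * (r ^ 2 * Real.pi)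
          ≤ 2 * (E * (t ^ 2 * (2 * (j + 1) * (1 + A)))) * (r ^ 2 * Real.pi) := by gcongr
        _ = K / harmSum N ^ 2 * ((j : ℝ) + 1)⁻¹ := by
          rw [ht, hK]
          field_simp
    · refine le_of_eq ?_
      rw [setLIntegral_congr_fun (g := fun _ => 0) (measurableSet_shell r), lintegral_zero]
      intro x hx
      simp only
      rw [gradient_logCut_of_mem_shell N hx, if_neg h, norm_zero, Phi_zero]
  rw [h1]
  refine (lintegral_punctured_le _).trans ((ENNReal.tsum_le_tsum hsh).trans ?_)
  rw [tsum_eq_sum (s := Finset.range N) fun j hj => if_neg (by simpa using hj),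
    Finset.sum_congr rfl fun j hj => if_pos (Finset.mem_range.1 hj),
    ← ENNReal.ofReal_sum_of_nonneg fun j _ => by positivity, ← Finset.mul_sum]
  refine ENNReal.ofReal_le_ofReal (le_of_eq ?_)
  change K / harmSum N ^ 2 * harmSum N = _
  field_simp

lemma tendsto_modular_zero {α β : ℝ} {g : Plane → Plane} (hgm : Measurable g)
    (hg : modular α β g < ∞) {f : ℕ → Plane → Plane} (hf : ∀ n, Measurable (f n))
    (hle : ∀ n x, ‖f n x‖ ≤ ‖g x‖) (h0 : ∀ᵐ x, Tendsto (fun n => f n x) atTop (𝓝 0)) :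
    Tendsto (fun n => modular α β (f n)) atTop (𝓝 0) := by
  obtain ⟨C, hC, H⟩ := Phi_scale α β 1
  have hm : Measurable fun x => C * Phi α β x ‖g x‖ := (measurable_Phi_norm α β hgm).const_mul _
  have := tendsto_lintegral_of_dominated_convergence (μ := (volume : Measure Plane))
    (F := fun n x => Phi α β x ‖f n x‖) (f := fun _ => 0) (fun x => C * Phi α β x ‖g x‖)
    (fun n => measurable_Phi_norm α β (hf n))
    (fun n => ae_of_all _ fun x => H x _ _ (norm_nonneg _) (norm_nonneg _) (by simpa using hle n x))
    (by rw [lintegral_const_mul' _ _ hC]; exact ENNReal.mul_ne_top hC hg.ne)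
    (h0.mono fun x hx => tendsto_Phi_zero α β x (fun n => norm_nonneg _) (by simpa using hx.norm))
  simpa [modular] using this

/-- Functions of finite energy are limits of bounded functions. -/
lemma Sob.approximable_of_bounded {α β : ℝ} (H : ∀ (w : Plane → ℝ) (g : Plane → Plane), Sob w g →
    modular α β g < ∞ → (∃ M, ∀ x, |w x| ≤ M) → Approximable α β g) {w : Plane → ℝ}
    {g : Plane → Plane} (h : Sob w g) (hg : modular α β g < ∞) : Approximable α β g := by
  -- A smooth truncation: bounded for each `n`, with derivative `q n` in `[0,1]` tending to `1`
  -- pointwise.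
  set G : ℕ → ℝ → ℝ := fun n t => ((n : ℝ) + 1) * Real.arctan (t / ((n : ℝ) + 1)) with hG
  set q : ℕ → ℝ → ℝ := fun n t => 1 / (1 + (t / ((n : ℝ) + 1)) ^ 2) with hq
  have hn0 : ∀ n : ℕ, (n : ℝ) + 1 ≠ 0 := fun n => by positivity
  have hd : ∀ n t, HasDerivAt (G n) (q n t) t := by
    intro n t
    have h1 := ((hasDerivAt_id t).div_const ((n : ℝ) + 1)).arctan.const_mul ((n : ℝ) + 1)
    refine h1.congr_deriv ?_
    simp only [hq, id]
    field_simp [hn0 n]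
  have hq0 : ∀ n t, 0 ≤ q n t := fun n t => by positivity
  have hq1 : ∀ n t, q n t ≤ 1 := fun n t =>
    (div_le_one (by positivity)).2 (by nlinarith [sq_nonneg (t / ((n : ℝ) + 1))])
  have hde : ∀ n, deriv (G n) = q n := fun n => funext fun t => (hd n t).deriv
  have hS : ∀ n, Sob (fun x => G n (w x)) (fun x => q n (w x) • g x) := by
    intro n
    have := h.comp_left (G := G n) (C := 1)
      (contDiff_const.mul (Real.contDiff_arctan.comp (contDiff_id.div_const _))) (by simp [hG])
      (fun t => by rw [hde, abs_of_nonneg (hq0 n t)]; exact hq1 n t)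
    rwa [hde] at this
  have hle : ∀ n x, ‖q n (w x) • g x‖ ≤ ‖g x‖ := fun n x => by
    rw [norm_smul, Real.norm_of_nonneg (hq0 _ _)]
    exact mul_le_of_le_one_left (norm_nonneg _) (hq1 _ _)
  have hle' : ∀ n x, ‖g x - q n (w x) • g x‖ ≤ ‖g x‖ := fun n x => by
    have e : g x - q n (w x) • g x = (1 - q n (w x)) • g x := by module
    rw [e, norm_smul, Real.norm_of_nonneg (by linarith [hq1 n (w x)])]
    exact mul_le_of_le_one_left (norm_nonneg _) (by linarith [hq0 n (w x)])
  have hlim := tendsto_modular_zero (f := fun n x => g x - q n (w x) • g x) h.meas_grad hg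
    (fun n => h.meas_grad.sub (hS n).meas_grad) hle' (ae_of_all _ fun x => by
      have h1 : Tendsto (fun n : ℕ => w x / ((n : ℝ) + 1)) atTop (𝓝 0) := by
        have := (tendsto_one_div_add_atTop_nhds_zero_nat (𝕜 := ℝ)).const_mul (w x)
        simpa [div_eq_mul_inv] using this
      have h2 : Tendsto (fun n => q n (w x)) atTop (𝓝 (1 / (1 + 0 ^ 2))) :=
        tendsto_const_nhds.div ((h1.pow 2).const_add 1) (by norm_num)
      have h3 := (h2.smul_const (g x)).const_sub (g x)
      simpa using h3)
  refine approximable_of_approx h.meas_grad fun ε hε => ?_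
  obtain ⟨n, hn⟩ := (hlim.eventually (gt_mem_nhds hε)).exists
  refine ⟨_, (hS n).meas_grad, H _ _ (hS n) ?_ ⟨((n : ℝ) + 1) * (Real.pi / 2), fun x => ?_⟩, hn⟩
  · obtain ⟨C, hC, HC⟩ := modular_scale α β 1
    exact (HC _ g (ae_of_all _ fun x => by simpa using hle n x)).trans_lt
      (ENNReal.mul_lt_top hC.lt_top hg)
  · rw [abs_mul, abs_of_nonneg (by positivity)]
    gcongr
    exact abs_le.2 ⟨(Real.neg_pi_div_two_lt_arctan _).le, (Real.arctan_lt_pi_div_two _).le⟩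

/-- At a fixed `x ≠ 0` only finitely many cutoffs are nonzero, while the normalising harmonic sum
diverges. -/
lemma tendsto_logCut_zero {x : Plane} (hx : x ≠ 0) :
    Tendsto (fun N => logCut N x) atTop (𝓝 0) := by
  obtain ⟨m, hm⟩ := exists_pow_lt_of_lt_one (norm_pos_iff.2 hx) (show (1 / 4 : ℝ) < 1 by norm_num)
  have h1 : ∀ N, |logCut N x| ≤ harmSum m / |harmSum N| := by
    intro N
    have hz : ∀ j, m ≤ j → cut ((1 / 4) ^ j) x = 0 := fun j hj =>
      cut_eq_zero (by positivity)
        ((pow_le_pow_of_le_one (by norm_num) (by norm_num) hj).trans hm.le)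
    have hpt : ∀ j ∈ Finset.range N, |((j : ℝ) + 1)⁻¹ / harmSum N * cut ((1 / 4) ^ j) x| ≤
        if j ∈ Finset.range m then ((j : ℝ) + 1)⁻¹ / |harmSum N| else 0 := by
      intro j _
      split_ifs with h
      · rw [abs_mul, abs_div, abs_of_nonneg (cut_nonneg _ _),
          abs_of_nonneg (show (0 : ℝ) ≤ ((j : ℝ) + 1)⁻¹ by positivity)]
        exact mul_le_of_le_one_right (by positivity) (cut_le_one _ _)
      · rw [hz j (by simpa using h)]; simp
    refine (Finset.abs_sum_le_sum_abs _ _).trans ((Finset.sum_le_sum hpt).trans ?_)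
    rw [← Finset.sum_filter, harmSum.eq_def m, Finset.sum_div]
    refine Finset.sum_le_sum_of_subset_of_nonneg (fun j hj => ?_) fun j _ _ => by positivity
    exact (Finset.mem_filter.1 hj).2
  refine squeeze_zero_norm h1 (tendsto_const_nhds.div_atTop ?_)
  exact tendsto_abs_atTop_atTop.comp tendsto_harmSum

/-- For `α ≤ 1` and `β ≥ 0` every gradient of finite energy is approximable. -/
theorem Sob.approximable_of_le_one_of_nonneg {α β : ℝ} (hα : α ≤ 1) (hβ : 0 ≤ β) {w : Plane → ℝ}
    {g : Plane → Plane} (h : Sob w g) (hg : modular α β g < ∞) : Approximable α β g := by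
  refine Sob.approximable_of_bounded (fun w g h hg ⟨M, hM⟩ => ?_) h hg
  obtain ⟨K, hK, HK⟩ := modular_gradient_logCut_le hα hβ
  obtain ⟨C, hC, HC⟩ := modular_scale α β M
  obtain ⟨A, hA, HA⟩ := modular_add_le α β
  have hne : ∀ᵐ x : Plane, x ≠ 0 := by rw [ae_iff]; simp
  -- Multiplication by `1 - logCut N` makes the gradient vanish near the origin, so
  -- `Sob.approximable` applies to the product.
  have hSg : ∀ N, 1 ≤ N → Sob (fun x => (1 - logCut N x) * w x)
      (fun x => (1 - logCut N x) • g x - w x • gradient (logCut N) x) := by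
    intro N hN
    have e : ∀ x, gradient (fun y => 1 - logCut N y) x = - gradient (logCut N) x := by
      intro x
      unfold gradient
      rw [fderiv_const_sub, map_neg]
    have hcs : HasCompactSupport (gradient (logCut N)) := by
      refine HasCompactSupport.intro (isCompact_closedBall 0 1) fun x hx => ?_
      exact gradient_logCut_eq_zero_of_ge N (not_le.1 fun h => hx (mem_closedBall_zero_iff.2 h)).le
    have hcont : Continuous (gradient (logCut N)) := by
      unfold gradient
      exact (LinearIsometryEquiv.continuous _).comp
        ((contDiff_logCut N).continuous_fderiv (by simp))
    obtain ⟨B, hB⟩ := hcs.exists_bound_of_continuous hcont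
    have := h.smooth_mul (η := fun y => 1 - logCut N y) (C := max 1 B)
      (contDiff_const.sub (contDiff_logCut N))
      (fun x => le_trans (by
        rw [abs_le]; constructor <;> linarith [logCut_nonneg hN x, logCut_le_one hN x])
        (le_max_left _ _))
      (fun x => by rw [e, norm_neg]; exact (hB x).trans (le_max_right _ _))
    simpa only [e, smul_neg, ← sub_eq_add_neg] using this
  have hmL : ∀ N, Measurable (logCut N) := fun N => (contDiff_logCut N).continuous.measurable
  have h1 : Tendsto (fun N => modular α β fun x => logCut (N + 1) x • g x) atTop (𝓝 0) := by
    refine tendsto_modular_zero h.meas_grad hg (fun N => (hmL _).smul h.meas_grad) (fun N x => ?_)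
      (hne.mono fun x hx => ?_)
    · rw [norm_smul, Real.norm_of_nonneg (logCut_nonneg (by omega) x)]
      exact mul_le_of_le_one_left (norm_nonneg _) (logCut_le_one (by omega) x)
    · have := ((tendsto_logCut_zero hx).comp (tendsto_add_atTop_nat 1)).smul_const (g x)
      simpa using this
  -- The reduction to bounded `w` is used here: `|w| ≤ M` lets the vanishing energy of the cutoffs
  -- control this term.
  have h2 : Tendsto (fun N => modular α β fun x => w x • gradient (logCut (N + 1)) x) atTop
      (𝓝 0) := by
    have hl : Tendsto (fun N => C * ENNReal.ofReal (K / harmSum (N + 1))) atTop (𝓝 0) := by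
      have l1 : Tendsto (fun N => K / harmSum (N + 1)) atTop (𝓝 0) :=
        tendsto_const_nhds.div_atTop (tendsto_harmSum.comp (tendsto_add_atTop_nat 1))
      have l2 := ENNReal.Tendsto.const_mul (a := C) (ENNReal.tendsto_ofReal l1) (Or.inr hC)
      simpa using l2
    refine tendsto_of_tendsto_of_tendsto_of_le_of_le tendsto_const_nhds hl (fun _ => zero_le)
      fun N => ?_
    refine (HC _ (gradient (logCut (N + 1))) (ae_of_all _ fun x => ?_)).trans
      (mul_le_mul_right (HK (N + 1) (by omega)) _)
    rw [norm_smul, Real.norm_eq_abs]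
    exact mul_le_mul_of_nonneg_right (hM x) (norm_nonneg _)
  have h3 : Tendsto (fun N => modular α β fun x => g x - ((1 - logCut (N + 1) x) • g x -
      w x • gradient (logCut (N + 1)) x)) atTop (𝓝 0) := by
    have l := ENNReal.Tendsto.const_mul (a := A) (h1.add h2) (Or.inr hA)
    rw [add_zero, mul_zero] at l
    refine tendsto_of_tendsto_of_tendsto_of_le_of_le tendsto_const_nhds l (fun _ => zero_le)
      fun N => ?_
    refine HA _ _ _ ((hmL _).smul h.meas_grad) (ae_of_all _ fun x => ?_)
    have e : g x - ((1 - logCut (N + 1) x) • g x - w x • gradient (logCut (N + 1)) x) =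
      logCut (N + 1) x • g x + w x • gradient (logCut (N + 1)) x := by module
    rw [e]
    exact norm_add_le _ _
  refine approximable_of_approx h.meas_grad fun ε hε => ?_
  obtain ⟨N, hN⟩ := (h3.eventually (gt_mem_nhds (lt_min hε one_pos))).exists
  refine ⟨_, (hSg (N + 1) (by omega)).meas_grad, ?_, hN.trans_le (min_le_left _ _)⟩
  refine (hSg (N + 1) (by omega)).approximable ?_ (δ₀ := (1 / 4) ^ (N + 1) / 2) (by positivity)
    (ae_of_all _ fun x hx => ?_)
  · refine (HA g _ _ h.meas_grad (ae_of_all _ fun x => ?_)).trans_lt (ENNReal.mul_lt_top hA.lt_top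
      (ENNReal.add_lt_top.2 ⟨hg, hN.trans_le ((min_le_right _ _).trans le_top)⟩))
    have := norm_sub_le (g x) (g x - ((1 - logCut (N + 1) x) • g x -
      w x • gradient (logCut (N + 1)) x))
    rwa [sub_sub_cancel] at this
  · rw [logCut_eq_one (by omega) hx.le, gradient_logCut_eq_zero hx.le]
    simp

/-! ### The angular jump has finite energy for `β > 1`. -/

/-- The `j`-th shell contributes `O((j+1)^{-β})`. The lemma is needed twice: with exponent `β` for
the energy of a jump, and with `α` for the conjugate energy of `bField`. -/
lemma lintegral_ePow_inv_norm_lt_top {β : ℝ} (hβ : 1 < β) :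
    ∫⁻ x in Metric.closedBall (0 : Plane) 1, ePow (-β) (1 / ‖x‖) < ∞ := by
  obtain ⟨C, hC, H⟩ := lintegral_shell_ePow_le (-β)
  have hs : Summable fun j : ℕ => C * 2 ^ β * ((j : ℝ) + 1) ^ (-β) := by
    have h1 : Summable fun j : ℕ => (((j + 1 : ℕ) : ℝ)) ^ (-β) :=
      (summable_nat_add_iff 1).2 (Real.summable_nat_rpow.2 (by linarith))
    refine Summable.mul_left _ ?_
    simpa using h1
  have hle : ∀ j : ℕ, ∫⁻ x in shell ((1 / 4) ^ j), ePow (-β) (1 / ‖x‖) ≤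
      ENNReal.ofReal (C * 2 ^ β * ((j : ℝ) + 1) ^ (-β)) := by
    intro j
    refine (H ((1 / 4) ^ j) 1 (by positivity) zero_le_one).trans (ENNReal.ofReal_le_ofReal ?_)
    rw [one_pow, one_mul, mul_assoc]
    refine mul_le_mul_of_nonneg_left ?_ hC
    have e4 : (1 : ℝ) / (1 / 4) ^ j = 4 ^ j := by rw [one_div, one_div, inv_pow, inv_inv]
    have h1 := one_le_log (t := 1 / (1 / 4) ^ j) (by positivity)
    have h2 : (j : ℝ) ≤ Real.log (Real.exp 1 + 1 / (1 / 4) ^ j) := by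
      have h3 : (4 : ℝ) ^ j ≤ Real.exp 1 + 1 / (1 / 4) ^ j := by
        rw [e4]; linarith [Real.exp_pos 1]
      have h4 := Real.log_le_log (by positivity) h3
      rw [Real.log_pow] at h4
      have h5 : (1 : ℝ) ≤ Real.log 4 := by
        rw [show (4 : ℝ) = 2 ^ 2 by norm_num, Real.log_pow]
        have := Real.log_two_gt_d9
        push_cast
        linarith
      nlinarith [j.cast_nonneg (α := ℝ)]
    have h6 : ((j : ℝ) + 1) / 2 ≤ Real.log (Real.exp 1 + 1 / (1 / 4) ^ j) := by linarith
    refine (Real.rpow_le_rpow_of_nonpos (by positivity) h6 (by linarith)).trans_eq ?_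
    rw [Real.div_rpow (by positivity) (by norm_num), Real.rpow_neg (x := 2) (by norm_num),
      div_inv_eq_mul, mul_comm]
  refine (lintegral_punctured_le _).trans_lt ((ENNReal.tsum_le_tsum hle).trans_lt ?_)
  rw [← ENNReal.ofReal_tsum_of_nonneg (fun j => by positivity) hs]
  exact ENNReal.ofReal_lt_top

/-- Any exponent strictly between `1` and `2` would bound `1/|x|` near `0` and remain integrable;
`3/2` is the one that also appears in the bound for the conjugate. On the `j`-th shell it gives `8π
2^{-j}`. -/
lemma lintegral_inv_norm_rpow_lt_top :
    ∫⁻ x in Metric.closedBall (0 : Plane) 1, ENNReal.ofReal ((1 / ‖x‖) ^ (3 / 2 : ℝ)) < ∞ := by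
  have hs : Summable fun j : ℕ => 8 * Real.pi * (1 / 2 : ℝ) ^ j :=
    (summable_geometric_of_lt_one (by norm_num) (by norm_num)).mul_left _
  have hle : ∀ j : ℕ, ∫⁻ x in shell ((1 / 4) ^ j), ENNReal.ofReal ((1 / ‖x‖) ^ (3 / 2 : ℝ)) ≤
      ENNReal.ofReal (8 * Real.pi * (1 / 2 : ℝ) ^ j) := by
    intro j
    have e8 : ((4 : ℝ) * 4 ^ j) ^ (3 / 2 : ℝ) = 8 * 8 ^ j := by
      have h1 : ((4 : ℝ) * 4 ^ j) = ((2 : ℝ) * 2 ^ j) ^ 2 := by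
        rw [mul_pow, ← pow_mul, mul_comm j 2, pow_mul]; norm_num
      rw [h1, ← Real.rpow_natCast, ← Real.rpow_mul (by positivity)]
      rw [show ((2 : ℕ) : ℝ) * (3 / 2) = ((3 : ℕ) : ℝ) by norm_num, Real.rpow_natCast, mul_pow,
        ← pow_mul, mul_comm j 3, pow_mul]
      norm_num
    calc _ ≤ ∫⁻ _ in shell ((1 / 4) ^ j), ENNReal.ofReal (8 * 8 ^ j) := by
          refine setLIntegral_mono' (measurableSet_shell _) fun x hx => ?_
          refine ENNReal.ofReal_le_ofReal ?_
          rw [← e8]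
          refine Real.rpow_le_rpow (by positivity) ?_ (by norm_num)
          have hx0 : 0 < ‖x‖ := lt_trans (by positivity) hx.1
          have h2 := hx.1.le
          rw [one_div, inv_pow] at h2
          rw [div_le_iff₀ hx0]
          have h3 : (0 : ℝ) < 4 ^ j := by positivity
          have h4 : (4 : ℝ) ^ j * (4 ^ j)⁻¹ = 1 := mul_inv_cancel₀ h3.ne'
          nlinarith
      _ ≤ ENNReal.ofReal (8 * 8 ^ j) * ENNReal.ofReal (((1 / 4) ^ j) ^ 2 * Real.pi) := by
          rw [setLIntegral_const]
          gcongr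
          exact volume_shell_le (by positivity)
      _ = _ := by
          rw [← ENNReal.ofReal_mul (by positivity)]
          congr 1
          have : (1 / 2 : ℝ) ^ j = 8 ^ j * ((1 / 4) ^ j) ^ 2 := by
            rw [← pow_mul, mul_comm j 2, pow_mul, ← mul_pow]; norm_num
          rw [this]
          ring
  refine (lintegral_punctured_le _).trans_lt ((ENNReal.tsum_le_tsum hle).trans_lt ?_)
  rw [← ENNReal.ofReal_tsum_of_nonneg (fun j => by positivity) hs]
  exact ENNReal.ofReal_lt_top

/-- No condition on `α` is needed, since in the double cone the gradient is bounded; `β > 1` pays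
for the singularity in the side cones. -/
lemma modular_cutAngGrad_lt_top (α : ℝ) {β : ℝ} (hβ : 1 < β) :
    modular α β cutAngGrad < ∞ := by
  obtain ⟨A, hA, H1, H2⟩ := exists_cutAngGrad_le
  obtain ⟨E₁, hE₁, M₁⟩ := ePow_scale (-β) A
  obtain ⟨E₂, hE₂, M₂⟩ := ePow_scale α A
  set B := Metric.closedBall (0 : Plane) 1
  have hB : MeasurableSet B := Metric.isClosed_closedBall.measurableSet
  have hne : ∀ᵐ x : Plane, x ≠ 0 := by rw [ae_iff]; simp
  have pt : ∀ x : Plane, x ≠ 0 → Phi α β x ‖cutAngGrad x‖ ≤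
      B.indicator (fun x => E₁ * ePow (-β) (1 / ‖x‖) + E₂ * ePow α 1) x := by
    intro x hx
    by_cases hxB : x ∈ B
    · rw [Set.indicator_of_mem hxB, Phi_eq α β x (norm_nonneg _)]
      refine add_le_add (M₁ _ _ (norm_nonneg _) (by positivity)
        ((H1 x hx).trans_eq (mul_one_div _ _).symm)) ?_
      by_cases hw : |x 0| < |x 1|
      · rw [weight_eq_one hw, ENNReal.ofReal_one, one_mul]
        exact M₂ _ _ (norm_nonneg _) zero_le_one (by rw [mul_one]; exact H2 x hw)
      · rw [weight_eq_zero hw]; simp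
    · have : 1 < ‖x‖ := not_le.1 fun h => hxB (mem_closedBall_zero_iff.2 h)
      rw [cutAngGrad_eq_zero (by linarith), norm_zero, Phi_zero]
      exact zero_le
  have hm : Measurable fun x : Plane => E₁ * ePow (-β) (1 / ‖x‖) :=
    ((measurable_ePow _).comp (by fun_prop)).const_mul _
  refine (lintegral_mono_ae (hne.mono pt)).trans_lt ?_
  rw [lintegral_indicator hB, lintegral_add_left hm, lintegral_const_mul' _ _ hE₁, setLIntegral_const]
  have hv : volume B < ∞ := measure_closedBall_lt_top
  exact ENNReal.add_lt_top.2 ⟨ENNReal.mul_lt_top hE₁.lt_top (lintegral_ePow_inv_norm_lt_top hβ),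
    ENNReal.mul_lt_top (ENNReal.mul_lt_top hE₂.lt_top (ePow_ne_top _ _).lt_top) hv⟩

lemma eventually_pow_le {x : Plane} (hx : x ≠ 0) : ∀ᶠ n : ℕ in atTop, (1 / 4 : ℝ) ^ n < ‖x‖ :=
  (tendsto_pow_atTop_nhds_zero_of_lt_one (by norm_num) (by norm_num)).eventually
    (gt_mem_nhds (norm_pos_iff.2 hx))

/-- The function `cutAng` is a Sobolev function. -/
lemma sob_cutAng : Sob cutAng cutAngGrad := by
  obtain ⟨A, hA, H1, -⟩ := exists_cutAngGrad_le
  obtain ⟨A', hA', H'⟩ := exists_gradient_cut_le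
  have hne : ∀ᵐ x : Plane, x ≠ 0 := by rw [ae_iff]; simp
  set B := Metric.closedBall (0 : Plane) 1
  have hB : MeasurableSet B := Metric.isClosed_closedBall.measurableSet
  have hr0 : ∀ n : ℕ, (0 : ℝ) < (1 / 4) ^ n := fun n => by positivity
  have hr1 : ∀ n : ℕ, (1 / 4 : ℝ) ^ n ≤ 1 := fun n => pow_le_one₀ (by norm_num) (by norm_num)
  have hB1 : ∫⁻ x, B.indicator (fun _ => (1 : ℝ≥0∞)) x ≠ ∞ := by
    rw [lintegral_indicator hB, setLIntegral_const, one_mul]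
    exact measure_closedBall_lt_top.ne
  -- Test functions with a hole of radius `4^{-n}` converge in `W^{1,1}`, because `1/|x|` is
  -- integrable. They need not converge in the modular, and for `α, β > 1` none do.
  refine Sob.of_tendsto measurable_cutAng measurable_cutAngGrad
    (w' := fun n => holeAng ((1 / 4) ^ n)) (g' := fun n => gradient (holeAng ((1 / 4) ^ n)))
    (fun n => Sob.of_test (isTest_holeAng (hr0 n))) ?_ ?_
  · have := tendsto_lintegral_of_dominated_convergence (μ := (volume : Measure Plane))
      (F := fun n x => ‖cutAng x - holeAng ((1 / 4) ^ n) x‖ₑ) (f := fun _ => 0)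
      (fun x => B.indicator (fun _ => (1 : ℝ≥0∞)) x)
      (fun n => (measurable_cutAng.sub (contDiff_holeAng (hr0 n)).continuous.measurable).enorm)
      (fun n => ae_of_all _ fun x => ?_) hB1 (hne.mono fun x hx => ?_)
    · simpa using this
    · have e : cutAng x - holeAng ((1 / 4) ^ n) x = cut ((1 / 4) ^ n) x * cutAng x := by
        rw [holeAng]; ring
      simp only
      rw [e]
      by_cases hxB : x ∈ B
      · rw [Set.indicator_of_mem hxB, Real.enorm_eq_ofReal_abs, ENNReal.ofReal_le_one, abs_mul,
          abs_of_nonneg (cut_nonneg _ _)]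
        have := abs_cutAng_le x
        nlinarith [cut_nonneg ((1 / 4) ^ n) x, cut_le_one ((1 / 4) ^ n) x, abs_nonneg (cutAng x)]
      · have : 1 < ‖x‖ := not_le.1 fun h => hxB (mem_closedBall_zero_iff.2 h)
        rw [cut_eq_zero (hr0 n) ((hr1 n).trans this.le), zero_mul, enorm_zero]
        exact zero_le
    · refine tendsto_const_nhds.congr' ?_
      filter_upwards [eventually_pow_le hx] with n hn
      rw [holeAng, cut_eq_zero (hr0 n) hn.le]
      simp
  · have hI : ∫⁻ x, B.indicator (fun x => ENNReal.ofReal (A + A') *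
        ENNReal.ofReal ((1 / ‖x‖) ^ (3 / 2 : ℝ))) x ≠ ∞ := by
      rw [lintegral_indicator hB, lintegral_const_mul' _ _ ENNReal.ofReal_ne_top]
      exact ENNReal.mul_ne_top ENNReal.ofReal_ne_top lintegral_inv_norm_rpow_lt_top.ne
    have e : ∀ n, ∀ x : Plane, x ≠ 0 → cutAngGrad x - gradient (holeAng ((1 / 4) ^ n)) x =
        cut ((1 / 4) ^ n) x • cutAngGrad x + cutAng x • gradient (cut ((1 / 4) ^ n)) x := by
      intro n x hx
      rw [gradient_holeAng hx]
      module
    have := tendsto_lintegral_of_dominated_convergence (μ := (volume : Measure Plane))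
      (F := fun n x => ‖cutAngGrad x - gradient (holeAng ((1 / 4) ^ n)) x‖ₑ) (f := fun _ => 0)
      (fun x => B.indicator (fun x => ENNReal.ofReal (A + A') *
        ENNReal.ofReal ((1 / ‖x‖) ^ (3 / 2 : ℝ))) x)
      (fun n => (measurable_cutAngGrad.sub (measurable_gradient _)).enorm)
      (fun n => hne.mono fun x hx => ?_) hI (hne.mono fun x hx => ?_)
    · simpa using this
    · simp only
      rw [e n x hx]
      by_cases hxB : x ∈ B
      · have hx0 := norm_pos_iff.2 hx
        have hx1 : ‖x‖ ≤ 1 := mem_closedBall_zero_iff.1 hxB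
        rw [Set.indicator_of_mem hxB, ← ofReal_norm, ← ENNReal.ofReal_mul (by positivity)]
        refine ENNReal.ofReal_le_ofReal ?_
        have hone : 1 ≤ 1 / ‖x‖ := (one_le_div hx0).2 hx1
        have hpow : 1 / ‖x‖ ≤ (1 / ‖x‖) ^ (3 / 2 : ℝ) := by
          conv_lhs => rw [← Real.rpow_one (1 / ‖x‖)]
          exact Real.rpow_le_rpow_of_exponent_le hone (by norm_num)
        have h1 : ‖cut ((1 / 4) ^ n) x • cutAngGrad x‖ ≤ A * (1 / ‖x‖) := by
          rw [norm_smul, Real.norm_of_nonneg (cut_nonneg _ _), mul_one_div]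
          exact (mul_le_of_le_one_left (norm_nonneg _) (cut_le_one _ _)).trans (H1 x hx)
        have h2 : ‖cutAng x • gradient (cut ((1 / 4) ^ n)) x‖ ≤ A' * (1 / ‖x‖) := by
          rw [norm_smul, Real.norm_eq_abs, mul_one_div]
          refine (mul_le_of_le_one_left (norm_nonneg _)
            ((abs_cutAng_le x).trans (by norm_num))).trans ?_
          rcases le_total ((1 / 4) ^ n) ‖x‖ with h | h
          · rw [gradient_cut_eq_zero_of_ge (hr0 n) h, norm_zero]
            positivity
          · refine (H' _ (hr0 n) x).trans ?_
            gcongr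
        calc _ ≤ A * (1 / ‖x‖) + A' * (1 / ‖x‖) := (norm_add_le _ _).trans (add_le_add h1 h2)
          _ = (A + A') * (1 / ‖x‖) := by ring
          _ ≤ _ := by gcongr
      · have : 1 < ‖x‖ := not_le.1 fun h => hxB (mem_closedBall_zero_iff.2 h)
        rw [cut_eq_zero (hr0 n) ((hr1 n).trans this.le),
          gradient_cut_eq_zero_of_ge (hr0 n) ((hr1 n).trans this.le)]
        simp
    · refine tendsto_const_nhds.congr' ?_
      filter_upwards [eventually_pow_le hx] with n hn
      rw [e n x hx, cut_eq_zero (hr0 n) hn.le, gradient_cut_eq_zero_of_ge (hr0 n) hn.le]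
      simp

/-! ### The singular divergence-free field and its flux. -/

/-- Planar integrals in Cartesian coordinates. -/
def prodEquiv : Plane ≃ᵐ ℝ × ℝ :=
  (MeasurableEquiv.toLp 2 (Fin 2 → ℝ)).symm.trans MeasurableEquiv.finTwoArrow

lemma measurePreserving_prodEquiv_symm : MeasurePreserving prodEquiv.symm :=
  ((EuclideanSpace.volume_preserving_symm_measurableEquiv_toLp (Fin 2)).trans
    (volume_preserving_finTwoArrow ℝ)).symm

lemma prodEquiv_symm_apply (p : ℝ × ℝ) : prodEquiv.symm p = !₂[p.1, p.2] := by
  ext i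
  fin_cases i <;> rfl

lemma integrableOn_inv_norm (R : ℝ) :
    IntegrableOn (fun x : Plane => ‖x‖⁻¹) (Metric.closedBall 0 R) := by
  have h1 : IntegrableOn (fun x : Plane => ‖x‖⁻¹) (Metric.closedBall 0 1) := by
    refine ⟨Measurable.aestronglyMeasurable (by fun_prop), lt_of_le_of_lt ?_
      lintegral_inv_norm_rpow_lt_top⟩
    refine setLIntegral_mono' Metric.isClosed_closedBall.measurableSet fun x hx => ?_
    rw [← ofReal_norm, norm_inv, norm_norm]
    refine ENNReal.ofReal_le_ofReal ?_
    rcases eq_or_ne x 0 with rfl | hx0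
    · simp
    · rw [← one_div]
      conv_lhs => rw [← Real.rpow_one (1 / ‖x‖)]
      exact Real.rpow_le_rpow_of_exponent_le
        ((one_le_div (norm_pos_iff.2 hx0)).2 (mem_closedBall_zero_iff.1 hx)) (by norm_num)
  have h2 : IntegrableOn (fun x : Plane => ‖x‖⁻¹) (Metric.closedBall 0 R \ Metric.closedBall 0 1) := by
    refine Measure.integrableOn_of_bounded (M := 1)
      ((measure_mono Set.sdiff_subset).trans_lt measure_closedBall_lt_top).ne
      (Measurable.aestronglyMeasurable (by fun_prop)) ?_
    refine (ae_restrict_iff' (Metric.isClosed_closedBall.measurableSet.diff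
      Metric.isClosed_closedBall.measurableSet)).2 (ae_of_all _ fun x hx => ?_)
    have : 1 < ‖x‖ := not_le.1 fun h => hx.2 (mem_closedBall_zero_iff.2 h)
    rw [norm_inv, norm_norm]
    exact inv_le_one_of_one_le₀ this.le
  refine (h1.union h2).mono_set fun x hx => ?_
  by_cases h : x ∈ Metric.closedBall (0 : Plane) 1
  · exact Or.inl h
  · exact Or.inr ⟨hx, h⟩

/-- The radial derivative divided by `2 x₂²`. -/
def radialQuot (ψ : Plane → ℝ) (x : Plane) : ℝ := inner ℝ x (gradient ψ x) / (2 * x 1 ^ 2)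

lemma measurable_radialQuot (ψ : Plane → ℝ) : Measurable (radialQuot ψ) := by
  have h := measurable_gradient ψ
  unfold radialQuot
  exact (measurable_id.inner h).div (by fun_prop)

lemma abs_radialQuot_le (ψ : Plane → ℝ) {x : Plane} (hx : |x 0| < |x 1|) :
    |radialQuot ψ x| ≤ ‖gradient ψ x‖ * ‖x‖⁻¹ := by
  have h1 : 0 < |x 1| := (abs_nonneg _).trans_lt hx
  have hx0 : 0 < ‖x‖ := h1.trans_le (abs_coord_le x 1)
  have h2 : ‖x‖ ^ 2 ≤ 2 * x 1 ^ 2 := by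
    rw [plane_norm_sq, ← sq_abs (x 0), ← sq_abs (x 1)]
    nlinarith [abs_nonneg (x 0)]
  have h3 : 0 < 2 * x 1 ^ 2 := by rw [← sq_abs]; positivity
  unfold radialQuot
  rw [abs_div, abs_of_pos h3, ← div_eq_mul_inv, div_le_div_iff₀ h3 hx0]
  have h4 := abs_real_inner_le_norm x (gradient ψ x)
  calc |inner ℝ x (gradient ψ x)| * ‖x‖ ≤ (‖x‖ * ‖gradient ψ x‖) * ‖x‖ := by gcongr
    _ = ‖gradient ψ x‖ * ‖x‖ ^ 2 := by ring
    _ ≤ _ := by gcongr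

lemma integrable_radialQuot {ψ : Plane → ℝ} (hψ : ContDiff ℝ ((⊤ : ℕ∞) : WithTop ℕ∞) ψ)
    (hs : HasCompactSupport ψ) : IntegrableOn (radialQuot ψ) topCone := by
  have hg : Continuous (gradient ψ) := by
    unfold gradient
    exact (LinearIsometryEquiv.continuous _).comp (hψ.continuous_fderiv (by simp))
  have hgs : HasCompactSupport (gradient ψ) :=
    (hs.fderiv ℝ).comp_left (g := (InnerProductSpace.toDual ℝ Plane).symm) (map_zero _)
  obtain ⟨K, hK⟩ := hgs.exists_bound_of_continuous hg
  obtain ⟨R, hR⟩ := hgs.isCompact.isBounded.subset_closedBall 0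
  have hm : MeasurableSet (topCone ∩ Metric.closedBall 0 R) :=
    isOpen_topCone.measurableSet.inter Metric.isClosed_closedBall.measurableSet
  have h1 : IntegrableOn (radialQuot ψ) (topCone ∩ Metric.closedBall 0 R) := by
    refine (((integrableOn_inv_norm R).mono_set Set.inter_subset_right).const_mul K).mono'
      (measurable_radialQuot ψ).aestronglyMeasurable ((ae_restrict_iff' hm).2
        (ae_of_all _ fun x hx => ?_))
    refine (abs_radialQuot_le ψ (lt_abs.2 (Or.inl hx.1))).trans ?_
    gcongr
    exact hK x
  refine h1.of_forall_sdiff_eq_zero isOpen_topCone.measurableSet fun x hx => ?_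
  have : gradient ψ x = 0 := by
    by_contra h
    exact hx.2 ⟨hx.1, hR (subset_tsupport _ h)⟩
  rw [radialQuot, this, inner_zero_right, zero_div]

/-- In the coordinates `x = s(τ,1)` with `s > 0`, `|τ| < 1` and Jacobian `s`, the integrand becomes
the `s`-derivative of `ψ(s(τ,1))/2`. Each ray contributes `-ψ(0)/2`, and the interval of `τ` has
length two. -/
lemma integral_radialQuot_topCone {ψ : Plane → ℝ} (hψ : ContDiff ℝ ((⊤ : ℕ∞) : WithTop ℕ∞) ψ)
    (hs : HasCompactSupport ψ) : ∫ x in topCone, radialQuot ψ x = - ψ 0 := by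
  have hg : Continuous (gradient ψ) := by
    unfold gradient
    exact (LinearIsometryEquiv.continuous _).comp (hψ.continuous_fderiv (by simp))
  set v : ℝ → Plane := fun τ => !₂[τ, 1] with hv
  have hvc : Continuous v := by
    simp only [hv]
    refine (PiLp.continuous_toLp 2 _).comp (continuous_pi fun i => ?_)
    fin_cases i
    · exact continuous_id
    · exact continuous_const
  set G : ℝ → ℝ → ℝ := fun s τ => inner ℝ (v τ) (gradient ψ (s • v τ)) / 2 with hG
  set F : Plane → ℝ := topCone.indicator (radialQuot ψ) with hF
  have hFi : Integrable F :=
    (integrable_indicator_iff isOpen_topCone.measurableSet).2 (integrable_radialQuot hψ hs)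
  have hmp := measurePreserving_prodEquiv_symm
  have hFi' : Integrable (fun p : ℝ × ℝ => F !₂[p.1, p.2]) (volume.prod volume) := by
    have := hmp.integrable_comp_of_integrable hFi
    refine this.congr (ae_of_all _ fun p => ?_)
    rw [Function.comp, prodEquiv_symm_apply]
  have e1 : ∫ x in topCone, radialQuot ψ x = ∫ s, ∫ a, F !₂[a, s] := by
    rw [← integral_indicator isOpen_topCone.measurableSet, ← hF, ← hmp.integral_comp',
      ← integral_prod_symm _ hFi']
    refine integral_congr_ae (ae_of_all _ fun p => ?_)
    simp only
    rw [prodEquiv_symm_apply]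
  -- The horizontal slice at height `s` is `|a| < s`; the substitution `a = τ s` turns it into the
  -- fixed interval `(-1,1)`.
  have e2 : ∀ s, ∫ a, F !₂[a, s] = (Set.Ioi (0 : ℝ)).indicator
      (fun s => ∫ τ in Set.Ioo (-1 : ℝ) 1, G s τ) s := by
    intro s
    by_cases h0 : 0 < s
    · rw [Set.indicator_of_mem (Set.mem_Ioi.2 h0)]
      have hc := Measure.integral_comp_mul_right (fun a => F !₂[a, s]) s
      rw [abs_of_pos (inv_pos.2 h0), smul_eq_mul, eq_inv_mul_iff_mul_eq₀ h0.ne'] at hc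
      rw [← hc, ← integral_const_mul, ← integral_indicator measurableSet_Ioo]
      refine integral_congr_ae (ae_of_all _ fun τ => ?_)
      simp only
      have hsv : (!₂[τ * s, s] : Plane) = s • v τ := by
        ext i
        fin_cases i
        · simp [hv, mul_comm]
        · simp [hv]
      have hmem : (!₂[τ * s, s] : Plane) ∈ topCone ↔ τ ∈ Set.Ioo (-1 : ℝ) 1 := by
        change |τ * s| < s ↔ _
        rw [abs_mul, abs_of_pos h0, Set.mem_Ioo, ← abs_lt]
        constructor <;> intro h <;> nlinarith
      by_cases hτ : τ ∈ Set.Ioo (-1 : ℝ) 1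
      · rw [hF, Set.indicator_of_mem (hmem.2 hτ), Set.indicator_of_mem hτ, hsv, radialQuot,
          inner_smul_left]
        have : (s • v τ) 1 = s := by simp [hv]
        rw [this]
        simp only [hG, conj_trivial]
        field_simp
      · rw [hF, Set.indicator_of_notMem (fun h => hτ (hmem.1 h)), Set.indicator_of_notMem hτ,
          mul_zero]
    · rw [Set.indicator_of_notMem (by simpa using h0)]
      rw [integral_congr_ae (g := fun _ => 0), integral_zero]
      refine ae_of_all _ fun a => Set.indicator_of_notMem (fun h => h0 ?_) _
      have h : |a| < s := h
      exact (abs_nonneg a).trans_lt h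
  obtain ⟨R, hR⟩ := hs.isCompact.isBounded.subset_closedBall 0
  have hGc : Continuous (Function.uncurry G) := by
    have hc : Continuous fun p : ℝ × ℝ => p.1 • v p.2 := continuous_fst.smul (hvc.comp continuous_snd)
    exact ((hvc.comp continuous_snd).inner (hg.comp hc)).div_const 2
  have hGi : Integrable (Function.uncurry G)
      ((volume.restrict (Set.Ioi 0)).prod (volume.restrict (Set.Ioo (-1) 1))) := by
    rw [Measure.prod_restrict]
    have h1 : IntegrableOn (Function.uncurry G) (Set.Icc 0 R ×ˢ Set.Icc (-1) 1)
        (volume.prod volume) :=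
      hGc.continuousOn.integrableOn_compact (isCompact_Icc.prod isCompact_Icc)
    refine IntegrableOn.of_forall_sdiff_eq_zero (h1.mono_set (s := (Set.Icc 0 R ×ˢ Set.Icc (-1) 1) ∩
      (Set.Ioi 0 ×ˢ Set.Ioo (-1) 1)) Set.inter_subset_left)
      (measurableSet_Ioi.prod measurableSet_Ioo) ?_
    rintro ⟨s, τ⟩ ⟨⟨hs0, hτ⟩, hnot⟩
    have hsR : R < s := by
      by_contra! hle
      exact hnot ⟨⟨⟨le_of_lt hs0, hle⟩, ⟨hτ.1.le, hτ.2.le⟩⟩, hs0, hτ⟩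
    have hz : s • v τ ∉ tsupport ψ := by
      intro h
      have h1 := mem_closedBall_zero_iff.1 (hR h)
      have h2 := (abs_coord_le (s • v τ) 1).trans h1
      have h3 : (s • v τ) 1 = s := by simp [hv]
      rw [h3, abs_of_pos hs0] at h2
      linarith
    have h0 : fderiv ℝ ψ (s • v τ) = 0 := by
      by_contra h
      exact hz ((tsupport_fderiv_subset ℝ) (subset_tsupport _ h))
    change inner ℝ (v τ) (gradient ψ (s • v τ)) / 2 = 0
    rw [gradient, h0, map_zero, inner_zero_right, zero_div]
  rw [e1]
  simp only [e2]
  rw [integral_indicator measurableSet_Ioi, integral_integral_swap hGi]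
  have e3 : ∀ τ, ∫ s in Set.Ioi (0 : ℝ), G s τ = -(ψ 0 / 2) := by
    intro τ
    have hd : ∀ s, HasDerivAt (fun s : ℝ => ψ (s • v τ) / 2) (G s τ) s := by
      intro s
      have h1 : HasDerivAt (fun s : ℝ => s • v τ) (v τ) s := by
        simpa using (hasDerivAt_id s).smul_const (v τ)
      have h2 : HasFDerivAt ψ (fderiv ℝ ψ (s • v τ)) (s • v τ) :=
        (hψ.differentiable (by simp) _).hasFDerivAt
      refine ((h2.comp_hasDerivAt s h1).div_const 2).congr_deriv ?_
      simp only [hG]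
      rw [real_inner_comm, gradient, InnerProductSpace.toDual_symm_apply]
    have hcd : ContDiff ℝ 1 (fun s : ℝ => ψ (s • v τ) / 2) :=
      ((hψ.of_le (by exact_mod_cast le_top)).comp (contDiff_id.smul contDiff_const)).div_const 2
    have hcs : HasCompactSupport (fun s : ℝ => ψ (s • v τ) / 2) := by
      refine HasCompactSupport.intro (isCompact_Icc (a := -R) (b := R)) fun s hs' => ?_
      have : s • v τ ∉ tsupport ψ := by
        intro h
        have h1 := mem_closedBall_zero_iff.1 (hR h)
        have h2 := (abs_coord_le (s • v τ) 1).trans h1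
        have h3 : (s • v τ) 1 = s := by simp [hv]
        rw [h3] at h2
        exact hs' (abs_le.1 h2)
      rw [image_eq_zero_of_notMem_tsupport this, zero_div]
    have := hcs.integral_Ioi_deriv_eq hcd 0
    rw [zero_smul] at this
    rw [← this]
    exact integral_congr_ae (ae_of_all _ fun s => ((hd s).deriv).symm)
  simp only [e3]
  rw [setIntegral_const, measureReal_def, Real.volume_Ioo]
  norm_num
  ring

/-- The singular solenoidal field, supported in the double cone. -/
def bField (x : Plane) : Plane := (weight x / (2 * (x 1 * |x 1|))) • x

lemma measurable_bField : Measurable bField := by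
  have h : Measurable fun x : Plane => 2 * (x 1 * |x 1|) := by
    have : Continuous fun x : Plane => 2 * (x 1 * |x 1|) := by fun_prop
    exact this.measurable
  exact (measurable_weight.div h).smul measurable_id

lemma bField_eq_zero {x : Plane} (hx : ¬ |x 0| < |x 1|) : bField x = 0 := by
  rw [bField, weight_eq_zero hx, zero_div, zero_smul]

lemma norm_bField_le (x : Plane) : ‖bField x‖ ≤ ‖x‖⁻¹ := by
  by_cases hx : |x 0| < |x 1|
  · have h1 : 0 < |x 1| := (abs_nonneg _).trans_lt hx
    have hx0 : 0 < ‖x‖ := h1.trans_le (abs_coord_le x 1)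
    have h2 : ‖x‖ ^ 2 ≤ 2 * |x 1| ^ 2 := by
      rw [plane_norm_sq, ← sq_abs (x 0), ← sq_abs (x 1)]
      nlinarith [abs_nonneg (x 0)]
    rw [bField, weight_eq_one hx, norm_smul, norm_div, norm_one, norm_mul, norm_mul,
      Real.norm_eq_abs, Real.norm_eq_abs, Real.norm_eq_abs, abs_abs, abs_two, one_div_mul_eq_div,
      inv_eq_one_div, div_le_div_iff₀ (by positivity) hx0]
    nlinarith
  · rw [bField_eq_zero hx, norm_zero]
    positivity

/-- The field points towards the origin in the lower cone and away from it in the upper one, hence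
the difference of signs. The source terms `-ψ(0)` of the two cones therefore cancel. -/
lemma inner_bField_gradient (ψ : Plane → ℝ) (x : Plane) : inner ℝ (bField x) (gradient ψ x) =
    topCone.indicator (radialQuot ψ) x - botCone.indicator (radialQuot ψ) x := by
  by_cases hx : |x 0| < |x 1|
  · rw [bField, weight_eq_one hx, real_inner_smul_left]
    rcases topCone_or_botCone hx with h | h
    · have h1 : |x 0| < x 1 := h
      have h0 : 0 < x 1 := (abs_nonneg _).trans_lt h1
      have h2 : x ∉ botCone := fun h' => by
        have h' : |x 0| < -x 1 := h'
        linarith [abs_nonneg (x 0)]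
      rw [Set.indicator_of_mem h, Set.indicator_of_notMem h2, radialQuot, abs_of_pos h0, sub_zero]
      ring
    · have h1 : |x 0| < -x 1 := h
      have h0 : x 1 < 0 := by linarith [abs_nonneg (x 0)]
      have h2 : x ∉ topCone := fun h' => by
        have h' : |x 0| < x 1 := h'
        linarith [abs_nonneg (x 0)]
      rw [Set.indicator_of_mem h, Set.indicator_of_notMem h2, radialQuot, abs_of_neg h0, zero_sub]
      have := h0.ne
      field_simp
  · have h1 : x ∉ topCone := fun h => hx (lt_abs.2 (Or.inl h))
    have h2 : x ∉ botCone := fun h => hx (lt_abs.2 (Or.inr h))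
    rw [bField_eq_zero hx, Set.indicator_of_notMem h1, Set.indicator_of_notMem h2, inner_zero_left,
      sub_zero]

lemma gradient_comp_neg (ψ : Plane → ℝ) (x : Plane) :
    gradient (fun y => ψ (-y)) x = - gradient ψ (-x) := by
  have h := (ContinuousLinearEquiv.neg ℝ (M := Plane)).comp_right_fderiv (f := ψ) (x := x)
  have e : fderiv ℝ (fun y => ψ (-y)) x = - fderiv ℝ ψ (-x) := by
    refine Eq.trans h ?_
    ext v
    simp
  unfold gradient
  rw [e, map_neg]

lemma neg_mem_topCone {x : Plane} : -x ∈ topCone ↔ x ∈ botCone := by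
  simp [topCone, botCone]

lemma indicator_radialQuot_neg (ψ : Plane → ℝ) (x : Plane) :
    botCone.indicator (radialQuot ψ) x =
      topCone.indicator (radialQuot fun y => ψ (-y)) (-x) := by
  by_cases h : x ∈ botCone
  · rw [Set.indicator_of_mem h, Set.indicator_of_mem (neg_mem_topCone.2 h), radialQuot, radialQuot,
      gradient_comp_neg]
    simp
  · rw [Set.indicator_of_notMem h, Set.indicator_of_notMem (fun h' => h (neg_mem_topCone.1 h'))]

lemma contDiff_comp_neg {ψ : Plane → ℝ} (hψ : ContDiff ℝ ((⊤ : ℕ∞) : WithTop ℕ∞) ψ) :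
    ContDiff ℝ ((⊤ : ℕ∞) : WithTop ℕ∞) fun y => ψ (-y) := hψ.comp contDiff_neg

lemma hasCompactSupport_comp_neg {ψ : Plane → ℝ} (hs : HasCompactSupport ψ) :
    HasCompactSupport fun y => ψ (-y) := hs.comp_homeomorph (Homeomorph.neg Plane)

lemma integrable_indicator_topCone {ψ : Plane → ℝ}
    (hψ : ContDiff ℝ ((⊤ : ℕ∞) : WithTop ℕ∞) ψ) (hs : HasCompactSupport ψ) :
    Integrable (topCone.indicator (radialQuot ψ)) :=
  (integrable_indicator_iff isOpen_topCone.measurableSet).2 (integrable_radialQuot hψ hs)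

lemma integrable_indicator_botCone {ψ : Plane → ℝ}
    (hψ : ContDiff ℝ ((⊤ : ℕ∞) : WithTop ℕ∞) ψ) (hs : HasCompactSupport ψ) :
    Integrable (botCone.indicator (radialQuot ψ)) :=
  ((integrable_indicator_topCone (contDiff_comp_neg hψ)
    (hasCompactSupport_comp_neg hs)).comp_neg).congr
      (ae_of_all _ fun x => (indicator_radialQuot_neg ψ x).symm)

lemma integral_indicator_topCone {ψ : Plane → ℝ}
    (hψ : ContDiff ℝ ((⊤ : ℕ∞) : WithTop ℕ∞) ψ) (hs : HasCompactSupport ψ) :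
    ∫ x, topCone.indicator (radialQuot ψ) x = -ψ 0 := by
  rw [integral_indicator isOpen_topCone.measurableSet, integral_radialQuot_topCone hψ hs]

lemma integral_indicator_botCone {ψ : Plane → ℝ}
    (hψ : ContDiff ℝ ((⊤ : ℕ∞) : WithTop ℕ∞) ψ) (hs : HasCompactSupport ψ) :
    ∫ x, botCone.indicator (radialQuot ψ) x = -ψ 0 := by
  simp only [indicator_radialQuot_neg]
  rw [integral_neg_eq_self (fun x => topCone.indicator (radialQuot fun y => ψ (-y)) x),
    integral_indicator_topCone (contDiff_comp_neg hψ) (hasCompactSupport_comp_neg hs), neg_zero]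

lemma integrable_inner_bField_gradient {ψ : Plane → ℝ}
    (hψ : ContDiff ℝ ((⊤ : ℕ∞) : WithTop ℕ∞) ψ) (hs : HasCompactSupport ψ) :
    Integrable fun x => inner ℝ (bField x) (gradient ψ x) := by
  simp only [inner_bField_gradient]
  exact (integrable_indicator_topCone hψ hs).sub (integrable_indicator_botCone hψ hs)

/-- The field `bField` is divergence free in the sense of distributions. -/
lemma integral_inner_bField_gradient {ψ : Plane → ℝ}
    (hψ : ContDiff ℝ ((⊤ : ℕ∞) : WithTop ℕ∞) ψ) (hs : HasCompactSupport ψ) :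
    ∫ x, inner ℝ (bField x) (gradient ψ x) = 0 := by
  simp only [inner_bField_gradient]
  rw [integral_sub (integrable_indicator_topCone hψ hs) (integrable_indicator_botCone hψ hs),
    integral_indicator_topCone hψ hs, integral_indicator_botCone hψ hs, sub_self]

lemma hasCompactSupport_cut {r : ℝ} (hr : 0 < r) : HasCompactSupport (cut r) :=
  HasCompactSupport.intro (isCompact_closedBall (0 : Plane) r) fun _ hx =>
    cut_eq_zero hr (not_le.1 fun h => hx (mem_closedBall_zero_iff.2 h)).le

/-- The density detecting the flux through the upper cone. -/
def topDensity (r : ℝ) (x : Plane) : ℝ := - topCone.indicator (radialQuot (cut r)) x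

/-- The density detecting the flux through the lower cone. -/
def botDensity (r : ℝ) (x : Plane) : ℝ := - botCone.indicator (radialQuot (cut r)) x

lemma exists_abs_radialQuot_cut_le : ∃ C : ℝ, 0 < C ∧ ∀ r : ℝ, 0 < r → ∀ x : Plane,
    |x 0| < |x 1| → |radialQuot (cut r) x| ≤ C / r ^ 2 := by
  obtain ⟨A, hA, H⟩ := exists_gradient_cut_le
  refine ⟨2 * A, by positivity, fun r hr x hx => ?_⟩
  refine (abs_radialQuot_le _ hx).trans ?_
  rcases le_total ‖x‖ (r / 2) with h | h
  · rw [gradient_cut_eq_zero_of_le hr h, norm_zero, zero_mul]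
    positivity
  · calc ‖gradient (cut r) x‖ * ‖x‖⁻¹ ≤ (A / r) * (r / 2)⁻¹ := by
          gcongr
          exact H r hr x
      _ = 2 * A / r ^ 2 := by field_simp

lemma radialQuot_cut_eq_zero {r : ℝ} (hr : 0 < r) {x : Plane} (hx : x ∉ Metric.ball (0 : Plane) r) :
    radialQuot (cut r) x = 0 := by
  rw [radialQuot, gradient_cut_eq_zero_of_ge hr (not_lt.1 fun h => hx (mem_ball_zero_iff.2 h)),
    inner_zero_right, zero_div]

/-- The integral formula on a cone, applied to the cutoff with value one at `0`, gives total mass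
one. The bound holds because `∇(cut r)` lives at distance between `r/2` and `r` from the origin. -/
lemma exists_isDensity_cone : ∃ C : ℝ, ∀ r : ℝ, 0 < r →
    IsDensity C r (topCone ∩ Metric.ball 0 r) (topDensity r) ∧
      IsDensity C r (botCone ∩ Metric.ball 0 r) (botDensity r) := by
  obtain ⟨C, hC, H⟩ := exists_abs_radialQuot_cut_le
  refine ⟨C, fun r hr => ⟨⟨?_, fun x => ?_, fun x hx => ?_, ?_⟩,
    ⟨?_, fun x => ?_, fun x hx => ?_, ?_⟩⟩⟩
  · exact ((measurable_radialQuot _).indicator isOpen_topCone.measurableSet).neg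
  · rw [topDensity, abs_neg]
    by_cases h : x ∈ topCone
    · rw [Set.indicator_of_mem h]; exact H r hr x (lt_abs.2 (Or.inl h))
    · rw [Set.indicator_of_notMem h, abs_zero]; positivity
  · rw [topDensity]
    by_cases h : x ∈ topCone
    · rw [Set.indicator_of_mem h, radialQuot_cut_eq_zero hr fun h' => hx ⟨h, h'⟩, neg_zero]
    · rw [Set.indicator_of_notMem h, neg_zero]
  · simp only [topDensity]
    rw [integral_neg, integral_indicator_topCone (contDiff_cut r) (hasCompactSupport_cut hr),
      cut_eq_one hr (by rw [norm_zero]; positivity), neg_neg]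
  · exact ((measurable_radialQuot _).indicator isOpen_botCone.measurableSet).neg
  · rw [botDensity, abs_neg]
    by_cases h : x ∈ botCone
    · rw [Set.indicator_of_mem h]; exact H r hr x (lt_abs.2 (Or.inr h))
    · rw [Set.indicator_of_notMem h, abs_zero]; positivity
  · rw [botDensity]
    by_cases h : x ∈ botCone
    · rw [Set.indicator_of_mem h, radialQuot_cut_eq_zero hr fun h' => hx ⟨h, h'⟩, neg_zero]
    · rw [Set.indicator_of_notMem h, neg_zero]
  · simp only [botDensity]
    rw [integral_neg, integral_indicator_botCone (contDiff_cut r) (hasCompactSupport_cut hr),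
      cut_eq_one hr (by rw [norm_zero]; positivity), neg_neg]

lemma tendsto_integral_inner {V : Plane → Plane} (hV : Measurable V) {K : ℝ} (hK : ∀ x, ‖V x‖ ≤ K)
    {g : Plane → Plane} (hg : Integrable g) {f : ℕ → Plane → Plane} (hf : ∀ n, Integrable (f n))
    (h : Tendsto (fun n => ∫⁻ x, ‖g x - f n x‖ₑ) atTop (𝓝 0)) :
    Tendsto (fun n => ∫ x, inner ℝ (V x) (f n x)) atTop (𝓝 (∫ x, inner ℝ (V x) (g x))) := by
  have hi : ∀ f : Plane → Plane, Integrable f → Integrable fun x => inner ℝ (V x) (f x) := by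
    intro f hf
    refine (hf.norm.const_mul K).mono' (hV.aestronglyMeasurable.inner hf.1) (ae_of_all _ fun x => ?_)
    exact (norm_inner_le_norm _ _).trans (mul_le_mul_of_nonneg_right (hK x) (norm_nonneg _))
  refine tendsto_integral_of_L1 _ (hi g hg).aestronglyMeasurable (Eventually.of_forall fun n => hi _ (hf n)) ?_
  have hl := ENNReal.Tendsto.const_mul (a := ENNReal.ofReal K) h (Or.inr ENNReal.ofReal_ne_top)
  rw [mul_zero] at hl
  refine tendsto_of_tendsto_of_tendsto_of_le_of_le tendsto_const_nhds hl (fun _ => zero_le)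
    fun n => ?_
  rw [← lintegral_const_mul' _ _ ENNReal.ofReal_ne_top]
  refine lintegral_mono fun x => ?_
  rw [← inner_sub_right, ← ofReal_norm, ← ofReal_norm,
    ← ENNReal.ofReal_mul ((norm_nonneg _).trans (hK x)), norm_sub_rev (g x)]
  refine ENNReal.ofReal_le_ofReal ?_
  exact (norm_inner_le_norm _ _).trans (mul_le_mul_of_nonneg_right (hK x) (norm_nonneg _))

/-- The jump of a Sobolev function equals its flux off a small ball. -/
lemma Sob.jump_eq {w : Plane → ℝ} {g : Plane → Plane} (h : Sob w g) {r : ℝ} (hr : 0 < r) :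
    (∫ y, topDensity r y * w y) - ∫ y, botDensity r y * w y =
      - ∫ x, (1 - cut r x) * inner ℝ (bField x) (g x) := by
  obtain ⟨C, hC⟩ := exists_isDensity_cone
  obtain ⟨hT, hB⟩ := hC r hr
  set c : Plane → ℝ := fun x => inner ℝ (bField x) (gradient (cut r) x) with hc
  have hcm : Measurable c := measurable_bField.inner (measurable_gradient _)
  obtain ⟨A, hA, H⟩ := exists_abs_radialQuot_cut_le
  have hcb : ∀ x, |c x| ≤ C / r ^ 2 + C / r ^ 2 := by
    intro x
    simp only [hc]
    rw [inner_bField_gradient]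
    refine (abs_sub _ _).trans (add_le_add ?_ ?_)
    · have := hT.bound x; rwa [topDensity, abs_neg] at this
    · have := hB.bound x; rwa [botDensity, abs_neg] at this
  have e1 : (∫ y, topDensity r y * w y) - ∫ y, botDensity r y * w y = - ∫ x, c x * w x := by
    rw [← integral_sub (hT.integrable_mul h.integrable.1) (hB.integrable_mul h.integrable.1),
      ← integral_neg]
    refine integral_congr_ae (ae_of_all _ fun x => ?_)
    simp only [hc]
    rw [inner_bField_gradient, topDensity, botDensity]
    ring
  -- Cutting out the singularity makes the field bounded, so both sides pass to the limit under `L¹`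
  -- convergence alone, without finite energy.
  set V : Plane → Plane := fun x => (1 - cut r x) • bField x with hV
  have hVm : Measurable V :=
    (measurable_const.sub (contDiff_cut r).continuous.measurable).smul measurable_bField
  have hVb : ∀ x, ‖V x‖ ≤ (r / 2)⁻¹ := by
    intro x
    simp only [hV]
    rcases le_total ‖x‖ (r / 2) with hx | hx
    · rw [cut_eq_one hr hx, sub_self, zero_smul, norm_zero]; positivity
    · rw [norm_smul, Real.norm_of_nonneg (by linarith [cut_le_one r x])]
      refine (mul_le_of_le_one_left (norm_nonneg _) (by linarith [cut_nonneg r x])).trans ?_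
      refine (norm_bField_le x).trans ?_
      gcongr
  obtain ⟨φ, hφ, h1, h2⟩ := h.exists_seq
  have t2 := tendsto_integral_inner hVm hVb h.integrable.2
    (fun n => (hφ n).integrable_gradient) h2
  have t1 : Tendsto (fun n => ∫ x, c x * φ n x) atTop (𝓝 (∫ x, c x * w x)) := by
    refine tendsto_integral_of_L1 _
      (h.integrable.1.bdd_mul hcm.aestronglyMeasurable (ae_of_all _ hcb)).aestronglyMeasurable
      (Eventually.of_forall fun n =>
      (hφ n).integrable.bdd_mul hcm.aestronglyMeasurable (ae_of_all _ hcb)) ?_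
    have hl := ENNReal.Tendsto.const_mul (a := ENNReal.ofReal (C / r ^ 2 + C / r ^ 2)) h1
      (Or.inr ENNReal.ofReal_ne_top)
    rw [mul_zero] at hl
    refine tendsto_of_tendsto_of_tendsto_of_le_of_le tendsto_const_nhds hl (fun _ => zero_le)
      fun n => ?_
    rw [← lintegral_const_mul' _ _ ENNReal.ofReal_ne_top]
    refine lintegral_mono fun x => ?_
    rw [← mul_sub, Real.enorm_eq_ofReal_abs, Real.enorm_eq_ofReal_abs, abs_mul, abs_sub_comm,
      ← ENNReal.ofReal_mul ((abs_nonneg _).trans (hcb x))]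
    exact ENNReal.ofReal_le_ofReal (mul_le_mul_of_nonneg_right (hcb x) (abs_nonneg _))
  -- The product `(1 - cut r) φ` is an admissible test function for the divergence-free field; the
  -- product rule splits its gradient into the two integrands.
  have e2 : ∀ n, ∫ x, inner ℝ (V x) (gradient (φ n) x) = ∫ x, c x * φ n x := by
    intro n
    have hψ : ContDiff ℝ ((⊤ : ℕ∞) : WithTop ℕ∞) fun x => (1 - cut r x) * φ n x :=
      (contDiff_const.sub (contDiff_cut r)).mul (hφ n).1
    have h0 := integral_inner_bField_gradient hψ (hφ n).2.1.mul_left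
    have hi1 : Integrable fun x => inner ℝ (V x) (gradient (φ n) x) := by
      refine ((hφ n).integrable_gradient.norm.const_mul (r / 2)⁻¹).mono'
        (hVm.aestronglyMeasurable.inner (hφ n).integrable_gradient.1) (ae_of_all _ fun x => ?_)
      exact (norm_inner_le_norm _ _).trans (mul_le_mul_of_nonneg_right (hVb x) (norm_nonneg _))
    have hi2 : Integrable fun x => c x * φ n x :=
      (hφ n).integrable.bdd_mul hcm.aestronglyMeasurable (ae_of_all _ hcb)
    have e3 : ∀ x, inner ℝ (bField x) (gradient (fun x => (1 - cut r x) * φ n x) x) =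
        inner ℝ (V x) (gradient (φ n) x) - c x * φ n x := by
      intro x
      have hd : DifferentiableAt ℝ (fun y => 1 - cut r y) x :=
        (differentiableAt_const _).sub (differentiable_cut r x)
      rw [gradient_mul hd ((hφ n).differentiable x)]
      have e : gradient (fun y => 1 - cut r y) x = - gradient (cut r) x := by
        unfold gradient
        rw [fderiv_const_sub, map_neg]
      rw [e, smul_neg, ← sub_eq_add_neg, inner_sub_right, real_inner_smul_right,
        real_inner_smul_right]
      simp only [hV, hc]
      rw [real_inner_smul_left]
      ring
    simp only [e3] at h0
    rw [integral_sub hi1 hi2] at h0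
    linarith
  simp only [e2] at t2
  have := tendsto_nhds_unique t1 t2
  rw [e1, this]
  congr 1
  refine integral_congr_ae (ae_of_all _ fun x => ?_)
  simp only [hV]
  rw [real_inner_smul_left]

/-! ### The conjugate integrand, and integrability of `b · ∇w` by Young's inequality. -/

lemma conj_mono (Φ : Plane → ℝ → ℝ≥0∞) (x : Plane) {s s' : ℝ} (h : s ≤ s') :
    conj Φ x s ≤ conj Φ x s' :=
  iSup₂_mono fun _ ht => tsub_le_tsub_right
    (ENNReal.ofReal_le_ofReal (mul_le_mul_of_nonneg_right h ht)) _

lemma conj_zero (Φ : Plane → ℝ → ℝ≥0∞) (x : Plane) : conj Φ x 0 = 0 := by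
  simp [conj]

lemma ofReal_mul_le_conj_add (Φ : Plane → ℝ → ℝ≥0∞) (x : Plane) (s : ℝ) {t : ℝ} (ht : 0 ≤ t) :
    ENNReal.ofReal (s * t) ≤ conj Φ x s + Φ x t :=
  tsub_le_iff_right.1 (le_iSup₂ (f := fun (t : ℝ) (_ : 0 ≤ t) => ENNReal.ofReal (s * t) - Φ x t) t ht)

/-- Young's inequality divided by `γ`; replacing `γ⁻¹ Φ` by the larger `Φ` only weakens it. -/
lemma conj_div_le (Φ : Plane → ℝ → ℝ≥0∞) (x : Plane) (s : ℝ) {γ : ℝ} (hγ : 1 ≤ γ) :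
    conj Φ x (s / γ) ≤ (ENNReal.ofReal γ)⁻¹ * conj Φ x s := by
  have h0 : 0 < γ := one_pos.trans_le hγ
  refine iSup₂_le fun t ht => tsub_le_iff_right.2 ?_
  have e : ENNReal.ofReal (s / γ * t) = (ENNReal.ofReal γ)⁻¹ * ENNReal.ofReal (s * t) := by
    rw [← ENNReal.ofReal_inv_of_pos h0, ← ENNReal.ofReal_mul (inv_nonneg.2 h0.le)]
    congr 1
    field_simp
  rw [e]
  refine (mul_le_mul_right (ofReal_mul_le_conj_add Φ x s ht) _).trans ?_
  rw [mul_add]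
  gcongr
  refine mul_le_of_le_one_left zero_le ?_
  rw [ENNReal.inv_le_one]
  exact ENNReal.one_le_ofReal.2 hγ

/-- For `t ≤ √s` the product `st` is at most `s^{3/2}`. For `t ≥ √s` the logarithm of `t` is at
least half that of `s`, so `log^α(e+t) ≥ X` with `X` depending on `s` only, and `st ≤ s²/X + t²X` is
the quadratic Young inequality. -/
lemma conj_Phi_le {α : ℝ} (β : ℝ) (hα : 0 ≤ α) {x : Plane} (hx : weight x = 1) {s : ℝ}
    (hs : 0 ≤ s) : conj (Phi α β) x s ≤
      ENNReal.ofReal (s ^ (3 / 2 : ℝ)) + ENNReal.ofReal (2 ^ α) * ePow (-α) s := by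
  refine iSup₂_le fun t ht => tsub_le_iff_right.2 ?_
  have h1 : ePow α t ≤ Phi α β x t := by
    rw [Phi_eq α β x ht, hx, ENNReal.ofReal_one, one_mul]
    exact le_add_self
  refine le_trans ?_ (add_le_add le_rfl h1)
  have hn1 := logPow_nonneg (-α) hs
  have hn2 := logPow_nonneg α ht
  have hn3 : 0 ≤ s ^ (3 / 2 : ℝ) := Real.rpow_nonneg hs _
  rw [ePow, ePow, ← ENNReal.ofReal_mul (by positivity), ← ENNReal.ofReal_add hn3 (by positivity),
    ← ENNReal.ofReal_add (by positivity) hn2]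
  refine ENNReal.ofReal_le_ofReal ?_
  rcases le_total t (√s) with h | h
  · have : s * t ≤ s ^ (3 / 2 : ℝ) := by
      calc s * t ≤ s * √s := by gcongr
        _ = s ^ (3 / 2 : ℝ) := by
          rw [Real.sqrt_eq_rpow, show (3 / 2 : ℝ) = 1 + 1 / 2 by norm_num,
            Real.rpow_add_of_nonneg hs (by norm_num) (by norm_num), Real.rpow_one]
    have : 0 ≤ (2 : ℝ) ^ α * logPow (-α) s := by positivity
    linarith
  · have hL := one_le_log hs
    have hl := one_le_log ht
    set L := Real.log (Real.exp 1 + s)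
    set l := Real.log (Real.exp 1 + t)
    have hLl : L / 2 ≤ l := by
      have h2 : Real.exp 1 + s ≤ (Real.exp 1 + t) ^ 2 := by
        have h3 : s ≤ t ^ 2 := by
          calc s = √s ^ 2 := (Real.sq_sqrt hs).symm
            _ ≤ t ^ 2 := by gcongr
        have h4 : 1 ≤ Real.exp 1 := Real.one_le_exp zero_le_one
        nlinarith
      have := Real.log_le_log (by positivity) h2
      rw [Real.log_pow] at this
      push_cast at this
      linarith
    have h5 : L ^ α / 2 ^ α ≤ l ^ α := by
      rw [← Real.div_rpow (by linarith) (by norm_num)]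
      exact Real.rpow_le_rpow (by linarith) hLl hα
    have hLp : 0 < L ^ α := Real.rpow_pos_of_pos (by linarith) _
    have h2p : (0 : ℝ) < 2 ^ α := by positivity
    set X := L ^ α / 2 ^ α with hX
    have hX0 : 0 < X := by positivity
    have e : (2 : ℝ) ^ α * logPow (-α) s = s ^ 2 / X := by
      change (2 : ℝ) ^ α * (s ^ 2 * L ^ (-α)) = _
      rw [Real.rpow_neg (by linarith), hX]
      field_simp
    have e2 : t ^ 2 * X ≤ logPow α t := by
      change t ^ 2 * X ≤ t ^ 2 * l ^ α
      gcongr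
    rw [e]
    have h6 : s * t ≤ s ^ 2 / X + t ^ 2 * X := by
      rw [← sub_nonneg]
      have : s ^ 2 / X + t ^ 2 * X - s * t = ((s - t * X / 2) ^ 2 + 3 / 4 * (t * X) ^ 2) / X := by
        field_simp
        ring
      rw [this]
      positivity
    linarith

lemma volume_Square_lt_top : volume Square < ∞ := by
  refine (measure_mono (t := Metric.closedBall (0 : Plane) 2) fun x hx => ?_).trans_lt
    measure_closedBall_lt_top
  rw [mem_closedBall_zero_iff]
  refine le_of_sq_le_sq ?_ (by norm_num)
  rw [plane_norm_sq, ← sq_abs (x 0), ← sq_abs (x 1)]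
  nlinarith [hx.1, hx.2, abs_nonneg (x 0), abs_nonneg (x 1)]

/-- The field vanishes in the side cones, where the conjugate would be large, and in the double cone
`|b| ≤ 1/|x|`. This is where `α > 1` is needed. -/
lemma lintegral_conj_bField_lt_top {α : ℝ} (β : ℝ) (hα : 1 < α) :
    ∫⁻ x, conj (Phi α β) x ‖bField x‖ ∂mu < ∞ := by
  set B := Metric.closedBall (0 : Plane) 1
  have hB : MeasurableSet B := Metric.isClosed_closedBall.measurableSet
  set F : Plane → ℝ≥0∞ := fun x => ENNReal.ofReal ((1 / ‖x‖) ^ (3 / 2 : ℝ)) +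
    ENNReal.ofReal (2 ^ α) * ePow (-α) (1 / ‖x‖) with hF
  set c : ℝ≥0∞ := ENNReal.ofReal 1 + ENNReal.ofReal (2 ^ α) * ENNReal.ofReal 1 with hc
  have pt : ∀ x, conj (Phi α β) x ‖bField x‖ ≤ B.indicator F x + c := by
    intro x
    by_cases hx : |x 0| < |x 1|
    · have hw := weight_eq_one hx
      refine (conj_mono _ x ((norm_bField_le x).trans_eq (one_div _).symm)).trans ?_
      refine (conj_Phi_le β (by linarith) hw (by positivity)).trans ?_
      by_cases hxB : x ∈ B
      · rw [Set.indicator_of_mem hxB]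
        exact le_self_add
      · have h1 : 1 < ‖x‖ := not_le.1 fun h => hxB (mem_closedBall_zero_iff.2 h)
        have h2 : 1 / ‖x‖ ≤ 1 := (div_le_one (by linarith)).2 h1.le
        rw [Set.indicator_of_notMem hxB, zero_add]
        refine add_le_add (ENNReal.ofReal_le_ofReal ?_)
          (mul_le_mul_right (ENNReal.ofReal_le_ofReal ?_) _)
        · exact Real.rpow_le_one (by positivity) h2 (by norm_num)
        · refine mul_le_one₀ (pow_le_one₀ (by positivity) h2) (Real.rpow_nonneg ?_ _) ?_
          · linarith [one_le_log (t := 1 / ‖x‖) (by positivity)]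
          · exact Real.rpow_le_one_of_one_le_of_nonpos (one_le_log (by positivity)) (by linarith)
    · rw [bField_eq_zero hx, norm_zero, conj_zero]
      exact zero_le
  have hm : Measurable fun x : Plane => ENNReal.ofReal ((1 / ‖x‖) ^ (3 / 2 : ℝ)) := by fun_prop
  refine (lintegral_mono pt).trans_lt ?_
  rw [lintegral_add_right _ measurable_const, lintegral_const, Measure.restrict_apply_univ]
  refine ENNReal.add_lt_top.2 ⟨(setLIntegral_le_lintegral _ _).trans_lt ?_,
    ENNReal.mul_lt_top (by simp [hc]) volume_Square_lt_top⟩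
  rw [lintegral_indicator hB, lintegral_add_left hm, lintegral_const_mul' _ _ ENNReal.ofReal_ne_top]
  exact ENNReal.add_lt_top.2 ⟨lintegral_inv_norm_rpow_lt_top,
    ENNReal.mul_lt_top ENNReal.ofReal_lt_top (lintegral_ePow_inv_norm_lt_top hα)⟩

/-- A scaled Young inequality for the flux against `bField`. -/
lemma lintegral_inner_bField_le {α : ℝ} (β : ℝ) (hα : 1 < α) : ∃ B : ℝ≥0∞, B ≠ ∞ ∧
    ∀ γ : ℝ, 1 ≤ γ → ∃ C : ℝ≥0∞, C ≠ ∞ ∧ ∀ g : Plane → Plane, Measurable g →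
      ∫⁻ x, ‖(inner ℝ (bField x) (g x) : ℝ)‖ₑ ∂mu ≤
        (ENNReal.ofReal γ)⁻¹ * B + C * modular α β g := by
  refine ⟨_, (lintegral_conj_bField_lt_top β hα).ne, fun γ hγ => ?_⟩
  have hγ0 : 0 < γ := one_pos.trans_le hγ
  obtain ⟨C, hC, H⟩ := Phi_scale α β γ
  refine ⟨C, hC, fun g hg => ?_⟩
  have pt : ∀ x, ‖(inner ℝ (bField x) (g x) : ℝ)‖ₑ ≤
      (ENNReal.ofReal γ)⁻¹ * conj (Phi α β) x ‖bField x‖ + C * Phi α β x ‖g x‖ := by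
    intro x
    rw [← ofReal_norm]
    calc ENNReal.ofReal ‖(inner ℝ (bField x) (g x) : ℝ)‖
        ≤ ENNReal.ofReal ((‖bField x‖ / γ) * (γ * ‖g x‖)) := by
          refine ENNReal.ofReal_le_ofReal ((norm_inner_le_norm _ _).trans_eq ?_)
          field_simp
      _ ≤ conj (Phi α β) x (‖bField x‖ / γ) + Phi α β x (γ * ‖g x‖) :=
          ofReal_mul_le_conj_add _ _ _ (by positivity)
      _ ≤ _ := add_le_add (conj_div_le _ _ _ hγ)
          (H x _ _ (by positivity) (norm_nonneg _) le_rfl)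
  have hm : Measurable fun x => C * Phi α β x ‖g x‖ := (measurable_Phi_norm α β hg).const_mul _
  refine (lintegral_mono pt).trans ?_
  rw [lintegral_add_right _ hm, lintegral_const_mul' _ _
    (ENNReal.inv_ne_top.2 (by simpa using hγ0)), lintegral_const_mul' _ _ hC]
  gcongr
  exact setLIntegral_le_lintegral _ _

lemma integrable_inner_bField {α β : ℝ} (hα : 1 < α) {g : Plane → Plane} (hgm : Measurable g)
    (hg : modular α β g < ∞) : Integrable (fun x => (inner ℝ (bField x) (g x) : ℝ)) mu := by
  obtain ⟨B, hB, H⟩ := lintegral_inner_bField_le β hα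
  obtain ⟨C, hC, H⟩ := H 1 le_rfl
  refine ⟨(measurable_bField.inner hgm).aestronglyMeasurable, (H g hgm).trans_lt ?_⟩
  rw [ENNReal.ofReal_one, inv_one, one_mul]
  exact ENNReal.add_lt_top.2 ⟨hB.lt_top, ENNReal.mul_lt_top hC.lt_top hg⟩

/-! ### The flux is the only obstruction for `α, β > 1`. -/

lemma IsTest.integral_inner_bField {φ : Plane → ℝ} (hφ : IsTest φ) :
    ∫ x, (inner ℝ (bField x) (gradient φ x) : ℝ) ∂mu = 0 := by
  rw [setIntegral_eq_integral_of_forall_compl_eq_zero, integral_inner_bField_gradient hφ.1 hφ.2.1]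
  intro x hx
  rw [hφ.gradient_eq_zero hx, inner_zero_right]

/-- Approximable fields have no flux. -/
lemma Approximable.integral_inner_bField {α β : ℝ} (hα : 1 < α) {g : Plane → Plane}
    (hgm : Measurable g) (h : Approximable α β g) :
    ∫ x, (inner ℝ (bField x) (g x) : ℝ) ∂mu = 0 := by
  obtain ⟨B, hB, H⟩ := lintegral_inner_bField_le β hα
  rw [← enorm_eq_zero]
  refine le_antisymm (ENNReal.le_of_forall_pos_le_add fun ε hε _ => ?_) zero_le
  rw [zero_add]
  have hε' : (0 : ℝ≥0∞) < ε := by exact_mod_cast hε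
  -- The order of choices matters: first the Young parameter `γ = n + 1` makes the fixed term `B/γ`
  -- small, then the test function is chosen in terms of the constant `C` that belongs to this `γ`.
  obtain ⟨n, hn⟩ : ∃ n : ℕ, B * ((n : ℝ≥0∞) + 1)⁻¹ < ε / 2 := by
    have hl : Tendsto (fun n : ℕ => B * ((n : ℝ≥0∞) + 1)⁻¹) atTop (𝓝 0) := by
      have h1 := (tendsto_add_atTop_iff_nat 1).2 ENNReal.tendsto_inv_nat_nhds_zero
      have h2 := ENNReal.Tendsto.const_mul (a := B) h1 (Or.inr hB)
      simpa using h2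
    exact (hl.eventually (gt_mem_nhds (ENNReal.half_pos hε'.ne'))).exists
  obtain ⟨C, hC, HC⟩ := H ((n : ℝ) + 1) (by linarith [n.cast_nonneg (α := ℝ)])
  obtain ⟨φ, hφ, hφ'⟩ := h (ε / 2 / (C + 1))
    (ENNReal.div_pos (ENNReal.half_pos hε'.ne').ne' (by finiteness))
  have hm : Measurable fun x => g x - gradient φ x := hgm.sub (measurable_gradient φ)
  have hmod : modular α β (fun x => g x - gradient φ x) < ∞ := hφ'.trans_le le_top
  have e : ∫ x, (inner ℝ (bField x) (g x) : ℝ) ∂mu =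
      ∫ x, (inner ℝ (bField x) (g x - gradient φ x) : ℝ) ∂mu := by
    have h1 := integrable_inner_bField hα hm hmod
    have h2 : Integrable (fun x => (inner ℝ (bField x) (gradient φ x) : ℝ)) mu :=
      (integrable_inner_bField_gradient hφ.1 hφ.2.1).integrableOn
    have h3 : ∀ x, (inner ℝ (bField x) (g x) : ℝ) =
      inner ℝ (bField x) (g x - gradient φ x) + inner ℝ (bField x) (gradient φ x) := fun x => by
        rw [← inner_add_right, sub_add_cancel]
    rw [integral_congr_ae (ae_of_all _ h3), integral_add h1 h2, hφ.integral_inner_bField, add_zero]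
  rw [e]
  refine (enorm_integral_le_lintegral_enorm _).trans ((HC _ hm).trans ?_)
  rw [← ENNReal.add_halves (ε : ℝ≥0∞)]
  refine add_le_add ?_ ?_
  · rw [mul_comm, ENNReal.ofReal_add (Nat.cast_nonneg n) zero_le_one, ENNReal.ofReal_natCast,
      ENNReal.ofReal_one]
    exact hn.le
  · rw [ENNReal.lt_div_iff_mul_lt (Or.inl (by simp)) (Or.inl (by finiteness)), mul_comm] at hφ'
    exact (mul_le_mul_left le_self_add _).trans hφ'.le

/-- On the double cone `cutAng` is `±1/2` times the cutoff, with the sign of the cone. The opposite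
orientations of the field are thus compensated, and the two contributions `-1/2` add up. -/
lemma integral_inner_bField_cutAngGrad :
    ∫ x, (inner ℝ (bField x) (cutAngGrad x) : ℝ) ∂mu = -1 := by
  have h2 : (0 : ℝ) < 1 / 2 := by norm_num
  rw [setIntegral_eq_integral_of_forall_compl_eq_zero]
  · have e : ∀ x, (inner ℝ (bField x) (cutAngGrad x) : ℝ) = 1 / 2 *
        (topCone.indicator (radialQuot (cut (1 / 2))) x +
          botCone.indicator (radialQuot (cut (1 / 2))) x) := by
      intro x
      by_cases hx : |x 0| < |x 1|
      · have hi := inner_bField_gradient (cut (1 / 2)) x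
        rw [cutAngGrad, gradient_ang_eq_zero hx, smul_zero, zero_add, real_inner_smul_right, hi]
        rcases topCone_or_botCone hx with h | h
        · have h' : x ∉ botCone := fun h' => by
            have h1 : |x 0| < x 1 := h
            have h2 : |x 0| < -x 1 := h'
            linarith [abs_nonneg (x 0)]
          rw [ang_top h, Set.indicator_of_mem h, Set.indicator_of_notMem h']
          ring
        · have h' : x ∉ topCone := fun h' => by
            have h1 : |x 0| < x 1 := h'
            have h2 : |x 0| < -x 1 := h
            linarith [abs_nonneg (x 0)]
          rw [ang_bot h, Set.indicator_of_mem h, Set.indicator_of_notMem h']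
          ring
      · have h1 : x ∉ topCone := fun h => hx (lt_abs.2 (Or.inl h))
        have h2 : x ∉ botCone := fun h => hx (lt_abs.2 (Or.inr h))
        rw [bField_eq_zero hx, inner_zero_left, Set.indicator_of_notMem h1,
          Set.indicator_of_notMem h2]
        ring
    have hc := contDiff_cut (1 / 2)
    have hs := hasCompactSupport_cut h2
    rw [integral_congr_ae (ae_of_all _ e), integral_const_mul,
      integral_add (integrable_indicator_topCone hc hs) (integrable_indicator_botCone hc hs),
      integral_indicator_topCone hc hs, integral_indicator_botCone hc hs,
      cut_eq_one h2 (by rw [norm_zero]; norm_num)]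
    norm_num
  · intro x hx
    have : 1 / 2 ≤ ‖x‖ := by
      by_contra! hlt
      exact hx (closedBall_subset_Square (r := 1 / 2) (by norm_num) (mem_closedBall_zero_iff.2 hlt.le))
    rw [cutAngGrad_eq_zero this, inner_zero_right]

/-- Gradients of finite energy without flux are approximable. -/
theorem Sob.approximable_of_flux_eq_zero {α β : ℝ} (hα : 1 < α) (hβ : 1 < β) {w : Plane → ℝ}
    {g : Plane → Plane} (h : Sob w g) (hg : modular α β g < ∞)
    (h0 : ∫ x, (inner ℝ (bField x) (g x) : ℝ) ∂mu = 0) : Approximable α β g := by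
  obtain ⟨C₀, hC₀⟩ := exists_isDensity_cone
  obtain ⟨E, hE, M⟩ := ePow_mul_le (-β)
  set I := ∫⁻ x in Metric.closedBall (0 : Plane) 1, ePow (-β) (1 / ‖x‖) with hI
  have hIt : I < ∞ := lintegral_ePow_inv_norm_lt_top hβ
  set r : ℕ → ℝ := fun n => (1 / 4) ^ n with hr
  have hr0 : ∀ n, 0 < r n := fun n => by positivity
  set D : ℕ → ℝ := fun n => (∫ y, topDensity (r n) y * w y) - ∫ y, botDensity (r n) y * w y with hD
  have hz : ∀ᵐ x, x ∉ Square → (inner ℝ (bField x) (g x) : ℝ) = 0 :=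
    h.ae_eq_zero.mono fun x hx hxS => by rw [(hx hxS).2, inner_zero_right]
  have hint := integrable_inner_bField hα h.meas_grad hg
  have hint' : Integrable fun x => (inner ℝ (bField x) (g x) : ℝ) :=
    IntegrableOn.integrable_of_ae_notMem_eq_zero hint hz
  rw [setIntegral_eq_integral_of_ae_compl_eq_zero hz] at h0
  have hne : ∀ᵐ x : Plane, x ≠ 0 := by rw [ae_iff]; simp
  -- The jump at scale `r` is minus the flux outside a small ball; it converges to minus the total
  -- flux, which is zero.
  have hDlim : Tendsto D atTop (𝓝 0) := by
    have h1 : Tendsto (fun n => ∫ x, (1 - cut (r n) x) * (inner ℝ (bField x) (g x) : ℝ)) atTop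
        (𝓝 (∫ x, (inner ℝ (bField x) (g x) : ℝ))) := by
      refine tendsto_integral_of_dominated_convergence
        (fun x => ‖(inner ℝ (bField x) (g x) : ℝ)‖) (fun n => ?_) hint'.norm
        (fun n => ae_of_all _ fun x => ?_) (hne.mono fun x hx => ?_)
      · exact (continuous_const.sub (contDiff_cut _).continuous).aestronglyMeasurable.mul hint'.1
      · rw [norm_mul, Real.norm_of_nonneg (by linarith [cut_le_one (r n) x])]
        exact mul_le_of_le_one_left (norm_nonneg _) (by linarith [cut_nonneg (r n) x])
      · refine tendsto_const_nhds.congr' ?_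
        filter_upwards [eventually_pow_le hx] with n hn
        rw [cut_eq_zero (hr0 n) hn.le, sub_zero, one_mul]
    rw [h0] at h1
    have h2 := h1.neg
    rw [neg_zero] at h2
    exact h2.congr fun n => (h.jump_eq (hr0 n)).symm
  have hDabs : Tendsto (fun n => |D n|) atTop (𝓝 0) := by simpa using hDlim.abs
  -- For `β > 1` the energy of `1/|x|` is finite up to the origin, so the cost of a jump is bounded
  -- by a multiple of `|D|` uniformly in the size of the hole.
  have hcost : ∀ n, |D n| ≤ 1 → holeCost α β g (r n) (D n) ≤
      (∫⁻ x in Metric.ball (0 : Plane) (r n), Phi α β x ‖g x‖) +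
        (E * I * ENNReal.ofReal |D n| + ePow α |D n|) := by
    intro n hn
    unfold holeCost
    gcongr
    calc _ ≤ ∫⁻ x in Metric.closedBall (0 : Plane) 1, ePow (-β) (|D n| / ‖x‖) :=
          lintegral_mono_set fun x hx => mem_closedBall_zero_iff.2 hx.2
      _ ≤ ∫⁻ x in Metric.closedBall (0 : Plane) 1,
          E * ENNReal.ofReal |D n| * ePow (-β) (1 / ‖x‖) := by
          refine lintegral_mono fun x => ?_
          exact M _ _ _ (abs_nonneg _) hn (by positivity) (by positivity) (mul_one_div _ _).ge
      _ = E * ENNReal.ofReal |D n| * I := lintegral_const_mul' _ _ (by finiteness)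
      _ = _ := by ring
  have hbig : Tendsto (fun n => (∫⁻ x in Metric.ball (0 : Plane) (r n), Phi α β x ‖g x‖) +
        (E * I * ENNReal.ofReal |D n| + ePow α |D n|)) atTop (𝓝 0) := by
    have h2 := ENNReal.Tendsto.const_mul (a := E * I) (ENNReal.tendsto_ofReal hDabs)
      (Or.inr (ENNReal.mul_ne_top hE hIt.ne))
    have h3 := (tendsto_lintegral_ball_zero hg).add (h2.add (tendsto_ePow_zero α hDabs))
    simpa [hr] using h3
  refine h.approximable_of_holeCost hg (C₀ := C₀) fun ε hε => ?_
  obtain ⟨n, ⟨hn, hn1⟩, hn2⟩ := (((hbig.eventually (gt_mem_nhds hε)).and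
    (hDabs.eventually (ge_mem_nhds one_pos))).and (eventually_ge_atTop 1)).exists
  refine ⟨r n, _, _, hr0 n, ?_, (hC₀ _ (hr0 n)).1, (hC₀ _ (hr0 n)).2, (hcost n hn1).trans_lt hn⟩
  calc r n ≤ (1 / 4) ^ 1 := pow_le_pow_of_le_one (by norm_num) (by norm_num) hn2
    _ = 1 / 4 := pow_one _

/-! ### Consequences for `H0` and `W0`. -/

lemma Sob.of_mem_W0 {α β : ℝ} {w : W11} (hw : w ∈ W0 α β) : Sob (rep w) (repGrad w) :=
  Sob.of_mem_W110 (mem_W0_iff.1 hw).1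

lemma H0_eq_W0_of_approximable {α β : ℝ}
    (h : ∀ w g, Sob w g → modular α β g < ∞ → Approximable α β g) : H0 α β = W0 α β :=
  le_antisymm (fun _ hw => (mem_H0_iff.1 hw).1) fun _ hw =>
    mem_H0_iff.2 ⟨hw, h _ _ (Sob.of_mem_W0 hw) (mem_W0_iff.1 hw).2⟩

lemma H0_eq_W0_of_min_le_one {α β : ℝ} (h : min α β ≤ 1) : H0 α β = W0 α β := by
  refine H0_eq_W0_of_approximable fun w g hw hg => ?_
  rcases le_or_gt β 1 with hβ | hβ
  · exact hw.approximable_of_le_one hβ hg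
  · rcases min_le_iff.1 h with hα | hβ'
    · exact hw.approximable_of_le_one_of_nonneg hα (by linarith) hg
    · exact absurd hβ' hβ.not_ge

lemma inner_weakGrad_ae (w : W11) :
    (fun x => (inner ℝ (bField x) (weakGrad w x) : ℝ)) =ᵐ[mu]
      fun x => inner ℝ (bField x) (repGrad w x) := by
  filter_upwards [repGrad_ae w] with x hx
  rw [hx]

lemma integrable_inner_weakGrad {α β : ℝ} (hα : 1 < α) {w : W11} (hw : w ∈ W0 α β) :
    Integrable (fun x => (inner ℝ (bField x) (weakGrad w x) : ℝ)) mu :=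
  (integrable_inner_bField hα (Sob.of_mem_W0 hw).meas_grad (mem_W0_iff.1 hw).2).congr
    (inner_weakGrad_ae w).symm

/-- The flux `w ↦ ∫ b · ∇w` through the saddle point. -/
def flux {α : ℝ} (β : ℝ) (hα : 1 < α) : W0 α β →ₗ[ℝ] ℝ where
  toFun w := ∫ x, (inner ℝ (bField x) (weakGrad (w : W11) x) : ℝ) ∂mu
  map_add' w v := by
    rw [← integral_add (integrable_inner_weakGrad hα w.2) (integrable_inner_weakGrad hα v.2)]
    refine integral_congr_ae ?_
    filter_upwards [Lp.coeFn_add (weakGrad (w : W11)) (weakGrad (v : W11))] with x hx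
    rw [Submodule.coe_add, map_add, hx, Pi.add_apply, inner_add_right]
  map_smul' c w := by
    rw [RingHom.id_apply, smul_eq_mul, ← integral_const_mul]
    refine integral_congr_ae ?_
    filter_upwards [Lp.coeFn_smul c (weakGrad (w : W11))] with x hx
    rw [Submodule.coe_smul, map_smul, hx, Pi.smul_apply, real_inner_smul_right]

lemma flux_apply {α β : ℝ} (hα : 1 < α) (w : W0 α β) :
    flux β hα w = ∫ x, (inner ℝ (bField x) (weakGrad (w : W11) x) : ℝ) ∂mu := rfl

/-- The identification of `H0` with the kernel of one linear functional; it yields non-density, the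
codimension and the gap. -/
lemma mem_H0_iff_flux_eq_zero {α β : ℝ} (hα : 1 < α) (hβ : 1 < β) (w : W0 α β) :
    (w : W11) ∈ H0 α β ↔ flux β hα w = 0 := by
  rw [flux_apply, integral_congr_ae (inner_weakGrad_ae (w : W11))]
  have hs := Sob.of_mem_W0 w.2
  constructor
  · intro h
    exact Approximable.integral_inner_bField hα hs.meas_grad (mem_H0_iff.1 h).2
  · intro h
    exact mem_H0_iff.2 ⟨w.2, hs.approximable_of_flux_eq_zero hα hβ (mem_W0_iff.1 w.2).2 h⟩

lemma exists_flux_eq_neg_one {α β : ℝ} (hα : 1 < α) (hβ : 1 < β) :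
    ∃ v : W0 α β, flux β hα v = -1 ∧
      ∫⁻ x, Phi α β x ‖weakGrad (v : W11) x‖ ∂mu = modular α β cutAngGrad := by
  obtain ⟨v, hv, h⟩ := sob_cutAng.exists_mem_W0 (modular_cutAngGrad_lt_top α hβ)
  refine ⟨⟨v, hv⟩, ?_, modular_eq_mu α β h ?_⟩
  · rw [flux_apply, ← integral_inner_bField_cutAngGrad]
    refine integral_congr_ae ?_
    filter_upwards [h] with x hx
    rw [hx]
  · exact sob_cutAng.ae_eq_zero.mono fun x hx hx' => (hx hx').2

lemma H0_ne_W0 {α β : ℝ} (hα : 1 < α) (hβ : 1 < β) : H0 α β ≠ W0 α β := by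
  intro h
  obtain ⟨v, hv, -⟩ := exists_flux_eq_neg_one hα hβ
  have h0 := (mem_H0_iff_flux_eq_zero hα hβ v).1 (h.symm.le v.2)
  rw [hv] at h0
  norm_num at h0

/-- If `α, β > 1`, then `H^{1,Φ}_0` has codimension one in `W^{1,Φ}_0`. -/
theorem finrank_quotient_H0 {α β : ℝ} (hα : 1 < α) (hβ : 1 < β) :
    Module.finrank ℝ (W0 α β ⧸ (H0 α β).submoduleOf (W0 α β)) = 1 := by
  have hker : (H0 α β).submoduleOf (W0 α β) = LinearMap.ker (flux β hα) := by
    ext w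
    rw [LinearMap.mem_ker, ← mem_H0_iff_flux_eq_zero hα hβ]
    exact Iff.rfl
  have hsurj : Function.Surjective (flux β hα) := by
    intro c
    obtain ⟨v, hv, -⟩ := exists_flux_eq_neg_one hα hβ
    exact ⟨(-c) • v, by rw [map_smul, hv, smul_eq_mul]; ring⟩
  rw [((Submodule.quotEquivOfEq _ _ hker).trans
    ((flux β hα).quotKerEquivOfSurjective hsurj)).finrank_eq, Module.finrank_self]

lemma memOrlicz_smul_bField {α : ℝ} (β : ℝ) (hα : 1 < α) {c : ℝ} (hc : 0 < c) :
    MemOrlicz (conj (Phi α β)) (fun x => c • bField x) := by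
  have hB := lintegral_conj_bField_lt_top β hα
  refine ⟨(measurable_bField.const_smul c).aestronglyMeasurable, luxNorm_lt.2 ?_⟩
  set B := ∫⁻ x, conj (Phi α β) x ‖bField x‖ ∂mu with hBdef
  set γ := max 1 B.toReal with hγ
  have hγ1 : 1 ≤ γ := le_max_left _ _
  have hγ0 : 0 < γ := one_pos.trans_le hγ1
  refine ⟨c * γ, ⟨by positivity, ?_⟩, ENNReal.ofReal_lt_top⟩
  have hBγ : B ≤ ENNReal.ofReal γ := by
    rw [← ENNReal.ofReal_toReal hB.ne]
    exact ENNReal.ofReal_le_ofReal (le_max_right _ _)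
  have hne : ENNReal.ofReal γ ≠ 0 := (ENNReal.ofReal_pos.2 hγ0).ne'
  calc ∫⁻ x, conj (Phi α β) x (‖c • bField x‖ / (c * γ)) ∂mu
      ≤ ∫⁻ x, (ENNReal.ofReal γ)⁻¹ * conj (Phi α β) x ‖bField x‖ ∂mu := by
        refine lintegral_mono fun x => ?_
        dsimp only
        rw [norm_smul, Real.norm_of_nonneg hc.le, mul_div_mul_left _ _ hc.ne']
        exact conj_div_le _ _ _ hγ1
    _ = (ENNReal.ofReal γ)⁻¹ * B := lintegral_const_mul' _ _ (ENNReal.inv_ne_top.2 hne)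
    _ ≤ (ENNReal.ofReal γ)⁻¹ * ENNReal.ofReal γ := mul_le_mul_right hBγ _
    _ = 1 := ENNReal.inv_mul_cancel hne ENNReal.ofReal_ne_top

lemma energyG_smul_bField {α β : ℝ} (hα : 1 < α) (c : ℝ) (w : W0 α β) :
    energyG α β (fun x => c • bField x) w =
      ((∫⁻ x, Phi α β x ‖weakGrad (w : W11) x‖ ∂mu : ℝ≥0∞) : EReal) +
        ((c * flux β hα w : ℝ) : EReal) := by
  rw [energyG, flux_apply, ← integral_const_mul]
  simp only [real_inner_smul_left]

/-- If `α, β > 1`, then a multiple of `bField` leads to a Lavrentiev gap. -/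
theorem exists_lavrentiev_gap {α β : ℝ} (hα : 1 < α) (hβ : 1 < β) :
    ∃ b : Plane → Plane, MemOrlicz (conj (Phi α β)) b ∧
      (∀ w ∈ W0 α β, Integrable (fun x => (inner ℝ (b x) (weakGrad w x) : ℝ)) mu) ∧
      (⨅ w ∈ W0 α β, energyG α β b w) < ⨅ w ∈ H0 α β, energyG α β b w := by
  obtain ⟨v, hv, hE⟩ := exists_flux_eq_neg_one hα hβ
  have hfin := modular_cutAngGrad_lt_top α hβ
  set K := (modular α β cutAngGrad).toReal with hK
  have hK0 : 0 ≤ K := ENNReal.toReal_nonneg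
  -- `K` is the energy of the competitor with flux `-1`, so the functional takes the value `K -
  -- (K+1) = -1` there.
  refine ⟨fun x => (K + 1) • bField x, memOrlicz_smul_bField β hα (by linarith),
    fun w hw => ?_, ?_⟩
  · simp only [real_inner_smul_left]
    exact (integrable_inner_weakGrad hα hw).const_mul _
  -- Zero separates the two infima: on `H0` the linear term is a multiple of the flux and drops out,
  -- leaving a nonnegative energy.
  · refine lt_of_lt_of_le (b := (0 : EReal)) ?_ (le_iInf₂ fun w hw => ?_)
    · refine (iInf₂_le (v : W11) v.2).trans_lt ?_
      rw [energyG_smul_bField hα, hv, hE, ← ENNReal.ofReal_toReal hfin.ne,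
        EReal.coe_ennreal_ofReal, ← hK, max_eq_left hK0, ← EReal.coe_add]
      exact_mod_cast (by linarith : K + (K + 1) * -1 < 0)
    · have hw' : w ∈ W0 α β := (mem_H0_iff.1 hw).1
      have h0 := (mem_H0_iff_flux_eq_zero hα hβ ⟨w, hw'⟩).1 hw
      have := energyG_smul_bField hα (K + 1) ⟨w, hw'⟩
      rw [h0, mul_zero, EReal.coe_zero, add_zero] at this
      rw [this]
      exact EReal.coe_ennreal_nonneg _

end BorderlineDoublePhase

end


theorem mainTheorem1 (α β : ℝ) :
    (BorderlineDoublePhase.H0 α β = BorderlineDoublePhase.W0 α β ↔ min α β ≤ 1) ∧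
    (1 < α → 1 < β →
      (∃ b : BorderlineDoublePhase.Plane → BorderlineDoublePhase.Plane,
        BorderlineDoublePhase.MemOrlicz
          (BorderlineDoublePhase.conj (BorderlineDoublePhase.Phi α β)) b ∧
        (∀ w ∈ BorderlineDoublePhase.W0 α β,
          MeasureTheory.Integrable
            (fun x => inner ℝ (b x) (BorderlineDoublePhase.weakGrad w x))
            BorderlineDoublePhase.mu) ∧
        (⨅ w ∈ BorderlineDoublePhase.W0 α β, BorderlineDoublePhase.energyG α β b w) <
          ⨅ w ∈ BorderlineDoublePhase.H0 α β, BorderlineDoublePhase.energyG α β b w) ∧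
      Module.finrank ℝ
        (BorderlineDoublePhase.W0 α β ⧸
          (BorderlineDoublePhase.H0 α β).submoduleOf (BorderlineDoublePhase.W0 α β)) = 1) := by
  refine ⟨⟨fun h => ?_, BorderlineDoublePhase.H0_eq_W0_of_min_le_one⟩, fun hα hβ =>
    ⟨BorderlineDoublePhase.exists_lavrentiev_gap hα hβ,
      BorderlineDoublePhase.finrank_quotient_H0 hα hβ⟩⟩
  by_contra! hlt
  obtain ⟨hα, hβ⟩ := lt_min_iff.1 hlt
  exact BorderlineDoublePhase.H0_ne_W0 hα hβ h
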